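/- Let $U\subseteq\mathbb R^n$ be open and let $g^{ij},\Gamma^{ij}_k,w^i_k$ be smooth functions of $u=(u^1,\dots,u^n)\in U$ with $\det(g^{ij})\neq 0$ on $U$ (sums over repeated indices; $f_{,k}=\partial f/\partial u^k$). Consider the weakly nonlocal operator of hydrodynamic type $$P^{ij}=g^{ij}\partial_x+\Gamma^{ij}_ku^k_x+W^i\partial_x^{-1}W^j,\qquad W^i=w^i_ku^k_x .$$ In each of the following three formalisms, $P$ is Hamiltonian if and only if the following conditions hold on $U$: $$g^{ij}=g^{ji},\qquad g^{ij}_{,k}=\Gamma^{ij}_k+\Gamma^{ji}_k,\qquad g^{is}\Gamma^{jk}_s=g^{js}\Gamma^{ik}_s,$$ $$g^{is}w^j_s=g^{js}w^i_s,\qquad \nabla_iw^j_k=\nabla_kw^j_i,\qquad R^{ij}_{kh}=w^i_kw^j_h-w^j_kw^i_h .$$ Here $(g_{ij})$ is the inverse matrix of $(g^{ij})$, $\Gamma^k_{ij}=-g_{il}\Gamma^{lk}_j$, $\nabla_iw^j_k=w^j_{k,i}+\Gamma^j_{im}w^m_k-\Gamma^m_{ik}w^j_m$, $R^{ij}_{kh}=g^{is}R^j_{skh}$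 and $R^j_{skh}=\Gamma^j_{sk,h}-\Gamma^j_{sh,k}+\Gamma^j_{hm}\Gamma^m_{sk}-\Gamma^j_{km}\Gamma^m_{sh}$ (the sign for which the unit sphere has $R^{ij}_{kh}=\delta^i_k\delta^j_h-\delta^j_k\delta^i_h$). In (1) and (2), fields are smooth maps $u:\mathbb R\to U$ and test covectors are smooth with compact support. (1) Distributions. Put $P^{ij}_{x,y}=g^{ij}(u(x))\delta'(x-y)+\Gamma^{ij}_k(u(x))u^k_x\delta(x-y)+W^i(x)\nu(x-y)W^j(y)$ with $\nu=\tfrac12\operatorname{sgn}$. Hamiltonian means that for every field $u$ one has $P^{ij}_{x,y}=-P^{ji}_{y,x}$, and $$\sum_{\sigma=0,1}\Big(\frac{\partial P^{ij}_{x,y}}{\partial u^l_\sigma(x)}\partial_x^\sigma P^{lk}_{x,z}+\frac{\partial P^{ij}_{x,y}}{\partial u^l_\sigma(y)}\partial_y^\sigma P^{lk}_{y,z}\Big)+\text{cyclic}\big((i,x),(j,y),(k,z)\big)=0,$$ both as distributions, tested on $p_i(x)q_j(y)$ and $p_i(x)q_j(y)r_k(z)$ respectively. (2) Differential operators. Let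 $\partial_x^{-1}f(x)=\tfrac12\int_{-\infty}^xf-\tfrac12\int_x^{\infty}f$. Hamiltonian means that for every field $u$ one has $P^*=-P$, where $P^*(\psi)^j=-\partial_x(g^{ij}\psi_i)+\Gamma^{ij}_ku^k_x\psi_i-W^j\partial_x^{-1}(W^i\psi_i)$, and $$[P,P](\psi^1,\psi^2,\psi^3)=2\int\big(\ell_{P,\psi^1}(P\psi^2)^i\psi^3_i+\text{cyclic}\big)\,dx=0$$ for all test covectors, where $\ell_{P,\psi}(\varphi)$ is the linearization in the direction $\varphi$ of $u\mapsto P(\psi)$ with $\psi$ fixed. (3) Poisson vertex algebras. Let $\mathcal A$ be the algebra of smooth functions of $u\in U$ and of finitely many of the $x$-derivatives $u_\sigma$, with total derivative $\partial$, and let $$\{f_\lambda h\}=\sum_s C_s(f,h)\lambda^s=\frac{\partial h}{\partial u^j_\sigma}(\lambda+\partial)^\sigma P^{ji}(\lambda+\partial)(-\lambda-\partial)^\tau\frac{\partial f}{\partial u^i_\tau},$$ where $P^{ji}(\lambda+\partial)=g^{ji}(\lambda+\partial)+\Gamma^{ji}_ku^k_x+W^j(\lambda+\partial)^{-1}W^i$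 and $(\lambda+\partial)^{k}=\sum_{t\ge0}\binom kt\lambda^{k-t}\partial^t$ for $k\in\mathbb Z$. Hamiltonian means that, for all generators $f,h,e\in\{u^1,\dots,u^n\}$, one has $\{h_\lambda f\}=-\sum_s(-\lambda-\partial)^sC_s(f,h)$, and $$\{f_\lambda\{h_\mu e\}\}-\{h_\mu\{f_\lambda e\}\}=\{\{f_\lambda h\}_{\lambda+\mu}e\}.$$ The last identity is required in the space $V_{\lambda,\mu}$ of sums $\sum_{m\le M,\,l\le L,\,p\ge0}a_{mlp}\lambda^m\mu^l(\lambda+\mu)^{-p}$ with $a_{mlp}\in\mathcal A$: it means that its three terms are the expansions of elements of $V_{\lambda,\mu}$ in powers of $(\lambda,\mu)$ for $|\mu|>|\lambda|$, of $(\lambda,\mu)$ for $|\lambda|>|\mu|$, and of $(\lambda,\lambda+\mu)$ for $|\lambda|>|\lambda+\mu|$ respectively, and that these elements satisfy the identity. -/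

import Mathlib

open scoped ContDiff

noncomputable section

/-- The coefficients of the operator
`P^{ij} = g^{ij} ∂ₓ + Γ^{ij}_k u^k_x + w^i_k u^k_x ∂ₓ⁻¹ w^j_h u^h_x`
in the field variables `v = (u^1, …, u^n)`:
`g v i j = g^{ij}(v)`, `Γ v i j k = Γ^{ij}_k(v)`, `w v i k = w^i_k(v)`. -/
structure HydroOp (n : ℕ) where
  g : (Fin n → ℝ) → Fin n → Fin n → ℝ
  Γ : (Fin n → ℝ) → Fin n → Fin n → Fin n → ℝ
  w : (Fin n → ℝ) → Fin n → Fin n → ℝ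

/-- The partial derivative `f_{,k} = ∂f/∂u^k` of a function of the field variables. -/
def fieldDeriv {n : ℕ} (k : Fin n) (f : (Fin n → ℝ) → ℝ) (v : Fin n → ℝ) : ℝ :=
  fderiv ℝ f v (Pi.single k 1)

namespace HydroOp

variable {n : ℕ}

/-- All coefficients are smooth functions on `U`. -/
def SmoothOn (P : HydroOp n) (U : Set (Fin n → ℝ)) : Prop :=
  (∀ i j, ContDiffOn ℝ ∞ (fun v => P.g v i j) U) ∧
  (∀ i j k, ContDiffOn ℝ ∞ (fun v => P.Γ v i j k) U) ∧
  (∀ i k, ContDiffOn ℝ ∞ (fun v => P.w v i k) U)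

/-- `g` is non-degenerate at every point of `U`. -/
def NondegenerateOn (P : HydroOp n) (U : Set (Fin n → ℝ)) : Prop :=
  ∀ v ∈ U, (Matrix.of (P.g v)).det ≠ 0

/-! ### The differential-geometric conditions -/

/-- `g_{ij}`, the inverse matrix of `g^{ij}`. -/
def lowerMetric (P : HydroOp n) (v : Fin n → ℝ) (i j : Fin n) : ℝ :=
  (Matrix.of (P.g v))⁻¹ i j

/-- `Γ^k_{ij} = - g_{il} Γ^{lk}_j`, as `P.christoffel k i j v`. -/
def christoffel (P : HydroOp n) (k i j : Fin n) (v : Fin n → ℝ) : ℝ :=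
  -∑ l, P.lowerMetric v i l * P.Γ v l k j

/-- `∇_i w^j_k = w^j_{k,i} + Γ^j_{im} w^m_k - Γ^m_{ik} w^j_m`. -/
def nablaW (P : HydroOp n) (i j k : Fin n) (v : Fin n → ℝ) : ℝ :=
  fieldDeriv i (fun v => P.w v j k) v
    + ∑ m, P.christoffel j i m v * P.w v m k
    - ∑ m, P.christoffel m i k v * P.w v j m

/-- `R^j_{skh} = Γ^j_{sk,h} - Γ^j_{sh,k} + Γ^j_{hm} Γ^m_{sk} - Γ^j_{km} Γ^m_{sh}`.
(This is the sign for which `R^{ij}_{kh} = g^{is} R^j_{skh}` equals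
`δ^i_k δ^j_h - δ^j_k δ^i_h` on the unit sphere.) -/
def riemann (P : HydroOp n) (j s k h : Fin n) (v : Fin n → ℝ) : ℝ :=
  fieldDeriv h (P.christoffel j s k) v - fieldDeriv k (P.christoffel j s h) v
    + ∑ m, P.christoffel j h m v * P.christoffel m s k v
    - ∑ m, P.christoffel j k m v * P.christoffel m s h v

/-- `R^{ij}_{kh} = g^{is} R^j_{skh}`. -/
def riemannUp (P : HydroOp n) (i j k h : Fin n) (v : Fin n → ℝ) : ℝ :=
  ∑ s, P.g v i s * P.riemann j s k h v

/-- The six systems of conditions on the coefficients, at every point of `U`. -/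
def Conditions (P : HydroOp n) (U : Set (Fin n → ℝ)) : Prop :=
  ∀ v ∈ U,
    (∀ i j, P.g v i j = P.g v j i) ∧
    (∀ i j k, fieldDeriv k (fun v => P.g v i j) v = P.Γ v i j k + P.Γ v j i k) ∧
    (∀ i j k, ∑ s, P.g v i s * P.Γ v j k s = ∑ s, P.g v j s * P.Γ v i k s) ∧
    (∀ i j, ∑ s, P.g v i s * P.w v j s = ∑ s, P.g v j s * P.w v i s) ∧
    (∀ i j k, P.nablaW i j k v = P.nablaW k j i v) ∧
    (∀ i j k h, P.riemannUp i j k h v = P.w v i k * P.w v j h - P.w v j k * P.w v i h)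

end HydroOp

/-! ### Fields and test covectors -/

/-- `∂ₓ`, componentwise. -/
def xDeriv {n : ℕ} (f : ℝ → Fin n → ℝ) (x : ℝ) (k : Fin n) : ℝ :=
  deriv (fun y => f y k) x

/-- Smooth fields `u : ℝ → U`. -/
def IsSmoothField {n : ℕ} (U : Set (Fin n → ℝ)) (u : ℝ → Fin n → ℝ) : Prop :=
  ContDiff ℝ ∞ u ∧ ∀ x, u x ∈ U

/-- Test covectors: smooth with compact support. -/
def IsTest {n : ℕ} (ψ : ℝ → Fin n → ℝ) : Prop :=
  ContDiff ℝ ∞ ψ ∧ HasCompactSupport ψ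

namespace HydroOp

variable {n : ℕ}

/-- `W^i(x) = w^i_k(u(x)) u^k_x(x)`. -/
def tail (P : HydroOp n) (u : ℝ → Fin n → ℝ) (x : ℝ) (i : Fin n) : ℝ :=
  ∑ k, P.w (u x) i k * xDeriv u x k

/-- The linearization `∂W^i/∂u^l φ^l + ∂W^i/∂u^l_x φ^l_x`. -/
def tailLin (P : HydroOp n) (u φ : ℝ → Fin n → ℝ) (x : ℝ) (i : Fin n) : ℝ :=
  (∑ l, ∑ k, fieldDeriv l (fun v => P.w v i k) (u x) * xDeriv u x k * φ x l)
    + ∑ l, P.w (u x) i l * xDeriv φ x l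

end HydroOp

/-! ### First formalism: distributions -/

/-- `ν(x) = ½ sgn x`. -/
def nuStep (x : ℝ) : ℝ := (1 / 2) * Real.sign x

/-- The value on test functions `p_i(x) q_j(y)` of the distribution
`A^{ij}(x) δ'(x-y) + B^{ij}(x) δ(x-y) + C^i(x) ν(x-y) D^j(y)`. -/
def kernelPair {n : ℕ} (A B : ℝ → Fin n → Fin n → ℝ) (C D : ℝ → Fin n → ℝ)
    (p q : ℝ → Fin n → ℝ) : ℝ :=
  (∫ x, ∑ i, ∑ j, A x i j * p x i * xDeriv q x j)
    + (∫ x, ∑ i, ∑ j, B x i j * p x i * q x j)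
    + ∫ x, ∫ y, nuStep (x - y) * (∑ i, C x i * p x i) * (∑ j, D y j * q y j)

namespace HydroOp

variable {n : ℕ}

/-- The distribution `P^{ij}_{x,y} = {u^i(x), u^j(y)}` at the field `u`, on `p_i(x) q_j(y)`. -/
def distPair (P : HydroOp n) (u p q : ℝ → Fin n → ℝ) : ℝ :=
  kernelPair (fun x => P.g (u x)) (fun x i j => ∑ k, P.Γ (u x) i j k * xDeriv u x k)
    (P.tail u) (P.tail u) p q

/-- `x ↦ ∫ P^{lk}_{x,z} r_k(z) dz`. -/
def distSmear (P : HydroOp n) (u r : ℝ → Fin n → ℝ) (x : ℝ) (l : Fin n) : ℝ :=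
  (∑ k, P.g (u x) l k * xDeriv r x k)
    + (∑ k, (∑ s, P.Γ (u x) l k s * xDeriv u x s) * r x k)
    + P.tail u x l * ∫ z, nuStep (x - z) * ∑ k, P.tail u z k * r z k

/-- `(∂P^{ij}_{x,y}/∂u^l(x)) φ^l(x) + (∂P^{ij}_{x,y}/∂u^l_x(x)) φ^l_x(x)`, on `p_i(x) q_j(y)`. -/
def distVarFst (P : HydroOp n) (u φ p q : ℝ → Fin n → ℝ) : ℝ :=
  kernelPair
    (fun x i j => ∑ l, fieldDeriv l (fun v => P.g v i j) (u x) * φ x l)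
    (fun x i j =>
      (∑ l, ∑ s, fieldDeriv l (fun v => P.Γ v i j s) (u x) * xDeriv u x s * φ x l)
        + ∑ l, P.Γ (u x) i j l * xDeriv φ x l)
    (P.tailLin u φ) (P.tail u) p q

/-- `(∂P^{ij}_{x,y}/∂u^l(y)) φ^l(y) + (∂P^{ij}_{x,y}/∂u^l_y(y)) φ^l_y(y)`, on `p_i(x) q_j(y)`. -/
def distVarSnd (P : HydroOp n) (u φ p q : ℝ → Fin n → ℝ) : ℝ :=
  kernelPair (fun _ _ _ => 0) (fun _ _ _ => 0) (P.tail u) (P.tailLin u φ) p q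

/-- The distribution `J^{ijk}_{xyz}`, i.e. the Jacobi expression
`{{u^i(x), u^j(y)}, u^k(z)} + cyclic`, on `p_i(x) q_j(y) r_k(z)`. -/
def distJacobi (P : HydroOp n) (u p q r : ℝ → Fin n → ℝ) : ℝ :=
  P.distVarFst u (P.distSmear u r) p q + P.distVarSnd u (P.distSmear u r) p q
    + P.distVarFst u (P.distSmear u q) r p + P.distVarSnd u (P.distSmear u q) r p
    + P.distVarFst u (P.distSmear u p) q r + P.distVarSnd u (P.distSmear u p) q r

/-- `P` defines a Poisson bracket in the formalism of distributions:
`{u^i(x), u^j(y)} = -{u^j(y), u^i(x)}` and `J^{ijk}_{xyz} = 0` as distributions. -/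
def IsHamiltonianDist (P : HydroOp n) (U : Set (Fin n → ℝ)) : Prop :=
  ∀ u, IsSmoothField U u →
    (∀ p q, IsTest p → IsTest q → P.distPair u p q = -P.distPair u q p) ∧
    (∀ p q r, IsTest p → IsTest q → IsTest r → P.distJacobi u p q r = 0)

end HydroOp

/-! ### Second formalism: differential operators -/

/-- `∂ₓ⁻¹ f (x) = ½ ∫_{-∞}^x f - ½ ∫_x^{+∞} f`. -/
def xInv (f : ℝ → ℝ) (x : ℝ) : ℝ :=
  (1 / 2) * (∫ y in Set.Iic x, f y) - (1 / 2) * ∫ y in Set.Ioi x, f y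

namespace HydroOp

variable {n : ℕ}

/-- `P(ψ)^i`. -/
def apply (P : HydroOp n) (u ψ : ℝ → Fin n → ℝ) (x : ℝ) (i : Fin n) : ℝ :=
  (∑ j, P.g (u x) i j * xDeriv ψ x j)
    + (∑ j, (∑ k, P.Γ (u x) i j k * xDeriv u x k) * ψ x j)
    + P.tail u x i * xInv (fun y => ∑ j, P.tail u y j * ψ y j) x

/-- The formal adjoint
`P^*(ψ)^j = -∂ₓ(g^{ij} ψ_i) + Γ^{ij}_k u^k_x ψ_i - W^j ∂ₓ⁻¹(W^i ψ_i)`. -/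
def adjoint (P : HydroOp n) (u ψ : ℝ → Fin n → ℝ) (x : ℝ) (j : Fin n) : ℝ :=
  -deriv (fun y => ∑ i, P.g (u y) i j * ψ y i) x
    + (∑ i, (∑ k, P.Γ (u x) i j k * xDeriv u x k) * ψ x i)
    - P.tail u x j * xInv (fun y => ∑ i, P.tail u y i * ψ y i) x

/-- The linearization `ℓ_{P,ψ}(φ)^i` of the coefficients of `P`. -/
def linearize (P : HydroOp n) (u ψ φ : ℝ → Fin n → ℝ) (x : ℝ) (i : Fin n) : ℝ :=
  (∑ j, (∑ k, fieldDeriv k (fun v => P.g v i j) (u x) * φ x k) * xDeriv ψ x j)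
    + (∑ j, ((∑ k, ∑ s, fieldDeriv k (fun v => P.Γ v i j s) (u x) * xDeriv u x s * φ x k)
        + ∑ k, P.Γ (u x) i j k * xDeriv φ x k) * ψ x j)
    + P.tailLin u φ x i * xInv (fun y => ∑ j, P.tail u y j * ψ y j) x
    + P.tail u x i * xInv (fun y => ∑ j, P.tailLin u φ y j * ψ y j) x

/-- The Schouten bracket
`[P,P](ψ¹,ψ²,ψ³) = 2 ∫ (ℓ_{P,ψ¹}(P ψ²)^i ψ³_i + cyclic) dx`. -/
def schouten (P : HydroOp n) (u ψ₁ ψ₂ ψ₃ : ℝ → Fin n → ℝ) : ℝ :=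
  2 * ∫ x, ∑ i,
    (P.linearize u ψ₁ (P.apply u ψ₂) x i * ψ₃ x i
      + P.linearize u ψ₂ (P.apply u ψ₃) x i * ψ₁ x i
      + P.linearize u ψ₃ (P.apply u ψ₁) x i * ψ₂ x i)

/-- `P` is a Hamiltonian operator: `P^* = -P` and `[P,P] = 0`. -/
def IsHamiltonianOp (P : HydroOp n) (U : Set (Fin n → ℝ)) : Prop :=
  ∀ u, IsSmoothField U u →
    (∀ ψ, IsTest ψ → ∀ x j, P.adjoint u ψ x j = -P.apply u ψ x j) ∧
    (∀ ψ₁ ψ₂ ψ₃, IsTest ψ₁ → IsTest ψ₂ → IsTest ψ₃ → P.schouten u ψ₁ ψ₂ ψ₃ = 0)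

end HydroOp

/-! ### Third formalism: Poisson vertex algebras -/

/-- Jets `(u, u_x, u_xx, …)`: the value `J σ k` is `u^k_σ`. -/
abbrev Jet (n : ℕ) : Type := ℕ → Fin n → ℝ

/-- `∂f/∂u^k_σ`. -/
def jetPartial {n : ℕ} (σ : ℕ) (k : Fin n) (f : Jet n → ℝ) (J : Jet n) : ℝ :=
  deriv (fun t : ℝ => f (Function.update J σ (Function.update (J σ) k t))) (J σ k)

/-- The total derivative `∂f = ∑ u^k_{σ+1} ∂f/∂u^k_σ`. -/
def totalDeriv {n : ℕ} (f : Jet n → ℝ) (J : Jet n) : ℝ :=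
  ∑ᶠ σ : ℕ, ∑ k, J (σ + 1) k * jetPartial σ k f J

/-- The differential algebra `𝒜` over `U`: smooth functions of `u ∈ U` and of finitely many of
the derivatives `u_x, u_xx, …`. -/
def IsDiffFun {n : ℕ} (U : Set (Fin n → ℝ)) (f : Jet n → ℝ) : Prop :=
  ∃ (N : ℕ) (F : (Fin (N + 1) → Fin n → ℝ) → ℝ),
    ContDiffOn ℝ ∞ F {v | v 0 ∈ U} ∧ ∀ J : Jet n, J 0 ∈ U → f J = F (fun σ => J σ)

/-- The generator `u^i` of `𝒜`. -/
def jetGen {n : ℕ} (i : Fin n) : Jet n → ℝ := fun J => J 0 i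

/-- A formal series `∑_a F_a λ^a` (with exponents bounded above) is given by its coefficients. -/
abbrev LamSeries (n : ℕ) : Type := ℤ → Jet n → ℝ

/-- The constant series `f λ^0`. -/
def lamConst {n : ℕ} (f : Jet n → ℝ) : LamSeries n := fun a => if a = 0 then f else 0

/-- `(λ+∂)^k F`, with `(λ+∂)^k = ∑_{t ≥ 0} binom(k,t) λ^{k-t} ∂^t` for every integer `k`. -/
def lamPow {n : ℕ} (k : ℤ) (F : LamSeries n) : LamSeries n := fun a J =>
  ∑ᶠ t : ℕ, ((Ring.choose k t : ℤ) : ℝ) * (totalDeriv^[t] (F (a - k + t))) J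

/-- The coefficient of `λ^A μ^B` in the expansion for `|μ| > |λ|` of
`∑ a_{m,n,p} λ^m μ^n (λ+μ)^{-p}`, where `(λ+μ)^{-p} = ∑_k binom(-p,k) λ^k μ^{-p-k}`. -/
def expandLamMu {n : ℕ} (a : ℤ → ℤ → ℕ → Jet n → ℝ) (A B : ℤ) (J : Jet n) : ℝ :=
  ∑ᶠ kp : ℕ × ℕ,
    ((Ring.choose (-(kp.2 : ℤ)) kp.1 : ℤ) : ℝ) * a (A - kp.1) (B + kp.2 + kp.1) kp.2 J

/-- The coefficient of `λ^A μ^B` in the expansion for `|λ| > |μ|` of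
`∑ a_{m,n,p} λ^m μ^n (λ+μ)^{-p}`, where `(λ+μ)^{-p} = ∑_k binom(-p,k) λ^{-p-k} μ^k`. -/
def expandMuLam {n : ℕ} (a : ℤ → ℤ → ℕ → Jet n → ℝ) (A B : ℤ) (J : Jet n) : ℝ :=
  ∑ᶠ kp : ℕ × ℕ,
    ((Ring.choose (-(kp.2 : ℤ)) kp.1 : ℤ) : ℝ) * a (A + kp.2 + kp.1) (B - kp.1) kp.2 J

/-- The coefficient of `λ^A (λ+μ)^C` in the expansion for `|λ| > |λ+μ|` of
`∑ a_{m,n,p} λ^m μ^n (λ+μ)^{-p}`, where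
`μ^n = ((λ+μ) - λ)^n = ∑_k binom(n,k) (λ+μ)^k (-λ)^{n-k}`. -/
def expandLamSum {n : ℕ} (a : ℤ → ℤ → ℕ → Jet n → ℝ) (A C : ℤ) (J : Jet n) : ℝ :=
  ∑ᶠ kpm : ℕ × ℕ × ℤ,
    if (kpm.1 : ℤ) - kpm.2.1 = C then
      (-1 : ℝ) ^ (kpm.2.2 - kpm.1) * ((Ring.choose kpm.2.2 kpm.1 : ℤ) : ℝ)
        * a (A + kpm.1 - kpm.2.2) kpm.2.2 kpm.2.1 J
    else 0

/-- `∑ a_{m,n,p} λ^m μ^n (λ+μ)^{-p}` is an element of `V_{λ,μ}`: the coefficients lie in `𝒜` and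
the exponents `m` and `n` are bounded above. -/
def IsAdmissibleArray {n : ℕ} (U : Set (Fin n → ℝ)) (a : ℤ → ℤ → ℕ → Jet n → ℝ) : Prop :=
  (∀ m l p, IsDiffFun U (a m l p)) ∧ ∃ M : ℤ, ∀ m l p, M < m ∨ M < l → a m l p = 0

namespace HydroOp

variable {n : ℕ}

/-- `W^i = w^i_k u^k_x` as an element of `𝒜`. -/
def jetTail (P : HydroOp n) (i : Fin n) (J : Jet n) : ℝ := ∑ k, P.w (J 0) i k * J 1 k

/-- `P^{ij}(λ+∂) F = g^{ij} (λ+∂) F + Γ^{ij}_k u^k_x F + W^i (λ+∂)⁻¹ (W^j F)`. -/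
def symbol (P : HydroOp n) (i j : Fin n) (F : LamSeries n) : LamSeries n := fun a J =>
  P.g (J 0) i j * lamPow 1 F a J
    + (∑ k, P.Γ (J 0) i j k * J 1 k) * F a J
    + P.jetTail i J * lamPow (-1) (fun b J => P.jetTail j J * F b J) a J

/-- The `λ`-bracket of elements of `𝒜`, given by the master formula
`{f_λ h} = ∂h/∂u^j_σ (λ+∂)^σ P^{ji}(λ+∂) (-λ-∂)^τ ∂f/∂u^i_τ`;
on the generators `{u^i_λ u^j} = P^{ji}(λ)`. -/
def lamBracket (P : HydroOp n) (f h : Jet n → ℝ) : LamSeries n := fun a J =>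
  ∑ i, ∑ j, ∑ᶠ στ : ℕ × ℕ,
    jetPartial στ.1 j h J * (-1) ^ στ.2
      * lamPow στ.1 (P.symbol j i (lamPow στ.2 (lamConst (jetPartial στ.2 i f)))) a J

/-- The skew-symmetry `{h_λ f} = -∑_s (-λ-∂)^s C_s(f,h)`, where `{f_λ h} = ∑_s C_s(f,h) λ^s`. -/
def PVASkew (P : HydroOp n) (U : Set (Fin n → ℝ)) (f h : Jet n → ℝ) : Prop :=
  ∀ (a : ℤ) (J : Jet n), J 0 ∈ U →
    P.lamBracket h f a J
      = -∑ᶠ s : ℤ, (-1 : ℝ) ^ s * lamPow s (lamConst (P.lamBracket f h s)) a J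

/-- The PVA-Jacobi identity `{f_λ {h_μ e}} - {h_μ {f_λ e}} = {{f_λ h}_{λ+μ} e}`:
the three terms are the expansions, in powers of `(λ,μ)`, `(μ,λ)` and `(λ,λ+μ)` respectively, of
elements `t₁`, `t₂`, `t₃` of `V_{λ,μ}`, and `t₁ - t₂ = t₃`. -/
def PVAJacobi (P : HydroOp n) (U : Set (Fin n → ℝ)) (f h e : Jet n → ℝ) : Prop :=
  ∃ t₁ t₂ t₃ : ℤ → ℤ → ℕ → Jet n → ℝ,
    IsAdmissibleArray U t₁ ∧ IsAdmissibleArray U t₂ ∧ IsAdmissibleArray U t₃ ∧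
    (∀ (A B : ℤ) (J : Jet n), J 0 ∈ U →
      P.lamBracket f (P.lamBracket h e B) A J = expandLamMu t₁ A B J) ∧
    (∀ (A B : ℤ) (J : Jet n), J 0 ∈ U →
      P.lamBracket h (P.lamBracket f e A) B J = expandMuLam t₂ A B J) ∧
    (∀ (A C : ℤ) (J : Jet n), J 0 ∈ U →
      P.lamBracket (P.lamBracket f h A) e C J = expandLamSum t₃ A C J) ∧
    t₁ - t₂ = t₃

/-- The `λ`-bracket of `P` satisfies the PVA skew-symmetry and the PVA-Jacobi identity on the
generators `u^1, …, u^n` of `𝒜`. -/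
def IsHamiltonianPVA (P : HydroOp n) (U : Set (Fin n → ℝ)) : Prop :=
  (∀ i j, P.PVASkew U (jetGen i) (jetGen j)) ∧
  (∀ i j k, P.PVAJacobi U (jetGen i) (jetGen j) (jetGen k))

end HydroOp

end

/-!
All three formalisms lead to the same pointwise identities, and the proof reduces to a computation
at a single point of the jet space.

The conditions are first rewritten as identities between multilinear forms at each point of `U`
(`HydroOp.conditions_iff`). Symmetry of `g` and its compatibility with `Γ` form `HydroOp.SkewAt`.
The other four systems form `HydroOp.JacobiAt`, in which the curvature and the covariant derivative
of `w` are expressed by `Γ^{ij}_k` and `g^{ij}` without inverting the metric.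

`SkewAt` on `U` is equivalent to skew-symmetry in each formalism (`HydroOp.op_skew_iff`,
`pvaSkew_iff_skewAt`). Given it, the linearization of `P` is skew-adjoint too, hence the Schouten
bracket is the pairing of the third covector with the Jacobi expression
`ℓ_q(P r) - ℓ_r(P q) - P(δ∫ q·P r)` (`HydroOp.schouten_eq`). In this expression the argument of the
outer `∂⁻¹` is a total derivative up to one term (`HydroOp.tail_identity`), and sorting the rest by
the nonlocal variables `∂⁻¹(W·q)` and `∂⁻¹(W·r)` leaves two local coefficients, `HydroOp.locCoeff`
and `HydroOp.nonlocCoeff` (`HydroOp.jacobi_local_identity`, `HydroOp.dotProduct_jacobiator`).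

For sufficiency, `JacobiAt` expresses the variational derivatives `adjTail` and `adjLoc`, contracted
with `g`, without derivatives of the coefficients of `P` (`HydroOp.gForm_adjTail`,
`HydroOp.gForm_adjLoc`). Differentiating these two formulas eliminates the remaining unknowns, so
that no second derivatives of the coefficients are needed and both coefficients vanish
(`HydroOp.nonlocCoeff_eq_zero`, `HydroOp.locCoeff_eq_zero`).

For necessity, the coefficients are evaluated where `u_x = 0`, for a prescribed `u_xx`: there
`nonlocCoeff` reduces to the symmetry of `w g` and the Codazzi expression, and `locCoeff` to the
torsion and the Gauss expression (`HydroOp.nonlocCoeff_of_vel_zero`,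
`HydroOp.locCoeff_of_vel_zero`). The nonlocal coefficient can be isolated only if `w u_xx ≠ 0`; the
points where `w` vanishes are reached by continuity (`HydroOp.wSymm_codazzi_of_nonloc`).

The formalism of distributions is that of differential operators read on kernels
(`HydroOp.isHamiltonianDist_iff_op`). For Poisson vertex algebras, the iterated brackets of
generators are computed as expansions of explicit elements of `V_{λ,μ}` (`brG_outer`, `brG_inner`).
Coefficient by coefficient these obey the same two identities, with basis covectors on which the
derivative acts as multiplication by `λ` and `μ` (`jacobi_loc_apply`, `jacobi_tail_apply`). Under
the conditions, the Jacobi expression becomes `-w G + w (λ + μ + ∂)⁻¹ (λ + μ + ∂) G`, which has zero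
expansion in powers of `λ` and `λ + μ` (`jacobiArr_eq_tailArr`, `expLS_tailArr_arrD`) and so can be
absorbed in the third term. Conversely, each of the three expansions determines the others, since in
each degree all of them expand the same rational function (`expLM_eq_zero_of_expLS`,
`expLM_eq_zero_of_swap`); hence the Jacobi identity forces the expansion for `|μ| > |λ|` of the
Jacobi expression to vanish, and its coefficients at jets with `u_x = 0` give the conditions
(`jacobiAt_of_pvaJacobi`).
-/


noncomputable section

/-! ### Multilinear forms with given coefficients -/

section Forms

variable {n : ℕ}

/-- The bilinear form `a_{ij} α_i β_j`. -/
def bilForm (a : Fin n → Fin n → ℝ) : (Fin n → ℝ) →ₗ[ℝ] (Fin n → ℝ) →ₗ[ℝ] ℝ :=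
  ∑ i, ∑ j, a i j • (LinearMap.proj i : (Fin n → ℝ) →ₗ[ℝ] ℝ).smulRight
    (LinearMap.proj j : (Fin n → ℝ) →ₗ[ℝ] ℝ)

/-- The trilinear form `c_{ijk} α_i β_j φ_k`. -/
def triForm (c : Fin n → Fin n → Fin n → ℝ) :
    (Fin n → ℝ) →ₗ[ℝ] (Fin n → ℝ) →ₗ[ℝ] (Fin n → ℝ) →ₗ[ℝ] ℝ :=
  ∑ i, (LinearMap.proj i : (Fin n → ℝ) →ₗ[ℝ] ℝ).smulRight (bilForm (c i))

/-- The quadrilinear form `c_{ijkl} α_i β_j φ_k ψ_l`. -/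
def quadForm (c : Fin n → Fin n → Fin n → Fin n → ℝ) :
    (Fin n → ℝ) →ₗ[ℝ] (Fin n → ℝ) →ₗ[ℝ] (Fin n → ℝ) →ₗ[ℝ] (Fin n → ℝ) →ₗ[ℝ] ℝ :=
  ∑ i, (LinearMap.proj i : (Fin n → ℝ) →ₗ[ℝ] ℝ).smulRight (triForm (c i))

theorem bilForm_apply (a : Fin n → Fin n → ℝ) (α β : Fin n → ℝ) :
    bilForm a α β = ∑ i, ∑ j, a i j * α i * β j := by
  simp [bilForm, mul_assoc]

theorem triForm_apply (c : Fin n → Fin n → Fin n → ℝ) (α β φ : Fin n → ℝ) :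
    triForm c α β φ = ∑ i, ∑ j, ∑ k, c i j k * α i * β j * φ k := by
  simp only [triForm, LinearMap.sum_apply, LinearMap.smulRight_apply, LinearMap.proj_apply,
    LinearMap.smul_apply, bilForm_apply, smul_eq_mul, Finset.mul_sum]
  refine Finset.sum_congr rfl fun i _ => Finset.sum_congr rfl fun j _ =>
    Finset.sum_congr rfl fun k _ => by ring

theorem quadForm_apply (c : Fin n → Fin n → Fin n → Fin n → ℝ) (α β φ ψ : Fin n → ℝ) :
    quadForm c α β φ ψ = ∑ i, ∑ j, ∑ k, ∑ l, c i j k l * α i * β j * φ k * ψ l := by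
  simp only [quadForm, LinearMap.sum_apply, LinearMap.smulRight_apply, LinearMap.proj_apply,
    LinearMap.smul_apply, triForm_apply, smul_eq_mul, Finset.mul_sum]
  refine Finset.sum_congr rfl fun i _ => Finset.sum_congr rfl fun j _ =>
    Finset.sum_congr rfl fun k _ => Finset.sum_congr rfl fun l _ => by ring

/-- The vector `i ↦ a_{ij} β_j`. -/
def bilVec (a : Fin n → Fin n → ℝ) : (Fin n → ℝ) →ₗ[ℝ] (Fin n → ℝ) :=
  LinearMap.pi fun i => bilForm a (Pi.single i 1)

/-- The covector `j ↦ a_{ij} α_i`. -/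
def bilCovec (a : Fin n → Fin n → ℝ) : (Fin n → ℝ) →ₗ[ℝ] (Fin n → ℝ) :=
  LinearMap.pi fun j => (bilForm a).flip (Pi.single j 1)

/-- The vector `i ↦ c_{ijk} β_j φ_k`. -/
def triVec (c : Fin n → Fin n → Fin n → ℝ) :
    (Fin n → ℝ) →ₗ[ℝ] (Fin n → ℝ) →ₗ[ℝ] (Fin n → ℝ) :=
  LinearMap.mk₂ ℝ (fun β φ i => triForm c (Pi.single i 1) β φ)
    (by intros; ext; simp) (by intros; ext; simp) (by intros; ext; simp) (by intros; ext; simp)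

theorem bilVec_apply (a : Fin n → Fin n → ℝ) (β : Fin n → ℝ) (i : Fin n) :
    bilVec a β i = ∑ j, a i j * β j := by
  simp [bilVec, bilForm_apply, Pi.single_apply]

theorem bilCovec_apply (a : Fin n → Fin n → ℝ) (α : Fin n → ℝ) (j : Fin n) :
    bilCovec a α j = ∑ i, a i j * α i := by
  simp [bilCovec, bilForm_apply, Pi.single_apply]

theorem triVec_apply (c : Fin n → Fin n → Fin n → ℝ) (β φ : Fin n → ℝ) (i : Fin n) :
    triVec c β φ i = ∑ j, ∑ k, c i j k * β j * φ k := by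
  simp [triVec, triForm_apply, Pi.single_apply]

theorem dotProduct_eq_of_linear (f : (Fin n → ℝ) →ₗ[ℝ] ℝ) (α : Fin n → ℝ) :
    (∑ i, α i * f (Pi.single i 1)) = f α := by
  conv_rhs => rw [LinearMap.pi_apply_eq_sum_univ f α]
  refine Finset.sum_congr rfl fun i _ => ?_
  rw [smul_eq_mul]
  congr 2
  ext j
  simp [Pi.single_apply, eq_comm]

@[simp] theorem dotProduct_bilVec (a : Fin n → Fin n → ℝ) (α β : Fin n → ℝ) :
    α ⬝ᵥ bilVec a β = bilForm a α β :=
  dotProduct_eq_of_linear ((bilForm a).flip β) α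

@[simp] theorem bilCovec_dotProduct (a : Fin n → Fin n → ℝ) (α β : Fin n → ℝ) :
    bilCovec a α ⬝ᵥ β = bilForm a α β := by
  rw [dotProduct_comm]
  exact dotProduct_eq_of_linear (bilForm a α) β

@[simp] theorem dotProduct_triVec (c : Fin n → Fin n → Fin n → ℝ) (α β φ : Fin n → ℝ) :
    α ⬝ᵥ triVec c β φ = triForm c α β φ :=
  dotProduct_eq_of_linear (((triForm c).flip β).flip φ) α

/-- The covector representing a linear functional. -/
def covec (f : (Fin n → ℝ) →ₗ[ℝ] ℝ) : Fin n → ℝ := fun i => f (Pi.single i 1)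

@[simp] theorem covec_dotProduct (f : (Fin n → ℝ) →ₗ[ℝ] ℝ) (φ : Fin n → ℝ) :
    covec f ⬝ᵥ φ = f φ := by
  rw [dotProduct_comm]
  exact dotProduct_eq_of_linear f φ

theorem covector_ext {y z : Fin n → ℝ} (h : ∀ φ, y ⬝ᵥ φ = z ⬝ᵥ φ) : y = z := by
  ext i
  simpa using h (Pi.single i 1)

/-- Two linear functions on `ℝⁿ` that agree on the standard basis are equal. -/
theorem IsLinearMap.eq_of_single {F G : (Fin n → ℝ) → ℝ} (hF : IsLinearMap ℝ F)
    (hG : IsLinearMap ℝ G) (h : ∀ i, F (Pi.single i 1) = G (Pi.single i 1)) (α : Fin n → ℝ) :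
    F α = G α := by
  have := dotProduct_eq_of_linear hF.mk' α
  have h2 := dotProduct_eq_of_linear hG.mk' α
  simp only [IsLinearMap.mk'_apply] at this h2
  rw [← this, ← h2]
  simp [h]

theorem HasDerivAt.bilForm {a : ℝ → Fin n → Fin n → ℝ} {a' : Fin n → Fin n → ℝ}
    {α β : ℝ → Fin n → ℝ} {α' β' : Fin n → ℝ} {x : ℝ}
    (ha : ∀ i j, HasDerivAt (fun y => a y i j) (a' i j) x)
    (hα : HasDerivAt α α' x) (hβ : HasDerivAt β β' x) :
    HasDerivAt (fun y => bilForm (a y) (α y) (β y))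
      (bilForm a' (α x) (β x) + bilForm (a x) α' (β x) + bilForm (a x) (α x) β') x := by
  simp only [bilForm_apply, ← Finset.sum_add_distrib]
  refine HasDerivAt.fun_sum fun i _ => HasDerivAt.fun_sum fun j _ => ?_
  refine (((ha i j).mul (hasDerivAt_pi.1 hα i)).mul (hasDerivAt_pi.1 hβ j)).congr_deriv ?_
  simp only [Pi.mul_apply]
  ring

theorem HasDerivAt.triForm {a : ℝ → Fin n → Fin n → Fin n → ℝ} {a' : Fin n → Fin n → Fin n → ℝ}
    {α β φ : ℝ → Fin n → ℝ} {α' β' φ' : Fin n → ℝ} {x : ℝ}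
    (ha : ∀ i j k, HasDerivAt (fun y => a y i j k) (a' i j k) x)
    (hα : HasDerivAt α α' x) (hβ : HasDerivAt β β' x) (hφ : HasDerivAt φ φ' x) :
    HasDerivAt (fun y => triForm (a y) (α y) (β y) (φ y))
      (triForm a' (α x) (β x) (φ x) + triForm (a x) α' (β x) (φ x)
        + triForm (a x) (α x) β' (φ x) + triForm (a x) (α x) (β x) φ') x := by
  simp only [triForm_apply, ← Finset.sum_add_distrib]
  refine HasDerivAt.fun_sum fun i _ => HasDerivAt.fun_sum fun j _ =>
    HasDerivAt.fun_sum fun k _ => ?_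
  refine ((((ha i j k).mul (hasDerivAt_pi.1 hα i)).mul (hasDerivAt_pi.1 hβ j)).mul
    (hasDerivAt_pi.1 hφ k)).congr_deriv ?_
  simp only [Pi.mul_apply]
  ring

end Forms

/-! ### The conditions as identities between multilinear forms -/

namespace HydroOp

variable {n : ℕ} (P : HydroOp n) (v : Fin n → ℝ)

/-- `g^{ij} α_i β_j` at the point `v`. -/
abbrev gForm := bilForm (P.g v)
/-- The vector `g^{ij} β_j`. -/
abbrev gVec := bilVec (P.g v)
/-- `Γ^{ij}_k α_i β_j φ^k`. -/
abbrev ΓForm := triForm (P.Γ v)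
/-- The vector `Γ^{ij}_k β_j φ^k`. -/
abbrev ΓVec := triVec (P.Γ v)
/-- `w^i_k α_i φ^k`. -/
abbrev wForm := bilForm (P.w v)
/-- The vector `w^i_k φ^k`. -/
abbrev wVec := bilVec (P.w v)
/-- The covector `w^i_k α_i`. -/
abbrev wCov := bilCovec (P.w v)
/-- `g^{ij}_{,l} α_i β_j φ^l`. -/
abbrev dgForm := triForm fun i j l => fieldDeriv l (fun v => P.g v i j) v
/-- `Γ^{ij}_{k,l} α_i β_j φ^k ψ^l`. -/
abbrev dΓForm := quadForm fun i j k l => fieldDeriv l (fun v => P.Γ v i j k) v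
/-- `w^i_{k,l} α_i φ^k ψ^l`. -/
abbrev dwForm := triForm fun i k l => fieldDeriv l (fun v => P.w v i k) v

/-- The expression whose vanishing for all arguments is the symmetry of `∇w`, with the
differentiation index raised. -/
def codazzi (p c ξ : Fin n → ℝ) : ℝ :=
  P.dwForm v c ξ (P.gVec v p) - P.dwForm v c (P.gVec v p) ξ + P.ΓForm v (P.wCov v p) c ξ
    - P.ΓForm v p c (P.wVec v ξ)

/-- The expression whose vanishing for all arguments is `R^{ij}_{kh} = w^i_k w^j_h - w^j_k w^i_h`,
with the index `k` raised. -/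
def gauss (p b c ξ : Fin n → ℝ) : ℝ :=
  P.ΓForm v p b (P.ΓVec v c ξ) - P.ΓForm v p c (P.ΓVec v b ξ)
    - P.dΓForm v b c ξ (P.gVec v p) + P.dΓForm v b c (P.gVec v p) ξ
    + P.wForm v c ξ * P.wForm v b (P.gVec v p) - P.wForm v b ξ * P.wForm v c (P.gVec v p)

/-- The first two systems of conditions at `v`: `g` is symmetric and `Γ` is compatible with it. -/
structure SkewAt : Prop where
  symm : ∀ a b, P.gForm v a b = P.gForm v b a
  compat : ∀ a b φ, P.dgForm v a b φ = P.ΓForm v a b φ + P.ΓForm v b a φ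

/-- The last four systems of conditions at `v`. -/
structure JacobiAt : Prop where
  torsion : ∀ a b c, P.ΓForm v b c (P.gVec v a) = P.ΓForm v a c (P.gVec v b)
  wSymm : ∀ a b, P.wForm v a (P.gVec v b) = P.wForm v b (P.gVec v a)
  codazzi : ∀ p c ξ, P.codazzi v p c ξ = 0
  gauss : ∀ p b c ξ, P.gauss v p b c ξ = 0

end HydroOp

/-! ### The Jacobi expression at a point -/

namespace HydroOp

variable {n : ℕ} (P : HydroOp n) (v ξ : Fin n → ℝ)

/-- The local part `g^{ij} r_j' + Γ^{ij}_k ξ^k r_j` of `P r`, for `u = v` and `u_x = ξ`. -/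
def loc (r0 r1 : Fin n → ℝ) : Fin n → ℝ := P.gVec v r1 + P.ΓVec v r0 ξ

/-- The linearization of `p_i w^i_k u^k_x` in a direction with value `φ` and derivative `φ'`. -/
def linTail (p φ φ' : Fin n → ℝ) : ℝ := P.dwForm v p ξ φ + P.wForm v p φ'

/-- The value at `p` of the linearization of the local part of `P q`. -/
def linLoc (p q0 q1 φ φ' : Fin n → ℝ) : ℝ :=
  P.dgForm v p q1 φ + P.dΓForm v p q0 ξ φ + P.ΓForm v p q0 φ'

/-- The adjoint of the linearization of `W`, applied to a covector with value `q0` and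
derivative `q1`. -/
def adjTail (q0 q1 : Fin n → ℝ) : Fin n → ℝ :=
  covec (P.dwForm v q0 ξ - (P.dwForm v q0).flip ξ - P.wForm v q1)

/-- The local part of the variational derivative of `∫ q · P r`. -/
def adjLoc (q0 q1 r0 r1 : Fin n → ℝ) : Fin n → ℝ :=
  covec (P.ΓForm v r1 q0 - P.ΓForm v q1 r0 + P.dΓForm v q0 r0 ξ - (P.dΓForm v q0 r0).flip ξ
    - P.wForm v r0 ξ • P.wForm v q0 + P.wForm v q0 ξ • P.wForm v r0)

theorem adjTail_dotProduct (q0 q1 φ : Fin n → ℝ) :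
    P.adjTail v ξ q0 q1 ⬝ᵥ φ = P.dwForm v q0 ξ φ - P.dwForm v q0 φ ξ - P.wForm v q1 φ := by
  simp [adjTail]

theorem adjLoc_dotProduct (q0 q1 r0 r1 φ : Fin n → ℝ) :
    P.adjLoc v ξ q0 q1 r0 r1 ⬝ᵥ φ = P.ΓForm v r1 q0 φ - P.ΓForm v q1 r0 φ
      + P.dΓForm v q0 r0 ξ φ - P.dΓForm v q0 r0 φ ξ - P.wForm v r0 ξ * P.wForm v q0 φ
      + P.wForm v q0 ξ * P.wForm v r0 φ := by
  simp [adjLoc]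

/-- The bilinear expression that the tail of the Jacobi expression is the derivative of, without
its nonlocal terms. -/
def bdry (q0 r0 Lq yr : Fin n → ℝ) : ℝ :=
  -P.wForm v r0 Lq - P.gForm v q0 yr + P.ΓForm v q0 r0 (P.wVec v ξ)

/-- The coefficient, paired with `p`, of `∂⁻¹(W·q)` in the Jacobi expression. Here `Lr`, `W` and
`yr` are the local part of `P r`, the tail and `adjTail` of `r`, and primes denote derivatives. -/
def nonlocCoeff (p r0 r1 W' Lr Lr' yr yr' : Fin n → ℝ) : ℝ :=
  P.linTail v ξ p Lr Lr' + P.wForm v r0 ξ * P.wForm v p (P.wVec v ξ)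
    - P.linLoc v ξ p r0 r1 (P.wVec v ξ) W'
    + P.gForm v p yr' + P.ΓForm v p yr ξ - P.wForm v p ξ * P.wForm v r0 (P.wVec v ξ)

/-- The local part, paired with `p`, of the Jacobi expression. -/
def locCoeff (p q0 q1 r0 r1 Lq Lq' Lr Lr' yq yr s s' : Fin n → ℝ) : ℝ :=
  P.linLoc v ξ p q0 q1 Lr (Lr' + P.wForm v r0 ξ • P.wVec v ξ)
    - P.linLoc v ξ p r0 r1 Lq (Lq' + P.wForm v q0 ξ • P.wVec v ξ)
    - P.gForm v p s' - P.ΓForm v p s ξ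
    - P.wForm v r0 ξ * P.gForm v p yq + P.wForm v q0 ξ * P.gForm v p yr
    + P.wForm v p ξ * P.bdry v ξ q0 r0 Lq yr

/-- The local part of the Jacobi expression, sorted by the nonlocal variables
`Q = ∂⁻¹(W·q)` and `R = ∂⁻¹(W·r)`. -/
theorem jacobi_local_identity (p q0 q1 r0 r1 W' Lq Lq' Lr Lr' yq yq' yr yr' s s' : Fin n → ℝ)
    (Q R : ℝ) :
    (P.linLoc v ξ p q0 q1 (Lr + R • P.wVec v ξ) (Lr' + R • W' + P.wForm v r0 ξ • P.wVec v ξ)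
      + Q * P.linTail v ξ p (Lr + R • P.wVec v ξ)
          (Lr' + R • W' + P.wForm v r0 ξ • P.wVec v ξ))
    - (P.linLoc v ξ p r0 r1 (Lq + Q • P.wVec v ξ) (Lq' + Q • W' + P.wForm v q0 ξ • P.wVec v ξ)
      + R * P.linTail v ξ p (Lq + Q • P.wVec v ξ)
          (Lq' + Q • W' + P.wForm v q0 ξ • P.wVec v ξ))
    - P.gForm v p (s' + R • yq' + P.wForm v r0 ξ • yq - Q • yr' - P.wForm v q0 ξ • yr)
    - P.ΓForm v p (s + R • yq - Q • yr) ξ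
    = P.locCoeff v ξ p q0 q1 r0 r1 Lq Lq' Lr Lr' yq yr s s'
      + Q * P.nonlocCoeff v ξ p r0 r1 W' Lr Lr' yr yr'
      - R * P.nonlocCoeff v ξ p q0 q1 W' Lq Lq' yq yq'
      - P.wForm v p ξ * (P.bdry v ξ q0 r0 Lq yr + R * P.wForm v q0 (P.wVec v ξ)
          - Q * P.wForm v r0 (P.wVec v ξ)) := by
  simp only [linLoc, linTail, locCoeff, nonlocCoeff, map_add, map_sub, map_smul, smul_eq_mul,
    LinearMap.add_apply, LinearMap.sub_apply, LinearMap.smul_apply]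
  ring

/-- The derivative of `bdry`, given by the product rule. -/
def bdryDeriv (q0 q1 r0 r1 W' Lq Lq' yr yr' : Fin n → ℝ) : ℝ :=
  -(P.dwForm v r0 Lq ξ + P.wForm v r1 Lq + P.wForm v r0 Lq')
    - (P.dgForm v q0 yr ξ + P.gForm v q1 yr + P.gForm v q0 yr')
    + (P.dΓForm v q0 r0 (P.wVec v ξ) ξ + P.ΓForm v q1 r0 (P.wVec v ξ)
      + P.ΓForm v q0 r1 (P.wVec v ξ) + P.ΓForm v q0 r0 W')

variable {P v ξ}

/-- The argument of the outer `∂⁻¹` in the Jacobi expression is a derivative up to the nonlocal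
coefficient. -/
theorem tail_identity (h : P.SkewAt v)
    (q0 q1 r0 r1 W' Lq Lq' Lr Lr' yr' : Fin n → ℝ) (Q R : ℝ)
    (hLq : Lq = P.loc v ξ q0 q1) :
    P.linTail v ξ q0 (Lr + R • P.wVec v ξ) (Lr' + R • W' + P.wForm v r0 ξ • P.wVec v ξ)
      - P.linTail v ξ r0 (Lq + Q • P.wVec v ξ) (Lq' + Q • W' + P.wForm v q0 ξ • P.wVec v ξ)
      - (P.adjLoc v ξ q0 q1 r0 r1 + R • P.adjTail v ξ q0 q1 - Q • P.adjTail v ξ r0 r1)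
          ⬝ᵥ P.wVec v ξ
    = P.bdryDeriv v ξ q0 q1 r0 r1 W' Lq Lq' (P.adjTail v ξ r0 r1) yr'
      + (P.wForm v r0 ξ * P.wForm v q0 (P.wVec v ξ)
        + R * (P.dwForm v q0 (P.wVec v ξ) ξ + P.wForm v q1 (P.wVec v ξ) + P.wForm v q0 W'))
      - (P.wForm v q0 ξ * P.wForm v r0 (P.wVec v ξ)
        + Q * (P.dwForm v r0 (P.wVec v ξ) ξ + P.wForm v r1 (P.wVec v ξ) + P.wForm v r0 W'))
      + P.nonlocCoeff v ξ q0 r0 r1 W' Lr Lr' (P.adjTail v ξ r0 r1) yr' := by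
  have e1 : P.adjTail v ξ r0 r1 ⬝ᵥ Lq = P.gForm v q1 (P.adjTail v ξ r0 r1)
      + P.ΓForm v (P.adjTail v ξ r0 r1) q0 ξ := by
    rw [hLq, loc, dotProduct_add, dotProduct_bilVec, dotProduct_triVec, h.symm]
  rw [adjTail_dotProduct] at e1
  simp only [linLoc, linTail, bdryDeriv, nonlocCoeff, map_add, map_smul, smul_eq_mul,
    add_dotProduct, sub_dotProduct, smul_dotProduct, adjLoc_dotProduct, adjTail_dotProduct, h.compat]
  linear_combination -e1

/-- Under the last four systems of conditions the variational expressions simplify: no derivative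
of a coefficient of the operator is left. -/
theorem gForm_adjTail (h : P.SkewAt v) (hJ : P.JacobiAt v) (p r0 r1 : Fin n → ℝ) :
    P.gForm v p (P.adjTail v ξ r0 r1)
      = -P.wForm v p (P.loc v ξ r0 r1) + P.ΓForm v p r0 (P.wVec v ξ) := by
  have e := adjTail_dotProduct P v ξ r0 r1 (P.gVec v p)
  have hc := hJ.codazzi p r0 ξ
  have e2 : P.ΓForm v (P.wCov v p) r0 ξ = P.wForm v p (P.ΓVec v r0 ξ) := by
    rw [← dotProduct_triVec, bilCovec_dotProduct]
  rw [HydroOp.codazzi, e2] at hc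
  rw [dotProduct_bilVec, h.symm] at e
  rw [e, loc, map_add, hJ.wSymm r1 p]
  linear_combination hc

/-- The counterpart of `gForm_adjTail` for the local part of the variational derivative; the
derivatives of `Γ` are eliminated by `gauss`. -/
theorem gForm_adjLoc (h : P.SkewAt v) (hJ : P.JacobiAt v) (p q0 q1 r0 r1 : Fin n → ℝ) :
    P.gForm v p (P.adjLoc v ξ q0 q1 r0 r1)
      = P.ΓForm v p q0 (P.loc v ξ r0 r1) - P.ΓForm v p r0 (P.loc v ξ q0 q1) := by
  have e := adjLoc_dotProduct P v ξ q0 q1 r0 r1 (P.gVec v p)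
  have hc := hJ.gauss p q0 r0 ξ
  rw [HydroOp.gauss] at hc
  rw [dotProduct_bilVec, h.symm] at e
  rw [e, loc, loc, map_add, map_add, hJ.torsion p r1 q0, hJ.torsion p q1 r0]
  linear_combination -hc

/-- The coefficient of the nonlocal variables vanishes. -/
theorem nonlocCoeff_eq_zero (h : P.SkewAt v) (hJ : P.JacobiAt v)
    (hs : Function.Surjective (P.gVec v)) (p r0 r1 W' Lr' yr' : Fin n → ℝ)
    (hy : P.dgForm v p (P.adjTail v ξ r0 r1) ξ + P.gForm v p yr'
      = -(P.dwForm v p (P.loc v ξ r0 r1) ξ + P.wForm v p Lr')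
        + (P.dΓForm v p r0 (P.wVec v ξ) ξ + P.ΓForm v p r1 (P.wVec v ξ) + P.ΓForm v p r0 W')) :
    P.nonlocCoeff v ξ p r0 r1 W' (P.loc v ξ r0 r1) Lr' (P.adjTail v ξ r0 r1) yr' = 0 := by
  obtain ⟨d, hd⟩ := hs (P.loc v ξ r0 r1)
  obtain ⟨o, ho⟩ := hs (P.wVec v ξ)
  -- With `d` and `o` the covectors of `Lr` and `W`, `adjTail = -(d w) + Γ(o, r; ·)`.
  have key : ∀ φ, P.adjTail v ξ r0 r1 ⬝ᵥ φ = -P.wForm v d φ + P.ΓForm v o r0 φ := by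
    intro φ
    obtain ⟨f, rfl⟩ := hs φ
    rw [dotProduct_bilVec, h.symm, gForm_adjTail h hJ, hJ.wSymm, hd, hJ.torsion f o r0, ho]
  have k1 := key (P.ΓVec v p ξ)
  rw [dotProduct_triVec] at k1
  have hc := hJ.codazzi d p ξ
  have hK := hJ.gauss o p r0 ξ
  rw [HydroOp.codazzi, hd, ← dotProduct_triVec (P.Γ v) (P.wCov v d), bilCovec_dotProduct] at hc
  rw [HydroOp.gauss, ho] at hK
  have t1 := hJ.torsion o d p
  have t2 := hJ.torsion o r1 p
  rw [ho] at t1 t2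
  have hL : P.loc v ξ r0 r1 = P.gVec v r1 + P.ΓVec v r0 ξ := rfl
  rw [hd, hL, map_add] at t1
  simp only [nonlocCoeff, linTail, linLoc, h.compat] at *
  linear_combination hy + hc + hK + t1 - t2 - k1

/-- The local part of the Jacobi expression vanishes. -/
theorem locCoeff_eq_zero (h : P.SkewAt v) (hJ : P.JacobiAt v)
    (hs : Function.Surjective (P.gVec v)) (p q0 q1 r0 r1 Lq' Lr' s' : Fin n → ℝ)
    (hS : P.dgForm v p (P.adjLoc v ξ q0 q1 r0 r1) ξ + P.gForm v p s'
      = (P.dΓForm v p q0 (P.loc v ξ r0 r1) ξ + P.ΓForm v p q1 (P.loc v ξ r0 r1)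
          + P.ΓForm v p q0 Lr')
        - (P.dΓForm v p r0 (P.loc v ξ q0 q1) ξ + P.ΓForm v p r1 (P.loc v ξ q0 q1)
          + P.ΓForm v p r0 Lq')) :
    P.locCoeff v ξ p q0 q1 r0 r1 (P.loc v ξ q0 q1) Lq' (P.loc v ξ r0 r1) Lr'
      (P.adjTail v ξ q0 q1) (P.adjTail v ξ r0 r1) (P.adjLoc v ξ q0 q1 r0 r1) s' = 0 := by
  obtain ⟨d, hd⟩ := hs (P.loc v ξ r0 r1)
  obtain ⟨e, he⟩ := hs (P.loc v ξ q0 q1)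
  -- With `d` and `e` the covectors of `Lr` and `Lq`, `adjLoc = Γ(d, q; ·) - Γ(e, r; ·)`.
  have key : ∀ φ, P.adjLoc v ξ q0 q1 r0 r1 ⬝ᵥ φ = P.ΓForm v d q0 φ - P.ΓForm v e r0 φ := by
    intro φ
    obtain ⟨f, rfl⟩ := hs φ
    rw [dotProduct_bilVec, h.symm, gForm_adjLoc h hJ, hJ.torsion f d q0, hd,
      hJ.torsion f e r0, he]
  have k1 := key (P.ΓVec v p ξ)
  rw [dotProduct_triVec] at k1
  have K1 := hJ.gauss d p q0 ξ
  have K2 := hJ.gauss e p r0 ξ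
  rw [HydroOp.gauss, hd] at K1
  rw [HydroOp.gauss, he] at K2
  have t1 := hJ.torsion d q1 p
  have t2 := hJ.torsion e r1 p
  have t3 := hJ.torsion d e p
  rw [hd] at t1 t3
  rw [he] at t2 t3
  have hL1 : P.loc v ξ r0 r1 = P.gVec v r1 + P.ΓVec v r0 ξ := rfl
  have hL2 : P.loc v ξ q0 q1 = P.gVec v q1 + P.ΓVec v q0 ξ := rfl
  have t4 : P.ΓForm v d p (P.loc v ξ q0 q1) = P.ΓForm v d p (P.gVec v q1)
      + P.ΓForm v d p (P.ΓVec v q0 ξ) := by rw [hL2, map_add]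
  have t5 : P.ΓForm v e p (P.loc v ξ r0 r1) = P.ΓForm v e p (P.gVec v r1)
      + P.ΓForm v e p (P.ΓVec v r0 ξ) := by rw [hL1, map_add]
  simp only [locCoeff, bdry, linLoc, h.compat, gForm_adjTail h hJ, map_add, map_smul,
    smul_eq_mul] at *
  linear_combination -hS + k1 - K1 + K2 + t1 - t2 - t4 + t5 - t3

/-- At a point where `u_x = 0`, for covectors whose first derivatives vanish there, the nonlocal
coefficient reduces to the symmetry of `w g` and the Codazzi expression. -/
theorem nonlocCoeff_of_vel_zero (h : P.SkewAt v) (p r0 r2 η yr' : Fin n → ℝ)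
    (hy : yr' = covec (P.dwForm v r0 η - (P.dwForm v r0).flip η - P.wForm v r2)) :
    P.nonlocCoeff v 0 p r0 0 (P.wVec v η) 0 (P.gVec v r2 + P.ΓVec v r0 η) 0 yr'
      = P.wForm v p (P.gVec v r2) - P.wForm v r2 (P.gVec v p) + P.codazzi v p r0 η := by
  have e : P.gForm v p yr' = P.dwForm v r0 η (P.gVec v p) - P.dwForm v r0 (P.gVec v p) η
      - P.wForm v r2 (P.gVec v p) := by
    rw [h.symm, ← dotProduct_bilVec, hy, covec_dotProduct]
    simp
  have e2 : P.ΓForm v (P.wCov v p) r0 η = P.wForm v p (P.ΓVec v r0 η) := by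
    rw [← dotProduct_triVec, bilCovec_dotProduct]
  simp only [nonlocCoeff, linTail, linLoc, HydroOp.codazzi, e, e2, map_zero, map_add]
  ring

/-- At a point where `u_x = 0`, for covectors whose first derivatives vanish there, the local part
reduces to the torsion and the Gauss expression. -/
theorem locCoeff_of_vel_zero (h : P.SkewAt v) (p q0 q2 r0 r2 η s' : Fin n → ℝ)
    (hs : s' = covec (P.ΓForm v r2 q0 - P.ΓForm v q2 r0 + P.dΓForm v q0 r0 η
      - (P.dΓForm v q0 r0).flip η - P.wForm v r0 η • P.wForm v q0
      + P.wForm v q0 η • P.wForm v r0)) :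
    P.locCoeff v 0 p q0 0 r0 0 0 (P.gVec v q2 + P.ΓVec v q0 η) 0 (P.gVec v r2 + P.ΓVec v r0 η)
      0 0 0 s'
      = P.ΓForm v p q0 (P.gVec v r2) - P.ΓForm v r2 q0 (P.gVec v p)
        - (P.ΓForm v p r0 (P.gVec v q2) - P.ΓForm v q2 r0 (P.gVec v p))
        + P.gauss v p q0 r0 η := by
  have e : P.gForm v p s' = P.ΓForm v r2 q0 (P.gVec v p) - P.ΓForm v q2 r0 (P.gVec v p)
      + P.dΓForm v q0 r0 η (P.gVec v p) - P.dΓForm v q0 r0 (P.gVec v p) η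
      - P.wForm v r0 η * P.wForm v q0 (P.gVec v p)
      + P.wForm v q0 η * P.wForm v r0 (P.gVec v p) := by
    rw [h.symm, ← dotProduct_bilVec, hs, covec_dotProduct]
    simp
  simp only [locCoeff, linLoc, bdry, HydroOp.gauss, e, map_zero, map_add, zero_smul,
    add_zero, zero_mul]
  ring

end HydroOp

/-! ### Derivatives along curves -/

section Curves

variable {n : ℕ}

theorem hasDerivAt_comp_curve {f : (Fin n → ℝ) → ℝ} {u : ℝ → Fin n → ℝ} {ξ : Fin n → ℝ} {x : ℝ}
    (hf : DifferentiableAt ℝ f (u x)) (hu : HasDerivAt u ξ x) :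
    HasDerivAt (fun y => f (u y)) (∑ l, fieldDeriv l f (u x) * ξ l) x := by
  refine (hf.hasFDerivAt.comp_hasDerivAt x hu).congr_deriv ?_
  refine (dotProduct_eq_of_linear (fderiv ℝ f (u x) : (Fin n → ℝ) →ₗ[ℝ] ℝ) ξ).symm.trans ?_
  simp [fieldDeriv, mul_comm]

theorem bilForm_sum_mul (c : Fin n → Fin n → Fin n → ℝ) (χ α β : Fin n → ℝ) :
    bilForm (fun i j => ∑ l, c i j l * χ l) α β = triForm c α β χ := by
  simp only [bilForm_apply, triForm_apply, Finset.sum_mul]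
  refine Finset.sum_congr rfl fun i _ => Finset.sum_congr rfl fun j _ =>
    Finset.sum_congr rfl fun k _ => by ring

theorem triForm_sum_mul (c : Fin n → Fin n → Fin n → Fin n → ℝ) (χ α β φ : Fin n → ℝ) :
    triForm (fun i j k => ∑ l, c i j k l * χ l) α β φ = quadForm c α β φ χ := by
  simp only [triForm_apply, quadForm_apply, Finset.sum_mul]
  refine Finset.sum_congr rfl fun i _ => Finset.sum_congr rfl fun j _ =>
    Finset.sum_congr rfl fun k _ => Finset.sum_congr rfl fun l _ => by ring

@[simp] theorem bilForm_single (a : Fin n → Fin n → ℝ) (i j : Fin n) :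
    bilForm a (Pi.single i 1) (Pi.single j 1) = a i j := by
  simp [bilForm_apply, Pi.single_apply]

@[simp] theorem triForm_single (c : Fin n → Fin n → Fin n → ℝ) (i j k : Fin n) :
    triForm c (Pi.single i 1) (Pi.single j 1) (Pi.single k 1) = c i j k := by
  simp [triForm_apply, Pi.single_apply]

@[simp] theorem quadForm_single (c : Fin n → Fin n → Fin n → Fin n → ℝ) (i j k l : Fin n) :
    quadForm c (Pi.single i 1) (Pi.single j 1) (Pi.single k 1) (Pi.single l 1) = c i j k l := by
  simp [quadForm_apply, Pi.single_apply]

theorem ContDiffOn.differentiableAt_of_isOpen {U : Set (Fin n → ℝ)} (hU : IsOpen U)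
    {f : (Fin n → ℝ) → ℝ} (hf : ContDiffOn ℝ ∞ f U) {v : Fin n → ℝ} (hv : v ∈ U) :
    DifferentiableAt ℝ f v :=
  (hf.contDiffAt (hU.mem_nhds hv)).differentiableAt (by simp)

end Curves

namespace HydroOp

variable {n : ℕ} {P : HydroOp n} {U : Set (Fin n → ℝ)} {u α β φ : ℝ → Fin n → ℝ}
  {ξ α' β' φ' : Fin n → ℝ} {x : ℝ}

theorem hasDerivAt_gForm (hU : IsOpen U) (hP : P.SmoothOn U) (hx : u x ∈ U)
    (hu : HasDerivAt u ξ x) (hα : HasDerivAt α α' x) (hβ : HasDerivAt β β' x) :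
    HasDerivAt (fun y => P.gForm (u y) (α y) (β y))
      (P.dgForm (u x) (α x) (β x) ξ + P.gForm (u x) α' (β x) + P.gForm (u x) (α x) β') x := by
  rw [← bilForm_sum_mul]
  exact HasDerivAt.bilForm
    (fun i j => hasDerivAt_comp_curve ((hP.1 i j).differentiableAt_of_isOpen hU hx) hu) hα hβ

theorem hasDerivAt_wForm (hU : IsOpen U) (hP : P.SmoothOn U) (hx : u x ∈ U)
    (hu : HasDerivAt u ξ x) (hα : HasDerivAt α α' x) (hβ : HasDerivAt β β' x) :
    HasDerivAt (fun y => P.wForm (u y) (α y) (β y))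
      (P.dwForm (u x) (α x) (β x) ξ + P.wForm (u x) α' (β x) + P.wForm (u x) (α x) β') x := by
  rw [← bilForm_sum_mul]
  exact HasDerivAt.bilForm
    (fun i j => hasDerivAt_comp_curve ((hP.2.2 i j).differentiableAt_of_isOpen hU hx) hu) hα hβ

theorem hasDerivAt_ΓForm (hU : IsOpen U) (hP : P.SmoothOn U) (hx : u x ∈ U)
    (hu : HasDerivAt u ξ x) (hα : HasDerivAt α α' x) (hβ : HasDerivAt β β' x)
    (hφ : HasDerivAt φ φ' x) :
    HasDerivAt (fun y => P.ΓForm (u y) (α y) (β y) (φ y))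
      (P.dΓForm (u x) (α x) (β x) (φ x) ξ + P.ΓForm (u x) α' (β x) (φ x)
        + P.ΓForm (u x) (α x) β' (φ x) + P.ΓForm (u x) (α x) (β x) φ') x := by
  rw [← triForm_sum_mul]
  exact HasDerivAt.triForm
    (fun i j k => hasDerivAt_comp_curve ((hP.2.1 i j k).differentiableAt_of_isOpen hU hx) hu)
    hα hβ hφ

/-! ### The Christoffel symbols and the curvature -/

variable {v : Fin n → ℝ}

theorem lowerMetric_contDiffOn (hP : P.SmoothOn U) (hg : P.NondegenerateOn U) (i j : Fin n) :
    ContDiffOn ℝ ∞ (fun v => P.lowerMetric v i j) U := by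
  have hdet : ∀ M : (Fin n → ℝ) → Matrix (Fin n) (Fin n) ℝ,
      (∀ i j, ContDiffOn ℝ ∞ (fun v => M v i j) U) → ContDiffOn ℝ ∞ (fun v => (M v).det) U := by
    intro M hM
    simp only [Matrix.det_apply]
    exact ContDiffOn.sum fun σ _ => (contDiffOn_prod fun k _ => hM _ _).const_smul _
  have h1 : ∀ v ∈ U, P.lowerMetric v i j
      = ((Matrix.of (P.g v)).det)⁻¹ * (Matrix.of (P.g v)).adjugate i j := by
    intro v _
    simp [lowerMetric, Matrix.inv_def]
  refine ContDiffOn.congr (ContDiffOn.mul ((hdet _ fun i j => hP.1 i j).inv fun v hv => hg v hv)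
    ?_) h1
  simp only [Matrix.adjugate_apply]
  refine hdet _ fun a b => ?_
  by_cases hab : a = j
  · subst hab
    simpa using contDiffOn_const
  · simpa [Matrix.updateRow_ne hab] using hP.1 a b

theorem christoffel_contDiffOn (hP : P.SmoothOn U) (hg : P.NondegenerateOn U) (k i j : Fin n) :
    ContDiffOn ℝ ∞ (P.christoffel k i j) U := by
  unfold christoffel
  exact (ContDiffOn.sum fun l _ => (lowerMetric_contDiffOn hP hg i l).mul (hP.2.1 l k j)).neg

theorem gVec_eq_mulVec (a : Fin n → ℝ) : P.gVec v a = (Matrix.of (P.g v)).mulVec a := by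
  ext i
  simp [bilVec_apply, Matrix.mulVec, _root_.dotProduct]

theorem gVec_surjective (hg : (Matrix.of (P.g v)).det ≠ 0) :
    Function.Surjective (P.gVec v) := by
  intro φ
  refine ⟨(Matrix.of (P.g v))⁻¹.mulVec φ, ?_⟩
  rw [gVec_eq_mulVec, Matrix.mulVec_mulVec, Matrix.mul_nonsing_inv _ (isUnit_iff_ne_zero.2 hg),
    Matrix.one_mulVec]

variable (P v) in
/-- `Γ^k_{ij} γ_k φ^i ψ^j`. -/
abbrev chrForm := triForm fun k i j => P.christoffel k i j v

theorem chrForm_gVec (hg : (Matrix.of (P.g v)).det ≠ 0) (h : ∀ i j, P.g v i j = P.g v j i)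
    (p γ ψ : Fin n → ℝ) :
    P.chrForm v γ (P.gVec v p) ψ = -P.ΓForm v p γ ψ := by
  have hinv : ∀ l m, ∑ i, P.lowerMetric v i l * P.g v i m = if l = m then 1 else 0 := by
    intro l m
    have h1 : ((Matrix.of (P.g v)) * (Matrix.of (P.g v))⁻¹) m l = (1 : Matrix _ _ ℝ) m l := by
      rw [Matrix.mul_nonsing_inv _ (isUnit_iff_ne_zero.2 hg)]
    rw [Matrix.mul_apply, Matrix.one_apply] at h1
    simp only [eq_comm (a := m)] at h1
    rw [← h1]
    refine Finset.sum_congr rfl fun i _ => ?_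
    rw [lowerMetric, Matrix.of_apply, h i m, mul_comm]
  refine IsLinearMap.eq_of_single (F := fun p => P.chrForm v γ (P.gVec v p) ψ)
    (G := fun p => -P.ΓForm v p γ ψ) ⟨by intros; simp, by intros; simp⟩
    ⟨by intros; simp; ring, by intros; simp⟩ (fun m => ?_) p
  refine IsLinearMap.eq_of_single (F := fun γ => P.chrForm v γ (P.gVec v _) ψ)
    (G := fun γ => -P.ΓForm v _ γ ψ) ⟨by intros; simp, by intros; simp⟩
    ⟨by intros; simp; ring, by intros; simp⟩ (fun k => ?_) γ
  refine IsLinearMap.eq_of_single (F := fun ψ => P.chrForm v _ (P.gVec v _) ψ)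
    (G := fun ψ => -P.ΓForm v _ _ ψ) ⟨by intros; simp, by intros; simp⟩
    ⟨by intros; simp; ring, by intros; simp⟩ (fun j => ?_) ψ
  rw [triForm_single]
  simp only [triForm_apply, Pi.single_apply, bilVec_apply, mul_ite, mul_one, mul_zero, ite_mul,
    zero_mul, Finset.sum_ite_eq', Finset.mem_univ, if_true, Finset.sum_ite_irrel,
    Finset.sum_const_zero, christoffel, neg_mul, Finset.sum_neg_distrib, Finset.sum_mul]
  rw [Finset.sum_comm]
  congr 1
  calc ∑ l, ∑ i, P.lowerMetric v i l * P.Γ v l k j * P.g v i m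
      = ∑ l, P.Γ v l k j * ∑ i, P.lowerMetric v i l * P.g v i m := by
        refine Finset.sum_congr rfl fun l _ => ?_
        rw [Finset.mul_sum]
        refine Finset.sum_congr rfl fun i _ => by ring
    _ = P.Γ v m k j := by simp [hinv]

theorem SkewAt_iff : P.SkewAt v ↔ (∀ i j, P.g v i j = P.g v j i) ∧
    (∀ i j k, fieldDeriv k (fun v => P.g v i j) v = P.Γ v i j k + P.Γ v j i k) := by
  constructor
  · intro h
    refine ⟨fun i j => ?_, fun i j k => ?_⟩
    · simpa using h.symm (Pi.single i 1) (Pi.single j 1)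
    · simpa using h.compat (Pi.single i 1) (Pi.single j 1) (Pi.single k 1)
  · rintro ⟨h1, h2⟩
    refine ⟨fun a b => ?_, fun a b φ => ?_⟩
    · simp only [bilForm_apply]
      rw [Finset.sum_comm]
      refine Finset.sum_congr rfl fun i _ => Finset.sum_congr rfl fun j _ => ?_
      rw [h1 j i]; ring
    · have : P.ΓForm v b a φ = triForm (fun i j k => P.Γ v j i k) a b φ := by
        simp only [triForm_apply]
        rw [Finset.sum_comm]
        refine Finset.sum_congr rfl fun i _ => Finset.sum_congr rfl fun j _ =>
          Finset.sum_congr rfl fun k _ => by ring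
      rw [this]
      simp only [triForm_apply, ← Finset.sum_add_distrib]
      refine Finset.sum_congr rfl fun i _ => Finset.sum_congr rfl fun j _ =>
        Finset.sum_congr rfl fun k _ => by rw [h2]; ring

theorem chrForm_symm (hg : (Matrix.of (P.g v)).det ≠ 0) (h : ∀ i j, P.g v i j = P.g v j i)
    (ht : ∀ a b c, P.ΓForm v b c (P.gVec v a) = P.ΓForm v a c (P.gVec v b)) (γ φ ψ : Fin n → ℝ) :
    P.chrForm v γ φ ψ = P.chrForm v γ ψ φ := by
  obtain ⟨a, rfl⟩ := gVec_surjective hg φ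
  obtain ⟨b, rfl⟩ := gVec_surjective hg ψ
  rw [chrForm_gVec hg h, chrForm_gVec hg h, ht]

theorem nablaW_eq (i j k : Fin n) :
    P.nablaW i j k v = P.dwForm v (Pi.single j 1) (Pi.single k 1) (Pi.single i 1)
      + P.chrForm v (Pi.single j 1) (Pi.single i 1) (P.wVec v (Pi.single k 1))
      - P.chrForm v (P.wCov v (Pi.single j 1)) (Pi.single i 1) (Pi.single k 1) := by
  rw [nablaW, triForm_single]
  simp [triForm_apply, Pi.single_apply, bilVec_apply, bilCovec_apply]

/-- `Γ^k_{ij,l} γ_k φ^i ψ^j χ^l`. -/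
abbrev dchrForm (P : HydroOp n) (v : Fin n → ℝ) :=
  quadForm fun k i j l => fieldDeriv l (P.christoffel k i j) v

/-- The curvature with its first index raised, as a multilinear form. -/
def riemannForm (P : HydroOp n) (v α γ ψ χ : Fin n → ℝ) : ℝ :=
  P.dchrForm v γ (P.gVec v α) ψ χ - P.dchrForm v γ (P.gVec v α) χ ψ
    + P.chrForm v γ χ (triVec (fun k i j => P.christoffel k i j v) (P.gVec v α) ψ)
    - P.chrForm v γ ψ (triVec (fun k i j => P.christoffel k i j v) (P.gVec v α) χ)

theorem riemannUp_eq (h : ∀ i j, P.g v i j = P.g v j i) (i j k l : Fin n) :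
    P.riemannUp i j k l v
      = P.riemannForm v (Pi.single i 1) (Pi.single j 1) (Pi.single k 1) (Pi.single l 1) := by
  have key : ∀ φ : Fin n → ℝ, ∑ s, φ s * P.riemann j s k l v
      = P.dchrForm v (Pi.single j 1) φ (Pi.single k 1) (Pi.single l 1)
        - P.dchrForm v (Pi.single j 1) φ (Pi.single l 1) (Pi.single k 1)
        + P.chrForm v (Pi.single j 1) (Pi.single l 1)
            (triVec (fun k i j => P.christoffel k i j v) φ (Pi.single k 1))
        - P.chrForm v (Pi.single j 1) (Pi.single k 1)
            (triVec (fun k i j => P.christoffel k i j v) φ (Pi.single l 1)) := by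
    intro φ
    refine IsLinearMap.eq_of_single (F := fun φ => ∑ s, φ s * P.riemann j s k l v)
      (G := fun φ => P.dchrForm v (Pi.single j 1) φ (Pi.single k 1) (Pi.single l 1)
        - P.dchrForm v (Pi.single j 1) φ (Pi.single l 1) (Pi.single k 1)
        + P.chrForm v (Pi.single j 1) (Pi.single l 1)
            (triVec (fun k i j => P.christoffel k i j v) φ (Pi.single k 1))
        - P.chrForm v (Pi.single j 1) (Pi.single k 1)
            (triVec (fun k i j => P.christoffel k i j v) φ (Pi.single l 1)))
      ⟨fun a b => ?_, fun c a => ?_⟩ ⟨fun a b => ?_, fun c a => ?_⟩ (fun s => ?_) φ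
    · simp [add_mul, Finset.sum_add_distrib]
    · simp [Finset.mul_sum, mul_assoc]
    · simp only [map_add, LinearMap.add_apply]; ring
    · simp only [map_smul, LinearMap.smul_apply, smul_eq_mul]; ring
    · rw [quadForm_single, quadForm_single]
      simp [riemann, triForm_apply, triVec_apply, Pi.single_apply]
  rw [riemannForm, ← key, riemannUp]
  refine Finset.sum_congr rfl fun s _ => ?_
  rw [bilVec_apply]
  simp [Pi.single_apply, h i s]

/-- The derivative of `g^{il} Γ^j_{lk} = -Γ^{ij}_k`. -/
theorem dchrForm_gVec (hU : IsOpen U) (hP : P.SmoothOn U) (hg : P.NondegenerateOn U)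
    (hS : ∀ v ∈ U, P.SkewAt v) (hv : v ∈ U) (α γ ψ χ : Fin n → ℝ) :
    P.dchrForm v γ (P.gVec v α) ψ χ
      + P.chrForm v γ (triVec (fun i j l => fieldDeriv l (fun v => P.g v i j) v) α χ) ψ
      = -P.dΓForm v α γ ψ χ := by
  have hu : HasDerivAt (fun t : ℝ => v + t • χ) χ 0 := by
    simpa using ((hasDerivAt_id (0 : ℝ)).smul_const χ).const_add v
  have h0 : v + (0 : ℝ) • χ = v := by simp
  have hx : (fun t : ℝ => v + t • χ) 0 ∈ U := by simpa using hv
  have hgV : HasDerivAt (fun t : ℝ => P.gVec (v + t • χ) α)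
      (triVec (fun i j l => fieldDeriv l (fun v => P.g v i j) v) α χ) 0 := by
    refine hasDerivAt_pi.2 fun i => ?_
    have := hasDerivAt_gForm hU hP hx hu (hasDerivAt_const _ (Pi.single i 1))
      (hasDerivAt_const _ α)
    simpa [triVec, bilVec] using this
  have h1 : HasDerivAt (fun t : ℝ => P.chrForm (v + t • χ) γ (P.gVec (v + t • χ) α) ψ)
      (P.dchrForm v γ (P.gVec v α) ψ χ
        + P.chrForm v γ (triVec (fun i j l => fieldDeriv l (fun v => P.g v i j) v) α χ) ψ) 0 := by
    have := HasDerivAt.triForm (x := 0) (a := fun t k i j => P.christoffel k i j (v + t • χ))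
      (fun k i j => hasDerivAt_comp_curve
        ((christoffel_contDiffOn hP hg k i j).differentiableAt_of_isOpen hU hx) hu)
      (hasDerivAt_const _ γ) hgV (hasDerivAt_const _ ψ)
    rw [triForm_sum_mul] at this
    simpa using this
  have h2 : HasDerivAt (fun t : ℝ => -P.ΓForm (v + t • χ) α γ ψ) (-P.dΓForm v α γ ψ χ) 0 := by
    have := (hasDerivAt_ΓForm hU hP hx hu (hasDerivAt_const _ α) (hasDerivAt_const _ γ)
      (hasDerivAt_const _ ψ)).fun_neg
    simpa using this
  refine (h1.congr_of_eventuallyEq ?_).unique h2 |>.symm ▸ rfl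
  have hmem : ∀ᶠ t in nhds (0 : ℝ), v + t • χ ∈ U :=
    hu.continuousAt.eventually_mem (hU.mem_nhds hx)
  filter_upwards [hmem] with t ht
  rw [chrForm_gVec (hg _ ht) (SkewAt_iff.1 (hS _ ht)).1]

theorem gauss_eq (hU : IsOpen U) (hP : P.SmoothOn U) (hg : P.NondegenerateOn U)
    (hS : ∀ v ∈ U, P.SkewAt v) (hv : v ∈ U)
    (ht : ∀ a b c, P.ΓForm v b c (P.gVec v a) = P.ΓForm v a c (P.gVec v b))
    (p b c ξ : Fin n → ℝ) :
    P.gauss v p b c ξ = -P.riemannForm v b c (P.gVec v p) ξ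
      + (P.wForm v b (P.gVec v p) * P.wForm v c ξ - P.wForm v c (P.gVec v p) * P.wForm v b ξ) := by
  have hs := chrForm_symm (hg v hv) (SkewAt_iff.1 (hS v hv)).1 ht
  have hc := chrForm_gVec (hg v hv) (SkewAt_iff.1 (hS v hv)).1
  have d1 := dchrForm_gVec hU hP hg hS hv b c (P.gVec v p) ξ
  have d2 := dchrForm_gVec hU hP hg hS hv b c ξ (P.gVec v p)
  obtain ⟨x, rfl⟩ := gVec_surjective (hg v hv) ξ
  rw [hs, hc] at d1 d2
  have hV : ∀ χ, triVec (fun i j l => fieldDeriv l (fun v => P.g v i j) v) b χ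
      + triVec (fun k i j => P.christoffel k i j v) (P.gVec v b) χ = P.ΓVec v b χ := by
    intro χ
    ext i
    have e1 := (hS v hv).compat (Pi.single i 1) b χ
    have e2 := hc b (Pi.single i 1) χ
    rw [← dotProduct_triVec] at e1 e2
    simp only [single_one_dotProduct] at e1 e2
    rw [Pi.add_apply, e1, e2, ← dotProduct_triVec]
    simp
  have hX : P.ΓForm v x c (P.ΓVec v b (P.gVec v p)) = P.ΓForm v p b (P.ΓVec v c (P.gVec v x)) := by
    have : P.ΓVec v b (P.gVec v p) = P.gVec v (covec (P.ΓForm v p b)) := by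
      refine covector_ext fun δ => ?_
      rw [dotProduct_comm, dotProduct_triVec, dotProduct_comm, dotProduct_bilVec,
        (hS v hv).symm, ← dotProduct_bilVec, covec_dotProduct, ht]
    rw [this, ht (covec (P.ΓForm v p b)) x c, ← dotProduct_triVec, covec_dotProduct]
  rw [gauss, riemannForm, hc, hc, hX.symm]
  have a1 := congrArg (P.ΓForm v p c) (hV (P.gVec v x))
  have a2 := congrArg (P.ΓForm v x c) (hV (P.gVec v p))
  rw [map_add] at a1 a2
  linear_combination d1 - d2 + a1 - a2

theorem codazzi_eq (hg : (Matrix.of (P.g v)).det ≠ 0) (hS : P.SkewAt v)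
    (ht : ∀ a b c, P.ΓForm v b c (P.gVec v a) = P.ΓForm v a c (P.gVec v b))
    (hw : ∀ a b, P.wForm v a (P.gVec v b) = P.wForm v b (P.gVec v a)) (p γ ψ : Fin n → ℝ) :
    P.codazzi v p γ ψ = triForm (fun i j k => P.nablaW i j k v) (P.gVec v p) γ ψ
      - triForm (fun i j k => P.nablaW i j k v) ψ γ (P.gVec v p) := by
  have hN : ∀ φ γ ψ, triForm (fun i j k => P.nablaW i j k v) φ γ ψ
      = P.dwForm v γ ψ φ + P.chrForm v γ φ (P.wVec v ψ) - P.chrForm v (P.wCov v γ) φ ψ := by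
    intro φ γ ψ
    refine IsLinearMap.eq_of_single (F := fun φ => triForm (fun i j k => P.nablaW i j k v) φ γ ψ)
      (G := fun φ => P.dwForm v γ ψ φ + P.chrForm v γ φ (P.wVec v ψ)
        - P.chrForm v (P.wCov v γ) φ ψ)
      ⟨by intros; simp, by intros; simp⟩ ⟨by intros; simp; ring, by intros; simp; ring⟩
      (fun i => ?_) φ
    refine IsLinearMap.eq_of_single (F := fun γ => triForm (fun i j k => P.nablaW i j k v) _ γ ψ)
      (G := fun γ => P.dwForm v γ ψ _ + P.chrForm v γ _ (P.wVec v ψ)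
        - P.chrForm v (P.wCov v γ) _ ψ)
      ⟨by intros; simp, by intros; simp⟩ ⟨by intros; simp; ring, by intros; simp; ring⟩
      (fun j => ?_) γ
    refine IsLinearMap.eq_of_single (F := fun ψ => triForm (fun i j k => P.nablaW i j k v) _ _ ψ)
      (G := fun ψ => P.dwForm v _ ψ _ + P.chrForm v _ _ (P.wVec v ψ)
        - P.chrForm v (P.wCov v _) _ ψ)
      ⟨by intros; simp, by intros; simp⟩ ⟨by intros; simp; ring, by intros; simp; ring⟩
      (fun k => ?_) ψ
    rw [triForm_single, nablaW_eq]
  have hs := chrForm_symm hg (SkewAt_iff.1 hS).1 ht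
  have hc := chrForm_gVec hg (SkewAt_iff.1 hS).1
  have hwg : P.wVec v (P.gVec v p) = P.gVec v (P.wCov v p) := by
    refine covector_ext fun δ => ?_
    rw [dotProduct_comm, dotProduct_bilVec, dotProduct_comm _ δ, dotProduct_bilVec, hS.symm δ,
      ← dotProduct_bilVec (P.g v), bilCovec_dotProduct, hw]
  have c1 := hc (P.wCov v p) γ ψ
  rw [hs, ← hwg] at c1
  rw [hN, hN, hc, c1, hs (P.wCov v γ) ψ, codazzi]
  ring

/-- The index conditions are the two systems `SkewAt` and `JacobiAt`. -/
theorem conditions_iff (hU : IsOpen U) (hP : P.SmoothOn U) (hg : P.NondegenerateOn U) :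
    P.Conditions U ↔ (∀ v ∈ U, P.SkewAt v) ∧ ∀ v ∈ U, P.JacobiAt v := by
  have hT : ∀ v, P.SkewAt v →
      ((∀ i j k, ∑ s, P.g v i s * P.Γ v j k s = ∑ s, P.g v j s * P.Γ v i k s) ↔
      ∀ a b c, P.ΓForm v b c (P.gVec v a) = P.ΓForm v a c (P.gVec v b)) := by
    intro v hS
    have e : ∀ i j k, P.ΓForm v (Pi.single j 1) (Pi.single k 1) (P.gVec v (Pi.single i 1))
        = ∑ s, P.g v i s * P.Γ v j k s := by
      intro i j k
      simp [triForm_apply, bilVec_apply, Pi.single_apply, (SkewAt_iff.1 hS).1 i, mul_comm]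
    refine ⟨fun h a b c => ?_, fun h i j k => by rw [← e, ← e, h]⟩
    refine IsLinearMap.eq_of_single (F := fun a => P.ΓForm v b c (P.gVec v a))
      (G := fun a => P.ΓForm v a c (P.gVec v b)) ⟨by intros; simp, by intros; simp⟩
      ⟨by intros; simp, by intros; simp⟩ (fun i => ?_) a
    refine IsLinearMap.eq_of_single (F := fun b => P.ΓForm v b c (P.gVec v _))
      (G := fun b => P.ΓForm v _ c (P.gVec v b)) ⟨by intros; simp, by intros; simp⟩
      ⟨by intros; simp, by intros; simp⟩ (fun j => ?_) b
    refine IsLinearMap.eq_of_single (F := fun c => P.ΓForm v _ c (P.gVec v _))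
      (G := fun c => P.ΓForm v _ c (P.gVec v _)) ⟨by intros; simp, by intros; simp⟩
      ⟨by intros; simp, by intros; simp⟩ (fun k => ?_) c
    rw [e, e, h]
  have hWs : ∀ v, P.SkewAt v →
      ((∀ i j, ∑ s, P.g v i s * P.w v j s = ∑ s, P.g v j s * P.w v i s) ↔
      ∀ a b, P.wForm v a (P.gVec v b) = P.wForm v b (P.gVec v a)) := by
    intro v hS
    have e : ∀ i j, P.wForm v (Pi.single j 1) (P.gVec v (Pi.single i 1))
        = ∑ s, P.g v i s * P.w v j s := by
      intro i j
      simp [bilForm_apply, bilVec_apply, Pi.single_apply, (SkewAt_iff.1 hS).1 i, mul_comm]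
    refine ⟨fun h a b => ?_, fun h i j => by rw [← e, ← e, h]⟩
    refine IsLinearMap.eq_of_single (F := fun a => P.wForm v a (P.gVec v b))
      (G := fun a => P.wForm v b (P.gVec v a)) ⟨by intros; simp, by intros; simp⟩
      ⟨by intros; simp, by intros; simp⟩ (fun i => ?_) a
    refine IsLinearMap.eq_of_single (F := fun b => P.wForm v _ (P.gVec v b))
      (G := fun b => P.wForm v b (P.gVec v _)) ⟨by intros; simp, by intros; simp⟩
      ⟨by intros; simp, by intros; simp⟩ (fun j => ?_) b
    rw [e, e, h]
  have hN : ∀ v ∈ U, P.SkewAt v →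
      (∀ a b c, P.ΓForm v b c (P.gVec v a) = P.ΓForm v a c (P.gVec v b)) →
      (∀ a b, P.wForm v a (P.gVec v b) = P.wForm v b (P.gVec v a)) →
      ((∀ i j k, P.nablaW i j k v = P.nablaW k j i v) ↔ ∀ p c ξ, P.codazzi v p c ξ = 0) := by
    intro v hv hS ht hw
    constructor
    · intro h p c ξ
      rw [codazzi_eq (hg v hv) hS ht hw, sub_eq_zero]
      have hh : ∀ a b c : Fin n → ℝ, triForm (fun i j k => P.nablaW i j k v) a b c
          = triForm (fun i j k => P.nablaW i j k v) c b a := by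
        intro a b c
        simp only [triForm_apply]
        rw [Finset.sum_comm]
        conv_rhs => rw [Finset.sum_comm]
        refine Finset.sum_congr rfl fun i _ => ?_
        rw [Finset.sum_comm]
        refine Finset.sum_congr rfl fun j _ => Finset.sum_congr rfl fun k _ => ?_
        rw [h]; ring
      exact hh _ _ _
    · intro h i j k
      obtain ⟨p, hp⟩ := gVec_surjective (hg v hv) (Pi.single i 1)
      have := h p (Pi.single j 1) (Pi.single k 1)
      rw [codazzi_eq (hg v hv) hS ht hw, hp, triForm_single, triForm_single, sub_eq_zero] at this
      exact this
  have hR : ∀ v ∈ U, (∀ v ∈ U, P.SkewAt v) →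
      (∀ a b c, P.ΓForm v b c (P.gVec v a) = P.ΓForm v a c (P.gVec v b)) →
      ((∀ i j k h, P.riemannUp i j k h v = P.w v i k * P.w v j h - P.w v j k * P.w v i h) ↔
        ∀ p b c ξ, P.gauss v p b c ξ = 0) := by
    intro v hv hS ht
    constructor
    · intro h p b c ξ
      rw [gauss_eq hU hP hg hS hv ht]
      have hh : ∀ α γ ψ χ : Fin n → ℝ, P.riemannForm v α γ ψ χ
          = P.wForm v α ψ * P.wForm v γ χ - P.wForm v γ ψ * P.wForm v α χ := by
        intro α γ ψ χ
        refine IsLinearMap.eq_of_single (F := fun α => P.riemannForm v α γ ψ χ)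
          (G := fun α => P.wForm v α ψ * P.wForm v γ χ - P.wForm v γ ψ * P.wForm v α χ)
          ⟨by intros; simp [riemannForm]; ring, by intros; simp [riemannForm]; ring⟩
          ⟨by intros; simp; ring, by intros; simp; ring⟩ (fun i => ?_) α
        refine IsLinearMap.eq_of_single (F := fun γ => P.riemannForm v _ γ ψ χ)
          (G := fun γ => P.wForm v _ ψ * P.wForm v γ χ - P.wForm v γ ψ * P.wForm v _ χ)
          ⟨by intros; simp [riemannForm]; ring, by intros; simp [riemannForm]; ring⟩
          ⟨by intros; simp; ring, by intros; simp; ring⟩ (fun j => ?_) γ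
        refine IsLinearMap.eq_of_single (F := fun ψ => P.riemannForm v _ _ ψ χ)
          (G := fun ψ => P.wForm v _ ψ * P.wForm v _ χ - P.wForm v _ ψ * P.wForm v _ χ)
          ⟨by intros; simp [riemannForm]; ring, by intros; simp [riemannForm]; ring⟩
          ⟨by intros; simp; ring, by intros; simp; ring⟩ (fun k => ?_) ψ
        refine IsLinearMap.eq_of_single (F := fun χ => P.riemannForm v _ _ _ χ)
          (G := fun χ => P.wForm v _ _ * P.wForm v _ χ - P.wForm v _ _ * P.wForm v _ χ)
          ⟨by intros; simp [riemannForm]; ring, by intros; simp [riemannForm]; ring⟩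
          ⟨by intros; simp; ring, by intros; simp; ring⟩ (fun l => ?_) χ
        rw [← riemannUp_eq (SkewAt_iff.1 (hS v hv)).1, h]
        simp
      rw [hh]
      ring
    · intro h i j k l
      obtain ⟨p, hp⟩ := gVec_surjective (hg v hv) (Pi.single k 1)
      have := h p (Pi.single i 1) (Pi.single j 1) (Pi.single l 1)
      rw [gauss_eq hU hP hg hS hv ht, hp, ← riemannUp_eq (SkewAt_iff.1 (hS v hv)).1] at this
      simp only [bilForm_single] at this
      linarith
  constructor
  · intro h
    have hS : ∀ v ∈ U, P.SkewAt v := fun v hv => SkewAt_iff.2 ⟨(h v hv).1, (h v hv).2.1⟩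
    refine ⟨hS, fun v hv => ?_⟩
    obtain ⟨-, -, h3, h4, h5, h6⟩ := h v hv
    have ht := (hT v (hS v hv)).1 h3
    have hw := (hWs v (hS v hv)).1 h4
    exact ⟨ht, hw, (hN v hv (hS v hv) ht hw).1 h5, (hR v hv hS ht).1 h6⟩
  · rintro ⟨hS, hJ⟩ v hv
    obtain ⟨h1, h2⟩ := SkewAt_iff.1 (hS v hv)
    obtain ⟨ht, hw, hc, hG⟩ := hJ v hv
    exact ⟨h1, h2, (hT v (hS v hv)).2 ht, (hWs v (hS v hv)).2 hw,
      (hN v hv (hS v hv) ht hw).2 hc, (hR v hv hS ht).2 hG⟩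

end HydroOp

/-! ### The operator `∂⁻¹` -/

section XInv

open MeasureTheory

theorem xInv_eq_sub {f : ℝ → ℝ} (hf : Continuous f) (hc : HasCompactSupport f) (x : ℝ) :
    xInv f x = (∫ y in Set.Iic x, f y) - (1 / 2) * ∫ y, f y := by
  have h := integral_add_compl (measurableSet_Iic (a := x)) (hf.integrable_of_hasCompactSupport (μ := volume) hc)
  rw [Set.compl_Iic] at h
  rw [xInv, ← h]
  ring

theorem hasDerivAt_xInv {f : ℝ → ℝ} (hf : Continuous f) (hc : HasCompactSupport f) (x : ℝ) :
    HasDerivAt (xInv f) (f x) x := by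
  have hi := hf.integrable_of_hasCompactSupport (μ := volume) hc
  have e : xInv f = fun x => (∫ y in (0 : ℝ)..x, f y)
      + ((∫ y in Set.Iic (0 : ℝ), f y) - (1 / 2) * ∫ y, f y) := by
    funext x
    rw [xInv_eq_sub hf hc, ← intervalIntegral.integral_Iic_sub_Iic hi.integrableOn hi.integrableOn]
    ring
  rw [e]
  exact (intervalIntegral.integral_hasDerivAt_right (hf.intervalIntegrable _ _)
    (hf.stronglyMeasurableAtFilter _ _) hf.continuousAt).add_const _

theorem contDiff_xInv {f : ℝ → ℝ} (hf : ContDiff ℝ ∞ f) (hc : HasCompactSupport f) :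
    ContDiff ℝ ∞ (xInv f) := by
  refine contDiff_infty_iff_deriv.2 ⟨fun x => (hasDerivAt_xInv hf.continuous hc x).differentiableAt,
    ?_⟩
  rwa [show deriv (xInv f) = f from funext fun x => (hasDerivAt_xInv hf.continuous hc x).deriv]

theorem xInv_deriv {F : ℝ → ℝ} (hF : ContDiff ℝ ∞ F) (hc : HasCompactSupport F) (x : ℝ) :
    xInv (deriv F) x = F x := by
  have h1 : ContDiff ℝ 1 F := hF.of_le (by simp)
  rw [xInv, hc.integral_Iic_deriv_eq h1, hc.integral_Ioi_deriv_eq h1]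
  ring

theorem xInv_add {f g : ℝ → ℝ} (hf : Continuous f) (hfc : HasCompactSupport f)
    (hg : Continuous g) (hgc : HasCompactSupport g) (x : ℝ) :
    xInv (fun y => f y + g y) x = xInv f x + xInv g x := by
  have hi := hf.integrable_of_hasCompactSupport (μ := volume) hfc
  have hj := hg.integrable_of_hasCompactSupport (μ := volume) hgc
  simp only [xInv]
  rw [integral_add hi.integrableOn hj.integrableOn, integral_add hi.integrableOn hj.integrableOn]
  ring

theorem xInv_neg (f : ℝ → ℝ) (x : ℝ) : xInv (fun y => -f y) x = -xInv f x := by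
  simp only [xInv, integral_neg]
  ring

theorem xInv_sub {f g : ℝ → ℝ} (hf : Continuous f) (hfc : HasCompactSupport f)
    (hg : Continuous g) (hgc : HasCompactSupport g) (x : ℝ) :
    xInv (fun y => f y - g y) x = xInv f x - xInv g x := by
  have := xInv_add (g := fun y => -g y) hf hfc hg.neg (hgc.comp_left (g := fun t => -t) (by simp)) x
  simp only [sub_eq_add_neg]
  rw [← xInv_neg, ← this]

theorem integral_deriv_eq_zero {F : ℝ → ℝ} (hF : ContDiff ℝ ∞ F) (hc : HasCompactSupport F) :
    ∫ x, deriv F x = 0 := by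
  have h1 : ContDiff ℝ 1 F := hF.of_le (by simp)
  have hi : Integrable (deriv F) := (h1.continuous_deriv le_rfl).integrable_of_hasCompactSupport
    hc.deriv
  have h := integral_add_compl (measurableSet_Iic (a := (0 : ℝ))) hi
  rw [Set.compl_Iic, hc.integral_Iic_deriv_eq h1, hc.integral_Ioi_deriv_eq h1] at h
  linarith

theorem exists_support_subset_Ioc {f : ℝ → ℝ} (hc : HasCompactSupport f) :
    ∃ M : ℝ, 0 < M ∧ ∀ x, M ≤ |x| → f x = 0 := by
  obtain ⟨R, hR⟩ := hc.isCompact.isBounded.subset_closedBall 0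
  refine ⟨max R 0 + 1, by positivity, fun x hx => ?_⟩
  by_contra h
  have := hR (subset_tsupport _ h)
  rw [mem_closedBall_zero_iff, Real.norm_eq_abs] at this
  linarith [le_max_left R 0]

theorem xInv_of_forall_ge {f : ℝ → ℝ} {x : ℝ} (h : ∀ y, x ≤ y → f y = 0) :
    xInv f x = (1 / 2) * ∫ y, f y := by
  rw [xInv, setIntegral_eq_zero_of_forall_eq_zero (t := Set.Ioi x) fun y hy => h y (le_of_lt hy),
    setIntegral_eq_integral_of_forall_compl_eq_zero fun y hy => h y (le_of_lt (by simpa using hy))]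
  ring

theorem xInv_of_forall_le {f : ℝ → ℝ} {x : ℝ} (h : ∀ y, y ≤ x → f y = 0) :
    xInv f x = -((1 / 2) * ∫ y, f y) := by
  rw [xInv, setIntegral_eq_zero_of_forall_eq_zero (t := Set.Iic x) fun y hy => h y hy,
    setIntegral_eq_integral_of_forall_compl_eq_zero fun y hy => h y (by simpa using hy)]
  ring

/-- `∂⁻¹` is skew-adjoint: both ends contribute the same boundary value `¼ ∫ a ∫ b`. -/
theorem integral_mul_xInv {a b : ℝ → ℝ} (ha : Continuous a) (hac : HasCompactSupport a)
    (hb : Continuous b) (hbc : HasCompactSupport b) :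
    ∫ x, a x * xInv b x = -∫ x, b x * xInv a x := by
  obtain ⟨M, hM0, hM⟩ := exists_support_subset_Ioc hac
  obtain ⟨N, hN0, hN⟩ := exists_support_subset_Ioc hbc
  set K := max M N with hK
  have hK0 : 0 < K := lt_max_of_lt_left hM0
  have haK : ∀ x, K ≤ |x| → a x = 0 := fun x hx => hM x ((le_max_left _ _).trans hx)
  have hbK : ∀ x, K ≤ |x| → b x = 0 := fun x hx => hN x ((le_max_right _ _).trans hx)
  have hcont : ∀ f : ℝ → ℝ, Continuous f → HasCompactSupport f → Continuous (xInv f) :=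
    fun f hf hc => continuous_iff_continuousAt.2 fun x => (hasDerivAt_xInv hf hc x).continuousAt
  have hA := hcont a ha hac
  have hB := hcont b hb hbc
  have hi1 : Integrable fun x => a x * xInv b x :=
    (ha.mul hB).integrable_of_hasCompactSupport hac.mul_right
  have hi2 : Integrable fun x => b x * xInv a x :=
    (hb.mul hA).integrable_of_hasCompactSupport hbc.mul_right
  rw [eq_neg_iff_add_eq_zero, ← integral_add hi1 hi2]
  have hsupp : (Function.support fun x => a x * xInv b x + b x * xInv a x) ⊆ Set.Ioc (-K) K := by
    intro x hx
    by_contra hx'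
    apply hx
    have : K ≤ |x| := by
      rw [Set.mem_Ioc, not_and_or, not_lt, not_le] at hx'
      rcases hx' with h | h
      · rw [abs_of_nonpos (by linarith)]; linarith
      · exact h.le.trans (le_abs_self x)
    simp [haK x this, hbK x this]
  have hFTC := intervalIntegral.integral_eq_sub_of_hasDerivAt (a := -K) (b := K)
      (f := fun x => xInv a x * xInv b x) (f' := fun x => a x * xInv b x + b x * xInv a x)
      (fun x _ => ((hasDerivAt_xInv ha hac x).mul (hasDerivAt_xInv hb hbc x)).congr_deriv (by ring))
      (((ha.mul hB).add (hb.mul hA)).intervalIntegrable _ _)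
  rw [← intervalIntegral.integral_eq_integral_of_support_subset hsupp, hFTC]
  have hp : ∀ y, K ≤ y → K ≤ |y| := fun y hy => hy.trans (le_abs_self y)
  have hm : ∀ y, y ≤ -K → K ≤ |y| := fun y hy => by
    rw [abs_of_nonpos (by linarith)]; linarith
  rw [xInv_of_forall_ge fun y hy => haK y (hp y hy), xInv_of_forall_ge fun y hy => hbK y (hp y hy),
    xInv_of_forall_le fun y hy => haK y (hm y hy), xInv_of_forall_le fun y hy => hbK y (hm y hy)]
  ring

theorem integral_nuStep_mul {f : ℝ → ℝ} (hf : Continuous f) (hc : HasCompactSupport f) (x : ℝ) :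
    ∫ y, nuStep (x - y) * f y = xInv f x := by
  have hi := hf.integrable_of_hasCompactSupport (μ := volume) hc
  have hint : Integrable fun y => nuStep (x - y) * f y := by
    refine hi.bdd_mul (c := 1) ?_ (Filter.Eventually.of_forall fun y => ?_)
    · have hm : Measurable Real.sign := by
        unfold Real.sign
        exact Measurable.ite measurableSet_Iio measurable_const
          (Measurable.ite measurableSet_Ioi measurable_const measurable_const)
      exact ((hm.comp (measurable_const.sub measurable_id)).const_mul _).aestronglyMeasurable
    · rw [nuStep, Real.norm_eq_abs, abs_mul]
      rcases Real.sign_apply_eq (x - y) with h | h | h <;> rw [h] <;> norm_num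
  rw [← integral_add_compl (measurableSet_Iic (a := x)) hint, Set.compl_Iic, xInv, sub_eq_add_neg]
  congr 1
  · rw [← integral_const_mul, integral_Iic_eq_integral_Iio, integral_Iic_eq_integral_Iio]
    refine setIntegral_congr_fun measurableSet_Iio fun y hy => ?_
    have : 0 < x - y := sub_pos.2 hy
    simp [nuStep, Real.sign_of_pos this]
  · rw [← neg_mul, ← integral_const_mul]
    refine setIntegral_congr_fun measurableSet_Ioi fun y hy => ?_
    have : x - y < 0 := sub_neg.2 hy
    simp [nuStep, Real.sign_of_neg this]

/-- The fundamental lemma of the calculus of variations, for covector-valued functions. -/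
theorem eq_zero_of_forall_test {n : ℕ} {f : ℝ → Fin n → ℝ} (hf : Continuous f)
    (h : ∀ p, IsTest p → ∫ x, p x ⬝ᵥ f x = 0) (x : ℝ) : f x = 0 := by
  ext i
  have hi : Continuous fun y => f y i := (continuous_pi_iff.1 hf) i
  have h0 : ∀ᵐ y, f y i = 0 := by
    refine ae_eq_zero_of_integral_contDiff_smul_eq_zero hi.locallyIntegrable fun b hb hbc => ?_
    have := h (fun y => Pi.single i (b y)) ⟨contDiff_pi.2 fun j => ?_, ?_⟩
    · simpa [single_dotProduct] using this
    · by_cases hj : j = i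
      · subst hj; simpa using hb
      · simpa [Pi.single_apply, hj] using contDiff_const
    · exact hbc.comp_left (g := fun t : ℝ => (Pi.single i t : Fin n → ℝ)) (by simp)
  have := (Continuous.ae_eq_iff_eq volume hi continuous_const).1 h0
  exact congrFun this x

end XInv

/-! ### Smooth fields and covectors along them -/

section Smooth

variable {n : ℕ}

theorem dotProduct_eq_of_isLinearMap {F : (Fin n → ℝ) → ℝ} (hF : IsLinearMap ℝ F)
    {a : Fin n → ℝ} (h : ∀ i, a i = F (Pi.single i 1)) (p : Fin n → ℝ) : p ⬝ᵥ a = F p := by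
  rw [← IsLinearMap.mk'_apply hF p, ← dotProduct_eq_of_linear, _root_.dotProduct]
  simp [h]

theorem ContDiff.bilForm {a : ℝ → Fin n → Fin n → ℝ} {α β : ℝ → Fin n → ℝ}
    (ha : ∀ i j, ContDiff ℝ ∞ fun y => a y i j) (hα : ContDiff ℝ ∞ α) (hβ : ContDiff ℝ ∞ β) :
    ContDiff ℝ ∞ fun y => bilForm (a y) (α y) (β y) := by
  simp only [bilForm_apply]
  exact ContDiff.sum fun i _ => ContDiff.sum fun j _ =>
    ((ha i j).mul (contDiff_pi.1 hα i)).mul (contDiff_pi.1 hβ j)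

theorem ContDiff.triForm {a : ℝ → Fin n → Fin n → Fin n → ℝ} {α β φ : ℝ → Fin n → ℝ}
    (ha : ∀ i j k, ContDiff ℝ ∞ fun y => a y i j k) (hα : ContDiff ℝ ∞ α) (hβ : ContDiff ℝ ∞ β)
    (hφ : ContDiff ℝ ∞ φ) :
    ContDiff ℝ ∞ fun y => triForm (a y) (α y) (β y) (φ y) := by
  simp only [triForm_apply]
  exact ContDiff.sum fun i _ => ContDiff.sum fun j _ => ContDiff.sum fun k _ =>
    (((ha i j k).mul (contDiff_pi.1 hα i)).mul (contDiff_pi.1 hβ j)).mul (contDiff_pi.1 hφ k)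

theorem ContDiff.quadForm {a : ℝ → Fin n → Fin n → Fin n → Fin n → ℝ} {α β φ ψ : ℝ → Fin n → ℝ}
    (ha : ∀ i j k l, ContDiff ℝ ∞ fun y => a y i j k l) (hα : ContDiff ℝ ∞ α)
    (hβ : ContDiff ℝ ∞ β) (hφ : ContDiff ℝ ∞ φ) (hψ : ContDiff ℝ ∞ ψ) :
    ContDiff ℝ ∞ fun y => quadForm (a y) (α y) (β y) (φ y) (ψ y) := by
  simp only [quadForm_apply]
  exact ContDiff.sum fun i _ => ContDiff.sum fun j _ => ContDiff.sum fun k _ =>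
    ContDiff.sum fun l _ =>
    ((((ha i j k l).mul (contDiff_pi.1 hα i)).mul (contDiff_pi.1 hβ j)).mul
      (contDiff_pi.1 hφ k)).mul (contDiff_pi.1 hψ l)

theorem ContDiff.hasDerivAt_xDeriv {f : ℝ → Fin n → ℝ} (hf : ContDiff ℝ ∞ f) (x : ℝ) :
    HasDerivAt f (xDeriv f x) x :=
  hasDerivAt_pi.2 fun i =>
    (((contDiff_pi.1 hf i).differentiable (by simp)) x).hasDerivAt

theorem HasDerivAt.xDeriv_eq {f : ℝ → Fin n → ℝ} {f' : Fin n → ℝ} {x : ℝ}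
    (hf : HasDerivAt f f' x) : xDeriv f x = f' :=
  funext fun i => (hasDerivAt_pi.1 hf i).deriv

theorem ContDiff.xDeriv {f : ℝ → Fin n → ℝ} (hf : ContDiff ℝ ∞ f) : ContDiff ℝ ∞ (xDeriv f) :=
  contDiff_pi.2 fun i => (contDiff_infty_iff_deriv.1 (contDiff_pi.1 hf i)).2

theorem xDeriv_eq_zero_of_notMem {f : ℝ → Fin n → ℝ} {x : ℝ} (hx : x ∉ tsupport f) :
    xDeriv f x = 0 := by
  have h : f =ᶠ[nhds x] fun _ => 0 := notMem_tsupport_iff_eventuallyEq.1 hx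
  exact ((hasDerivAt_const x (0 : Fin n → ℝ)).congr_of_eventuallyEq h).xDeriv_eq

theorem IsTest.hasCompactSupport_of_zero {E : Type*} [Zero E] {q : ℝ → Fin n → ℝ} (hq : IsTest q)
    {f : ℝ → E} (h : ∀ x, q x = 0 → xDeriv q x = 0 → f x = 0) : HasCompactSupport f := by
  refine hq.2.mono' fun x hx => ?_
  by_contra hx'
  exact hx (h x (image_eq_zero_of_notMem_tsupport hx') (xDeriv_eq_zero_of_notMem hx'))

theorem ContDiffOn.fieldDeriv {U : Set (Fin n → ℝ)} (hU : IsOpen U) {f : (Fin n → ℝ) → ℝ}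
    (hf : ContDiffOn ℝ ∞ f U) (l : Fin n) : ContDiffOn ℝ ∞ (fieldDeriv l f) U :=
  (hf.fderiv_of_isOpen hU (by simp)).clm_apply contDiffOn_const

theorem IsSmoothField.comp {U : Set (Fin n → ℝ)} {u : ℝ → Fin n → ℝ} (hu : IsSmoothField U u)
    {f : (Fin n → ℝ) → ℝ} (hf : ContDiffOn ℝ ∞ f U) : ContDiff ℝ ∞ fun x => f (u x) := by
  rw [← contDiffOn_univ]
  exact hf.comp hu.1.contDiffOn fun x _ => hu.2 x

end Smooth

namespace HydroOp

variable {n : ℕ} {P : HydroOp n} {U : Set (Fin n → ℝ)} {u α β φ ψ : ℝ → Fin n → ℝ}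

theorem contDiff_gForm (hP : P.SmoothOn U) (hu : IsSmoothField U u)
    (hα : ContDiff ℝ ∞ α) (hβ : ContDiff ℝ ∞ β) :
    ContDiff ℝ ∞ fun y => P.gForm (u y) (α y) (β y) :=
  ContDiff.bilForm (fun i j => hu.comp (hP.1 i j)) hα hβ

theorem contDiff_wForm (hP : P.SmoothOn U) (hu : IsSmoothField U u)
    (hα : ContDiff ℝ ∞ α) (hβ : ContDiff ℝ ∞ β) :
    ContDiff ℝ ∞ fun y => P.wForm (u y) (α y) (β y) :=
  ContDiff.bilForm (fun i j => hu.comp (hP.2.2 i j)) hα hβ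

theorem contDiff_ΓForm (hP : P.SmoothOn U) (hu : IsSmoothField U u)
    (hα : ContDiff ℝ ∞ α) (hβ : ContDiff ℝ ∞ β) (hφ : ContDiff ℝ ∞ φ) :
    ContDiff ℝ ∞ fun y => P.ΓForm (u y) (α y) (β y) (φ y) :=
  ContDiff.triForm (fun i j k => hu.comp (hP.2.1 i j k)) hα hβ hφ

theorem contDiff_dgForm (hU : IsOpen U) (hP : P.SmoothOn U) (hu : IsSmoothField U u)
    (hα : ContDiff ℝ ∞ α) (hβ : ContDiff ℝ ∞ β) (hφ : ContDiff ℝ ∞ φ) :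
    ContDiff ℝ ∞ fun y => P.dgForm (u y) (α y) (β y) (φ y) :=
  ContDiff.triForm (fun i j k => hu.comp ((hP.1 i j).fieldDeriv hU k)) hα hβ hφ

theorem contDiff_dwForm (hU : IsOpen U) (hP : P.SmoothOn U) (hu : IsSmoothField U u)
    (hα : ContDiff ℝ ∞ α) (hβ : ContDiff ℝ ∞ β) (hφ : ContDiff ℝ ∞ φ) :
    ContDiff ℝ ∞ fun y => P.dwForm (u y) (α y) (β y) (φ y) :=
  ContDiff.triForm (fun i j k => hu.comp ((hP.2.2 i j).fieldDeriv hU k)) hα hβ hφ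

theorem contDiff_dΓForm (hU : IsOpen U) (hP : P.SmoothOn U) (hu : IsSmoothField U u)
    (hα : ContDiff ℝ ∞ α) (hβ : ContDiff ℝ ∞ β) (hφ : ContDiff ℝ ∞ φ) (hψ : ContDiff ℝ ∞ ψ) :
    ContDiff ℝ ∞ fun y => P.dΓForm (u y) (α y) (β y) (φ y) (ψ y) :=
  ContDiff.quadForm (fun i j k l => hu.comp ((hP.2.1 i j k).fieldDeriv hU l)) hα hβ hφ hψ

/-! ### The operator along a field -/

section Fields

variable (P) (u q r φ p : ℝ → Fin n → ℝ) (x : ℝ)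

/-- `W·q` along the field. -/
def tailDot : ℝ := P.wForm (u x) (q x) (xDeriv u x)

/-- The nonlocal variable `∂⁻¹(W·q)`. -/
def pot : ℝ := xInv (P.tailDot u q) x

/-- `loc` along the field. -/
def locF : Fin n → ℝ := P.loc (u x) (xDeriv u x) (q x) (xDeriv q x)

/-- `linTail` along the field. -/
def linTailF : ℝ := P.linTail (u x) (xDeriv u x) (q x) (φ x) (xDeriv φ x)

/-- `linLoc` along the field. -/
def linLocF (p : Fin n → ℝ) : ℝ :=
  P.linLoc (u x) (xDeriv u x) p (q x) (xDeriv q x) (φ x) (xDeriv φ x)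

/-- `adjTail` along the field. -/
def adjTailF : Fin n → ℝ := P.adjTail (u x) (xDeriv u x) (q x) (xDeriv q x)

/-- `adjLoc` along the field. -/
def adjLocF : Fin n → ℝ :=
  P.adjLoc (u x) (xDeriv u x) (q x) (xDeriv q x) (r x) (xDeriv r x)

/-- The variational derivative of `∫ q · P r` with respect to the field. -/
def varAdj : Fin n → ℝ :=
  P.adjLocF u q r x + P.pot u r x • P.adjTailF u q x - P.pot u q x • P.adjTailF u r x

theorem tail_eq : P.tail u x = P.wVec (u x) (xDeriv u x) := by
  ext i
  simp [tail, bilVec_apply]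

theorem tail_dot_eq : (fun y => ∑ j, P.tail u y j * q y j) = P.tailDot u q := by
  funext y
  rw [tailDot, ← dotProduct_bilVec, ← tail_eq, dotProduct_comm]
  rfl

theorem apply_eq : P.apply u q x = P.locF u q x + P.pot u q x • P.tail u x := by
  ext i
  simp only [HydroOp.apply, tail_dot_eq, pot, locF, loc, Pi.add_apply, Pi.smul_apply, smul_eq_mul,
    bilVec_apply, triVec_apply, Finset.sum_mul]
  rw [mul_comm (xInv _ _)]
  simp only [mul_right_comm _ (xDeriv u x _) (q x _)]

theorem dotProduct_tailLin (p : Fin n → ℝ) :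
    p ⬝ᵥ P.tailLin u φ x = P.linTail (u x) (xDeriv u x) p (φ x) (xDeriv φ x) := by
  refine dotProduct_eq_of_isLinearMap
    (F := fun p => P.linTail (u x) (xDeriv u x) p (φ x) (xDeriv φ x))
    ⟨fun a b => by simp [linTail]; ring, fun c a => by simp [linTail]; ring⟩ (fun i => ?_) p
  simp only [tailLin, linTail, triForm_apply, bilForm_apply, Pi.single_apply]
  simp only [mul_ite, mul_one, mul_zero, ite_mul, zero_mul, Finset.sum_ite_irrel,
    Finset.sum_const_zero, Finset.sum_ite_eq', Finset.mem_univ, if_true]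
  rw [Finset.sum_comm]

theorem tailLin_dot_eq : (fun y => ∑ j, P.tailLin u φ y j * q y j) = P.linTailF u q φ := by
  funext y
  rw [linTailF, ← dotProduct_tailLin, dotProduct_comm]
  rfl

theorem dotProduct_linearize (p : Fin n → ℝ) :
    p ⬝ᵥ P.linearize u q φ x = P.linLocF u q φ x p
      + P.pot u q x * P.linTail (u x) (xDeriv u x) p (φ x) (xDeriv φ x)
      + P.wForm (u x) p (xDeriv u x) * xInv (P.linTailF u q φ) x := by
  have e : P.linearize u q φ x = (fun i => P.linLocF u q φ x (Pi.single i 1))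
      + P.pot u q x • P.tailLin u φ x + xInv (P.linTailF u q φ) x • P.tail u x := by
    ext i
    simp only [linearize, tail_dot_eq, tailLin_dot_eq, pot, linLocF, linLoc, Pi.add_apply,
      Pi.smul_apply, smul_eq_mul, triForm_apply, quadForm_apply, Pi.single_apply]
    simp only [mul_ite, mul_one, mul_zero, ite_mul, zero_mul, Finset.sum_ite_irrel,
      Finset.sum_const_zero, Finset.sum_ite_eq', Finset.mem_univ, if_true, Finset.sum_mul,
      add_mul, Finset.sum_add_distrib]
    rw [mul_comm (xInv _ _), mul_comm (xInv _ _)]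
    have h1 : ∑ j, ∑ k, fieldDeriv k (fun v => P.g v i j) (u x) * φ x k * xDeriv q x j
        = ∑ j, ∑ k, fieldDeriv k (fun v => P.g v i j) (u x) * xDeriv q x j * φ x k :=
      Finset.sum_congr rfl fun j _ => Finset.sum_congr rfl fun k _ => by ring
    have h2 : ∑ j, ∑ k, ∑ l, fieldDeriv k (fun v => P.Γ v i j l) (u x) * xDeriv u x l * φ x k
          * q x j
        = ∑ j, ∑ k, ∑ l, fieldDeriv l (fun v => P.Γ v i j k) (u x) * q x j * xDeriv u x k
          * φ x l := by
      refine Finset.sum_congr rfl fun j _ => ?_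
      rw [Finset.sum_comm]
      exact Finset.sum_congr rfl fun k _ => Finset.sum_congr rfl fun l _ => by ring
    have h3 : ∑ j, ∑ k, P.Γ (u x) i j k * xDeriv φ x k * q x j
        = ∑ j, ∑ k, P.Γ (u x) i j k * q x j * xDeriv φ x k :=
      Finset.sum_congr rfl fun j _ => Finset.sum_congr rfl fun k _ => by ring
    rw [h1, h2, h3]
    ring
  have e2 : p ⬝ᵥ (fun i => P.linLocF u q φ x (Pi.single i 1)) = P.linLocF u q φ x p :=
    dotProduct_eq_of_isLinearMap ⟨fun a b => by simp [linLocF, linLoc]; ring,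
      fun c a => by simp [linLocF, linLoc]; ring⟩ (fun i => rfl) p
  rw [e, dotProduct_add, dotProduct_add, dotProduct_smul, dotProduct_smul, e2,
    dotProduct_tailLin, tail_eq, dotProduct_bilVec, smul_eq_mul, smul_eq_mul]
  ring

end Fields

end HydroOp

namespace HydroOp

open MeasureTheory

variable {n : ℕ} {P : HydroOp n} {U : Set (Fin n → ℝ)} {u q r φ p a b : ℝ → Fin n → ℝ}

/-! ### Smoothness and supports of the expressions along a field -/

section Regularity

theorem contDiff_of_dotProduct {f : ℝ → Fin n → ℝ}
    (h : ∀ c : Fin n → ℝ, ContDiff ℝ ∞ fun x => f x ⬝ᵥ c) : ContDiff ℝ ∞ f :=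
  contDiff_pi.2 fun i => by simpa using h (Pi.single i 1)

theorem contDiff_tail (hP : P.SmoothOn U) (hu : IsSmoothField U u) :
    ContDiff ℝ ∞ (P.tail u) := by
  refine contDiff_of_dotProduct fun c => ?_
  simp only [dotProduct_comm _ c, tail_eq, dotProduct_bilVec]
  exact contDiff_wForm hP hu contDiff_const hu.1.xDeriv

theorem contDiff_locF (hP : P.SmoothOn U) (hu : IsSmoothField U u) (hq : ContDiff ℝ ∞ q) :
    ContDiff ℝ ∞ (P.locF u q) := by
  refine contDiff_of_dotProduct fun c => ?_
  simp only [dotProduct_comm _ c, locF, loc, dotProduct_add, dotProduct_bilVec, dotProduct_triVec]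
  exact (contDiff_gForm hP hu contDiff_const hq.xDeriv).add
    (contDiff_ΓForm hP hu contDiff_const hq hu.1.xDeriv)

theorem contDiff_tailDot (hP : P.SmoothOn U) (hu : IsSmoothField U u) (hq : ContDiff ℝ ∞ q) :
    ContDiff ℝ ∞ (P.tailDot u q) :=
  contDiff_wForm hP hu hq hu.1.xDeriv

theorem hasCompactSupport_tailDot (hq : IsTest q) : HasCompactSupport (P.tailDot u q) :=
  hq.hasCompactSupport_of_zero fun x h _ => by simp [tailDot, h]

theorem contDiff_pot (hP : P.SmoothOn U) (hu : IsSmoothField U u) (hq : IsTest q) :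
    ContDiff ℝ ∞ (P.pot u q) :=
  contDiff_xInv (contDiff_tailDot hP hu hq.1) (hasCompactSupport_tailDot hq)

theorem hasDerivAt_pot (hP : P.SmoothOn U) (hu : IsSmoothField U u) (hq : IsTest q) (x : ℝ) :
    HasDerivAt (P.pot u q) (P.wForm (u x) (q x) (xDeriv u x)) x :=
  hasDerivAt_xInv (contDiff_tailDot hP hu hq.1).continuous (hasCompactSupport_tailDot hq) x

theorem contDiff_apply (hP : P.SmoothOn U) (hu : IsSmoothField U u) (hq : IsTest q) :
    ContDiff ℝ ∞ (P.apply u q) := by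
  rw [show P.apply u q = fun x => P.locF u q x + P.pot u q x • P.tail u x from
    funext fun x => apply_eq P u q x]
  exact (contDiff_locF hP hu hq.1).add ((contDiff_pot hP hu hq).smul (contDiff_tail hP hu))

theorem contDiff_linTailF (hU : IsOpen U) (hP : P.SmoothOn U) (hu : IsSmoothField U u)
    (hq : ContDiff ℝ ∞ q) (hφ : ContDiff ℝ ∞ φ) : ContDiff ℝ ∞ (P.linTailF u q φ) :=
  (contDiff_dwForm hU hP hu hq hu.1.xDeriv hφ).add (contDiff_wForm hP hu hq hφ.xDeriv)

theorem hasCompactSupport_linTailF (hq : IsTest q) : HasCompactSupport (P.linTailF u q φ) :=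
  hq.hasCompactSupport_of_zero fun x h _ => by simp [linTailF, linTail, h]

theorem contDiff_linLocF (hU : IsOpen U) (hP : P.SmoothOn U) (hu : IsSmoothField U u)
    (hq : ContDiff ℝ ∞ q) (hφ : ContDiff ℝ ∞ φ) (hp : ContDiff ℝ ∞ p) :
    ContDiff ℝ ∞ fun x => P.linLocF u q φ x (p x) :=
  ((contDiff_dgForm hU hP hu hp hq.xDeriv hφ).add
    (contDiff_dΓForm hU hP hu hp hq hu.1.xDeriv hφ)).add (contDiff_ΓForm hP hu hp hq hφ.xDeriv)

theorem contDiff_adjTailF (hU : IsOpen U) (hP : P.SmoothOn U) (hu : IsSmoothField U u)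
    (hq : ContDiff ℝ ∞ q) : ContDiff ℝ ∞ (P.adjTailF u q) := by
  refine contDiff_of_dotProduct fun c => ?_
  simp only [adjTailF, adjTail_dotProduct]
  exact ((contDiff_dwForm hU hP hu hq hu.1.xDeriv contDiff_const).sub
    (contDiff_dwForm hU hP hu hq contDiff_const hu.1.xDeriv)).sub
    (contDiff_wForm hP hu hq.xDeriv contDiff_const)

theorem contDiff_adjLocF (hU : IsOpen U) (hP : P.SmoothOn U) (hu : IsSmoothField U u)
    (hq : ContDiff ℝ ∞ q) (hr : ContDiff ℝ ∞ r) : ContDiff ℝ ∞ (P.adjLocF u q r) := by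
  refine contDiff_of_dotProduct fun c => ?_
  simp only [adjLocF, adjLoc_dotProduct]
  exact (((((contDiff_ΓForm hP hu hr.xDeriv hq contDiff_const).sub
    (contDiff_ΓForm hP hu hq.xDeriv hr contDiff_const)).add
    (contDiff_dΓForm hU hP hu hq hr hu.1.xDeriv contDiff_const)).sub
    (contDiff_dΓForm hU hP hu hq hr contDiff_const hu.1.xDeriv)).sub
    ((contDiff_wForm hP hu hr hu.1.xDeriv).mul (contDiff_wForm hP hu hq contDiff_const))).add
    ((contDiff_wForm hP hu hq hu.1.xDeriv).mul (contDiff_wForm hP hu hr contDiff_const))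

theorem isTest_varAdj (hU : IsOpen U) (hP : P.SmoothOn U) (hu : IsSmoothField U u)
    (hq : IsTest q) (hr : IsTest r) : IsTest (P.varAdj u q r) := by
  constructor
  · exact ((contDiff_adjLocF hU hP hu hq.1 hr.1).add
      ((contDiff_pot hP hu hr).smul (contDiff_adjTailF hU hP hu hq.1))).sub
      ((contDiff_pot hP hu hq).smul (contDiff_adjTailF hU hP hu hr.1))
  · refine HasCompactSupport.sub (HasCompactSupport.add ?_ ?_) ?_
    · exact hq.hasCompactSupport_of_zero fun x h h' =>
        covector_ext fun ψ => by simp [adjLocF, adjLoc_dotProduct, h, h']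
    · exact hq.hasCompactSupport_of_zero fun x h h' =>
        covector_ext fun ψ => by
          simp [adjTailF, adjTail_dotProduct, h, h']
    · exact hr.hasCompactSupport_of_zero fun x h h' =>
        covector_ext fun ψ => by
          simp [adjTailF, adjTail_dotProduct, h, h']

theorem contDiff_linearize (hU : IsOpen U) (hP : P.SmoothOn U) (hu : IsSmoothField U u)
    (hq : IsTest q) (hφ : ContDiff ℝ ∞ φ) : ContDiff ℝ ∞ (P.linearize u q φ) := by
  refine contDiff_of_dotProduct fun c => ?_
  simp only [dotProduct_comm _ c, dotProduct_linearize]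
  exact ((contDiff_linLocF hU hP hu hq.1 hφ contDiff_const).add
    ((contDiff_pot hP hu hq).mul ((contDiff_dwForm hU hP hu contDiff_const hu.1.xDeriv hφ).add
      (contDiff_wForm hP hu contDiff_const hφ.xDeriv)))).add
    ((contDiff_wForm hP hu contDiff_const hu.1.xDeriv).mul
      (contDiff_xInv (contDiff_linTailF hU hP hu hq.1 hφ) (hasCompactSupport_linTailF hq)))

theorem _root_.IsTest.integrable_dotProduct {f : ℝ → Fin n → ℝ} (hp : IsTest p) (hf : Continuous f) :
    Integrable fun x => p x ⬝ᵥ f x := by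
  refine Continuous.integrable_of_hasCompactSupport ?_
    (hp.hasCompactSupport_of_zero fun x h _ => by simp [h])
  exact continuous_finsetSum _ fun i _ =>
    ((continuous_pi_iff.1 hp.1.continuous i)).mul (continuous_pi_iff.1 hf i)

end Regularity

/-! ### Integration by parts -/

section Parts

/-- An integral vanishes if its integrand is a derivative plus products `a ∂⁻¹b + b ∂⁻¹a`. -/
theorem integral_eq_zero_of_parts {I H a b c d : ℝ → ℝ} (hH : ContDiff ℝ ∞ H)
    (hHc : HasCompactSupport H) (ha : Continuous a) (hac : HasCompactSupport a)
    (hb : Continuous b) (hbc : HasCompactSupport b) (hc : Continuous c) (hcc : HasCompactSupport c)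
    (hd : Continuous d) (hdc : HasCompactSupport d)
    (h : ∀ x, I x = deriv H x + (a x * xInv b x + b x * xInv a x)
      + (c x * xInv d x + d x * xInv c x)) : ∫ x, I x = 0 := by
  have hcont : ∀ f : ℝ → ℝ, Continuous f → HasCompactSupport f → Continuous (xInv f) :=
    fun f hf hc => continuous_iff_continuousAt.2 fun x => (hasDerivAt_xInv hf hc x).continuousAt
  have h1 : ContDiff ℝ 1 H := hH.of_le (by simp)
  have i0 : Integrable (deriv H) :=
    (h1.continuous_deriv le_rfl).integrable_of_hasCompactSupport hHc.deriv
  have hi : ∀ f g : ℝ → ℝ, Continuous f → HasCompactSupport f → Continuous g →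
      HasCompactSupport g → Integrable fun x => f x * xInv g x := fun f g hf hfc hg hgc =>
    (hf.mul (hcont g hg hgc)).integrable_of_hasCompactSupport hfc.mul_right
  have hp : ∀ f g : ℝ → ℝ, Continuous f → HasCompactSupport f → Continuous g →
      HasCompactSupport g → Integrable (fun x => f x * xInv g x + g x * xInv f x) ∧
        ∫ x, (f x * xInv g x + g x * xInv f x) = 0 := by
    intro f g hf hfc hg hgc
    refine ⟨(hi f g hf hfc hg hgc).add (hi g f hg hgc hf hfc), ?_⟩
    rw [integral_add (hi f g hf hfc hg hgc) (hi g f hg hgc hf hfc),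
      integral_mul_xInv hf hfc hg hgc]
    ring
  obtain ⟨j1, e1⟩ := hp a b ha hac hb hbc
  obtain ⟨j2, e2⟩ := hp c d hc hcc hd hdc
  simp only [h]
  rw [integral_add (f := fun x => deriv H x + (a x * xInv b x + b x * xInv a x)) (i0.add j1) j2,
    integral_add i0 j1, integral_deriv_eq_zero hH hHc, e1, e2]
  ring

theorem dotProduct_apply (c : Fin n → ℝ) (x : ℝ) : c ⬝ᵥ P.apply u q x
    = P.gForm (u x) c (xDeriv q x) + P.ΓForm (u x) c (q x) (xDeriv u x)
      + P.pot u q x * P.wForm (u x) c (xDeriv u x) := by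
  rw [apply_eq, dotProduct_add, dotProduct_smul, tail_eq, dotProduct_bilVec, locF, loc,
    dotProduct_add, dotProduct_bilVec, dotProduct_triVec, smul_eq_mul]

/-- `P` is skew-adjoint if `g` is symmetric and compatible with `Γ`. -/
theorem integral_dotProduct_apply (hU : IsOpen U) (hP : P.SmoothOn U) (hu : IsSmoothField U u)
    (hS : ∀ v ∈ U, P.SkewAt v) (ha : IsTest a) (hb : IsTest b) :
    ∫ x, a x ⬝ᵥ P.apply u b x = -∫ x, b x ⬝ᵥ P.apply u a x := by
  rw [eq_neg_iff_add_eq_zero, ← integral_add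
    (ha.integrable_dotProduct (contDiff_apply hP hu hb).continuous)
    (hb.integrable_dotProduct (contDiff_apply hP hu ha).continuous)]
  refine integral_eq_zero_of_parts (H := fun x => P.gForm (u x) (a x) (b x))
    (a := P.tailDot u a) (b := P.tailDot u b)
    (contDiff_gForm hP hu ha.1 hb.1) (ha.hasCompactSupport_of_zero fun x h _ => by simp [h])
    (contDiff_tailDot hP hu ha.1).continuous (hasCompactSupport_tailDot ha)
    (contDiff_tailDot hP hu hb.1).continuous (hasCompactSupport_tailDot hb)
    (c := fun _ => 0) (d := fun _ => 0) continuous_const HasCompactSupport.zero continuous_const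
    HasCompactSupport.zero fun x => ?_
  rw [(hasDerivAt_gForm hU hP (hu.2 x) (hu.1.hasDerivAt_xDeriv x) (ha.1.hasDerivAt_xDeriv x)
    (hb.1.hasDerivAt_xDeriv x)).deriv, dotProduct_apply, dotProduct_apply,
    (hS _ (hu.2 x)).compat, (hS _ (hu.2 x)).symm (b x), ← pot, ← pot, tailDot, tailDot]
  ring

/-- Symmetry of the second derivatives of `g`, in terms of `Γ`. -/
theorem dΓForm_add_symm (hU : IsOpen U) (hP : P.SmoothOn U) (hS : ∀ v ∈ U, P.SkewAt v)
    {v : Fin n → ℝ} (hv : v ∈ U) (a b ξ χ : Fin n → ℝ) :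
    P.dΓForm v a b ξ χ + P.dΓForm v b a ξ χ = P.dΓForm v a b χ ξ + P.dΓForm v b a χ ξ := by
  have key : ∀ i j k l, fieldDeriv l (fun v => P.Γ v i j k) v
      + fieldDeriv l (fun v => P.Γ v j i k) v
      = fieldDeriv k (fun v => P.Γ v i j l) v + fieldDeriv k (fun v => P.Γ v j i l) v := by
    have e : ∀ i j k l, fieldDeriv l (fun v => P.Γ v i j k) v
        + fieldDeriv l (fun v => P.Γ v j i k) v
        = fderiv ℝ (fderiv ℝ fun v => P.g v i j) v (Pi.single l 1) (Pi.single k 1) := by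
      intro i j k l
      have hd : DifferentiableAt ℝ (fderiv ℝ fun v => P.g v i j) v :=
        (((hP.1 i j).fderiv_of_isOpen (m := ∞) hU (by simp)).contDiffAt
          (hU.mem_nhds hv)).differentiableAt (by simp)
      have h1 := ((hP.2.1 i j k).differentiableAt_of_isOpen hU hv)
      have h2 := ((hP.2.1 j i k).differentiableAt_of_isOpen hU hv)
      rw [fieldDeriv, fieldDeriv, ← add_apply, ← fderiv_fun_add h1 h2]
      have h3 : (fun v => P.Γ v i j k + P.Γ v j i k)
          =ᶠ[nhds v] fun v => fderiv ℝ (fun v => P.g v i j) v (Pi.single k 1) := by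
        filter_upwards [hU.mem_nhds hv] with y hy
        exact ((SkewAt_iff.1 (hS y hy)).2 i j k).symm
      rw [h3.fderiv_eq, fderiv_clm_apply hd (differentiableAt_const _)]
      simp
    intro i j k l
    rw [e, e]
    have hsymm : IsSymmSndFDerivAt ℝ (fun v => P.g v i j) v :=
      ((hP.1 i j).contDiffAt (hU.mem_nhds hv)).isSymmSndFDerivAt
        (by simp only [minSmoothness_of_isRCLikeNormedField]; exact WithTop.coe_le_coe.2 le_top)
    exact hsymm _ _
  have hswap : ∀ ξ χ, P.dΓForm v b a ξ χ
      = quadForm (fun i j k l => fieldDeriv l (fun v => P.Γ v j i k) v) a b ξ χ := by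
    intro ξ χ
    simp only [quadForm_apply]
    rw [Finset.sum_comm]
    refine Finset.sum_congr rfl fun i _ => Finset.sum_congr rfl fun j _ =>
      Finset.sum_congr rfl fun k _ => Finset.sum_congr rfl fun l _ => by ring
  rw [hswap, hswap]
  simp only [quadForm_apply, ← Finset.sum_add_distrib]
  refine Finset.sum_congr rfl fun i _ => Finset.sum_congr rfl fun j _ => ?_
  rw [Finset.sum_comm]
  refine Finset.sum_congr rfl fun l _ => Finset.sum_congr rfl fun k _ => ?_
  linear_combination (a i * b j * ξ k * χ l) * key i j k l

/-- The linearization of a skew-adjoint operator is skew-adjoint. -/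
theorem integral_dotProduct_linearize (hU : IsOpen U) (hP : P.SmoothOn U)
    (hu : IsSmoothField U u) (hS : ∀ v ∈ U, P.SkewAt v) (hq : IsTest q) (hr : IsTest r)
    (hφ : ContDiff ℝ ∞ φ) :
    ∫ x, q x ⬝ᵥ P.linearize u r φ x = -∫ x, r x ⬝ᵥ P.linearize u q φ x := by
  rw [eq_neg_iff_add_eq_zero, ← integral_add
    (hq.integrable_dotProduct (contDiff_linearize hU hP hu hr hφ).continuous)
    (hr.integrable_dotProduct (contDiff_linearize hU hP hu hq hφ).continuous)]
  refine integral_eq_zero_of_parts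
    (H := fun x => P.ΓForm (u x) (q x) (r x) (φ x) + P.ΓForm (u x) (r x) (q x) (φ x))
    (a := P.tailDot u q) (b := P.linTailF u r φ) (c := P.tailDot u r) (d := P.linTailF u q φ)
    ((contDiff_ΓForm hP hu hq.1 hr.1 hφ).add (contDiff_ΓForm hP hu hr.1 hq.1 hφ))
    (hq.hasCompactSupport_of_zero fun x h _ => by simp [h])
    (contDiff_tailDot hP hu hq.1).continuous (hasCompactSupport_tailDot hq)
    (contDiff_linTailF hU hP hu hr.1 hφ).continuous (hasCompactSupport_linTailF hr)
    (contDiff_tailDot hP hu hr.1).continuous (hasCompactSupport_tailDot hr)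
    (contDiff_linTailF hU hP hu hq.1 hφ).continuous (hasCompactSupport_linTailF hq) fun x => ?_
  have dq := hq.1.hasDerivAt_xDeriv x
  have dr := hr.1.hasDerivAt_xDeriv x
  have du := hu.1.hasDerivAt_xDeriv x
  have dφ := hφ.hasDerivAt_xDeriv x
  have hx := hu.2 x
  rw [((hasDerivAt_ΓForm hU hP hx du dq dr dφ).fun_add
    (hasDerivAt_ΓForm hU hP hx du dr dq dφ)).deriv, dotProduct_linearize, dotProduct_linearize,
    ← pot, ← pot, tailDot, tailDot, linLocF, linLocF, linLoc, linLoc, linTailF, linTailF,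
    (hS _ hx).compat, (hS _ hx).compat]
  linear_combination dΓForm_add_symm hU hP hS hx (q x) (r x) (xDeriv u x) (φ x)

/-- `varAdj` is the variational derivative of `∫ q · P r`. -/
theorem integral_dotProduct_varAdj (hU : IsOpen U) (hP : P.SmoothOn U)
    (hu : IsSmoothField U u) (hS : ∀ v ∈ U, P.SkewAt v) (hq : IsTest q) (hr : IsTest r)
    (hφ : ContDiff ℝ ∞ φ) :
    ∫ x, q x ⬝ᵥ P.linearize u r φ x = ∫ x, P.varAdj u q r x ⬝ᵥ φ x := by
  rw [← sub_eq_zero, ← integral_sub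
    (hq.integrable_dotProduct (contDiff_linearize hU hP hu hr hφ).continuous)
    ((isTest_varAdj hU hP hu hq hr).integrable_dotProduct hφ.continuous)]
  have c1 : HasCompactSupport fun x => P.ΓForm (u x) (q x) (r x) (φ x)
      + P.pot u r x * P.wForm (u x) (q x) (φ x) :=
    hq.hasCompactSupport_of_zero fun x h _ => by simp [h]
  have c2 : HasCompactSupport fun x => P.pot u q x * P.wForm (u x) (r x) (φ x) :=
    hr.hasCompactSupport_of_zero fun x h _ => by simp [h]
  refine integral_eq_zero_of_parts
    (H := fun x => P.ΓForm (u x) (q x) (r x) (φ x) + P.pot u r x * P.wForm (u x) (q x) (φ x)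
      - P.pot u q x * P.wForm (u x) (r x) (φ x))
    (a := P.tailDot u q) (b := P.linTailF u r φ) (c := fun _ => 0) (d := fun _ => 0)
    (((contDiff_ΓForm hP hu hq.1 hr.1 hφ).add ((contDiff_pot hP hu hr).mul
      (contDiff_wForm hP hu hq.1 hφ))).sub ((contDiff_pot hP hu hq).mul
      (contDiff_wForm hP hu hr.1 hφ)))
    (c1.sub c2)
    (contDiff_tailDot hP hu hq.1).continuous (hasCompactSupport_tailDot hq)
    (contDiff_linTailF hU hP hu hr.1 hφ).continuous (hasCompactSupport_linTailF hr)
    continuous_const HasCompactSupport.zero continuous_const HasCompactSupport.zero fun x => ?_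
  have dq := hq.1.hasDerivAt_xDeriv x
  have dr := hr.1.hasDerivAt_xDeriv x
  have du := hu.1.hasDerivAt_xDeriv x
  have dφ := hφ.hasDerivAt_xDeriv x
  have hx := hu.2 x
  rw [(((hasDerivAt_ΓForm hU hP hx du dq dr dφ).fun_add ((hasDerivAt_pot hP hu hr x).fun_mul
    (hasDerivAt_wForm hU hP hx du dq dφ))).fun_sub ((hasDerivAt_pot hP hu hq x).fun_mul
    (hasDerivAt_wForm hU hP hx du dr dφ))).deriv, dotProduct_linearize, varAdj,
    ← pot, tailDot, linLocF, linLoc, linTailF, sub_dotProduct, add_dotProduct, smul_dotProduct,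
    smul_dotProduct, adjLocF, adjTailF, adjTailF, adjLoc_dotProduct, adjTail_dotProduct,
    adjTail_dotProduct]
  simp only [(hS _ hx).compat, linTail, smul_eq_mul]
  ring

/-- The Jacobi expression `ℓ_q(P r) - ℓ_r(P q) - P(δ∫ q·P r)`. -/
def jacobiator (P : HydroOp n) (u q r : ℝ → Fin n → ℝ) (x : ℝ) : Fin n → ℝ :=
  P.linearize u q (P.apply u r) x - P.linearize u r (P.apply u q) x
    - P.apply u (P.varAdj u q r) x

theorem contDiff_jacobiator (hU : IsOpen U) (hP : P.SmoothOn U) (hu : IsSmoothField U u)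
    (hq : IsTest q) (hr : IsTest r) : ContDiff ℝ ∞ (P.jacobiator u q r) :=
  ((contDiff_linearize hU hP hu hq (contDiff_apply hP hu hr)).sub
    (contDiff_linearize hU hP hu hr (contDiff_apply hP hu hq))).sub
    (contDiff_apply hP hu (isTest_varAdj hU hP hu hq hr))

/-- The Schouten bracket is the pairing of `p` with `jacobiator`: the skew-adjointness of `P` and of
its linearization moves all derivatives off `p`. -/
theorem schouten_eq (hU : IsOpen U) (hP : P.SmoothOn U) (hu : IsSmoothField U u)
    (hS : ∀ v ∈ U, P.SkewAt v) (hp : IsTest p) (hq : IsTest q) (hr : IsTest r) :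
    P.schouten u q r p = 2 * ∫ x, p x ⬝ᵥ P.jacobiator u q r x := by
  have ap := contDiff_apply hP hu hp
  have aq := contDiff_apply hP hu hq
  have ar := contDiff_apply hP hu hr
  have hV := isTest_varAdj hU hP hu hq hr
  have i1 := hp.integrable_dotProduct (contDiff_linearize hU hP hu hq ar).continuous
  have i2 := hp.integrable_dotProduct (contDiff_linearize hU hP hu hr aq).continuous
  have i3 := hp.integrable_dotProduct (contDiff_apply hP hu hV).continuous
  have i4 := hr.integrable_dotProduct (contDiff_linearize hU hP hu hp aq).continuous
  have i5 := hq.integrable_dotProduct (contDiff_linearize hU hP hu hr ap).continuous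
  have e1 : ∫ x, p x ⬝ᵥ P.jacobiator u q r x = ∫ x, p x ⬝ᵥ P.linearize u q (P.apply u r) x
      - p x ⬝ᵥ P.linearize u r (P.apply u q) x - p x ⬝ᵥ P.apply u (P.varAdj u q r) x := by
    simp only [jacobiator, dotProduct_sub]
  have e2 : P.schouten u q r p = 2 * ∫ x, p x ⬝ᵥ P.linearize u q (P.apply u r) x
      + q x ⬝ᵥ P.linearize u r (P.apply u p) x + r x ⬝ᵥ P.linearize u p (P.apply u q) x := by
    simp only [schouten, _root_.dotProduct, ← Finset.sum_add_distrib]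
    congr 2
    funext x
    refine Finset.sum_congr rfl fun i _ => by ring
  rw [e1, e2, integral_sub (f := fun x => p x ⬝ᵥ P.linearize u q (P.apply u r) x
      - p x ⬝ᵥ P.linearize u r (P.apply u q) x) (i1.sub i2) i3, integral_sub i1 i2,
    integral_add (f := fun x => p x ⬝ᵥ P.linearize u q (P.apply u r) x
      + q x ⬝ᵥ P.linearize u r (P.apply u p) x) (i1.add i5) i4, integral_add i1 i5,
    integral_dotProduct_linearize hU hP hu hS hr hp aq,
    integral_dotProduct_varAdj hU hP hu hS hq hr ap,
    integral_dotProduct_apply hU hP hu hS hV hp]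
  ring

end Parts

end HydroOp

namespace HydroOp

open MeasureTheory

variable {n : ℕ} {P : HydroOp n} {U : Set (Fin n → ℝ)} {u q r φ p a b : ℝ → Fin n → ℝ}

/-! ### The Jacobi expression along a field -/

section Jacobi

/-- `nonlocCoeff` along a field. -/
def nonlocF (P : HydroOp n) (u r : ℝ → Fin n → ℝ) (c : Fin n → ℝ) (x : ℝ) : ℝ :=
  P.nonlocCoeff (u x) (xDeriv u x) c (r x) (xDeriv r x) (xDeriv (P.tail u) x) (P.locF u r x)
    (xDeriv (P.locF u r) x) (P.adjTailF u r x) (xDeriv (P.adjTailF u r) x)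

/-- `locCoeff` along a field. -/
def locCoeffF (P : HydroOp n) (u q r : ℝ → Fin n → ℝ) (c : Fin n → ℝ) (x : ℝ) : ℝ :=
  P.locCoeff (u x) (xDeriv u x) c (q x) (xDeriv q x) (r x) (xDeriv r x) (P.locF u q x)
    (xDeriv (P.locF u q) x) (P.locF u r x) (xDeriv (P.locF u r) x) (P.adjTailF u q x)
    (P.adjTailF u r x) (P.adjLocF u q r x) (xDeriv (P.adjLocF u q r) x)

/-- The function that the tail of the Jacobi expression is the derivative of. -/
def bdryF (P : HydroOp n) (u q r : ℝ → Fin n → ℝ) (x : ℝ) : ℝ :=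
  P.bdry (u x) (xDeriv u x) (q x) (r x) (P.locF u q x) (P.adjTailF u r x)
    + P.pot u r x * P.wForm (u x) (q x) (P.tail u x)
    - P.pot u q x * P.wForm (u x) (r x) (P.tail u x)

theorem xDeriv_apply (hP : P.SmoothOn U) (hu : IsSmoothField U u) (hr : IsTest r) (x : ℝ) :
    xDeriv (P.apply u r) x = xDeriv (P.locF u r) x + P.pot u r x • xDeriv (P.tail u) x
      + P.wForm (u x) (r x) (xDeriv u x) • P.tail u x := by
  rw [show P.apply u r = fun x => P.locF u r x + P.pot u r x • P.tail u x from
    funext fun x => apply_eq P u r x]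
  rw [((((contDiff_locF hP hu hr.1).hasDerivAt_xDeriv x)).fun_add
    ((hasDerivAt_pot hP hu hr x).fun_smul ((contDiff_tail hP hu).hasDerivAt_xDeriv x))).xDeriv_eq,
    add_assoc]

theorem xDeriv_varAdj (hU : IsOpen U) (hP : P.SmoothOn U) (hu : IsSmoothField U u)
    (hq : IsTest q) (hr : IsTest r) (x : ℝ) :
    xDeriv (P.varAdj u q r) x = xDeriv (P.adjLocF u q r) x
      + P.pot u r x • xDeriv (P.adjTailF u q) x
      + P.wForm (u x) (r x) (xDeriv u x) • P.adjTailF u q x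
      - P.pot u q x • xDeriv (P.adjTailF u r) x
      - P.wForm (u x) (q x) (xDeriv u x) • P.adjTailF u r x := by
  rw [show P.varAdj u q r = fun x => P.adjLocF u q r x + P.pot u r x • P.adjTailF u q x
    - P.pot u q x • P.adjTailF u r x from rfl]
  rw [((((contDiff_adjLocF hU hP hu hq.1 hr.1).hasDerivAt_xDeriv x).fun_add
    ((hasDerivAt_pot hP hu hr x).fun_smul
      ((contDiff_adjTailF hU hP hu hq.1).hasDerivAt_xDeriv x))).fun_sub
    ((hasDerivAt_pot hP hu hq x).fun_smul
      ((contDiff_adjTailF hU hP hu hr.1).hasDerivAt_xDeriv x))).xDeriv_eq]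
  abel

theorem contDiff_bdryF (hU : IsOpen U) (hP : P.SmoothOn U) (hu : IsSmoothField U u)
    (hq : IsTest q) (hr : IsTest r) : ContDiff ℝ ∞ (P.bdryF u q r) := by
  have hW : ContDiff ℝ ∞ fun x => P.wVec (u x) (xDeriv u x) := by
    simp only [← tail_eq]
    exact contDiff_tail hP hu
  exact ((((contDiff_wForm hP hu hr.1 (contDiff_locF hP hu hq.1)).neg.sub
    (contDiff_gForm hP hu hq.1 (contDiff_adjTailF hU hP hu hr.1))).add
    (contDiff_ΓForm hP hu hq.1 hr.1 hW)).add ((contDiff_pot hP hu hr).mul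
    (contDiff_wForm hP hu hq.1 (contDiff_tail hP hu)))).sub ((contDiff_pot hP hu hq).mul
    (contDiff_wForm hP hu hr.1 (contDiff_tail hP hu)))

theorem hasCompactSupport_bdryF (hq : IsTest q) (hr : IsTest r) :
    HasCompactSupport (P.bdryF u q r) := by
  have c1 : HasCompactSupport fun x => P.bdry (u x) (xDeriv u x) (q x) (r x) (P.locF u q x)
      (P.adjTailF u r x) + P.pot u r x * P.wForm (u x) (q x) (P.tail u x) :=
    hq.hasCompactSupport_of_zero fun x h h' => by simp [h, h', bdry, locF, loc]
  have c2 : HasCompactSupport fun x => P.pot u q x * P.wForm (u x) (r x) (P.tail u x) :=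
    hr.hasCompactSupport_of_zero fun x h _ => by simp [h]
  exact c1.sub c2

/-- The argument of the outer `∂⁻¹` in the Jacobi expression is the derivative of `bdryF` plus a
multiple of the nonlocal coefficient. -/
theorem deriv_bdryF (hU : IsOpen U) (hP : P.SmoothOn U) (hu : IsSmoothField U u)
    (hS : ∀ v ∈ U, P.SkewAt v) (hq : IsTest q) (hr : IsTest r) (x : ℝ) :
    P.linTailF u q (P.apply u r) x - P.linTailF u r (P.apply u q) x
      - P.tailDot u (P.varAdj u q r) x
      = deriv (P.bdryF u q r) x + P.nonlocF u r (q x) x := by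
  have dq := hq.1.hasDerivAt_xDeriv x
  have dr := hr.1.hasDerivAt_xDeriv x
  have du := hu.1.hasDerivAt_xDeriv x
  have dW := (contDiff_tail hP hu).hasDerivAt_xDeriv x
  have hx := hu.2 x
  have e1 := hasDerivAt_wForm hU hP hx du dr ((contDiff_locF hP hu hq.1).hasDerivAt_xDeriv x)
  have e2 := hasDerivAt_gForm hU hP hx du dq ((contDiff_adjTailF hU hP hu hr.1).hasDerivAt_xDeriv x)
  have e3 := hasDerivAt_ΓForm hU hP hx du dq dr dW
  have e4 := (hasDerivAt_pot hP hu hr x).fun_mul (hasDerivAt_wForm hU hP hx du dq dW)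
  have e5 := (hasDerivAt_pot hP hu hq x).fun_mul (hasDerivAt_wForm hU hP hx du dr dW)
  have hb : P.bdryF u q r = fun x => -P.wForm (u x) (r x) (P.locF u q x)
      - P.gForm (u x) (q x) (P.adjTailF u r x) + P.ΓForm (u x) (q x) (r x) (P.tail u x)
      + P.pot u r x * P.wForm (u x) (q x) (P.tail u x)
      - P.pot u q x * P.wForm (u x) (r x) (P.tail u x) := by
    funext x
    rw [bdryF, bdry, tail_eq]
  rw [hb, ((((e1.fun_neg.fun_sub e2).fun_add e3).fun_add e4).fun_sub e5).deriv]
  have key := tail_identity (hS _ hx) (ξ := xDeriv u x) (q x) (xDeriv q x) (r x) (xDeriv r x)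
    (xDeriv (P.tail u) x) (P.locF u q x) (xDeriv (P.locF u q) x) (P.locF u r x)
    (xDeriv (P.locF u r) x) (xDeriv (P.adjTailF u r) x) (P.pot u q x) (P.pot u r x) rfl
  rw [← tail_eq] at key
  have hv : P.wForm (u x) (P.varAdj u q r x) (xDeriv u x) = P.varAdj u q r x ⬝ᵥ P.tail u x := by
    rw [tail_eq, dotProduct_bilVec]
  rw [linTailF, linTailF, tailDot, apply_eq, apply_eq, xDeriv_apply hP hu hq, xDeriv_apply hP hu hr,
    hv, nonlocF]
  refine key.trans ?_
  simp only [bdryDeriv, ← tail_eq, adjTailF]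

theorem contDiff_nonlocF (hU : IsOpen U) (hP : P.SmoothOn U) (hu : IsSmoothField U u)
    (hq : ContDiff ℝ ∞ q) (hr : ContDiff ℝ ∞ r) :
    ContDiff ℝ ∞ fun x => P.nonlocF u r (q x) x := by
  have hW : ContDiff ℝ ∞ fun x => P.wVec (u x) (xDeriv u x) := by
    simp only [← tail_eq]
    exact contDiff_tail hP hu
  have hx := hu.1.xDeriv
  have hL := contDiff_locF hP hu hr
  have hy := contDiff_adjTailF hU hP hu hr
  exact ((((((contDiff_dwForm hU hP hu hq hx hL).add (contDiff_wForm hP hu hq hL.xDeriv)).add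
    ((contDiff_wForm hP hu hr hx).mul (contDiff_wForm hP hu hq hW))).sub
    (((contDiff_dgForm hU hP hu hq hr.xDeriv hW).add (contDiff_dΓForm hU hP hu hq hr hx hW)).add
      (contDiff_ΓForm hP hu hq hr (contDiff_tail hP hu).xDeriv))).add
    (contDiff_gForm hP hu hq hy.xDeriv)).add (contDiff_ΓForm hP hu hq hy hx)).sub
    ((contDiff_wForm hP hu hq hx).mul (contDiff_wForm hP hu hr hW))

theorem hasCompactSupport_nonlocF (hq : IsTest q) :
    HasCompactSupport fun x => P.nonlocF u r (q x) x :=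
  hq.hasCompactSupport_of_zero fun x h _ => by
    simp [h, nonlocF, nonlocCoeff, linTail, linLoc]

/-- The Jacobi expression, sorted by nonlocal variables. -/
theorem dotProduct_jacobiator (hU : IsOpen U) (hP : P.SmoothOn U) (hu : IsSmoothField U u)
    (hS : ∀ v ∈ U, P.SkewAt v) (hq : IsTest q) (hr : IsTest r) (c : Fin n → ℝ) (x : ℝ) :
    c ⬝ᵥ P.jacobiator u q r x = P.locCoeffF u q r c x + P.pot u q x * P.nonlocF u r c x
      - P.pot u r x * P.nonlocF u q c x
      + P.wForm (u x) c (xDeriv u x) * xInv (fun y => P.nonlocF u r (q y) y) x := by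
  have htail : xInv (P.linTailF u q (P.apply u r)) x - xInv (P.linTailF u r (P.apply u q)) x
      - P.pot u (P.varAdj u q r) x
      = P.bdryF u q r x + xInv (fun y => P.nonlocF u r (q y) y) x := by
    have c1 := contDiff_linTailF hU hP hu hq.1 (contDiff_apply hP hu hr)
    have c2 := contDiff_linTailF hU hP hu hr.1 (contDiff_apply hP hu hq)
    have hV := isTest_varAdj hU hP hu hq hr
    have s1 := hasCompactSupport_linTailF (P := P) (u := u) (φ := P.apply u r) hq
    have s2 := hasCompactSupport_linTailF (P := P) (u := u) (φ := P.apply u q) hr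
    have c3 := contDiff_bdryF hU hP hu hq hr
    rw [pot, ← xInv_sub c1.continuous s1 c2.continuous s2,
      ← xInv_sub (f := fun y => P.linTailF u q (P.apply u r) y
        - P.linTailF u r (P.apply u q) y) (c1.continuous.sub c2.continuous) (s1.sub s2)
        (contDiff_tailDot hP hu hV.1).continuous (hasCompactSupport_tailDot hV)]
    simp only [deriv_bdryF hU hP hu hS hq hr]
    rw [xInv_add (f := deriv (P.bdryF u q r))
      ((contDiff_infty_iff_deriv.1 c3).2.continuous) (hasCompactSupport_bdryF hq hr).deriv
      (contDiff_nonlocF hU hP hu hq.1 hr.1).continuous (hasCompactSupport_nonlocF hq),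
      xInv_deriv c3 (hasCompactSupport_bdryF hq hr)]
  have key := jacobi_local_identity P (u x) (xDeriv u x) c (q x) (xDeriv q x) (r x) (xDeriv r x)
    (xDeriv (P.tail u) x) (P.locF u q x) (xDeriv (P.locF u q) x) (P.locF u r x)
    (xDeriv (P.locF u r) x) (P.adjTailF u q x) (xDeriv (P.adjTailF u q) x) (P.adjTailF u r x)
    (xDeriv (P.adjTailF u r) x) (P.adjLocF u q r x) (xDeriv (P.adjLocF u q r) x)
    (P.pot u q x) (P.pot u r x)
  rw [← tail_eq, ← apply_eq, ← apply_eq, ← xDeriv_apply hP hu hq, ← xDeriv_apply hP hu hr,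
    ← xDeriv_varAdj hU hP hu hq hr] at key
  rw [bdryF] at htail
  rw [jacobiator, dotProduct_sub, dotProduct_sub, dotProduct_linearize, dotProduct_linearize,
    dotProduct_apply, linLocF, linLocF, locCoeffF, nonlocF, nonlocF]
  rw [← varAdj] at key
  linear_combination key + P.wForm (u x) c (xDeriv u x) * htail

end Jacobi

/-! ### The conditions imply the Jacobi identity -/

section Sufficiency

theorem hasDerivAt_of_eq {f g : ℝ → ℝ} {f' g' x : ℝ} (hf : HasDerivAt f f' x)
    (hg : HasDerivAt g g' x) (h : ∀ y, f y = g y) : f' = g' := by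
  obtain rfl : f = g := funext h
  exact hf.unique hg

/-- The nonlocal coefficient vanishes along a field. The derivative of `adjTailF` that it contains
is found by differentiating `gForm_adjTail` along the field. -/
theorem nonlocF_eq_zero (hU : IsOpen U) (hP : P.SmoothOn U) (hg : P.NondegenerateOn U)
    (hu : IsSmoothField U u) (hS : ∀ v ∈ U, P.SkewAt v) (hJ : ∀ v ∈ U, P.JacobiAt v)
    (hr : ContDiff ℝ ∞ r) (c : Fin n → ℝ) (x : ℝ) : P.nonlocF u r c x = 0 := by
  have hx := hu.2 x
  refine nonlocCoeff_eq_zero (hS _ hx) (hJ _ hx) (gVec_surjective (hg _ hx)) _ _ _ _ _ _ ?_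
  have du := hu.1.hasDerivAt_xDeriv x
  have dc := hasDerivAt_const x c
  have h1 := hasDerivAt_gForm hU hP hx du dc ((contDiff_adjTailF hU hP hu hr).hasDerivAt_xDeriv x)
  have h2 := (hasDerivAt_wForm hU hP hx du dc
    ((contDiff_locF hP hu hr).hasDerivAt_xDeriv x)).fun_neg.fun_add
    (hasDerivAt_ΓForm hU hP hx du dc (hr.hasDerivAt_xDeriv x)
      ((contDiff_tail hP hu).hasDerivAt_xDeriv x))
  have := hasDerivAt_of_eq h1 h2 fun y => by
    rw [tail_eq]
    exact gForm_adjTail (hS _ (hu.2 y)) (hJ _ (hu.2 y)) _ _ _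
  simpa [tail_eq, adjTailF, locF] using this

/-- The local coefficient vanishes along a field. The derivative of `adjLocF` that it contains is
found by differentiating `gForm_adjLoc` along the field. -/
theorem locCoeffF_eq_zero (hU : IsOpen U) (hP : P.SmoothOn U) (hg : P.NondegenerateOn U)
    (hu : IsSmoothField U u) (hS : ∀ v ∈ U, P.SkewAt v) (hJ : ∀ v ∈ U, P.JacobiAt v)
    (hq : ContDiff ℝ ∞ q) (hr : ContDiff ℝ ∞ r) (c : Fin n → ℝ) (x : ℝ) :
    P.locCoeffF u q r c x = 0 := by
  have hx := hu.2 x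
  refine locCoeff_eq_zero (hS _ hx) (hJ _ hx) (gVec_surjective (hg _ hx)) _ _ _ _ _ _ _ _ ?_
  have du := hu.1.hasDerivAt_xDeriv x
  have dc := hasDerivAt_const x c
  have h1 := hasDerivAt_gForm hU hP hx du dc
    ((contDiff_adjLocF hU hP hu hq hr).hasDerivAt_xDeriv x)
  have h2 := (hasDerivAt_ΓForm hU hP hx du dc (hq.hasDerivAt_xDeriv x)
      ((contDiff_locF hP hu hr).hasDerivAt_xDeriv x)).fun_sub
    (hasDerivAt_ΓForm hU hP hx du dc (hr.hasDerivAt_xDeriv x)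
      ((contDiff_locF hP hu hq).hasDerivAt_xDeriv x))
  have := hasDerivAt_of_eq h1 h2 fun y =>
    gForm_adjLoc (hS _ (hu.2 y)) (hJ _ (hu.2 y)) _ _ _ _ _
  simpa [adjLocF, locF] using this

theorem jacobiator_eq_zero (hU : IsOpen U) (hP : P.SmoothOn U) (hg : P.NondegenerateOn U)
    (hu : IsSmoothField U u) (hS : ∀ v ∈ U, P.SkewAt v) (hJ : ∀ v ∈ U, P.JacobiAt v)
    (hq : IsTest q) (hr : IsTest r) (x : ℝ) : P.jacobiator u q r x = 0 := by
  refine covector_ext fun c => ?_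
  rw [dotProduct_comm, dotProduct_jacobiator hU hP hu hS hq hr,
    locCoeffF_eq_zero hU hP hg hu hS hJ hq.1 hr.1, nonlocF_eq_zero hU hP hg hu hS hJ hr.1,
    nonlocF_eq_zero hU hP hg hu hS hJ hq.1]
  simp only [nonlocF_eq_zero hU hP hg hu hS hJ hr.1]
  simp [xInv]

end Sufficiency

end HydroOp

namespace HydroOp

open MeasureTheory

variable {n : ℕ} {P : HydroOp n} {U : Set (Fin n → ℝ)} {u q r φ p a b : ℝ → Fin n → ℝ}

/-! ### The formalism of distributions and that of differential operators agree -/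

section Distributions

/-- A kernel of the form `A δ' + B δ + C ν D` pairs with two test covectors to the integral of an
operator with tail `C ∂⁻¹ D`, since convolution with `ν` is `∂⁻¹`. -/
theorem kernelPair_eq {A B : ℝ → Fin n → Fin n → ℝ} {C D : ℝ → Fin n → ℝ} {fA fB fC fD : ℝ → ℝ}
    (hA : ∀ x, ∑ i, ∑ j, A x i j * p x i * xDeriv q x j = fA x)
    (hB : ∀ x, ∑ i, ∑ j, B x i j * p x i * q x j = fB x)
    (hC : ∀ x, ∑ i, C x i * p x i = fC x) (hD : ∀ x, ∑ i, D x i * q x i = fD x)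
    (cA : Continuous fA) (sA : HasCompactSupport fA) (cB : Continuous fB)
    (sB : HasCompactSupport fB) (cC : Continuous fC) (sC : HasCompactSupport fC)
    (cD : Continuous fD) (sD : HasCompactSupport fD) :
    Integrable (fun x => fA x + fB x + fC x * xInv fD x) ∧
    kernelPair A B C D p q = ∫ x, (fA x + fB x + fC x * xInv fD x) := by
  have hcont : Continuous (xInv fD) := continuous_iff_continuousAt.2 fun x =>
    (hasDerivAt_xInv cD sD x).continuousAt
  have i1 : Integrable fA := cA.integrable_of_hasCompactSupport sA
  have i2 : Integrable fB := cB.integrable_of_hasCompactSupport sB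
  have i3 : Integrable fun x => fC x * xInv fD x :=
    (cC.mul hcont).integrable_of_hasCompactSupport sC.mul_right
  refine ⟨(i1.add i2).add i3, ?_⟩
  rw [integral_add (f := fun x => fA x + fB x) (i1.add i2) i3, integral_add i1 i2, kernelPair]
  simp only [hA, hB, hC, hD]
  congr 2
  funext x
  rw [← integral_nuStep_mul cD sD, ← integral_const_mul]
  congr 1
  funext y
  ring

theorem distPair_eq (hP : P.SmoothOn U) (hu : IsSmoothField U u) (hp : IsTest p)
    (hq : IsTest q) : P.distPair u p q = ∫ x, p x ⬝ᵥ P.apply u q x := by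
  rw [distPair, (kernelPair_eq (fA := fun x => P.gForm (u x) (p x) (xDeriv q x))
    (fB := fun x => P.ΓForm (u x) (p x) (q x) (xDeriv u x)) (fC := P.tailDot u p)
    (fD := P.tailDot u q) (fun x => by rw [bilForm_apply]) (fun x => ?_)
    (fun x => congrFun (tail_dot_eq P u p) x) (fun x => congrFun (tail_dot_eq P u q) x)
    (contDiff_gForm hP hu hp.1 hq.1.xDeriv).continuous
    (hp.hasCompactSupport_of_zero fun x h _ => by simp [h])
    (contDiff_ΓForm hP hu hp.1 hq.1 hu.1.xDeriv).continuous
    (hp.hasCompactSupport_of_zero fun x h _ => by simp [h])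
    (contDiff_tailDot hP hu hp.1).continuous (hasCompactSupport_tailDot hp)
    (contDiff_tailDot hP hu hq.1).continuous (hasCompactSupport_tailDot hq)).2]
  · simp only [dotProduct_apply, tailDot, pot, mul_comm]
  · rw [triForm_apply]
    simp only [Finset.sum_mul]
    refine Finset.sum_congr rfl fun i _ => Finset.sum_congr rfl fun j _ =>
      Finset.sum_congr rfl fun k _ => by ring

theorem distSmear_eq (hP : P.SmoothOn U) (hu : IsSmoothField U u) (hr : IsTest r) :
    P.distSmear u r = P.apply u r := by
  funext x i
  rw [distSmear, HydroOp.apply, tail_dot_eq,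
    ← integral_nuStep_mul (contDiff_tailDot hP hu hr.1).continuous (hasCompactSupport_tailDot hr)]
  congr 3
  funext z
  rw [← tail_dot_eq]

/-- The two variations of the kernel, with respect to the fields at `x` and at `y`, add up to the
kernel of the linearization. -/
theorem distVar_eq (hU : IsOpen U) (hP : P.SmoothOn U) (hu : IsSmoothField U u)
    (hφ : ContDiff ℝ ∞ φ) (hp : IsTest p) (hq : IsTest q) :
    P.distVarFst u φ p q + P.distVarSnd u φ p q = ∫ x, p x ⬝ᵥ P.linearize u q φ x := by
  have hB : ∀ x, ∑ i, ∑ j, ((∑ l, ∑ s, fieldDeriv l (fun v => P.Γ v i j s) (u x) * xDeriv u x s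
        * φ x l) + ∑ l, P.Γ (u x) i j l * xDeriv φ x l) * p x i * q x j
      = P.dΓForm (u x) (p x) (q x) (xDeriv u x) (φ x) + P.ΓForm (u x) (p x) (q x) (xDeriv φ x) := by
    intro x
    rw [← triForm_sum_mul, triForm_apply, triForm_apply]
    simp only [Finset.sum_add_distrib, Finset.sum_mul, add_mul]
    refine congrArg₂ _ (Finset.sum_congr rfl fun i _ => Finset.sum_congr rfl fun j _ => ?_)
      (Finset.sum_congr rfl fun i _ => Finset.sum_congr rfl fun j _ =>
        Finset.sum_congr rfl fun l _ => by ring)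
    rw [Finset.sum_comm]
    exact Finset.sum_congr rfl fun k _ => Finset.sum_congr rfl fun l _ => by ring
  obtain ⟨i1, e1⟩ := kernelPair_eq
    (A := fun x i j => ∑ l, fieldDeriv l (fun v => P.g v i j) (u x) * φ x l)
    (B := fun x i j => (∑ l, ∑ s, fieldDeriv l (fun v => P.Γ v i j s) (u x) * xDeriv u x s * φ x l)
        + ∑ l, P.Γ (u x) i j l * xDeriv φ x l) (C := P.tailLin u φ) (D := P.tail u)
    (p := p) (q := q)
    (fA := fun x => P.dgForm (u x) (p x) (xDeriv q x) (φ x))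
    (fB := fun x => P.dΓForm (u x) (p x) (q x) (xDeriv u x) (φ x)
      + P.ΓForm (u x) (p x) (q x) (xDeriv φ x)) (fC := P.linTailF u p φ)
    (fD := P.tailDot u q) (fun x => by rw [← bilForm_sum_mul, bilForm_apply]) hB
    (fun x => congrFun (tailLin_dot_eq P u p φ) x) (fun x => congrFun (tail_dot_eq P u q) x)
    (contDiff_dgForm hU hP hu hp.1 hq.1.xDeriv hφ).continuous
    (hp.hasCompactSupport_of_zero fun x h _ => by simp [h])
    ((contDiff_dΓForm hU hP hu hp.1 hq.1 hu.1.xDeriv hφ).add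
      (contDiff_ΓForm hP hu hp.1 hq.1 hφ.xDeriv)).continuous
    (hp.hasCompactSupport_of_zero fun x h _ => by simp [h])
    (contDiff_linTailF hU hP hu hp.1 hφ).continuous (hasCompactSupport_linTailF hp)
    (contDiff_tailDot hP hu hq.1).continuous (hasCompactSupport_tailDot hq)
  obtain ⟨i2, e2⟩ := kernelPair_eq (A := fun _ _ _ => 0) (B := fun _ _ _ => 0) (C := P.tail u)
    (D := P.tailLin u φ) (p := p) (q := q)
    (fA := fun _ => 0) (fB := fun _ => 0) (fC := P.tailDot u p)
    (fD := P.linTailF u q φ) (fun x => by simp) (fun x => by simp)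
    (fun x => congrFun (tail_dot_eq P u p) x) (fun x => congrFun (tailLin_dot_eq P u q φ) x)
    continuous_const HasCompactSupport.zero continuous_const HasCompactSupport.zero
    (contDiff_tailDot hP hu hp.1).continuous (hasCompactSupport_tailDot hp)
    (contDiff_linTailF hU hP hu hq.1 hφ).continuous (hasCompactSupport_linTailF hq)
  rw [distVarFst, distVarSnd, e1, e2, ← integral_add i1 i2]
  congr 1
  funext x
  rw [dotProduct_linearize, linLocF, linLoc, linTailF, tailDot, pot]
  ring

theorem distJacobi_eq (hU : IsOpen U) (hP : P.SmoothOn U) (hu : IsSmoothField U u)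
    (hp : IsTest p) (hq : IsTest q) (hr : IsTest r) :
    P.schouten u q r p = 2 * P.distJacobi u p q r := by
  have ap := contDiff_apply hP hu hp
  have aq := contDiff_apply hP hu hq
  have ar := contDiff_apply hP hu hr
  have i1 := hp.integrable_dotProduct (contDiff_linearize hU hP hu hq ar).continuous
  have i4 := hr.integrable_dotProduct (contDiff_linearize hU hP hu hp aq).continuous
  have i5 := hq.integrable_dotProduct (contDiff_linearize hU hP hu hr ap).continuous
  have e2 : P.schouten u q r p = 2 * ∫ x, p x ⬝ᵥ P.linearize u q (P.apply u r) x
      + q x ⬝ᵥ P.linearize u r (P.apply u p) x + r x ⬝ᵥ P.linearize u p (P.apply u q) x := by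
    simp only [schouten, _root_.dotProduct, ← Finset.sum_add_distrib]
    congr 2
    funext x
    refine Finset.sum_congr rfl fun i _ => by ring
  rw [e2, integral_add (f := fun x => p x ⬝ᵥ P.linearize u q (P.apply u r) x
      + q x ⬝ᵥ P.linearize u r (P.apply u p) x) (i1.add i5) i4, integral_add i1 i5,
    ← distVar_eq hU hP hu ar hp hq, ← distVar_eq hU hP hu ap hq hr,
    ← distVar_eq hU hP hu aq hr hp, distJacobi, distSmear_eq hP hu hp, distSmear_eq hP hu hq,
    distSmear_eq hP hu hr]
  ring

theorem dotProduct_adjoint (hU : IsOpen U) (hP : P.SmoothOn U) (hu : IsSmoothField U u)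
    (hq : IsTest q) (c : Fin n → ℝ) (x : ℝ) : c ⬝ᵥ P.adjoint u q x
      = -(P.dgForm (u x) (q x) c (xDeriv u x) + P.gForm (u x) (xDeriv q x) c)
        + P.ΓForm (u x) (q x) c (xDeriv u x) - P.pot u q x * P.wForm (u x) c (xDeriv u x) := by
  have e : P.adjoint u q x = fun j => -(P.dgForm (u x) (q x) (Pi.single j 1) (xDeriv u x)
        + P.gForm (u x) (xDeriv q x) (Pi.single j 1))
        + P.ΓForm (u x) (q x) (Pi.single j 1) (xDeriv u x)
        - P.pot u q x * P.wForm (u x) (Pi.single j 1) (xDeriv u x) := by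
    funext j
    have hd : (fun y => ∑ i, P.g (u y) i j * q y i)
        = fun y => P.gForm (u y) (q y) (Pi.single j 1) := by
      funext y
      simp [bilForm_apply, Pi.single_apply]
    rw [adjoint, hd, (hasDerivAt_gForm hU hP (hu.2 x) (hu.1.hasDerivAt_xDeriv x)
      (hq.1.hasDerivAt_xDeriv x) (hasDerivAt_const _ _)).deriv, tail_dot_eq, ← pot, tail_eq]
    have h3 : P.ΓForm (u x) (q x) (Pi.single j 1) (xDeriv u x)
        = ∑ i, (∑ k, P.Γ (u x) i j k * xDeriv u x k) * q x i := by
      simp only [triForm_apply, Pi.single_apply, mul_ite, mul_one, mul_zero, ite_mul, zero_mul,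
        Finset.sum_ite_irrel, Finset.sum_const_zero, Finset.sum_ite_eq', Finset.mem_univ, if_true,
        Finset.sum_mul]
      refine Finset.sum_congr rfl fun i _ => Finset.sum_congr rfl fun k _ => by ring
    rw [h3, ← dotProduct_bilVec (P.w (u x))]
    simp
    ring
  exact dotProduct_eq_of_isLinearMap (F := fun c => -(P.dgForm (u x) (q x) c (xDeriv u x)
    + P.gForm (u x) (xDeriv q x) c) + P.ΓForm (u x) (q x) c (xDeriv u x)
    - P.pot u q x * P.wForm (u x) c (xDeriv u x))
    ⟨fun a b => by simp; ring, fun t a => by simp; ring⟩ (fun j => by rw [e]) c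

theorem contDiff_adjoint (hU : IsOpen U) (hP : P.SmoothOn U) (hu : IsSmoothField U u)
    (hq : IsTest q) : ContDiff ℝ ∞ (P.adjoint u q) := by
  refine contDiff_of_dotProduct fun c => ?_
  simp only [dotProduct_comm _ c, dotProduct_adjoint hU hP hu hq]
  have hx := hu.1.xDeriv
  exact (((contDiff_dgForm hU hP hu hq.1 contDiff_const hx).add
    (contDiff_gForm hP hu hq.1.xDeriv contDiff_const)).neg.add
    (contDiff_ΓForm hP hu hq.1 contDiff_const hx)).sub
    ((contDiff_pot hP hu hq).mul (contDiff_wForm hP hu contDiff_const hx))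

/-- `P.adjoint` is the formal adjoint of `P`, whether or not `P` is skew-adjoint. -/
theorem integral_dotProduct_adjoint (hU : IsOpen U) (hP : P.SmoothOn U) (hu : IsSmoothField U u)
    (hp : IsTest p) (hq : IsTest q) :
    ∫ x, q x ⬝ᵥ P.apply u p x = ∫ x, p x ⬝ᵥ P.adjoint u q x := by
  rw [← sub_eq_zero, ← integral_sub
    (hq.integrable_dotProduct (contDiff_apply hP hu hp).continuous)
    (hp.integrable_dotProduct (contDiff_adjoint hU hP hu hq).continuous)]
  refine integral_eq_zero_of_parts (H := fun x => P.gForm (u x) (q x) (p x))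
    (a := P.tailDot u p) (b := P.tailDot u q)
    (contDiff_gForm hP hu hq.1 hp.1) (hp.hasCompactSupport_of_zero fun x h _ => by simp [h])
    (contDiff_tailDot hP hu hp.1).continuous (hasCompactSupport_tailDot hp)
    (contDiff_tailDot hP hu hq.1).continuous (hasCompactSupport_tailDot hq)
    (c := fun _ => 0) (d := fun _ => 0) continuous_const HasCompactSupport.zero continuous_const
    HasCompactSupport.zero fun x => ?_
  rw [(hasDerivAt_gForm hU hP (hu.2 x) (hu.1.hasDerivAt_xDeriv x) (hq.1.hasDerivAt_xDeriv x)
    (hp.1.hasDerivAt_xDeriv x)).deriv, dotProduct_apply, dotProduct_adjoint hU hP hu hq,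
    ← pot, ← pot, tailDot, tailDot]
  ring

/-- The formalisms of distributions and of differential operators define the same notion: the
pairings of the distributions with test covectors are the integrals that appear in the latter. -/
theorem isHamiltonianDist_iff_op (hU : IsOpen U) (hP : P.SmoothOn U) :
    P.IsHamiltonianDist U ↔ P.IsHamiltonianOp U := by
  have hskew : ∀ u, IsSmoothField U u →
      ((∀ p q, IsTest p → IsTest q → P.distPair u p q = -P.distPair u q p) ↔
        ∀ ψ, IsTest ψ → ∀ x j, P.adjoint u ψ x j = -P.apply u ψ x j) := by
    intro u hu
    have key : ∀ p q, IsTest p → IsTest q → P.distPair u p q + P.distPair u q p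
        = ∫ x, p x ⬝ᵥ (P.apply u q x + P.adjoint u q x) := by
      intro p q hp hq
      simp only [dotProduct_add]
      rw [distPair_eq hP hu hp hq, distPair_eq hP hu hq hp,
        integral_dotProduct_adjoint hU hP hu hp hq, integral_add
        (hp.integrable_dotProduct (contDiff_apply hP hu hq).continuous)
        (hp.integrable_dotProduct (contDiff_adjoint hU hP hu hq).continuous)]
    constructor
    · intro h ψ hψ x j
      have := eq_zero_of_forall_test (f := fun x => P.apply u ψ x + P.adjoint u ψ x)
        ((contDiff_apply hP hu hψ).add (contDiff_adjoint hU hP hu hψ)).continuous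
        (fun p hp => by rw [← key p ψ hp hψ, h p ψ hp hψ]; ring) x
      have hj := congrFun this j
      simp only [Pi.add_apply, Pi.zero_apply] at hj
      linarith
    · intro h p q hp hq
      rw [eq_neg_iff_add_eq_zero, key p q hp hq]
      have : ∀ x, P.apply u q x + P.adjoint u q x = 0 := fun x => by
        ext j
        simp [h q hq x j]
      simp [this]
  unfold IsHamiltonianDist IsHamiltonianOp
  refine forall₂_congr fun u hu => and_congr (hskew u hu) ?_
  constructor
  · intro h q r p hq hr hp
    rw [distJacobi_eq hU hP hu hp hq hr, h p q r hp hq hr, mul_zero]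
  · intro h p q r hp hq hr
    have := h q r p hq hr hp
    rw [distJacobi_eq hU hP hu hp hq hr] at this
    linarith

end Distributions

end HydroOp

/-! ### Fields and test covectors with prescribed jets -/

section Jets

open Filter Topology

variable {n : ℕ} {U : Set (Fin n → ℝ)} {v : Fin n → ℝ}

/-- A smooth field through `v` with prescribed first and second derivatives at `0`. The oscillation
`ε sin (x / ε)` keeps the field near `v`. -/
theorem exists_field (hU : IsOpen U) (hv : v ∈ U) (ξ η : Fin n → ℝ) :
    ∃ u, IsSmoothField U u ∧ u 0 = v ∧ xDeriv u 0 = ξ ∧ xDeriv (xDeriv u) 0 = η := by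
  obtain ⟨δ, hδ, hball⟩ := Metric.isOpen_iff.1 hU v hv
  obtain ⟨ε, hε0, hε1, hε⟩ : ∃ ε : ℝ, 0 < ε ∧ ε ≤ 1 ∧ ε * (‖ξ‖ + 2 * ‖η‖) < δ := by
    have hK : 0 < ‖ξ‖ + 2 * ‖η‖ + 1 := by positivity
    refine ⟨min 1 (δ / (‖ξ‖ + 2 * ‖η‖ + 1)), by positivity, min_le_left _ _, ?_⟩
    have h1 := min_le_right 1 (δ / (‖ξ‖ + 2 * ‖η‖ + 1))
    have h2 : 0 < min 1 (δ / (‖ξ‖ + 2 * ‖η‖ + 1)) := by positivity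
    rw [le_div_iff₀ hK] at h1
    linarith
  have hd : ∀ x : ℝ, HasDerivAt (fun y : ℝ => y / ε) (1 / ε) x := fun x =>
    (hasDerivAt_id x).div_const ε
  have d1 : ∀ x, HasDerivAt
      (fun x => v + (ε * Real.sin (x / ε)) • ξ + (ε ^ 2 * (1 - Real.cos (x / ε))) • η)
      (Real.cos (x / ε) • ξ + (ε * Real.sin (x / ε)) • η) x := by
    intro x
    have hs := (((hd x).sin.const_mul ε).smul_const ξ).const_add v
    have hc := ((((hd x).cos.const_sub 1).const_mul (ε ^ 2)).smul_const η)
    refine (hs.fun_add hc).congr_deriv ?_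
    congr 2 <;> field_simp
  have d2 : HasDerivAt (fun x => Real.cos (x / ε) • ξ + (ε * Real.sin (x / ε)) • η) η 0 := by
    refine (((hd 0).cos.smul_const ξ).fun_add
      (((hd 0).sin.const_mul ε).smul_const η)).congr_deriv ?_
    simp [hε0.ne']
  refine ⟨_, ⟨?_, fun x => hball ?_⟩, ?_, (d1 0).xDeriv_eq.trans (by simp), ?_⟩
  · fun_prop
  · rw [mem_ball_iff_norm, add_assoc, add_sub_cancel_left]
    refine lt_of_le_of_lt ((norm_add_le _ _).trans ?_) hε
    rw [norm_smul, norm_smul, mul_add]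
    have a1 : ‖ε * Real.sin (x / ε)‖ ≤ ε := by
      rw [Real.norm_eq_abs, abs_mul, abs_of_pos hε0]
      exact mul_le_of_le_one_right hε0.le (Real.abs_sin_le_one _)
    have a2 : ‖ε ^ 2 * (1 - Real.cos (x / ε))‖ ≤ ε * 2 := by
      have b1 := Real.cos_le_one (x / ε)
      have b2 := Real.neg_one_le_cos (x / ε)
      rw [Real.norm_eq_abs, abs_of_nonneg (mul_nonneg (by positivity) (by linarith))]
      nlinarith [mul_nonneg hε0.le (sub_nonneg.2 b1)]
    have := mul_le_mul_of_nonneg_right a1 (norm_nonneg ξ)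
    have := mul_le_mul_of_nonneg_right a2 (norm_nonneg η)
    linarith
  · simp
  · rw [show xDeriv _ = _ from funext fun x => (d1 x).xDeriv_eq]
    exact d2.xDeriv_eq

/-- A test covector with a prescribed second-order jet at `0`. -/
theorem exists_test (a b c : Fin n → ℝ) :
    ∃ r, IsTest r ∧ r 0 = a ∧ xDeriv r 0 = b ∧ xDeriv (xDeriv r) 0 = c := by
  let f : ContDiffBump (0 : ℝ) := ⟨1, 2, one_pos, one_lt_two⟩
  have e : (fun x : ℝ => f x • (a + x • b + (x ^ 2 / 2) • c))
      =ᶠ[𝓝 0] fun x => a + x • b + (x ^ 2 / 2) • c := by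
    filter_upwards [f.eventuallyEq_one] with x hx
    simp [hx]
  have d1 : ∀ x : ℝ, HasDerivAt (fun x : ℝ => a + x • b + (x ^ 2 / 2) • c) (b + x • c) x := by
    intro x
    refine ((((hasDerivAt_id x).smul_const b).const_add a).fun_add
      (((hasDerivAt_pow 2 x).div_const 2).smul_const c)).congr_deriv ?_
    simp
  have d2 : HasDerivAt (fun x : ℝ => b + x • c) c 0 :=
    (((hasDerivAt_id (0 : ℝ)).smul_const c).const_add b).congr_deriv (by simp)
  have e1 : xDeriv (fun x : ℝ => f x • (a + x • b + (x ^ 2 / 2) • c))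
      =ᶠ[𝓝 0] fun x => b + x • c := by
    filter_upwards [e.eventuallyEq_nhds] with x hx
    exact ((d1 x).congr_of_eventuallyEq hx).xDeriv_eq
  refine ⟨fun x => f x • (a + x • b + (x ^ 2 / 2) • c), ⟨?_, f.hasCompactSupport.smul_right⟩,
    by simp [f.eventuallyEq_one.eq_of_nhds], by simpa using e1.eq_of_nhds,
    (d2.congr_of_eventuallyEq e1).xDeriv_eq⟩
  exact f.contDiff.smul (by fun_prop)

theorem HasDerivAt.quadForm {a : ℝ → Fin n → Fin n → Fin n → Fin n → ℝ}
    {a' : Fin n → Fin n → Fin n → Fin n → ℝ}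
    {α β φ ψ : ℝ → Fin n → ℝ} {α' β' φ' ψ' : Fin n → ℝ} {x : ℝ}
    (ha : ∀ i j k l, HasDerivAt (fun y => a y i j k l) (a' i j k l) x)
    (hα : HasDerivAt α α' x) (hβ : HasDerivAt β β' x) (hφ : HasDerivAt φ φ' x)
    (hψ : HasDerivAt ψ ψ' x) :
    HasDerivAt (fun y => quadForm (a y) (α y) (β y) (φ y) (ψ y))
      (quadForm a' (α x) (β x) (φ x) (ψ x) + quadForm (a x) α' (β x) (φ x) (ψ x)
        + quadForm (a x) (α x) β' (φ x) (ψ x) + quadForm (a x) (α x) (β x) φ' (ψ x)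
        + quadForm (a x) (α x) (β x) (φ x) ψ') x := by
  simp only [quadForm_apply, ← Finset.sum_add_distrib]
  refine HasDerivAt.fun_sum fun i _ => HasDerivAt.fun_sum fun j _ =>
    HasDerivAt.fun_sum fun k _ => HasDerivAt.fun_sum fun l _ => ?_
  refine (((((ha i j k l).mul (hasDerivAt_pi.1 hα i)).mul (hasDerivAt_pi.1 hβ j)).mul
    (hasDerivAt_pi.1 hφ k)).mul (hasDerivAt_pi.1 hψ l)).congr_deriv ?_
  simp only [Pi.mul_apply]
  ring

theorem xDeriv_eq_of_dotProduct {f : ℝ → Fin n → ℝ} {f' : Fin n → ℝ} {x : ℝ}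
    (h : ∀ c : Fin n → ℝ, HasDerivAt (fun y => c ⬝ᵥ f y) (c ⬝ᵥ f') x) : xDeriv f x = f' := by
  funext i
  simpa [xDeriv] using (h (Pi.single i 1)).deriv

end Jets

namespace HydroOp

open Filter Topology

variable {n : ℕ} {P : HydroOp n} {U : Set (Fin n → ℝ)} {u q r : ℝ → Fin n → ℝ}
  {v : Fin n → ℝ}

/-! ### Necessity of the conditions at a point -/

section Necessity

theorem codazzi_add (p c ξ χ : Fin n → ℝ) :
    P.codazzi v p c (ξ + χ) = P.codazzi v p c ξ + P.codazzi v p c χ := by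
  simp only [codazzi, map_add, LinearMap.add_apply]
  ring

theorem _root_.ContinuousAt.triForm {X : Type*} [TopologicalSpace X]
    {a : X → Fin n → Fin n → Fin n → ℝ} {α β φ : X → Fin n → ℝ} {x : X}
    (ha : ∀ i j k, ContinuousAt (fun y => a y i j k) x) (hα : ContinuousAt α x)
    (hβ : ContinuousAt β x) (hφ : ContinuousAt φ x) :
    ContinuousAt (fun y => triForm (a y) (α y) (β y) (φ y)) x := by
  simp only [triForm_apply]
  exact tendsto_finsetSum _ fun i _ => tendsto_finsetSum _ fun j _ => tendsto_finsetSum _ fun k _ =>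
    (((ha i j k).mul (continuousAt_pi.1 hα i)).mul (continuousAt_pi.1 hβ j)).mul
      (continuousAt_pi.1 hφ k)

theorem continuousAt_codazzi (hU : IsOpen U) (hP : P.SmoothOn U) (hv : v ∈ U) (p c ξ : Fin n → ℝ) :
    ContinuousAt (fun v => P.codazzi v p c ξ) v := by
  have hn := hU.mem_nhds hv
  have hg : ContinuousAt (fun v => P.gVec v p) v := by
    refine continuousAt_pi.2 fun i => ?_
    simp only [bilVec_apply]
    exact tendsto_finsetSum _ fun j _ =>
      ((hP.1 i j).continuousOn.continuousAt hn).mul continuousAt_const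
  have hw : ContinuousAt (fun v => P.wCov v p) v := by
    refine continuousAt_pi.2 fun i => ?_
    simp only [bilCovec_apply]
    exact tendsto_finsetSum _ fun j _ =>
      ((hP.2.2 j i).continuousOn.continuousAt hn).mul continuousAt_const
  have hw2 : ContinuousAt (fun v => P.wVec v ξ) v := by
    refine continuousAt_pi.2 fun i => ?_
    simp only [bilVec_apply]
    exact tendsto_finsetSum _ fun j _ =>
      ((hP.2.2 i j).continuousOn.continuousAt hn).mul continuousAt_const
  have hd : ∀ i k l, ContinuousAt (fun v => fieldDeriv l (fun v => P.w v i k) v) v := fun i k l =>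
    ((hP.2.2 i k).fieldDeriv hU l).continuousOn.continuousAt hn
  have hΓ : ∀ i j k, ContinuousAt (fun v => P.Γ v i j k) v := fun i j k =>
    (hP.2.1 i j k).continuousOn.continuousAt hn
  have hc : ∀ c : Fin n → ℝ, ContinuousAt (fun _ : Fin n → ℝ => c) v := fun c => continuousAt_const
  exact (((ContinuousAt.triForm hd (hc _) (hc _) hg).sub
    (ContinuousAt.triForm hd (hc _) hg (hc _))).add
    (ContinuousAt.triForm hΓ hw (hc _) (hc _))).sub (ContinuousAt.triForm hΓ (hc _) (hc _) hw2)

/-- The symmetry of `w g` and the Codazzi equations follow from the vanishing of the nonlocal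
coefficient for all `η` that are not in the kernel of `w`: where `w` does not vanish this is
linearity in `η`, and the remaining points are limits of such points, or `w` vanishes near them. -/
theorem wSymm_codazzi_of_nonloc (hU : IsOpen U) (hP : P.SmoothOn U)
    (hZ : ∀ v ∈ U, ∀ p r0 r2 η, P.wVec v η ≠ 0 →
      P.wForm v p (P.gVec v r2) - P.wForm v r2 (P.gVec v p) + P.codazzi v p r0 η = 0) :
    ∀ v ∈ U, (∀ a b, P.wForm v a (P.gVec v b) = P.wForm v b (P.gVec v a)) ∧
      ∀ p c ξ, P.codazzi v p c ξ = 0 := by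
  have key : ∀ v ∈ U, ∀ η, P.wVec v η ≠ 0 →
      (∀ a b, P.wForm v a (P.gVec v b) = P.wForm v b (P.gVec v a)) ∧
      ∀ p c ξ, P.codazzi v p c ξ = 0 := by
    intro v hv η hη
    have h1 : ∀ a b, P.wForm v a (P.gVec v b) = P.wForm v b (P.gVec v a) := fun a b => by
      have := hZ v hv a 0 b η hη
      simp only [codazzi, map_zero, LinearMap.zero_apply] at this
      linarith
    have h2 : ∀ p c ξ, P.wVec v ξ ≠ 0 → P.codazzi v p c ξ = 0 := fun p c ξ hξ => by
      have := hZ v hv p c 0 ξ hξ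
      rw [h1] at this
      linarith
    refine ⟨h1, fun p c ξ => ?_⟩
    by_cases hξ : P.wVec v ξ = 0
    · have := h2 p c (ξ + η) (by rwa [map_add, hξ, zero_add])
      rwa [codazzi_add, h2 p c η hη, add_zero] at this
    · exact h2 p c ξ hξ
  intro v hv
  by_cases hw : ∃ η, P.wVec v η ≠ 0
  · obtain ⟨η, hη⟩ := hw
    exact key v hv η hη
  push Not at hw
  refine ⟨fun a b => by rw [← dotProduct_bilVec, ← dotProduct_bilVec, hw, hw, dotProduct_zero,
    dotProduct_zero], fun p c ξ => ?_⟩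
  by_cases h : ∀ᶠ v' in 𝓝 v, ∀ η, P.wVec v' η = 0
  · have hw0 : ∀ v', (∀ η, P.wVec v' η = 0) → ∀ i j, P.w v' i j = 0 := fun v' h' i j => by
      simpa [bilVec_apply, Pi.single_apply] using congrFun (h' (Pi.single j 1)) i
    have hd : ∀ i k l, fieldDeriv l (fun v => P.w v i k) v = 0 := by
      intro i k l
      have : (fun v => P.w v i k) =ᶠ[𝓝 v] fun _ => 0 := by
        filter_upwards [h] with v' h' using hw0 v' h' i k
      rw [fieldDeriv, this.fderiv_eq]
      simp
    have hc : P.wCov v p = 0 := by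
      ext j
      simp [bilCovec_apply, hw0 v hw]
    simp [codazzi, hw, hc, triForm_apply (fun i k l => fieldDeriv l (fun v => P.w v i k) v), hd]
  · by_contra hne
    refine h ?_
    filter_upwards [(continuousAt_codazzi hU hP hv p c ξ).eventually_ne hne, hU.mem_nhds hv]
      with v' h1 h2 η
    by_contra hη
    exact h1 ((key v' h2 η hη).2 p c ξ)

end Necessity

/-! ### The formalism of differential operators -/

section Operators

/-- `P` is skew-adjoint exactly if `g` is symmetric and compatible with `Γ`: both sides are
determined by the values of the field, of its derivative and of the 1-jet of the covector at one
point, and these can be prescribed. -/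
theorem op_skew_iff (hU : IsOpen U) (hP : P.SmoothOn U) :
    (∀ u, IsSmoothField U u → ∀ ψ, IsTest ψ → ∀ x j, P.adjoint u ψ x j = -P.apply u ψ x j) ↔
      ∀ v ∈ U, P.SkewAt v := by
  constructor
  · intro h v hv
    have key : ∀ ξ q0 q1 c, P.gForm v c q1 - P.gForm v q1 c
        + (P.ΓForm v q0 c ξ + P.ΓForm v c q0 ξ - P.dgForm v q0 c ξ) = 0 := by
      intro ξ q0 q1 c
      obtain ⟨u, hu, rfl, rfl, -⟩ := exists_field hU hv ξ 0
      obtain ⟨q, hq, rfl, rfl, -⟩ := exists_test q0 q1 0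
      have e : P.adjoint u q 0 = -P.apply u q 0 := funext fun j => h u hu q hq 0 j
      have e2 := dotProduct_adjoint hU hP hu hq c 0
      rw [e, dotProduct_neg, dotProduct_apply] at e2
      linarith
    have h1 : ∀ a b, P.gForm v a b = P.gForm v b a := fun a b => by
      have := key 0 0 b a
      simp only [map_zero, LinearMap.zero_apply] at this
      linarith
    refine ⟨h1, fun a b φ => ?_⟩
    have := key φ a 0 b
    rw [h1] at this
    linarith
  · intro h u hu q hq x j
    have hx := h _ (hu.2 x)
    have : P.adjoint u q x = -P.apply u q x := by
      refine covector_ext fun c => ?_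
      rw [dotProduct_comm, dotProduct_comm (-P.apply u q x), dotProduct_neg,
        dotProduct_adjoint hU hP hu hq, dotProduct_apply, hx.compat, hx.symm]
      ring
    exact congrFun this j

/-- At a critical point of the field, for covectors that are critical there too, the Jacobi
expression gives the torsion, the Gauss and the Codazzi expressions. -/
theorem dotProduct_jacobiator_of_critical (hU : IsOpen U) (hP : P.SmoothOn U)
    (hu : IsSmoothField U u) (hS : ∀ v ∈ U, P.SkewAt v) (hq : IsTest q) (hr : IsTest r)
    (c : Fin n → ℝ) {x : ℝ} (hu1 : xDeriv u x = 0) (hq1 : xDeriv q x = 0)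
    (hr1 : xDeriv r x = 0) {v η q2 r2 q0 r0 : Fin n → ℝ} (hv : u x = v)
    (hη : xDeriv (xDeriv u) x = η) (hq2 : xDeriv (xDeriv q) x = q2)
    (hr2 : xDeriv (xDeriv r) x = r2) (hq0 : q x = q0) (hr0 : r x = r0) :
    c ⬝ᵥ P.jacobiator u q r x
      = P.ΓForm v c q0 (P.gVec v r2) - P.ΓForm v r2 q0 (P.gVec v c)
        - (P.ΓForm v c r0 (P.gVec v q2) - P.ΓForm v q2 r0 (P.gVec v c)) + P.gauss v c q0 r0 η
        + P.pot u q x * (P.wForm v c (P.gVec v r2) - P.wForm v r2 (P.gVec v c)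
          + P.codazzi v c r0 η)
        - P.pot u r x * (P.wForm v c (P.gVec v q2) - P.wForm v q2 (P.gVec v c)
          + P.codazzi v c q0 η) := by
  subst hv hη hq2 hr2 hq0 hr0
  have hx := hu.2 x
  have du : HasDerivAt u 0 x := hu1 ▸ hu.1.hasDerivAt_xDeriv x
  have dr : ∀ {r : ℝ → Fin n → ℝ}, IsTest r → xDeriv r x = 0 → HasDerivAt r 0 x :=
    fun hr hr1 => hr1 ▸ hr.1.hasDerivAt_xDeriv x
  have ddu := hu.1.xDeriv.hasDerivAt_xDeriv x
  have ddr : ∀ {r : ℝ → Fin n → ℝ}, IsTest r → HasDerivAt (xDeriv r) (xDeriv (xDeriv r) x) x :=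
    fun hr => hr.1.xDeriv.hasDerivAt_xDeriv x
  have dc : ∀ c : Fin n → ℝ, HasDerivAt (fun _ => c) 0 x := fun c => hasDerivAt_const x c
  have t1 : xDeriv (P.tail u) x = P.wVec (u x) (xDeriv (xDeriv u) x) := by
    refine xDeriv_eq_of_dotProduct fun c => ?_
    simp only [tail_eq, dotProduct_bilVec]
    refine (hasDerivAt_wForm hU hP hx du (dc c) ddu).congr_deriv ?_
    simp
  have l0 : ∀ {r : ℝ → Fin n → ℝ}, xDeriv r x = 0 → P.locF u r x = 0 := fun hr1 => by
    simp [locF, loc, hu1, hr1]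
  have l1 : ∀ {r : ℝ → Fin n → ℝ}, IsTest r → xDeriv r x = 0 → xDeriv (P.locF u r) x
      = P.gVec (u x) (xDeriv (xDeriv r) x) + P.ΓVec (u x) (r x) (xDeriv (xDeriv u) x) := by
    intro r hr hr1
    refine xDeriv_eq_of_dotProduct fun c => ?_
    simp only [locF, loc, dotProduct_add, dotProduct_bilVec, dotProduct_triVec]
    refine ((hasDerivAt_gForm hU hP hx du (dc c) (ddr hr)).fun_add
      (hasDerivAt_ΓForm hU hP hx du (dc c) (dr hr hr1) ddu)).congr_deriv ?_
    simp [hu1]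
  have a0 : ∀ {r : ℝ → Fin n → ℝ}, xDeriv r x = 0 → P.adjTailF u r x = 0 := by
    intro r hr1
    refine covector_ext fun c => ?_
    rw [adjTailF, adjTail_dotProduct]
    simp [hu1, hr1]
  have dw : ∀ i k l, HasDerivAt (fun y => fieldDeriv l (fun v => P.w v i k) (u y))
      (deriv (fun y => fieldDeriv l (fun v => P.w v i k) (u y)) x) x := fun i k l =>
    ((hu.comp ((hP.2.2 i k).fieldDeriv hU l)).differentiable (by simp) x).hasDerivAt
  have dΓ : ∀ i j k l, HasDerivAt (fun y => fieldDeriv l (fun v => P.Γ v i j k) (u y))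
      (deriv (fun y => fieldDeriv l (fun v => P.Γ v i j k) (u y)) x) x := fun i j k l =>
    ((hu.comp ((hP.2.1 i j k).fieldDeriv hU l)).differentiable (by simp) x).hasDerivAt
  have a1 : ∀ {r : ℝ → Fin n → ℝ}, IsTest r → xDeriv r x = 0 → xDeriv (P.adjTailF u r) x
      = covec (P.dwForm (u x) (r x) (xDeriv (xDeriv u) x)
        - (P.dwForm (u x) (r x)).flip (xDeriv (xDeriv u) x)
        - P.wForm (u x) (xDeriv (xDeriv r) x)) := by
    intro r hr hr1
    refine xDeriv_eq_of_dotProduct fun c => ?_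
    rw [dotProduct_comm c, covec_dotProduct]
    simp only [dotProduct_comm c, adjTailF, adjTail_dotProduct]
    refine (((HasDerivAt.triForm dw (dr hr hr1) ddu (dc c)).fun_sub
      (HasDerivAt.triForm dw (dr hr hr1) (dc c) ddu)).fun_sub
      (hasDerivAt_wForm hU hP hx du (ddr hr) (dc c))).congr_deriv ?_
    simp [hu1, hr1]
  have s0 : P.adjLocF u q r x = 0 := by
    refine covector_ext fun c => ?_
    rw [adjLocF, adjLoc_dotProduct]
    simp [hu1, hq1, hr1]
  have s1 : xDeriv (P.adjLocF u q r) x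
      = covec (P.ΓForm (u x) (xDeriv (xDeriv r) x) (q x)
        - P.ΓForm (u x) (xDeriv (xDeriv q) x) (r x)
        + P.dΓForm (u x) (q x) (r x) (xDeriv (xDeriv u) x)
        - (P.dΓForm (u x) (q x) (r x)).flip (xDeriv (xDeriv u) x)
        - P.wForm (u x) (r x) (xDeriv (xDeriv u) x) • P.wForm (u x) (q x)
        + P.wForm (u x) (q x) (xDeriv (xDeriv u) x) • P.wForm (u x) (r x)) := by
    refine xDeriv_eq_of_dotProduct fun c => ?_
    rw [dotProduct_comm c, covec_dotProduct]
    simp only [dotProduct_comm c, adjLocF, adjLoc_dotProduct]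
    have dq' := dr hq hq1
    have dr' := dr hr hr1
    refine ((((((hasDerivAt_ΓForm hU hP hx du (ddr hr) dq' (dc c)).fun_sub
      (hasDerivAt_ΓForm hU hP hx du (ddr hq) dr' (dc c))).fun_add
      (HasDerivAt.quadForm dΓ dq' dr' ddu (dc c))).fun_sub
      (HasDerivAt.quadForm dΓ dq' dr' (dc c) ddu)).fun_sub
      ((hasDerivAt_wForm hU hP hx du dr' ddu).fun_mul
        (hasDerivAt_wForm hU hP hx du dq' (dc c)))).fun_add
      ((hasDerivAt_wForm hU hP hx du dq' ddu).fun_mul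
        (hasDerivAt_wForm hU hP hx du dr' (dc c)))).congr_deriv ?_
    simp [hu1, hq1, hr1]
  have hx' := hS _ hx
  rw [dotProduct_jacobiator hU hP hu hS hq hr, locCoeffF, nonlocF, nonlocF, hu1, hq1, hr1, t1,
    l0 hq1, l0 hr1, l1 hq hq1, l1 hr hr1, a0 hq1, a0 hr1, s0,
    nonlocCoeff_of_vel_zero hx' c _ _ _ _ (a1 hq hq1), nonlocCoeff_of_vel_zero hx' c _ _ _ _ (a1 hr hr1),
    locCoeff_of_vel_zero hx' c _ _ _ _ _ _ s1]
  simp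

/-- A test covector that vanishes for `x ≤ 0` but has a non-zero nonlocal variable there. -/
theorem exists_test_pot_ne_zero (hU : IsOpen U) (hP : P.SmoothOn U) (hu : IsSmoothField U u)
    (hu1 : xDeriv u 0 = 0) (hw : P.wVec (u 0) (xDeriv (xDeriv u) 0) ≠ 0) :
    ∃ q, IsTest q ∧ q =ᶠ[𝓝 0] 0 ∧ P.pot u q 0 ≠ 0 := by
  have hT := contDiff_tail hP hu
  have dT : HasDerivAt (P.tail u) (P.wVec (u 0) (xDeriv (xDeriv u) 0)) 0 := by
    have h1 := hT.hasDerivAt_xDeriv 0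
    convert h1 using 1
    refine (xDeriv_eq_of_dotProduct fun c => ?_).symm
    simp only [tail_eq, dotProduct_bilVec]
    refine (hasDerivAt_wForm hU hP (hu.2 0) (hu.1.hasDerivAt_xDeriv 0) (hasDerivAt_const 0 c)
      (hu.1.xDeriv.hasDerivAt_xDeriv 0)).congr_deriv ?_
    simp [hu1]
  -- The tail vanishes at `0` but its derivative does not, so it is non-zero at some `x₁ > 0`.
  -- The covector is the tail itself, cut off near `x₁`: then `W·q` is non-negative, and not zero.
  obtain ⟨x₁, hx₁, hne⟩ : ∃ x₁ : ℝ, 0 < x₁ ∧ P.tail u x₁ ≠ 0 := by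
    have h1 : ∀ᶠ x in 𝓝[>] (0 : ℝ), P.tail u x ≠ 0 :=
      (dT.eventually_ne hw).filter_mono (nhdsWithin_mono _ fun x hx => ne_of_gt hx)
    obtain ⟨x, h, h'⟩ := (h1.and self_mem_nhdsWithin).exists
    exact ⟨x, h', h⟩
  let b : ContDiffBump x₁ := ⟨x₁ / 4, x₁ / 2, by positivity, by linarith⟩
  have hb : ∀ y ≤ x₁ / 2, b y = 0 := fun y hy => by
    refine b.zero_of_le_dist ?_
    rw [Real.dist_eq, abs_of_nonpos (by linarith)]
    change x₁ / 2 ≤ _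
    linarith
  have hq : IsTest fun y => b y • P.tail u y :=
    ⟨b.contDiff.smul hT, b.hasCompactSupport.smul_right⟩
  refine ⟨_, hq, ?_, ?_⟩
  · filter_upwards [eventually_le_nhds (show (0 : ℝ) < x₁ / 2 by positivity)] with y hy
    simp [hb y hy]
  · have e : ∀ y, P.tailDot u (fun y => b y • P.tail u y) y
        = b y * (P.tail u y ⬝ᵥ P.tail u y) := fun y => by
      rw [tailDot, map_smul, LinearMap.smul_apply, ← dotProduct_bilVec, ← tail_eq, smul_eq_mul]
    rw [pot, xInv_of_forall_le fun y hy => by rw [e, hb y (by linarith), zero_mul]]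
    have hpos : 0 < ∫ y, P.tailDot u (fun y => b y • P.tail u y) y := by
      refine Continuous.integral_pos_of_hasCompactSupport_nonneg_nonzero (x := x₁)
        (contDiff_tailDot hP hu hq.1).continuous (hasCompactSupport_tailDot hq) (fun y => ?_) ?_
      · rw [e]
        exact mul_nonneg b.nonneg (Finset.sum_nonneg fun i _ => mul_self_nonneg _)
      · rw [e, b.eventuallyEq_one.eq_of_nhds]
        simpa [dotProduct_self_eq_zero] using hne
    linarith [hpos.ne']

/-- If the Jacobi expression vanishes identically then the last four systems of conditions hold.
All evaluations take place at a critical point of the field and of the covectors. -/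
theorem jacobiAt_of_jacobiator (hU : IsOpen U) (hP : P.SmoothOn U) (hS : ∀ v ∈ U, P.SkewAt v)
    (h : ∀ u, IsSmoothField U u → ∀ q r, IsTest q → IsTest r → ∀ x, P.jacobiator u q r x = 0) :
    ∀ v ∈ U, P.JacobiAt v := by
  have hZ : ∀ v ∈ U, ∀ p r0 r2 η, P.wVec v η ≠ 0 →
      P.wForm v p (P.gVec v r2) - P.wForm v r2 (P.gVec v p) + P.codazzi v p r0 η = 0 := by
    intro v hv p r0 r2 η hη
    obtain ⟨u, hu, rfl, hu1, rfl⟩ := exists_field hU hv 0 η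
    obtain ⟨r, hr, rfl, hr1, rfl⟩ := exists_test r0 0 r2
    -- With `q` flat at `0`, only the term with the nonlocal variable of `q` survives there.
    obtain ⟨q, hq, hq0, hpot⟩ := exists_test_pot_ne_zero hU hP hu hu1 hη
    have hq1 : xDeriv q =ᶠ[𝓝 0] 0 := by
      filter_upwards [hq0.eventuallyEq_nhds] with y hy
      exact ((hasDerivAt_const y (0 : Fin n → ℝ)).congr_of_eventuallyEq hy).xDeriv_eq
    have hq2 : xDeriv (xDeriv q) 0 = 0 :=
      ((hasDerivAt_const 0 (0 : Fin n → ℝ)).congr_of_eventuallyEq hq1).xDeriv_eq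
    have e := dotProduct_jacobiator_of_critical hU hP hu hS hq hr p hu1 hq1.eq_of_nhds hr1 rfl rfl
      hq2 rfl hq0.eq_of_nhds rfl
    rw [h u hu q r hq hr] at e
    simp only [dotProduct_zero, codazzi, gauss, Pi.zero_apply, map_zero, LinearMap.zero_apply,
      sub_zero, add_zero, mul_zero, zero_mul, zero_add] at e
    rcases mul_eq_zero.1 e.symm with h0 | h0
    · exact absurd h0 hpot
    · exact h0
  have hZ' := wSymm_codazzi_of_nonloc hU hP hZ
  have hE : ∀ v ∈ U, ∀ c q0 q2 r0 r2 η, P.ΓForm v c q0 (P.gVec v r2)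
      - P.ΓForm v r2 q0 (P.gVec v c) - (P.ΓForm v c r0 (P.gVec v q2)
      - P.ΓForm v q2 r0 (P.gVec v c)) + P.gauss v c q0 r0 η = 0 := by
    intro v hv c q0 q2 r0 r2 η
    obtain ⟨hs, hc⟩ := hZ' v hv
    obtain ⟨u, hu, rfl, hu1, rfl⟩ := exists_field hU hv 0 η
    obtain ⟨r, hr, rfl, hr1, rfl⟩ := exists_test r0 0 r2
    obtain ⟨q, hq, rfl, hq1, rfl⟩ := exists_test q0 0 q2
    have e := dotProduct_jacobiator_of_critical hU hP hu hS hq hr c hu1 hq1 hr1 rfl rfl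
      rfl rfl rfl rfl
    -- Once the nonlocal coefficients are known to vanish, the local part has to vanish by itself.
    rw [h u hu q r hq hr, hc, hc, hs c, hs c, dotProduct_zero] at e
    linarith
  intro v hv
  have ht : ∀ a b c, P.ΓForm v b c (P.gVec v a) = P.ΓForm v a c (P.gVec v b) := fun a b c => by
    have := hE v hv a c 0 0 b 0
    simp only [gauss, map_zero, LinearMap.zero_apply] at this
    linarith
  refine ⟨ht, (hZ' v hv).1, (hZ' v hv).2, fun p b c ξ => ?_⟩
  have := hE v hv p b 0 c 0 ξ
  simp only [map_zero, LinearMap.zero_apply] at this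
  linarith

/-- The Hamiltonian property in the formalism of differential operators. -/
theorem isHamiltonianOp_iff (hU : IsOpen U) (hP : P.SmoothOn U) (hg : P.NondegenerateOn U) :
    P.IsHamiltonianOp U ↔ P.Conditions U := by
  rw [conditions_iff hU hP hg, ← op_skew_iff hU hP]
  constructor
  · intro h
    refine ⟨fun u hu => (h u hu).1, ?_⟩
    have hS := (op_skew_iff hU hP).1 fun u hu => (h u hu).1
    refine jacobiAt_of_jacobiator hU hP hS fun u hu q r hq hr => eq_zero_of_forall_test
      (contDiff_jacobiator hU hP hu hq hr).continuous fun p hp => ?_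
    have := schouten_eq hU hP hu hS hp hq hr
    rw [(h u hu).2 q r p hq hr hp] at this
    linarith
  · rintro ⟨h, hJ⟩ u hu
    have hS := (op_skew_iff hU hP).1 h
    refine ⟨h u hu, fun q r p hq hr hp => ?_⟩
    rw [schouten_eq hU hP hu hS hp hq hr]
    simp [jacobiator_eq_zero hU hP hg hu hS hJ hq hr]

end Operators

end HydroOp

/-! ### The algebra of differential functions -/

section DiffAlg

open TopologicalSpace (Opens)
open Filter Topology

variable {n : ℕ} {U : Opens (Fin n → ℝ)}

/-- Jets over `U`. -/
abbrev JetOver (U : Opens (Fin n → ℝ)) : Type := {J : Jet n // J 0 ∈ U}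

/-- The first `N + 1` entries of a jet. -/
def jetTrunc (N : ℕ) : Jet n →ₗ[ℝ] (Fin (N + 1) → Fin n → ℝ) :=
  LinearMap.funLeft ℝ (Fin n → ℝ) fun σ : Fin (N + 1) => (σ : ℕ)

@[simp] theorem jetTrunc_apply (N : ℕ) (J : Jet n) (σ : Fin (N + 1)) :
    jetTrunc N J σ = J σ := rfl

/-- `f` is the smooth function `F` of the first `N + 1` entries of a jet. -/
def IsRep (N : ℕ) (F : (Fin (N + 1) → Fin n → ℝ) → ℝ) (f : JetOver U → ℝ) : Prop :=
  ContDiffOn ℝ ∞ F {v | v 0 ∈ U} ∧ ∀ J, f J = F (jetTrunc N J.1)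

theorem IsRep.lift {N M : ℕ} (h : N ≤ M) {F : (Fin (N + 1) → Fin n → ℝ) → ℝ} {f : JetOver U → ℝ}
    (hF : IsRep N F f) :
    IsRep M (fun v => F fun σ => v (Fin.castLE (Nat.succ_le_succ h) σ)) f :=
  ⟨hF.1.comp (by fun_prop) fun v hv => hv, hF.2⟩

theorem IsRep.exists_pair {f g : JetOver U → ℝ} (hf : ∃ N F, IsRep N F f)
    (hg : ∃ N F, IsRep N F g) : ∃ N F G, IsRep N F f ∧ IsRep N G g := by
  obtain ⟨N, F, hF⟩ := hf
  obtain ⟨M, G, hG⟩ := hg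
  exact ⟨max N M, _, _, hF.lift (le_max_left _ _), hG.lift (le_max_right _ _)⟩

/-- The differential algebra over `U`, as an algebra of functions on jets over `U`. -/
def DiffAlg (U : Opens (Fin n → ℝ)) : Subalgebra ℝ (JetOver U → ℝ) where
  carrier := {f | ∃ N F, IsRep N F f}
  mul_mem' hf hg := by
    obtain ⟨N, F, G, hF, hG⟩ := IsRep.exists_pair hf hg
    exact ⟨N, fun v => F v * G v, hF.1.mul hG.1, fun J => by simp [hF.2, hG.2]⟩
  add_mem' hf hg := by
    obtain ⟨N, F, G, hF, hG⟩ := IsRep.exists_pair hf hg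
    exact ⟨N, fun v => F v + G v, hF.1.add hG.1, fun J => by simp [hF.2, hG.2]⟩
  algebraMap_mem' c := ⟨0, fun _ => c, contDiffOn_const, fun _ => rfl⟩

namespace DiffAlg

instance : CoeFun (DiffAlg U) fun _ => JetOver U → ℝ := ⟨fun a => a.1⟩

@[ext] theorem ext {a b : DiffAlg U} (h : ∀ J, a J = b J) : a = b := Subtype.ext (funext h)

@[simp] theorem add_apply (a b : DiffAlg U) (J : JetOver U) : (a + b) J = a J + b J := rfl
@[simp] theorem sub_apply (a b : DiffAlg U) (J : JetOver U) : (a - b) J = a J - b J := rfl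
@[simp] theorem mul_apply (a b : DiffAlg U) (J : JetOver U) : (a * b) J = a J * b J := rfl
@[simp] theorem neg_apply (a : DiffAlg U) (J : JetOver U) : (-a) J = -a J := rfl
@[simp] theorem zero_apply (J : JetOver U) : (0 : DiffAlg U) J = 0 := rfl
@[simp] theorem one_apply (J : JetOver U) : (1 : DiffAlg U) J = 1 := rfl
@[simp] theorem smul_apply (c : ℝ) (a : DiffAlg U) (J : JetOver U) : (c • a) J = c * a J := rfl

/-- Evaluation at a jet. -/
def eval (J : JetOver U) : DiffAlg U →ₐ[ℝ] ℝ := (Pi.evalAlgHom ℝ (fun _ => ℝ) J).comp (DiffAlg U).val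

@[simp] theorem eval_apply (J : JetOver U) (a : DiffAlg U) : eval J a = a J := rfl

@[simp] theorem sum_apply {ι : Type*} (s : Finset ι) (f : ι → DiffAlg U) (J : JetOver U) :
    (∑ i ∈ s, f i) J = ∑ i ∈ s, f i J := by
  simp only [← eval_apply, map_sum]

/-- Extension by zero to all jets. -/
def extend (a : DiffAlg U) (J : Jet n) : ℝ := by
  classical exact if h : J 0 ∈ U then a ⟨J, h⟩ else 0

theorem extend_of_mem (a : DiffAlg U) {J : Jet n} (h : J 0 ∈ U) : extend a J = a ⟨J, h⟩ := by
  simp [extend, h]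

@[simp] theorem extend_coe (a : DiffAlg U) (J : JetOver U) : extend a J.1 = a J := extend_of_mem a J.2

theorem eventually_mem (J : JetOver U) (V : Jet n) : ∀ᶠ s : ℝ in 𝓝 0, (J.1 + s • V) 0 ∈ U := by
  have hc : ContinuousAt (fun s : ℝ => (J.1 + s • V) 0) 0 := by
    simp only [Pi.add_apply, Pi.smul_apply]
    fun_prop
  refine hc.eventually_mem (U.isOpen.mem_nhds ?_)
  simpa using J.2

theorem isOpen_base (U : Opens (Fin n → ℝ)) (N : ℕ) :
    IsOpen {v : Fin (N + 1) → Fin n → ℝ | v 0 ∈ U} :=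
  U.isOpen.preimage (continuous_apply 0)

theorem hasDerivAt_of_isRep {N : ℕ} {F : (Fin (N + 1) → Fin n → ℝ) → ℝ} {a : DiffAlg U}
    (hF : IsRep N F a.1) (J : JetOver U) (V : Jet n) :
    HasDerivAt (fun s : ℝ => extend a (J.1 + s • V))
      (fderiv ℝ F (jetTrunc N J.1) (jetTrunc N V)) 0 := by
  have e : (fun s : ℝ => extend a (J.1 + s • V))
      =ᶠ[𝓝 0] fun s => F (jetTrunc N J.1 + s • jetTrunc N V) := by
    filter_upwards [eventually_mem J V] with s hs
    rw [extend_of_mem a hs, hF.2, map_add, map_smul]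
  have hd : DifferentiableAt ℝ F (jetTrunc N J.1) :=
    (hF.1.contDiffAt ((isOpen_base U N).mem_nhds J.2)).differentiableAt (by simp)
  have hl : HasDerivAt (fun s : ℝ => jetTrunc N J.1 + s • jetTrunc N V) (jetTrunc N V) 0 :=
    (((hasDerivAt_id (0 : ℝ)).smul_const (jetTrunc N V)).const_add _).congr_deriv (by simp)
  refine HasDerivAt.congr_of_eventuallyEq ?_ e
  exact HasFDerivAt.comp_hasDerivAt (x := (0 : ℝ))
    (f := fun s : ℝ => jetTrunc N J.1 + s • jetTrunc N V) (l := F)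
    (by simpa using hd.hasFDerivAt) hl

/-- The jet with a single entry. -/
abbrev jetSingle (σ : ℕ) (k : Fin n) : Jet n := Pi.single σ (Pi.single k 1)

theorem isRep_pd {N : ℕ} {F : (Fin (N + 1) → Fin n → ℝ) → ℝ} {a : DiffAlg U}
    (hF : IsRep N F a.1) (σ : ℕ) (k : Fin n) :
    IsRep N (fun v => fderiv ℝ F v (jetTrunc N (jetSingle σ k)))
      (fun J : JetOver U => deriv (fun s : ℝ => extend a (J.1 + s • jetSingle σ k)) 0) :=
  ⟨(hF.1.fderiv_of_isOpen (isOpen_base U N) (by simp)).clm_apply contDiffOn_const,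
    fun J => (hasDerivAt_of_isRep hF J _).deriv⟩

/-- `∂/∂u^k_σ` as a derivation. -/
def pd (σ : ℕ) (k : Fin n) : Derivation ℝ (DiffAlg U) (DiffAlg U) :=
  have hd : ∀ (a : DiffAlg U) (J : JetOver U), HasDerivAt
      (fun s : ℝ => extend a (J.1 + s • jetSingle σ k))
      (deriv (fun s : ℝ => extend a (J.1 + s • jetSingle σ k)) 0) 0 := fun a J => by
    obtain ⟨N, F, hF⟩ := a.2
    exact (hasDerivAt_of_isRep hF J _).differentiableAt.hasDerivAt
  Derivation.mk'
    { toFun := fun a => ⟨fun J => deriv (fun s : ℝ => extend a (J.1 + s • jetSingle σ k)) 0, by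
        obtain ⟨N, F, hF⟩ := a.2
        exact ⟨N, _, isRep_pd hF σ k⟩⟩
      map_add' := fun a b => by
        ext J
        refine (((hd a J).fun_add (hd b J)).congr_of_eventuallyEq ?_).deriv
        filter_upwards [eventually_mem J (jetSingle σ k)] with s hs
        simp [extend_of_mem _ hs]
      map_smul' := fun c a => by
        ext J
        refine (((hd a J).const_mul c).congr_of_eventuallyEq ?_).deriv
        filter_upwards [eventually_mem J (jetSingle σ k)] with s hs
        simp [extend_of_mem _ hs] }
    fun a b => by
      ext J
      refine ((((hd a J).fun_mul (hd b J)).congr_of_eventuallyEq ?_).deriv).trans ?_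
      · filter_upwards [eventually_mem J (jetSingle σ k)] with s hs
        simp [extend_of_mem _ hs]
      · simp
        ring

theorem pd_apply (σ : ℕ) (k : Fin n) (a : DiffAlg U) (J : JetOver U) :
    pd σ k a J = deriv (fun s : ℝ => extend a (J.1 + s • jetSingle σ k)) 0 := rfl

theorem pd_apply_of_isRep {N : ℕ} {F : (Fin (N + 1) → Fin n → ℝ) → ℝ} {a : DiffAlg U}
    (hF : IsRep N F a.1) (σ : ℕ) (k : Fin n) (J : JetOver U) :
    pd σ k a J = fderiv ℝ F (jetTrunc N J.1) (jetTrunc N (jetSingle σ k)) :=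
  (hasDerivAt_of_isRep hF J _).deriv

theorem pd_comm (σ τ : ℕ) (k l : Fin n) (a : DiffAlg U) :
    pd σ k (pd τ l a) = pd τ l (pd σ k a) := by
  obtain ⟨N, F, hF⟩ := a.2
  ext J
  have h2 : ∀ (σ τ : ℕ) (k l : Fin n), pd σ k (pd τ l a) J
      = fderiv ℝ (fderiv ℝ F) (jetTrunc N J.1) (jetTrunc N (jetSingle σ k))
        (jetTrunc N (jetSingle τ l)) := by
    intro σ τ k l
    rw [pd_apply_of_isRep (a := pd τ l a) (isRep_pd hF τ l)]
    have hd : DifferentiableAt ℝ (fderiv ℝ F) (jetTrunc N J.1) :=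
      ((hF.1.fderiv_of_isOpen (m := ∞) (isOpen_base U N) (by simp)).contDiffAt
        ((isOpen_base U N).mem_nhds J.2)).differentiableAt (by simp)
    rw [fderiv_clm_apply hd (differentiableAt_const _)]
    simp
  rw [h2, h2]
  have hm : {v : Fin (N + 1) → Fin n → ℝ | v 0 ∈ U} ∈ 𝓝 (jetTrunc N J.1) :=
    (isOpen_base U N).mem_nhds J.2
  have h2le : ((2 : ℕ∞) : WithTop ℕ∞) ≤ ∞ := WithTop.coe_le_coe.2 le_top
  exact (hF.1.contDiffAt hm).isSymmSndFDerivAt (by simpa using h2le) _ _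

theorem exists_order (a : DiffAlg U) : ∃ N, ∀ σ, N ≤ σ → ∀ k, pd σ k a = 0 := by
  obtain ⟨N, F, hF⟩ := a.2
  refine ⟨N + 1, fun σ hσ k => ?_⟩
  ext J
  have : jetTrunc N (jetSingle σ k) = 0 := by
    funext τ
    rw [jetTrunc_apply, jetSingle, Pi.single_eq_of_ne (by have := τ.2; omega)]
    rfl
  rw [pd_apply_of_isRep hF, this, map_zero]
  rfl

/-! ### Evolutionary derivations and the total derivative -/

theorem evol_finsum_eq (V : ℕ → Fin n → DiffAlg U) (a : DiffAlg U) {N : ℕ}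
    (hN : ∀ σ, N ≤ σ → ∀ k, pd σ k a = 0) :
    ∑ᶠ σ, ∑ k, V σ k * pd σ k a = ∑ σ ∈ Finset.range N, ∑ k, V σ k * pd σ k a := by
  refine finsum_eq_sum_of_support_subset _ fun σ hσ => ?_
  by_contra h
  refine hσ (Finset.sum_eq_zero fun k _ => ?_)
  rw [hN σ (by simpa using h), mul_zero]

theorem exists_order₂ (a b : DiffAlg U) :
    ∃ N, (∀ σ, N ≤ σ → ∀ k, pd σ k a = 0) ∧ ∀ σ, N ≤ σ → ∀ k, pd σ k b = 0 := by
  obtain ⟨N, hN⟩ := exists_order a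
  obtain ⟨M, hM⟩ := exists_order b
  exact ⟨max N M, fun σ h => hN σ ((le_max_left _ _).trans h),
    fun σ h => hM σ ((le_max_right _ _).trans h)⟩

/-- The derivation `∑ V^k_σ ∂/∂u^k_σ`. -/
def evol (V : ℕ → Fin n → DiffAlg U) : Derivation ℝ (DiffAlg U) (DiffAlg U) :=
  Derivation.mk'
    { toFun := fun a => ∑ᶠ σ, ∑ k, V σ k * pd σ k a
      map_add' := fun a b => by
        obtain ⟨N, ha, hb⟩ := exists_order₂ a b
        rw [evol_finsum_eq V a ha, evol_finsum_eq V b hb, evol_finsum_eq V (a + b) fun σ h k => by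
          rw [map_add, ha σ h, hb σ h, add_zero]]
        simp only [map_add, mul_add, Finset.sum_add_distrib]
      map_smul' := fun c a => by
        obtain ⟨N, ha⟩ := exists_order a
        rw [evol_finsum_eq V a ha, evol_finsum_eq V (c • a) fun σ h k => by
          rw [Derivation.map_smul, ha σ h, smul_zero]]
        simp only [Derivation.map_smul, mul_smul_comm, Finset.smul_sum, RingHom.id_apply] }
    fun a b => by
      obtain ⟨N, ha, hb⟩ := exists_order₂ a b
      change ∑ᶠ σ, ∑ k, V σ k * pd σ k (a * b) = a • (∑ᶠ σ, ∑ k, V σ k * pd σ k b)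
        + b • ∑ᶠ σ, ∑ k, V σ k * pd σ k a
      rw [evol_finsum_eq V a ha, evol_finsum_eq V b hb, evol_finsum_eq V (a * b) fun σ h k => by
        rw [Derivation.leibniz, ha σ h, hb σ h, smul_zero, smul_zero, add_zero]]
      simp only [Derivation.leibniz, smul_eq_mul, Finset.mul_sum, ← Finset.sum_add_distrib]
      refine Finset.sum_congr rfl fun σ _ => Finset.sum_congr rfl fun k _ => by ring

theorem evol_eq_finsum (V : ℕ → Fin n → DiffAlg U) (a : DiffAlg U) :
    evol V a = ∑ᶠ σ, ∑ k, V σ k * pd σ k a := rfl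

theorem evol_eq_sum (V : ℕ → Fin n → DiffAlg U) {a : DiffAlg U} {N : ℕ}
    (hN : ∀ σ, N ≤ σ → ∀ k, pd σ k a = 0) :
    evol V a = ∑ σ ∈ Finset.range N, ∑ k, V σ k * pd σ k a := evol_finsum_eq V a hN

/-- The coordinate `u^k_σ`. -/
def coord (σ : ℕ) (k : Fin n) : DiffAlg U :=
  ⟨fun J => J.1 σ k, σ, fun v => v (Fin.last σ) k, by fun_prop, fun J => rfl⟩

@[simp] theorem coord_apply (σ : ℕ) (k : Fin n) (J : JetOver U) :
    (coord σ k : DiffAlg U) J = J.1 σ k := rfl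

theorem pd_coord (σ τ : ℕ) (k l : Fin n) :
    pd τ l (coord σ k : DiffAlg U) = if τ = σ ∧ l = k then 1 else 0 := by
  ext J
  rw [pd_apply]
  have e : (fun s : ℝ => extend (coord σ k : DiffAlg U) (J.1 + s • jetSingle τ l))
      =ᶠ[𝓝 0] fun s => J.1 σ k + s * jetSingle τ l σ k := by
    filter_upwards [eventually_mem J (jetSingle τ l)] with s hs
    rw [extend_of_mem _ hs]
    simp
  rw [e.deriv_eq, deriv_const_add, deriv_mul_const_field]
  simp only [deriv_id'', one_mul]
  by_cases h1 : τ = σ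
  · subst h1
    by_cases h2 : l = k
    · subst h2
      simp
    · simp [h2]
  · simp [h1]

/-- The total derivative as a derivation. -/
def tot : Derivation ℝ (DiffAlg U) (DiffAlg U) := evol fun σ k => coord (σ + 1) k

/-- Total and partial derivatives commute up to a shift. -/
theorem pd_tot (τ : ℕ) (l : Fin n) (a : DiffAlg U) :
    pd τ l (tot a) = tot (pd τ l a) + if τ = 0 then 0 else pd (τ - 1) l a := by
  obtain ⟨N, h1, h2⟩ := exists_order₂ a (pd τ l a)
  have h1' : ∀ σ, max N τ ≤ σ → ∀ k, pd σ k a = 0 := fun σ h => h1 σ ((le_max_left _ _).trans h)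
  rw [tot, evol_eq_sum _ h1', evol_eq_sum (a := pd τ l a) (N := max N τ) _ fun σ h =>
    h2 σ ((le_max_left _ _).trans h), map_sum]
  simp only [map_sum, Derivation.leibniz, smul_eq_mul, pd_comm τ _ l, Finset.sum_add_distrib]
  congr 1
  simp only [pd_coord, mul_ite, mul_one, mul_zero]
  rcases Nat.eq_zero_or_pos τ with h | h
  · subst h
    simp
  · rw [Finset.sum_eq_single (τ - 1)]
    · rw [Finset.sum_eq_single l]
      · have : τ = τ - 1 + 1 := by omega
        simp [← this, h.ne']
      · intro k _ hk
        simp [hk.symm]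
      · simp
    · intro σ _ hσ
      refine Finset.sum_eq_zero fun k _ => ?_
      rw [if_neg]
      omega
    · intro hτ
      exact absurd (Finset.mem_range.2 (lt_max_of_lt_right (Nat.sub_one_lt h.ne'))) hτ

theorem evol_tot (V : ℕ → Fin n → DiffAlg U) (a : DiffAlg U) :
    evol V (tot a) = tot (evol V a) + evol (fun σ k => V (σ + 1) k - tot (V σ k)) a := by
  obtain ⟨N, h1, h2⟩ := exists_order₂ a (tot a)
  have h2' : ∀ σ, N + 1 ≤ σ → ∀ k, pd σ k (tot a) = 0 := fun σ h => h2 σ (by omega)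
  rw [evol_eq_sum _ h1, evol_eq_sum _ h1, evol_eq_sum _ h2']
  simp only [map_sum, Derivation.leibniz, smul_eq_mul, pd_tot, mul_add, Finset.sum_add_distrib]
  have e1 : ∑ σ ∈ Finset.range (N + 1), ∑ k, V σ k * tot (pd σ k a)
      = ∑ σ ∈ Finset.range N, ∑ k, V σ k * tot (pd σ k a) := by
    rw [Finset.sum_range_succ]
    simp [h1 N le_rfl]
  have e2 : ∑ σ ∈ Finset.range (N + 1), ∑ k, V σ k * (if σ = 0 then 0 else pd (σ - 1) k a)
      = ∑ σ ∈ Finset.range N, ∑ k, V (σ + 1) k * pd σ k a := by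
    rw [Finset.sum_range_succ']
    simp
  rw [e1, e2]
  simp only [sub_mul, Finset.sum_sub_distrib, mul_comm (pd _ _ _)]
  abel

/-- A smooth function of `u`, as a differential function. -/
def ofField (f : (Fin n → ℝ) → ℝ) (hf : ContDiffOn ℝ ∞ f U) : DiffAlg U :=
  ⟨fun J => f (J.1 0), 0, fun v => f (v 0), hf.comp (by fun_prop) fun _ h => h, fun _ => rfl⟩

@[simp] theorem ofField_apply (f : (Fin n → ℝ) → ℝ) (hf : ContDiffOn ℝ ∞ f U) (J : JetOver U) :
    ofField f hf J = f (J.1 0) := rfl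

theorem pd_ofField (f : (Fin n → ℝ) → ℝ) (hf : ContDiffOn ℝ ∞ f U) (σ : ℕ) (k : Fin n) :
    pd σ k (ofField f hf) = if σ = 0 then ofField (fieldDeriv k f) (hf.fieldDeriv U.isOpen k)
      else 0 := by
  ext J
  rw [pd_apply]
  have e : (fun s : ℝ => extend (ofField f hf : DiffAlg U) (J.1 + s • jetSingle σ k))
      =ᶠ[𝓝 0] fun s => f (J.1 0 + s • jetSingle σ k 0) := by
    filter_upwards [eventually_mem J (jetSingle σ k)] with s hs
    rw [extend_of_mem _ hs]
    simp
  have hd : HasDerivAt (fun s : ℝ => J.1 0 + s • jetSingle σ k 0) (jetSingle σ k 0) 0 :=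
    (((hasDerivAt_id (0 : ℝ)).smul_const (jetSingle σ k 0)).const_add _).congr_deriv (by simp)
  have hf' : HasFDerivAt f (fderiv ℝ f (J.1 0)) (J.1 0 + (0 : ℝ) • jetSingle σ k 0) := by
    simpa using (hf.differentiableAt_of_isOpen U.isOpen J.2).hasFDerivAt
  rw [e.deriv_eq, ← Function.comp_def f, (hf'.comp_hasDerivAt (0 : ℝ) hd).deriv]
  split_ifs with h
  · subst h
    simp [fieldDeriv]
  · simp [Pi.single_eq_of_ne (Ne.symm h)]

theorem evol_ofField (V : ℕ → Fin n → DiffAlg U) (f : (Fin n → ℝ) → ℝ) (hf : ContDiffOn ℝ ∞ f U) :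
    evol V (ofField f hf) = ∑ k, V 0 k * ofField (fieldDeriv k f) (hf.fieldDeriv U.isOpen k) := by
  rw [evol_eq_sum (N := 1) _ fun σ h k => by rw [pd_ofField, if_neg (by omega)]]
  simp [pd_ofField]

theorem evol_coord (V : ℕ → Fin n → DiffAlg U) (σ : ℕ) (k : Fin n) :
    evol V (coord σ k) = V σ k := by
  rw [evol_eq_sum (N := σ + 1) _ fun τ h l => by rw [pd_coord, if_neg (by omega)]]
  simp only [pd_coord, mul_ite, mul_one, mul_zero]
  rw [Finset.sum_eq_single σ (fun τ _ h => by simp [h]) (by simp),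
    Finset.sum_eq_single k (fun l _ h => by simp [h]) (by simp)]
  simp

end DiffAlg

end DiffAlg

/-! ### Formal series and arrays over a differential algebra -/

section Series

variable {A : Type*} [CommRing A] {F G : ℤ → A}

/-- A series whose exponents are bounded above. -/
def BddSer (F : ℤ → A) : Prop := ∃ M, ∀ a, M < a → F a = 0

theorem BddSer.add (hF : BddSer F) (hG : BddSer G) : BddSer (F + G) := by
  obtain ⟨M, hM⟩ := hF
  obtain ⟨N, hN⟩ := hG
  refine ⟨max M N, fun a h => ?_⟩
  rw [Pi.add_apply, hM a (lt_of_le_of_lt (le_max_left _ _) h),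
    hN a (lt_of_le_of_lt (le_max_right _ _) h), add_zero]

theorem BddSer.zero : BddSer (0 : ℤ → A) := ⟨0, fun _ _ => rfl⟩

theorem BddSer.sum {ι : Type*} {s : Finset ι} {F : ι → ℤ → A} (h : ∀ i ∈ s, BddSer (F i)) :
    BddSer (∑ i ∈ s, F i) :=
  Finset.sum_induction _ BddSer (fun _ _ => BddSer.add) BddSer.zero h

theorem BddSer.mul_left (b : A) (hF : BddSer F) : BddSer fun a => b * F a := by
  obtain ⟨M, hM⟩ := hF
  exact ⟨M, fun a h => by simp [hM a h]⟩

theorem BddSer.mul_right (b : A) (hF : BddSer F) : BddSer fun a => F a * b := by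
  obtain ⟨M, hM⟩ := hF
  exact ⟨M, fun a h => by simp [hM a h]⟩

/-- The constant series. -/
def serC (b : A) : ℤ → A := fun a => if a = 0 then b else 0

theorem bddSer_serC (b : A) : BddSer (serC b) := ⟨0, fun a h => if_neg (by omega)⟩

/-- An array with both exponents bounded above. -/
def BddArr (a : ℤ → ℤ → A) : Prop := ∃ M, ∀ m l, M < m ∨ M < l → a m l = 0

variable {a b : ℤ → ℤ → A}

theorem BddArr.add (ha : BddArr a) (hb : BddArr b) : BddArr (a + b) := by
  obtain ⟨M, hM⟩ := ha
  obtain ⟨N, hN⟩ := hb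
  refine ⟨max M N, fun m l h => ?_⟩
  rw [Pi.add_apply, Pi.add_apply, hM m l (by omega), hN m l (by omega), add_zero]

theorem BddArr.sub (ha : BddArr a) (hb : BddArr b) : BddArr (a - b) := by
  obtain ⟨M, hM⟩ := ha
  obtain ⟨N, hN⟩ := hb
  refine ⟨max M N, fun m l h => ?_⟩
  rw [Pi.sub_apply, Pi.sub_apply, hM m l (by omega), hN m l (by omega), sub_zero]

theorem BddArr.mul_right (ha : BddArr a) (x : A) : BddArr fun m l => a m l * x := by
  obtain ⟨M, hM⟩ := ha
  exact ⟨M, fun m l h => by simp [hM m l h]⟩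

/-- The series `α(λ)` as an array. -/
def arrLam (α : ℤ → A) : ℤ → ℤ → A := fun m l => if l = 0 then α m else 0

/-- The series `α(μ)` as an array. -/
def arrMu (α : ℤ → A) : ℤ → ℤ → A := fun m l => if m = 0 then α l else 0

theorem bddArr_arrLam {α : ℤ → A} (h : BddSer α) : BddArr (arrLam α) := by
  obtain ⟨M, hM⟩ := h
  refine ⟨max M 0, fun m l h => ?_⟩
  rw [arrLam]
  split_ifs
  · exact hM _ (by omega)
  · rfl

theorem bddArr_arrMu {α : ℤ → A} (h : BddSer α) : BddArr (arrMu α) := by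
  obtain ⟨M, hM⟩ := h
  refine ⟨max M 0, fun m l h => ?_⟩
  rw [arrMu]
  split_ifs
  · exact hM _ (by omega)
  · rfl

variable [Algebra ℝ A] (d : Derivation ℝ A A)

/-- The operator `λ + ∂`. -/
def serD : (ℤ → A) →ₗ[ℝ] (ℤ → A) where
  toFun F a := F (a - 1) + d (F a)
  map_add' F G := by ext a; simp; abel
  map_smul' c F := by ext a; simp

theorem serD_apply (F : ℤ → A) (a : ℤ) : serD d F a = F (a - 1) + d (F a) := rfl

/-- The operator `(λ + ∂)^k` for an integer `k`. -/
def serPow (k : ℤ) (F : ℤ → A) : ℤ → A := fun a =>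
  ∑ᶠ t : ℕ, ((Ring.choose k t : ℤ) : ℝ) • (d^[t] (F (a - k + t)))

/-- The series `(λ + ∂)⁻¹ b`. -/
def tailSer (b : A) : ℤ → A := fun a =>
  if a < 0 then (-1 : ℝ) ^ (-1 - a).toNat • d^[(-1 - a).toNat] b else 0

variable {d}

theorem iterate_map_sum {ι : Type*} (s : Finset ι) (f : ι → A) (t : ℕ) :
    d^[t] (∑ i ∈ s, f i) = ∑ i ∈ s, d^[t] (f i) := by
  induction t with
  | zero => rfl
  | succ t ih => simp only [Function.iterate_succ_apply', ih, map_sum]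

theorem iterate_map_smul (t : ℕ) (c : ℝ) (a : A) : d^[t] (c • a) = c • d^[t] a := by
  induction t with
  | zero => rfl
  | succ t ih => simp only [Function.iterate_succ_apply', ih, Derivation.map_smul]

theorem BddSer.smul (c : ℝ) (hF : BddSer F) : BddSer (c • F) := by
  obtain ⟨M, hM⟩ := hF
  exact ⟨M, fun a h => by rw [Pi.smul_apply, hM a h, smul_zero]⟩

theorem BddSer.serD (hF : BddSer F) : BddSer (serD d F) := by
  obtain ⟨M, hM⟩ := hF
  exact ⟨M + 1, fun a h => by rw [serD_apply, hM _ (by omega), hM _ (by omega)]; simp⟩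

theorem BddSer.serD_pow (hF : BddSer F) (t : ℕ) : BddSer ((_root_.serD d ^ t) F) := by
  induction t with
  | zero => simpa using hF
  | succ t ih => rw [pow_succ']; exact ih.serD

theorem bddSer_tailSer (b : A) : BddSer (tailSer d b) := ⟨0, fun a h => if_neg (by omega)⟩

theorem serPow_support_finite (k : ℤ) (hF : BddSer F) (a : ℤ) : (Function.support fun t : ℕ =>
    ((Ring.choose k t : ℤ) : ℝ) • (d^[t] (F (a - k + t)))).Finite := by
  obtain ⟨M, hM⟩ := hF
  refine (Set.finite_Iic (M - a + k).toNat).subset fun t ht => ?_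
  by_contra h
  refine ht ?_
  simp only [Set.mem_Iic, not_le] at h
  simp only
  rw [hM _ (by omega), iterate_map_zero, smul_zero]

theorem BddSer.serPow (k : ℤ) (hF : BddSer F) : BddSer (serPow d k F) := by
  obtain ⟨M, hM⟩ := hF
  refine ⟨M + k, fun a h => finsum_eq_zero_of_forall_eq_zero fun t => ?_⟩
  rw [hM _ (by omega), iterate_map_zero, smul_zero]

theorem serPow_zero (F : ℤ → A) : serPow d 0 F = F := by
  ext a
  rw [serPow, finsum_eq_single _ 0 fun t ht => by
    rw [Ring.choose_zero_pos ℤ (Nat.pos_of_ne_zero ht)]; simp]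
  simp

theorem serPow_add (k : ℤ) (hF : BddSer F) (hG : BddSer G) :
    serPow d k (F + G) = serPow d k F + serPow d k G := by
  ext a
  rw [Pi.add_apply, serPow, serPow, serPow, ← finsum_add_distrib (serPow_support_finite k hF a)
    (serPow_support_finite k hG a)]
  refine finsum_congr fun t => ?_
  rw [Pi.add_apply, iterate_map_add, smul_add]

theorem serPow_zero_right (k : ℤ) : serPow d k (0 : ℤ → A) = 0 := by
  ext a
  refine finsum_eq_zero_of_forall_eq_zero fun t => ?_
  rw [Pi.zero_apply, iterate_map_zero, smul_zero]

theorem serPow_smul (k : ℤ) (c : ℝ) : serPow d k (c • F) = c • serPow d k F := by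
  ext a
  rw [Pi.smul_apply, serPow, serPow, smul_finsum]
  refine finsum_congr fun t => ?_
  rw [Pi.smul_apply, iterate_map_smul, smul_comm]

theorem serPow_sum {ι : Type*} (k : ℤ) (s : Finset ι) {F : ι → ℤ → A}
    (h : ∀ i ∈ s, BddSer (F i)) : serPow d k (∑ i ∈ s, F i) = ∑ i ∈ s, serPow d k (F i) := by
  classical
  induction s using Finset.induction_on with
  | empty => simp [serPow_zero_right]
  | insert i s hi ih =>
    rw [Finset.sum_insert hi, Finset.sum_insert hi, serPow_add k (h i (by simp))
      (BddSer.sum fun j hj => h j (by simp [hj])), ih fun j hj => h j (by simp [hj])]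

theorem finsum_shift {M : Type*} [AddCommMonoid M] (f : ℕ → M) :
    ∑ᶠ t, f t = ∑ᶠ t, if t = 0 then 0 else f (t - 1) := by
  classical
  have h := finsum_mem_range (f := fun t => if t = 0 then 0 else f (t - 1)) Nat.succ_injective
  simp only [Nat.succ_eq_add_one, Nat.add_eq_zero_iff, one_ne_zero, and_false, if_false,
    Nat.add_sub_cancel] at h
  rw [← h]
  refine finsum_congr fun t => ?_
  rcases t with _ | t
  · simp
  · rw [finsum_eq_if, if_pos ⟨t, rfl⟩]

/-- Pascal's rule. -/
theorem serPow_add_one (k : ℤ) (hF : BddSer F) : serPow d (k + 1) F = serD d (serPow d k F) := by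
  ext a
  have hs := serPow_support_finite (d := d) k hF
  have h1 := hs (a - 1)
  have h2 : (Function.support fun t : ℕ =>
      ((Ring.choose k t : ℤ) : ℝ) • d (d^[t] (F (a - k + t)))).Finite := by
    refine (hs a).subset fun t ht ht' => ht ?_
    have ht'' : ((Ring.choose k t : ℤ) : ℝ) • (d^[t] (F (a - k + t))) = 0 := ht'
    simp only
    rw [← Derivation.map_smul, ht'', map_zero]
  have h3 : (Function.support fun t : ℕ => if t = 0 then (0 : A) else
      ((Ring.choose k (t - 1) : ℤ) : ℝ) • d (d^[t - 1] (F (a - k + (t - 1 : ℕ))))).Finite := by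
    refine ((h2.image (· + 1)).union (Set.finite_singleton 0)).subset fun t ht => ?_
    rcases Nat.eq_zero_or_pos t with h0 | h0
    · right; exact h0
    · left
      refine ⟨t - 1, fun h => ht ?_, by simp; omega⟩
      simp only [h0.ne', if_false]
      exact h
  rw [serD_apply, serPow, serPow, serPow]
  have e : d (∑ᶠ t : ℕ, ((Ring.choose k t : ℤ) : ℝ) • (d^[t] (F (a - k + t))))
      = ∑ᶠ t : ℕ, ((Ring.choose k t : ℤ) : ℝ) • d (d^[t] (F (a - k + t))) := by
    refine (AddMonoidHom.map_finsum (d : A →ₗ[ℝ] A).toAddMonoidHom (hs a)).trans ?_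
    exact finsum_congr fun t => Derivation.map_smul _ _ _
  have e2 : ∑ᶠ t : ℕ, ((Ring.choose k t : ℤ) : ℝ) • d (d^[t] (F (a - k + t)))
      = ∑ᶠ t : ℕ, if t = 0 then (0 : A) else
        ((Ring.choose k (t - 1) : ℤ) : ℝ) • d (d^[t - 1] (F (a - k + (t - 1 : ℕ)))) :=
    finsum_shift fun t => ((Ring.choose k t : ℤ) : ℝ) • d (d^[t] (F (a - k + t)))
  rw [e, e2, ← finsum_add_distrib h1 h3]
  refine finsum_congr fun t => ?_
  rcases t with _ | t
  · simp [show a - (k + 1) = a - 1 - k by ring]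
  · rw [Ring.choose_succ_succ, if_neg (by omega), ← Function.iterate_succ_apply' d]
    have e3 : a - 1 - k + ((t + 1 : ℕ) : ℤ) = a - k + t := by push_cast; ring
    have e4 : a - (k + 1) + ((t + 1 : ℕ) : ℤ) = a - k + t := by push_cast; ring
    rw [e3, e4, Nat.add_sub_cancel]
    push_cast
    rw [add_smul, add_comm]


theorem serPow_natCast (t : ℕ) (hF : BddSer F) : serPow d t F = (serD d ^ t) F := by
  induction t with
  | zero => simp [serPow_zero]
  | succ t ih => rw [Nat.cast_succ, serPow_add_one _ hF, ih, pow_succ', Module.End.mul_apply]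

theorem serD_pow_apply (t : ℕ) (hF : BddSer F) (a : ℤ) :
    (serD d ^ t) F a = ∑ s ∈ Finset.range (t + 1), (t.choose s : ℝ) • d^[s] (F (a - t + s)) := by
  rw [← serPow_natCast t hF, serPow, finsum_eq_sum_of_support_subset (s := Finset.range (t + 1))]
  · refine Finset.sum_congr rfl fun s _ => ?_
    rw [Ring.choose_natCast]
    simp
  · intro s hs
    by_contra h
    refine hs ?_
    simp only [Finset.coe_range, Set.mem_Iio, not_lt] at h
    simp only
    rw [Ring.choose_natCast, Nat.choose_eq_zero_of_lt (by omega)]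
    simp

theorem serPow_serD (k : ℤ) (hF : BddSer F) : serPow d k (serD d F) = serD d (serPow d k F) := by
  have e : serPow d k (serD d F) = serPow d (k + 1) F := by
    ext a
    have h1 : (Function.support fun t : ℕ =>
        ((Ring.choose k t : ℤ) : ℝ) • d^[t] (F (a - 1 - k + t))).Finite :=
      serPow_support_finite k hF (a - 1)
    have h2 : (Function.support fun t : ℕ =>
        ((Ring.choose k t : ℤ) : ℝ) • d^[t + 1] (F (a - k + t))).Finite := by
      obtain ⟨M, hM⟩ := hF
      refine (Set.finite_Iic (M - a + k).toNat).subset fun t ht => ?_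
      by_contra h
      refine ht ?_
      simp only [Set.mem_Iic, not_le] at h
      simp only
      rw [hM _ (by omega), iterate_map_zero, smul_zero]
    have h3 : (Function.support fun t : ℕ => if t = 0 then (0 : A) else
        ((Ring.choose k (t - 1) : ℤ) : ℝ) • d^[t - 1 + 1] (F (a - k + (t - 1 : ℕ)))).Finite := by
      refine ((h2.image (· + 1)).union (Set.finite_singleton 0)).subset fun t ht => ?_
      rcases Nat.eq_zero_or_pos t with h0 | h0
      · right; exact h0
      · left
        refine ⟨t - 1, fun h => ht ?_, by simp; omega⟩
        simp only [h0.ne', if_false]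
        exact h
    have e0 : serPow d k (serD d F) a
        = (∑ᶠ t : ℕ, ((Ring.choose k t : ℤ) : ℝ) • d^[t] (F (a - 1 - k + t)))
          + ∑ᶠ t : ℕ, ((Ring.choose k t : ℤ) : ℝ) • d^[t + 1] (F (a - k + t)) := by
      rw [serPow, ← finsum_add_distrib h1 h2]
      refine finsum_congr fun t => ?_
      rw [serD_apply, iterate_map_add, smul_add, Function.iterate_succ_apply,
        show a - 1 - k + t = a - k + t - 1 by ring]
    rw [e0, finsum_shift fun t : ℕ => ((Ring.choose k t : ℤ) : ℝ) • d^[t + 1] (F (a - k + t)),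
      ← finsum_add_distrib h1 h3, serPow]
    refine finsum_congr fun t => ?_
    rcases t with _ | t
    · simp [show a - (k + 1) = a - 1 - k by ring]
    · rw [Ring.choose_succ_succ, if_neg (by omega), Nat.add_sub_cancel]
      have e3 : a - 1 - k + ((t + 1 : ℕ) : ℤ) = a - k + t := by push_cast; ring
      have e4 : a - (k + 1) + ((t + 1 : ℕ) : ℤ) = a - k + t := by push_cast; ring
      rw [e3, e4]
      push_cast
      rw [add_smul, add_comm]
  rw [e, serPow_add_one k hF]

theorem serD_serPow_neg_one (hF : BddSer F) : serD d (serPow d (-1) F) = F := by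
  rw [← serPow_add_one _ hF, neg_add_cancel, serPow_zero]

theorem serPow_neg_one_serD (hF : BddSer F) : serPow d (-1) (serD d F) = F := by
  rw [serPow_serD _ hF, serD_serPow_neg_one hF]

theorem choose_neg_one (t : ℕ) : ((Ring.choose (-1 : ℤ) t : ℤ) : ℝ) = (-1) ^ t := by
  rw [Ring.choose_neg, show (1 : ℤ) + t - 1 = t by ring, Ring.choose_natCast]
  simp [Units.smul_def]

theorem serPow_neg_one_apply (F : ℤ → A) (a : ℤ) :
    serPow d (-1) F a = ∑ᶠ t : ℕ, (-1 : ℝ) ^ t • d^[t] (F (a + 1 + t)) := by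
  rw [serPow]
  refine finsum_congr fun t => ?_
  rw [choose_neg_one, sub_neg_eq_add]

theorem serPow_neg_one_serC (b : A) : serPow d (-1) (serC b) = tailSer d b := by
  ext a
  rw [serPow_neg_one_apply, tailSer]
  split_ifs with h
  · rw [finsum_eq_single _ (-1 - a).toNat fun t ht => by
      rw [serC, if_neg (by omega), iterate_map_zero, smul_zero]]
    rw [serC, if_pos (by omega)]
  · refine finsum_eq_zero_of_forall_eq_zero fun t => ?_
    rw [serC, if_neg (by omega), iterate_map_zero, smul_zero]

theorem serD_tailSer (b : A) : serD d (tailSer d b) = serC b := by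
  rw [← serPow_neg_one_serC, serD_serPow_neg_one (bddSer_serC b)]

theorem serD_mul (F : ℤ → A) (b : A) (a : ℤ) :
    serD d (fun a => F a * b) a = serD d F a * b + F a * d b := by
  simp only [serD_apply, Derivation.leibniz, smul_eq_mul]
  ring

/-! ### Arrays and their re-expansion -/

variable (d) in
/-- The operator `λ + μ + ∂` on arrays. -/
def arrD (a : ℤ → ℤ → A) : ℤ → ℤ → A := fun m l => a (m - 1) l + a m (l - 1) + d (a m l)

/-- The coefficients, at `λ^B`, of the expansion of `∑ a_{ml} λ^m μ^l` in powers of `λ` and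
`λ' = λ + μ`, as a series in `λ'`. -/
def reexp (a : ℤ → ℤ → A) (B : ℤ) : ℤ → A := fun C =>
  if 0 ≤ C then
    ∑ᶠ m : ℤ, ((-1 : ℝ) ^ (m - C) * ((Ring.choose m C.toNat : ℤ) : ℝ)) • a (B + C - m) m
  else 0

theorem BddArr.arrD (ha : BddArr a) : BddArr (arrD d a) := by
  obtain ⟨M, hM⟩ := ha
  exact ⟨M + 1, fun m l h => by
    rw [_root_.arrD, hM _ _ (by omega), hM _ _ (by omega), hM _ _ (by omega)]; simp⟩

theorem reexp_support_finite (ha : BddArr a) (c : ℤ → ℝ) (B C : ℤ) :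
    (Function.support fun m : ℤ => c m • a (B + C - m) m).Finite := by
  obtain ⟨M, hM⟩ := ha
  refine (Set.finite_Icc (B + C - M) M).subset fun m hm => ?_
  by_contra h
  refine hm ?_
  simp only
  rw [hM _ _ (by rw [Set.mem_Icc] at h; omega), smul_zero]

theorem BddArr.bddSer_reexp (ha : BddArr a) (B : ℤ) : BddSer (reexp a B) := by
  obtain ⟨M, hM⟩ := ha
  refine ⟨2 * M - B, fun C hC => ?_⟩
  rw [reexp]
  split_ifs
  · refine finsum_eq_zero_of_forall_eq_zero fun m => ?_
    rw [hM _ _ (by omega), smul_zero]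
  · rfl

theorem reexp_add (ha : BddArr a) (hb : BddArr b) (B : ℤ) :
    reexp (a + b) B = reexp a B + reexp b B := by
  ext C
  simp only [reexp, Pi.add_apply]
  split_ifs
  · rw [← finsum_add_distrib (reexp_support_finite ha _ B C) (reexp_support_finite hb _ B C)]
    exact finsum_congr fun m => smul_add _ _ _
  · simp

theorem reexp_sub (ha : BddArr a) (hb : BddArr b) (B : ℤ) :
    reexp (a - b) B = reexp a B - reexp b B := by
  rw [eq_sub_iff_add_eq, ← reexp_add (ha.sub hb) hb, sub_add_cancel]

theorem reexp_mul (ha : BddArr a) (x : A) (B : ℤ) :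
    reexp (fun m l => a m l * x) B = fun C => reexp a B C * x := by
  ext C
  simp only [reexp]
  split_ifs
  · rw [finsum_mul' _ _ (reexp_support_finite ha _ B C)]
    exact finsum_congr fun m => (smul_mul_assoc _ _ _).symm
  · simp

/-- Re-expansion intertwines `λ + μ + ∂` with `λ' + ∂`. -/
theorem reexp_arrD (ha : BddArr a) (B : ℤ) : reexp (arrD d a) B = serD d (reexp a B) := by
  ext C
  rw [serD_apply]
  rcases lt_trichotomy C (-1) with h | h | h
  · simp [reexp, show ¬(0 ≤ C) by omega, show ¬(1 ≤ C) by omega]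
  · subst h
    simp [reexp]
  obtain ⟨N, rfl⟩ : ∃ N : ℕ, C = N := ⟨C.toNat, by omega⟩
  have f0 := fun c => reexp_support_finite (c := c) ha (B - 1) N
  have f1 := fun c => reexp_support_finite (c := c) ha B N
  have hd : d (reexp a B N)
      = ∑ᶠ m : ℤ, ((-1 : ℝ) ^ (m - N) * ((Ring.choose m N : ℤ) : ℝ)) • d (a (B + N - m) m) := by
    rw [reexp, if_pos (by omega), Int.toNat_natCast]
    refine (AddMonoidHom.map_finsum (d : A →ₗ[ℝ] A).toAddMonoidHom (f1 _)).trans ?_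
    exact finsum_congr fun t => Derivation.map_smul _ _ _
  have f1' : ∀ c : ℤ → ℝ, (Function.support fun m : ℤ => c m • d (a (B + N - m) m)).Finite := by
    intro c
    refine (f1 c).subset fun m hm hm' => hm ?_
    have hm'' : c m • a (B + N - m) m = 0 := hm'
    simp only
    rw [← Derivation.map_smul, hm'', map_zero]
  have e1 : reexp (arrD d a) B N
      = ((∑ᶠ m : ℤ, ((-1 : ℝ) ^ (m - N) * ((Ring.choose m N : ℤ) : ℝ)) • a (B - 1 + N - m) m)
        + ∑ᶠ m : ℤ, ((-1 : ℝ) ^ (m + 1 - N) * ((Ring.choose (m + 1) N : ℤ) : ℝ))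
          • a (B - 1 + N - m) m) + d (reexp a B N) := by
    have e2 : ∑ᶠ m : ℤ, ((-1 : ℝ) ^ (m + 1 - N) * ((Ring.choose (m + 1) N : ℤ) : ℝ))
          • a (B - 1 + N - m) m
        = ∑ᶠ m : ℤ, ((-1 : ℝ) ^ (m - N) * ((Ring.choose m N : ℤ) : ℝ)) • a (B + N - m) (m - 1) := by
      rw [← finsum_comp_equiv (Equiv.addRight (-1 : ℤ))]
      refine finsum_congr fun m => ?_
      simp only [Equiv.coe_addRight, ← sub_eq_add_neg]
      rw [sub_add_cancel, show B - 1 + N - (m - 1) = B + N - m by ring]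
    have f2 : (Function.support fun m : ℤ => ((-1 : ℝ) ^ (m - N) * ((Ring.choose m N : ℤ) : ℝ))
        • a (B + N - m) (m - 1)).Finite := by
      obtain ⟨M, hM⟩ := ha
      refine (Set.finite_Icc (B + N - M) (M + 1)).subset fun m hm => ?_
      by_contra h
      refine hm ?_
      simp only
      rw [hM _ _ (by rw [Set.mem_Icc] at h; omega), smul_zero]
    rw [e2, hd, ← finsum_add_distrib (f0 _) f2, ← finsum_add_distrib _ (f1' _)]
    · rw [reexp, if_pos (by omega), Int.toNat_natCast]
      refine finsum_congr fun m => ?_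
      rw [arrD, smul_add, smul_add, show B - 1 + N - m = B + N - m - 1 by ring]
    · exact ((f0 _).union f2).subset (Function.support_add _ _)
  rw [e1]
  congr 1
  rw [← finsum_add_distrib (f0 _) (f0 _), reexp]
  rcases N with _ | N
  · rw [if_neg (by simp)]
    refine finsum_eq_zero_of_forall_eq_zero fun m => ?_
    rw [← add_smul]
    simp [zpow_add₀]
  · rw [if_pos (by simp), show ((N + 1 : ℕ) : ℤ) - 1 = N by push_cast; ring, Int.toNat_natCast]
    refine finsum_congr fun m => ?_
    rw [← add_smul, Ring.choose_succ_succ, show B - 1 + ((N + 1 : ℕ) : ℤ) - m = B + N - m by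
      push_cast; ring]
    congr 1
    rw [show m + 1 - ((N + 1 : ℕ) : ℤ) = m - N by push_cast; ring,
      show m - ((N + 1 : ℕ) : ℤ) = m - N - 1 by push_cast; ring, zpow_sub_one₀ (by norm_num)]
    push_cast
    ring

theorem reexp_arrLam (α : ℤ → A) (B : ℤ) : reexp (arrLam α) B = serC (α B) := by
  ext C
  rw [reexp, serC]
  split_ifs with h0 h1 h1
  · subst h1
    rw [finsum_eq_single _ 0 fun m hm => by rw [arrLam, if_neg hm, smul_zero]]
    simp [arrLam]
  · rw [finsum_eq_single _ 0 fun m hm => by rw [arrLam, if_neg hm, smul_zero],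
      Ring.choose_zero_pos ℤ (by omega)]
    simp
  · omega
  · rfl

theorem choose_neg_succ (s k : ℕ) :
    ((Ring.choose (-1 - s : ℤ) k : ℤ) : ℝ) = (-1) ^ k * ((s + k).choose k : ℝ) := by
  rw [show (-1 - s : ℤ) = -(1 + s) by ring, Ring.choose_neg,
    show (1 : ℤ) + s + k - 1 = ((s + k : ℕ) : ℤ) by push_cast; ring, Ring.choose_natCast]
  rcases Nat.even_or_odd k with h | h
  · simp [Int.negOnePow_even k (by exact_mod_cast h), h.neg_one_pow]
  · simp [Int.negOnePow_odd k (by exact_mod_cast h), h.neg_one_pow]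

/-- The series `(μ + ∂)⁻¹ b` for `μ = λ' - λ`, expanded for `|λ| > |λ'|`. -/
theorem reexp_arrMu_tailSer (b : A) (B : ℤ) : reexp (arrMu (tailSer d b)) B
    = if B < 0 then -((serD d ^ (-1 - B).toNat) (serC b)) else 0 := by
  ext C
  rw [reexp]
  by_cases hC : 0 ≤ C
  swap
  · rw [if_neg hC]
    split_ifs
    · rw [Pi.neg_apply, serD_pow_apply _ (bddSer_serC b), Finset.sum_eq_zero fun s hs => ?_,
        neg_zero]
      rw [Finset.mem_range] at hs
      rw [serC, if_neg (by omega), iterate_map_zero, smul_zero]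
    · rfl
  rw [if_pos hC, finsum_eq_single _ (B + C) fun m hm => by
    rw [arrMu, if_neg (by omega), smul_zero], arrMu, if_pos (by omega), tailSer]
  by_cases hB : B < 0
  swap
  · rw [if_neg hB, if_neg (by omega), smul_zero, Pi.zero_apply]
  rw [if_pos hB, Pi.neg_apply, serD_pow_apply _ (bddSer_serC b)]
  by_cases hBC : B + C < 0
  swap
  · rw [if_neg hBC, smul_zero, Finset.sum_eq_zero fun s hs => ?_, neg_zero]
    rw [serC, if_neg (by omega), iterate_map_zero, smul_zero]
  obtain ⟨c, rfl⟩ : ∃ c : ℕ, C = c := ⟨C.toNat, by omega⟩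
  obtain ⟨s, hs⟩ : ∃ s : ℕ, B = -1 - s - c := ⟨(-1 - B - c).toNat, by omega⟩
  subst hs
  rw [if_pos hBC, show (-1 - (-1 - (s : ℤ) - c)).toNat = s + c by omega,
    show (-1 - (-1 - (s : ℤ) - c + c)).toNat = s by omega,
    Finset.sum_eq_single s (fun t _ ht => by
      rw [serC, if_neg (by push_cast; omega), iterate_map_zero, smul_zero])
      (fun h => absurd (Finset.mem_range.2 (by omega)) h),
    serC, if_pos (by push_cast; ring), smul_smul, ← neg_smul, Int.toNat_natCast,
    show -1 - (s : ℤ) - c + c = -1 - s by ring, choose_neg_succ, ← Nat.choose_symm_add]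
  congr 1
  rw [show -1 - (s : ℤ) - c = -((s + c + 1 : ℕ) : ℤ) by push_cast; ring, zpow_neg, zpow_natCast]
  have h2 : ∀ k : ℕ, ((-1 : ℝ) ^ k)⁻¹ = (-1) ^ k := fun k => by
    rw [← inv_pow]; norm_num
  have h3 : ∀ k : ℕ, (-1 : ℝ) ^ k * (-1) ^ k = 1 := fun k => by
    rw [← mul_pow]; norm_num
  rw [h2, pow_succ, pow_add]
  linear_combination (-((s + c).choose s : ℝ)) * ((-1) ^ s * (-1) ^ s) * h3 c
    - ((s + c).choose s : ℝ) * h3 s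

end Series

/-! ### Expansions of elements of `V_{λ,μ}` -/

section Expansions

variable {A : Type*} [CommRing A]

/-- An array with the first two exponents bounded above. -/
def BddArr₃ (t : ℤ → ℤ → ℕ → A) : Prop := ∃ M, ∀ m l p, M < m ∨ M < l → t m l p = 0

theorem BddArr₃.add {s t : ℤ → ℤ → ℕ → A} (hs : BddArr₃ s) (ht : BddArr₃ t) :
    BddArr₃ (s + t) := by
  obtain ⟨M, hM⟩ := hs
  obtain ⟨N, hN⟩ := ht
  refine ⟨max M N, fun m l p h => ?_⟩
  rw [Pi.add_apply, Pi.add_apply, Pi.add_apply, hM m l p (by omega), hN m l p (by omega), add_zero]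

theorem BddArr₃.sub {s t : ℤ → ℤ → ℕ → A} (hs : BddArr₃ s) (ht : BddArr₃ t) :
    BddArr₃ (s - t) := by
  obtain ⟨M, hM⟩ := hs
  obtain ⟨N, hN⟩ := ht
  refine ⟨max M N, fun m l p h => ?_⟩
  rw [Pi.sub_apply, Pi.sub_apply, Pi.sub_apply, hM m l p (by omega), hN m l p (by omega), sub_zero]

variable [Algebra ℝ A]

/-- The expansion for `|μ| > |λ|` of `∑ t_{mlp} λ^m μ^l (λ+μ)^{-p}`. -/
def expLM (t : ℤ → ℤ → ℕ → A) (a b : ℤ) : A := ∑ᶠ kp : ℕ × ℕ,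
  ((Ring.choose (-(kp.2 : ℤ)) kp.1 : ℤ) : ℝ) • t (a - kp.1) (b + kp.2 + kp.1) kp.2

/-- The expansion for `|λ| > |λ+μ|` of `∑ t_{mlp} λ^m μ^l (λ+μ)^{-p}`. -/
def expLS (t : ℤ → ℤ → ℕ → A) (a c : ℤ) : A := ∑ᶠ kpm : ℕ × ℕ × ℤ,
  if (kpm.1 : ℤ) - kpm.2.1 = c then
    ((-1 : ℝ) ^ (kpm.2.2 - kpm.1) * ((Ring.choose kpm.2.2 kpm.1 : ℤ) : ℝ))
      • t (a + kpm.1 - kpm.2.2) kpm.2.2 kpm.2.1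
  else 0

theorem finsum_eq_finsum_comp {ι κ M : Type*} [AddCommMonoid M] (f : ι → M) {e : κ → ι}
    (he : Function.Injective e) (h : ∀ i, (∀ j, e j ≠ i) → f i = 0) :
    ∑ᶠ i, f i = ∑ᶠ j, f (e j) := by
  classical
  rw [← finsum_mem_range he]
  refine finsum_congr fun i => ?_
  rw [finsum_eq_if]
  split_ifs with hi
  · rfl
  · exact h i fun j hj => hi ⟨j, hj⟩

theorem expLM_support_finite {t : ℤ → ℤ → ℕ → A} (ht : BddArr₃ t) (a b : ℤ) :
    (Function.support fun kp : ℕ × ℕ => ((Ring.choose (-(kp.2 : ℤ)) kp.1 : ℤ) : ℝ)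
      • t (a - kp.1) (b + kp.2 + kp.1) kp.2).Finite := by
  obtain ⟨M, hM⟩ := ht
  refine ((Set.finite_Iic (M - b).toNat).prod (Set.finite_Iic (M - b).toNat)).subset fun kp h => ?_
  by_contra hn
  refine h ?_
  simp only
  rw [hM _ _ _ (Or.inr ?_), smul_zero]
  simp only [Set.mem_prod, Set.mem_Iic, not_and_or, not_le] at hn
  omega

theorem expLS_support_finite {t : ℤ → ℤ → ℕ → A} (ht : BddArr₃ t) (a c : ℤ) :
    (Function.support fun kpm : ℕ × ℕ × ℤ => if (kpm.1 : ℤ) - kpm.2.1 = c then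
      ((-1 : ℝ) ^ (kpm.2.2 - kpm.1) * ((Ring.choose kpm.2.2 kpm.1 : ℤ) : ℝ))
        • t (a + kpm.1 - kpm.2.2) kpm.2.2 kpm.2.1 else 0).Finite := by
  obtain ⟨M, hM⟩ := ht
  refine ((Set.finite_Iic (2 * M - a).toNat).prod ((Set.finite_Iic (2 * M - a - c).toNat).prod
    (Set.finite_Icc (a - M) M))).subset fun kpm h => ?_
  by_contra hn
  refine h ?_
  simp only
  split_ifs with hc
  · rw [hM _ _ _ ?_, smul_zero]
    simp only [Set.mem_prod, Set.mem_Iic, Set.mem_Icc, not_and_or, not_le] at hn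
    omega
  · rfl

theorem expLM_add {s t : ℤ → ℤ → ℕ → A} (hs : BddArr₃ s) (ht : BddArr₃ t) (a b : ℤ) :
    expLM (s + t) a b = expLM s a b + expLM t a b := by
  rw [expLM, expLM, expLM, ← finsum_add_distrib (expLM_support_finite hs a b)
    (expLM_support_finite ht a b)]
  exact finsum_congr fun _ => smul_add _ _ _

theorem expLS_add {s t : ℤ → ℤ → ℕ → A} (hs : BddArr₃ s) (ht : BddArr₃ t) (a c : ℤ) :
    expLS (s + t) a c = expLS s a c + expLS t a c := by
  rw [expLS, expLS, expLS, ← finsum_add_distrib (expLS_support_finite hs a c)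
    (expLS_support_finite ht a c)]
  refine finsum_congr fun _ => ?_
  split_ifs
  · exact smul_add _ _ _
  · simp

theorem expLM_sub {s t : ℤ → ℤ → ℕ → A} (hs : BddArr₃ s) (ht : BddArr₃ t) (a b : ℤ) :
    expLM (s - t) a b = expLM s a b - expLM t a b := by
  rw [eq_sub_iff_add_eq, ← expLM_add (hs.sub ht) ht, sub_add_cancel]

theorem expLS_sub {s t : ℤ → ℤ → ℕ → A} (hs : BddArr₃ s) (ht : BddArr₃ t) (a c : ℤ) :
    expLS (s - t) a c = expLS s a c - expLS t a c := by
  rw [eq_sub_iff_add_eq, ← expLS_add (hs.sub ht) ht, sub_add_cancel]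

variable (d : Derivation ℝ A A)

/-- The element `x + w (λ + μ + ∂)⁻¹ y` of `V_{λ,μ}`. -/
def tailArr (x : ℤ → ℤ → A) (w : A) (y : ℤ → ℤ → A) : ℤ → ℤ → ℕ → A := fun m l p =>
  match p with
  | 0 => x m l
  | s + 1 => (-1 : ℝ) ^ s • (w * d^[s] (y m l))

variable {d} {x y : ℤ → ℤ → A}

theorem BddArr.tailArr (hx : BddArr x) (w : A) (hy : BddArr y) : BddArr₃ (tailArr d x w y) := by
  obtain ⟨M, hM⟩ := hx
  obtain ⟨N, hN⟩ := hy
  refine ⟨max M N, fun m l p h => ?_⟩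
  rcases p with _ | p
  · exact hM m l (by omega)
  · simp only [_root_.tailArr]
    rw [hN m l (by omega), iterate_map_zero, mul_zero, smul_zero]

/-- The expansion of `x + w (λ + μ + ∂)⁻¹ Y(λ)` for `|μ| > |λ|`: the coefficient of `μ^{-1-t}` in
the tail is `(-1)^t w (λ + ∂)^t Y`. -/
theorem expLM_tailArr (w : A) {Y : ℤ → A} (hY : BddSer Y) (a b : ℤ) :
    expLM (tailArr d x w (arrLam Y)) a b = x a b
      + w * if b < 0 then (-1 : ℝ) ^ (-1 - b).toNat • (serD d ^ (-1 - b).toNat) Y a else 0 := by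
  have h0 : ∀ k q : ℕ, b + 1 + q + k ≠ 0 →
      tailArr d x w (arrLam Y) (a - k) (b + (q + 1 : ℕ) + k) (q + 1) = 0 := fun k q h => by
    rw [tailArr, arrLam, if_neg (by push_cast; omega), iterate_map_zero, mul_zero, smul_zero]
  by_cases hb : b < 0
  swap
  · rw [if_neg hb, mul_zero, add_zero, expLM, finsum_eq_single _ (0, 0)]
    · simp [tailArr]
    · rintro ⟨k, p⟩ hkp
      rcases p with _ | q
      · have hk : k ≠ 0 := fun h => hkp (by rw [h])
        simp [Ring.choose_zero_pos ℤ (Nat.pos_of_ne_zero hk)]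
      · simp only
        rw [h0 k q (by omega), smul_zero]
  obtain ⟨t, rfl⟩ : ∃ t : ℕ, b = -1 - t := ⟨(-1 - b).toNat, by omega⟩
  rw [if_pos hb, show (-1 - (-1 - (t : ℤ))).toNat = t by omega, expLM,
    finsum_eq_sum_of_support_subset
      (s := insert (0, 0) ((Finset.range (t + 1)).image fun s => (t - s, s + 1)))]
  · rw [Finset.sum_insert (by simp), Finset.sum_image (fun p _ q _ h => by simp at h; exact h.2)]
    congr 1
    · simp [tailArr]
    · rw [serD_pow_apply _ hY, Finset.smul_sum, Finset.mul_sum]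
      refine Finset.sum_congr rfl fun s hs => ?_
      rw [Finset.mem_range] at hs
      obtain ⟨k, rfl⟩ : ∃ k, t = s + k := ⟨t - s, by omega⟩
      rw [Nat.add_sub_cancel_left, tailArr, arrLam, if_pos (by push_cast; ring),
        show -((s + 1 : ℕ) : ℤ) = -1 - s by push_cast; ring, choose_neg_succ, Nat.choose_symm_add,
        show a - ((s + k : ℕ) : ℤ) + s = a - k by push_cast; ring, mul_smul_comm, mul_smul_comm,
        smul_smul, smul_smul, pow_add]
      congr 1
      ring
  · rintro ⟨k, p⟩ hkp
    by_contra hn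
    refine hkp ?_
    rcases p with _ | q
    · have hk : k ≠ 0 := fun h => hn (by simp [h])
      simp [Ring.choose_zero_pos ℤ (Nat.pos_of_ne_zero hk)]
    · simp only
      rw [h0 k q fun h => hn ?_, smul_zero]
      simp only [Finset.coe_insert, Finset.coe_image, Set.mem_insert_iff, Set.mem_image]
      refine Or.inr ⟨q, by simp; omega, ?_⟩
      rw [Prod.mk.injEq]
      exact ⟨by omega, rfl⟩

/-- For `|λ| > |λ+μ|` the powers of `λ + μ` stay as they are, and only those of `μ = (λ+μ) - λ` are
re-expanded. -/
theorem expLS_eq_finsum_reexp {t : ℤ → ℤ → ℕ → A} (ht : BddArr₃ t) (a c : ℤ) :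
    expLS t a c = ∑ᶠ p : ℕ, reexp (fun m l => t m l p) a (c + p) := by
  let e : ℕ × ℤ → ℕ × ℕ × ℤ := fun pm => ((c + pm.1).toNat, pm.1, pm.2)
  have he : Function.Injective e := fun p q h => by
    simp only [e, Prod.mk.injEq] at h
    exact Prod.ext h.2.1 h.2.2
  have hfin := (expLS_support_finite ht a c).preimage (f := e) he.injOn
  rw [expLS, finsum_eq_finsum_comp _ he]
  · rw [finsum_curry _ hfin]
    refine finsum_congr fun p => ?_
    rw [reexp]
    by_cases h : 0 ≤ c + p
    · rw [if_pos h]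
      refine finsum_congr fun m => ?_
      have h1 : (((c + p).toNat : ℕ) : ℤ) = c + p := by omega
      simp only [e, h1]
      rw [if_pos (by ring)]
    · rw [if_neg h]
      refine finsum_eq_zero_of_forall_eq_zero fun m => ?_
      simp only [e]
      rw [if_neg (by omega)]
  · rintro ⟨k, p, m⟩ h
    refine if_neg fun hc => h (p, m) ?_
    simp only [e, Prod.mk.injEq, and_true]
    simp only at hc
    omega

/-- The expansion of `x + w (λ + μ + ∂)⁻¹ y` for `|λ| > |λ+μ|` is obtained by re-expanding `x` and
`y`, since `λ + μ` is one of the two variables. -/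
theorem expLS_tailArr (w : A) (hx : BddArr x) (hy : BddArr y) (a c : ℤ) :
    expLS (tailArr d x w y) a c = reexp x a c + w * serPow d (-1) (reexp y a) c := by
  have ht := hx.tailArr (d := d) w hy
  have h1 : ∀ q : ℕ, reexp (fun m l => tailArr d x w y m l (q + 1)) a (c + (q + 1 : ℕ))
      = w * ((-1 : ℝ) ^ q • d^[q] (reexp y a (c + 1 + q))) := by
    intro q
    rw [show c + ((q + 1 : ℕ) : ℤ) = c + 1 + q by push_cast; ring, reexp, reexp]
    split_ifs with h
    · have hf := reexp_support_finite hy (fun m => (-1 : ℝ) ^ (m - (c + 1 + q))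
        * ((Ring.choose m (c + 1 + q).toNat : ℤ) : ℝ)) a (c + 1 + q)
      have e : d^[q] (∑ᶠ m : ℤ, ((-1 : ℝ) ^ (m - (c + 1 + q))
          * ((Ring.choose m (c + 1 + q).toNat : ℤ) : ℝ)) • y (a + (c + 1 + q) - m) m)
          = ∑ᶠ m : ℤ, ((-1 : ℝ) ^ (m - (c + 1 + q))
          * ((Ring.choose m (c + 1 + q).toNat : ℤ) : ℝ)) • d^[q] (y (a + (c + 1 + q) - m) m) := by
        rw [finsum_eq_sum_of_support_subset (s := hf.toFinset) _ (by simp), iterate_map_sum,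
          finsum_eq_sum_of_support_subset (s := hf.toFinset)]
        · exact Finset.sum_congr rfl fun m _ => iterate_map_smul _ _ _
        · intro m hm
          simp only [Set.Finite.coe_toFinset]
          intro h0
          refine hm ?_
          have h0' : ((-1 : ℝ) ^ (m - (c + 1 + q)) * ((Ring.choose m (c + 1 + q).toNat : ℤ) : ℝ))
            • y (a + (c + 1 + q) - m) m = 0 := h0
          simp only
          rw [← iterate_map_smul, h0', iterate_map_zero]
      rw [e, smul_finsum, mul_finsum']
      · refine finsum_congr fun m => ?_
        simp only [tailArr]
        rw [mul_smul_comm, mul_smul_comm, smul_smul, smul_smul, mul_comm]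
      · refine hf.subset fun m hm h0 => hm ?_
        have h0' : ((-1 : ℝ) ^ (m - (c + 1 + q)) * ((Ring.choose m (c + 1 + q).toNat : ℤ) : ℝ))
            • y (a + (c + 1 + q) - m) m = 0 := h0
        simp only
        rw [← iterate_map_smul, h0', iterate_map_zero, smul_zero]
    · rw [iterate_map_zero, smul_zero, mul_zero]
  have hs : (Function.support fun p : ℕ =>
      reexp (fun m l => tailArr d x w y m l p) a (c + p)).Finite := by
    obtain ⟨M, hM⟩ := ht
    refine (Set.finite_Iic (2 * M - a - c).toNat).subset fun p hp => ?_
    by_contra hn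
    refine hp ?_
    simp only [Set.mem_Iic, not_le] at hn
    simp only [reexp]
    split_ifs
    · refine finsum_eq_zero_of_forall_eq_zero fun m => ?_
      rw [hM _ _ _ (by omega), smul_zero]
    · rfl
  rw [expLS_eq_finsum_reexp ht, serPow_neg_one_apply]
  have key : ∀ f : ℕ → A, (Function.support f).Finite → ∑ᶠ p, f p = f 0 + ∑ᶠ q, f (q + 1) := by
    intro f hf
    have e : ∑ᶠ q, f (q + 1) = ∑ᶠ p, if p = 0 then 0 else f p := by
      rw [finsum_shift]
      refine finsum_congr fun p => ?_
      rcases p with _ | p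
      · rfl
      · simp
    have e2 : f 0 = ∑ᶠ p, if p = 0 then f p else 0 := by
      rw [finsum_eq_single _ 0 fun p hp => if_neg hp, if_pos rfl]
    rw [e, e2, ← finsum_add_distrib]
    · refine finsum_congr fun p => ?_
      split_ifs <;> simp
    · exact (Set.finite_singleton 0).subset fun p hp => by
        by_contra h
        exact hp (if_neg h)
    · refine hf.subset fun p hp h => hp ?_
      have h' : f p = 0 := h
      simp [h']
  rw [key _ hs]
  congr 1
  · simp [tailArr]
  · have hf2 : (Function.support fun q : ℕ => (-1 : ℝ) ^ q • d^[q] (reexp y a (c + 1 + q))).Finite := by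
      obtain ⟨M, hM⟩ := hy.bddSer_reexp a
      refine (Set.finite_Iic (M - c).toNat).subset fun p hp => ?_
      by_contra hn
      refine hp ?_
      simp only [Set.mem_Iic, not_le] at hn
      simp only
      rw [hM _ (by omega), iterate_map_zero, smul_zero]
    rw [mul_finsum' _ _ hf2]
    exact finsum_congr h1

/-- The expansion of `-w G + w (λ + μ + ∂)⁻¹ (λ + μ + ∂) G` vanishes. -/
theorem expLS_tailArr_arrD (w : A) {G : ℤ → ℤ → A} (hG : BddArr G) (a c : ℤ) :
    expLS (tailArr d (fun m l => -(G m l * w)) w (arrD d G)) a c = 0 := by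
  have h1 := reexp_mul hG (-w) a
  have e : (fun m l => -(G m l * w)) = fun m l => G m l * -w := by
    funext m l
    ring
  rw [e, expLS_tailArr w (hG.mul_right _) hG.arrD, h1, reexp_arrD hG,
    serPow_neg_one_serD (hG.bddSer_reexp a)]
  ring

end Expansions

/-! ### Differential functions as elements of the algebra -/

section Bridge

open TopologicalSpace (Opens)
open Filter Topology DiffAlg

variable {n : ℕ} {U : Opens (Fin n → ℝ)}

/-- The function `f` on all jets restricts to the element `a` of the differential algebra. -/
def Restr (f : Jet n → ℝ) (a : DiffAlg U) : Prop := ∀ J : JetOver U, f J.1 = a J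

theorem isDiffFun_iff {f : Jet n → ℝ} : IsDiffFun U f ↔ ∃ a : DiffAlg U, Restr f a := by
  constructor
  · rintro ⟨N, F, hF, h⟩
    exact ⟨⟨fun J => f J.1, N, F, hF, fun J => h J.1 J.2⟩, fun J => rfl⟩
  · rintro ⟨a, ha⟩
    obtain ⟨N, F, hF, h⟩ := a.2
    exact ⟨N, F, hF, fun J hJ => (ha ⟨J, hJ⟩).trans (h ⟨J, hJ⟩)⟩

theorem update_update_eq_add_smul (J : Jet n) (σ : ℕ) (k : Fin n) (s : ℝ) :
    Function.update J σ (Function.update (J σ) k (J σ k + s)) = J + s • jetSingle σ k := by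
  funext τ l
  by_cases h : τ = σ
  · subst h
    by_cases hl : l = k
    · subst hl
      simp
    · simp [hl]
  · simp [h]

theorem restr_extend (a : DiffAlg U) : Restr (extend a) a := fun J => extend_coe a J

theorem Restr.jetPartial {f : Jet n → ℝ} {a : DiffAlg U} (h : Restr f a) (σ : ℕ) (k : Fin n) :
    Restr (jetPartial σ k f) (pd σ k a) := by
  intro J
  have e := deriv_comp_const_add (J.1 σ k) 0 (f := fun t : ℝ =>
    f (Function.update J.1 σ (Function.update (J.1 σ) k t)))
  rw [add_zero] at e
  rw [_root_.jetPartial, ← e, pd_apply]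
  refine Filter.EventuallyEq.deriv_eq ?_
  filter_upwards [eventually_mem J (jetSingle σ k)] with s hs
  rw [update_update_eq_add_smul, extend_of_mem a hs]
  exact h ⟨_, hs⟩

/-- Evaluation at a jet commutes with finitely supported sums. -/
theorem DiffAlg.finsum_apply {ι : Type*} {f : ι → DiffAlg U} (hf : (Function.support f).Finite)
    (J : JetOver U) : (∑ᶠ i, f i) J = ∑ᶠ i, f i J :=
  (eval J).toLinearMap.toAddMonoidHom.map_finsum hf

theorem pd_sum_support_finite (c : ℕ → Fin n → DiffAlg U) (a : DiffAlg U) :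
    (Function.support fun σ => ∑ k, c σ k * pd σ k a).Finite := by
  obtain ⟨N, hN⟩ := exists_order a
  refine (Set.finite_lt_nat N).subset fun σ h => ?_
  by_contra hn
  refine h (Finset.sum_eq_zero fun k _ => ?_)
  rw [hN σ (not_lt.1 hn), mul_zero]

theorem Restr.totalDeriv {f : Jet n → ℝ} {a : DiffAlg U} (h : Restr f a) :
    Restr (totalDeriv f) (tot a) := by
  intro J
  rw [tot, evol_eq_finsum, finsum_apply (pd_sum_support_finite _ a), _root_.totalDeriv]
  refine finsum_congr fun σ => ?_
  rw [sum_apply]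
  refine Finset.sum_congr rfl fun k _ => ?_
  rw [mul_apply, coord_apply, h.jetPartial σ k J]

theorem Restr.iterate_totalDeriv {f : Jet n → ℝ} {a : DiffAlg U} (h : Restr f a) (t : ℕ) :
    Restr (_root_.totalDeriv^[t] f) (tot^[t] a) := by
  induction t with
  | zero => exact h
  | succ t ih =>
    rw [Function.iterate_succ_apply', Function.iterate_succ_apply']
    exact ih.totalDeriv

/-- The series `F` of functions on all jets restricts to the series `G`. -/
def RestrSer (F : LamSeries n) (G : ℤ → DiffAlg U) : Prop := ∀ a, Restr (F a) (G a)

theorem Restr.lamConst {f : Jet n → ℝ} {a : DiffAlg U} (h : Restr f a) :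
    RestrSer (lamConst f) (serC a) := by
  intro m J
  rw [_root_.lamConst, serC]
  split_ifs
  · exact h J
  · rfl

theorem RestrSer.lamPow {F : LamSeries n} {G : ℤ → DiffAlg U} (h : RestrSer F G) (hG : BddSer G)
    (k : ℤ) : RestrSer (lamPow k F) (serPow (A := DiffAlg U) tot k G) := by
  intro a J
  rw [serPow, finsum_apply (serPow_support_finite k hG a), _root_.lamPow]
  refine finsum_congr fun t => ?_
  rw [smul_apply, (h _).iterate_totalDeriv t J]

variable {P : HydroOp n} (hP : P.SmoothOn U)

/-- `g^{ij}` as an element of the differential algebra. -/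
abbrev gA (i j : Fin n) : DiffAlg U := ofField (fun v => P.g v i j) (hP.1 i j)

/-- `Γ^{ij}_k` as an element of the differential algebra. -/
abbrev ΓA (i j k : Fin n) : DiffAlg U := ofField (fun v => P.Γ v i j k) (hP.2.1 i j k)

/-- `w^i_k` as an element of the differential algebra. -/
abbrev wA (i k : Fin n) : DiffAlg U := ofField (fun v => P.w v i k) (hP.2.2 i k)

/-- `W^i = w^i_k u^k_x`. -/
def tailA (i : Fin n) : DiffAlg U := ∑ k, wA hP i k * coord 1 k

/-- `Γ^{ij}_k u^k_x`. -/
def ΓuA (i j : Fin n) : DiffAlg U := ∑ k, ΓA hP i j k * coord 1 k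

theorem tailA_apply (i : Fin n) (J : JetOver U) : tailA hP i J = P.jetTail i J.1 := by
  simp [tailA, HydroOp.jetTail]

theorem ΓuA_apply (i j : Fin n) (J : JetOver U) :
    ΓuA hP i j J = ∑ k, P.Γ (J.1 0) i j k * J.1 1 k := by
  simp [ΓuA]

/-- `P^{ij}(λ+∂) F`. -/
def symA (i j : Fin n) (F : ℤ → DiffAlg U) : ℤ → DiffAlg U := fun a =>
  gA hP i j * serD (A := DiffAlg U) tot F a + ΓuA hP i j * F a
    + tailA hP i * serPow (A := DiffAlg U) tot (-1) (fun b => tailA hP j * F b) a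

theorem BddSer.symA {F : ℤ → DiffAlg U} (hF : BddSer F) (i j : Fin n) :
    BddSer (symA hP i j F) :=
  ((hF.serD.mul_left _).add (hF.mul_left _)).add (((hF.mul_left _).serPow _).mul_left _)

theorem RestrSer.symbol {F : LamSeries n} {G : ℤ → DiffAlg U} (h : RestrSer F G) (hG : BddSer G)
    (i j : Fin n) : RestrSer (P.symbol i j F) (symA hP i j G) := by
  intro a J
  have h1 : RestrSer (fun b J => P.jetTail j J * F b J) fun b => tailA hP j * G b := fun b J => by
    change P.jetTail j J.1 * F b J.1 = _
    rw [mul_apply, tailA_apply, h b J]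
  have h2 : serPow (A := DiffAlg U) tot 1 G = serD (A := DiffAlg U) tot G := by
    simpa using serPow_natCast 1 hG
  rw [HydroOp.symbol, symA, DiffAlg.add_apply, DiffAlg.add_apply, mul_apply, mul_apply, mul_apply,
    ofField_apply,
    ΓuA_apply, tailA_apply, h.lamPow hG 1 a J, h a J, h1.lamPow (hG.mul_left _) (-1) a J, h2]

/-- The `λ`-bracket, as given by the master formula. -/
def brG (F H : DiffAlg U) : ℤ → DiffAlg U := fun a =>
  ∑ i, ∑ j, ∑ᶠ στ : ℕ × ℕ, pd στ.1 j H * (-1) ^ στ.2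
    * serPow (A := DiffAlg U) tot στ.1 (symA hP j i (serPow (A := DiffAlg U) tot στ.2 (serC (pd στ.2 i F)))) a

theorem brG_support_finite (F H : DiffAlg U) (a : ℤ) (i j : Fin n) :
    (Function.support fun στ : ℕ × ℕ => pd στ.1 j H * (-1) ^ στ.2
      * serPow (A := DiffAlg U) tot στ.1 (symA hP j i (serPow (A := DiffAlg U) tot στ.2 (serC (pd στ.2 i F)))) a).Finite := by
  obtain ⟨N, hF, hH⟩ := exists_order₂ F H
  refine ((Set.finite_lt_nat N).prod (Set.finite_lt_nat N)).subset fun στ h => ?_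
  by_contra hn
  refine h ?_
  simp only [Set.mem_prod, Set.mem_ofPred_eq, not_and_or, not_lt] at hn
  rcases hn with hn | hn
  · simp only [hH _ hn, zero_mul]
  · have e : serC (0 : DiffAlg U) = 0 := by
      funext a
      simp [serC]
    have e2 : symA hP j i 0 = 0 := by
      funext a
      have : (fun b => tailA hP i * (0 : ℤ → DiffAlg U) b) = 0 := by
        funext b
        simp
      simp only [symA, this, serPow_zero_right, map_zero]
      simp
    simp only [hF _ hn, e, serPow_zero_right, e2, Pi.zero_apply, mul_zero]

theorem Restr.lamBracket {f h : Jet n → ℝ} {F H : DiffAlg U} (hf : Restr f F) (hh : Restr h H) :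
    RestrSer (P.lamBracket f h) (brG hP F H) := by
  intro a J
  rw [HydroOp.lamBracket, brG, sum_apply]
  refine Finset.sum_congr rfl fun i _ => ?_
  rw [sum_apply]
  refine Finset.sum_congr rfl fun j _ => ?_
  rw [finsum_apply (brG_support_finite hP F H a i j)]
  refine finsum_congr fun στ => ?_
  have h1 := (((((hf.jetPartial στ.2 i).lamConst).lamPow (bddSer_serC _) στ.2).symbol hP
    ((bddSer_serC _).serPow _) j i).lamPow (((bddSer_serC _).serPow _).symA hP j i) στ.1) a J
  have h2 : ((-1 : DiffAlg U) ^ στ.2) J = (-1) ^ στ.2 := by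
    simp [← eval_apply]
  rw [h1, hh.jetPartial _ _ J, mul_apply, mul_apply, h2]

theorem restr_jetGen (i : Fin n) : Restr (jetGen i) (coord 0 i : DiffAlg U) := fun _ => rfl

end Bridge

/-! ### Brackets of generators -/

section Generators

open TopologicalSpace (Opens)
open DiffAlg

variable {n : ℕ} {U : Opens (Fin n → ℝ)}

/-- The series `∑_τ (-λ-∂)^τ (H ∂F/∂u^e_τ)`, the variational derivative of `∫ H F`. -/
def varD (e : Fin n) (H : ℤ → DiffAlg U) (F : DiffAlg U) : ℤ → DiffAlg U :=
  ∑ᶠ τ : ℕ, (-1 : ℝ) ^ τ • (serD (A := DiffAlg U) tot ^ τ) (fun m => H m * pd τ e F)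

theorem varD_eq_sum (e : Fin n) (H : ℤ → DiffAlg U) {F : DiffAlg U} {N : ℕ}
    (hN : ∀ τ, N ≤ τ → ∀ k, pd τ k F = 0) : varD e H F
      = ∑ τ ∈ Finset.range N,
        (-1 : ℝ) ^ τ • (serD (A := DiffAlg U) tot ^ τ) (fun m => H m * pd τ e F) := by
  refine finsum_eq_sum_of_support_subset _ fun τ h => ?_
  by_contra hn
  refine h ?_
  have e0 : (fun m => H m * pd τ e F) = 0 := by
    funext m
    rw [hN τ (by simpa using hn), mul_zero, Pi.zero_apply]
  simp only [e0, map_zero, smul_zero]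

theorem varD_add (e : Fin n) (H : ℤ → DiffAlg U) (F G : DiffAlg U) :
    varD e H (F + G) = varD e H F + varD e H G := by
  obtain ⟨N, hF, hG⟩ := exists_order₂ F G
  rw [varD_eq_sum e H hF, varD_eq_sum e H hG, varD_eq_sum e H (F := F + G) (N := N) fun τ h k => by
    rw [map_add, hF τ h, hG τ h, add_zero], ← Finset.sum_add_distrib]
  refine Finset.sum_congr rfl fun τ _ => ?_
  rw [← smul_add, ← map_add]
  congr 2
  funext m
  rw [map_add, mul_add, Pi.add_apply]

theorem varD_smul (e : Fin n) (H : ℤ → DiffAlg U) (c : ℝ) (F : DiffAlg U) :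
    varD e H (c • F) = c • varD e H F := by
  obtain ⟨N, hF⟩ := exists_order F
  rw [varD_eq_sum e H hF, varD_eq_sum e H (F := c • F) (N := N) fun τ h k => by
    rw [Derivation.map_smul, hF τ h, smul_zero], Finset.smul_sum]
  refine Finset.sum_congr rfl fun τ _ => ?_
  have e1 : (fun m => H m * pd τ e (c • F)) = c • fun m => H m * pd τ e F := by
    funext m
    rw [Derivation.map_smul, mul_smul_comm, Pi.smul_apply]
  rw [e1, map_smul]
  exact smul_comm _ _ _

theorem varD_mul (e : Fin n) (H : ℤ → DiffAlg U) (F G : DiffAlg U) :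
    varD e H (F * G) = varD e (fun m => H m * F) G + varD e (fun m => H m * G) F := by
  obtain ⟨N, hF, hG⟩ := exists_order₂ F G
  rw [varD_eq_sum e _ hF, varD_eq_sum e _ hG, varD_eq_sum e H (F := F * G) (N := N) fun τ h k => by
    rw [Derivation.leibniz, hF τ h, hG τ h, smul_zero, smul_zero, add_zero],
    ← Finset.sum_add_distrib]
  refine Finset.sum_congr rfl fun τ _ => ?_
  rw [← smul_add, ← map_add]
  congr 2
  funext m
  rw [Derivation.leibniz, Pi.add_apply, smul_eq_mul, smul_eq_mul]
  ring

/-- Integration by parts. -/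
theorem varD_tot (e : Fin n) (H : ℤ → DiffAlg U) (F : DiffAlg U) :
    varD e H (tot F) = varD e (-serD (A := DiffAlg U) tot H) F := by
  obtain ⟨N, hF, hG⟩ := exists_order₂ F (tot F)
  have hG' : ∀ τ, N + 1 ≤ τ → ∀ k, pd τ k (tot F) = 0 := fun τ h => hG τ (by omega)
  have e1 : ∀ τ, (fun m => (-serD (A := DiffAlg U) tot H) m * pd τ e F)
      = (fun m => H m * tot (pd τ e F)) - serD (A := DiffAlg U) tot (fun m => H m * pd τ e F) := by
    intro τ
    funext m
    rw [Pi.sub_apply, serD_mul, Pi.neg_apply]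
    ring
  have e2 : ∀ τ, (fun m => H m * pd τ e (tot F)) = (fun m => H m * tot (pd τ e F))
      + fun m => H m * if τ = 0 then 0 else pd (τ - 1) e F := by
    intro τ
    funext m
    rw [pd_tot, mul_add, Pi.add_apply]
  have e3 : (fun m => H m * (0 : DiffAlg U)) = 0 := by
    funext m
    rw [mul_zero, Pi.zero_apply]
  rw [varD_eq_sum e _ hF, varD_eq_sum e _ hG']
  simp only [e1, e2, map_add, map_sub, smul_add, smul_sub, Finset.sum_add_distrib,
    Finset.sum_sub_distrib]
  rw [sub_eq_add_neg]
  congr 1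
  · rw [Finset.sum_range_succ, hF N le_rfl, map_zero, e3, map_zero, smul_zero, add_zero]
  · rw [Finset.sum_range_succ', ← Finset.sum_neg_distrib]
    simp only [if_pos, e3, map_zero, smul_zero, add_zero]
    refine Finset.sum_congr rfl fun τ _ => ?_
    rw [if_neg (Nat.succ_ne_zero τ), Nat.add_sub_cancel, pow_succ (serD (A := DiffAlg U) tot),
      Module.End.mul_apply, pow_succ, mul_neg_one, neg_smul]

theorem varD_neg (e : Fin n) (H : ℤ → DiffAlg U) (F : DiffAlg U) :
    varD e (-H) F = -varD e H F := by
  obtain ⟨N, hF⟩ := exists_order F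
  rw [varD_eq_sum e _ hF, varD_eq_sum e _ hF, ← Finset.sum_neg_distrib]
  refine Finset.sum_congr rfl fun τ _ => ?_
  have e1 : (fun m => (-H) m * pd τ e F) = -fun m => H m * pd τ e F := by
    funext m
    rw [Pi.neg_apply, Pi.neg_apply]
    ring
  rw [e1, map_neg]
  exact smul_neg _ _

theorem varD_iterate_tot (e : Fin n) (H : ℤ → DiffAlg U) (F : DiffAlg U) (t : ℕ) :
    varD e H (tot^[t] F) = (-1 : ℝ) ^ t • varD e ((serD (A := DiffAlg U) tot ^ t) H) F := by
  induction t generalizing H with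
  | zero => simp
  | succ t ih =>
    rw [Function.iterate_succ_apply', varD_tot, varD_neg, ih, pow_succ, pow_succ,
      Module.End.mul_apply, mul_neg_one]
    exact (neg_smul _ _).symm

/-- The variational derivative of a function of `u` and `u_x`. -/
theorem varD_of_order_le_one (e : Fin n) (H : ℤ → DiffAlg U) {F : DiffAlg U}
    (hF : ∀ τ, 2 ≤ τ → ∀ k, pd τ k F = 0) :
    varD e H F
      = (fun m => H m * pd 0 e F) - serD (A := DiffAlg U) tot fun m => H m * pd 1 e F := by
  rw [varD_eq_sum e H hF, Finset.sum_range_succ, Finset.sum_range_one, pow_zero, pow_zero, pow_one,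
    pow_one, sub_eq_add_neg]
  exact congrArg₂ (· + ·) (one_smul ℝ _)
    ((neg_smul (1 : ℝ) (_ : ℤ → DiffAlg U)).trans (congrArg Neg.neg (one_smul ℝ _)))

variable {P : HydroOp n} (hP : P.SmoothOn U)

theorem symA_add (i j : Fin n) {F G : ℤ → DiffAlg U} (hF : BddSer F) (hG : BddSer G) :
    symA hP i j (F + G) = symA hP i j F + symA hP i j G := by
  have e : (fun b => tailA hP j * (F + G) b)
      = (fun b => tailA hP j * F b) + fun b => tailA hP j * G b := by
    funext b
    rw [Pi.add_apply, Pi.add_apply, mul_add]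
  funext a
  rw [Pi.add_apply, symA, symA, symA, e, serPow_add _ (hF.mul_left _) (hG.mul_left _), map_add,
    Pi.add_apply, Pi.add_apply, Pi.add_apply]
  ring

theorem symA_smul (i j : Fin n) (c : ℝ) (F : ℤ → DiffAlg U) :
    symA hP i j (c • F) = c • symA hP i j F := by
  have e : (fun b => tailA hP j * (c • F) b) = c • fun b => tailA hP j * F b := by
    funext b
    rw [Pi.smul_apply, Pi.smul_apply, mul_smul_comm]
  funext a
  rw [Pi.smul_apply, symA, symA, e, serPow_smul, map_smul, Pi.smul_apply, Pi.smul_apply,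
    Pi.smul_apply, mul_smul_comm, mul_smul_comm, mul_smul_comm, smul_add, smul_add]

theorem symA_zero (i j : Fin n) : symA hP i j 0 = 0 := by
  simpa using symA_smul hP i j 0 0

theorem symA_sum {ι : Type*} (i j : Fin n) (s : Finset ι) {F : ι → ℤ → DiffAlg U}
    (hF : ∀ t ∈ s, BddSer (F t)) :
    symA hP i j (∑ t ∈ s, F t) = ∑ t ∈ s, symA hP i j (F t) := by
  classical
  induction s using Finset.induction_on with
  | empty => simp [symA_zero]
  | insert t s ht ih =>
    have h := fun t ht => hF t (Finset.mem_insert_of_mem ht)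
    rw [Finset.sum_insert ht, Finset.sum_insert ht, symA_add hP i j
      (hF t (Finset.mem_insert_self _ _)) (BddSer.sum h), ih h]

/-- The series `{u^i_λ u^k} = P^{ki}(λ)`. -/
def brA (k i : Fin n) : ℤ → DiffAlg U := symA hP k i (serC 1)

theorem bddSer_brA (k i : Fin n) : BddSer (brA hP k i) := (bddSer_serC 1).symA hP k i

theorem brA_apply (k i : Fin n) (m : ℤ) : brA hP k i m
    = (if m = 1 then gA hP k i else 0) + (if m = 0 then ΓuA hP k i else 0)
      + tailA hP k * tailSer (A := DiffAlg U) tot (tailA hP i) m := by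
  have e : (fun b => tailA hP i * serC 1 b) = serC (tailA hP i) := by
    funext b
    simp [serC]
  rw [brA, symA, e, serPow_neg_one_serC, serD_apply]
  simp only [serC]
  congr 2
  · by_cases h : m = 1
    · subst h
      simp
    · rw [if_neg (show m - 1 ≠ 0 by omega), if_neg h]
      split_ifs <;> simp
  · simp

/-- The Hamiltonian derivation `f ↦ {u^i_λ f}`, coefficient of `λ^m`. -/
def hamD (i : Fin n) (m : ℤ) : Derivation ℝ (DiffAlg U) (DiffAlg U) :=
  evol fun σ l => (serD (A := DiffAlg U) tot ^ σ) (brA hP l i) m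

theorem brG_coord_left (i : Fin n) (H : DiffAlg U) (m : ℤ) :
    brG hP (coord 0 i) H m = hamD hP i m H := by
  obtain ⟨N, hN⟩ := exists_order H
  have e0 : serC (0 : DiffAlg U) = 0 := by
    funext a
    simp [serC]
  have h1 : ∀ i' j : Fin n, (∑ᶠ στ : ℕ × ℕ, pd στ.1 j H * (-1) ^ στ.2
      * serPow (A := DiffAlg U) tot στ.1 (symA hP j i' (serPow (A := DiffAlg U) tot στ.2
        (serC (pd στ.2 i' (coord 0 i : DiffAlg U))))) m)
      = if i' = i then ∑ σ ∈ Finset.range N,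
        (serD (A := DiffAlg U) tot ^ σ) (brA hP j i) m * pd σ j H else 0 := by
    intro i' j
    rw [finsum_eq_sum_of_support_subset (s := Finset.range N ×ˢ {0})]
    · rw [Finset.sum_product]
      split_ifs with h
      · subst h
        refine Finset.sum_congr rfl fun σ _ => ?_
        rw [Finset.sum_singleton, pd_coord, if_pos ⟨rfl, rfl⟩, pow_zero, mul_one, mul_comm,
          serPow_natCast _ (((bddSer_serC _).serPow _).symA hP j i')]
        simp only [Nat.cast_zero, serPow_zero, brA]
      · refine Finset.sum_eq_zero fun σ _ => ?_
        rw [Finset.sum_singleton, pd_coord, if_neg fun h' => h h'.2, e0, serPow_zero_right,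
          symA_zero, serPow_zero_right, Pi.zero_apply, mul_zero]
    · intro στ h
      simp only [Finset.coe_product, Finset.coe_range, Finset.coe_singleton, Set.mem_prod,
        Set.mem_Iio, Set.mem_singleton_iff]
      by_contra hn
      refine h ?_
      rw [not_and_or] at hn
      rcases hn with hn | hn
      · simp only [hN _ (not_lt.1 hn), zero_mul]
      · simp only [pd_coord, if_neg fun h' : στ.2 = 0 ∧ i' = i => hn h'.1, e0, serPow_zero_right,
          symA_zero, Pi.zero_apply, mul_zero]
  rw [brG, hamD, evol_eq_sum _ hN]
  simp only [h1, Finset.sum_ite_irrel, Finset.sum_const_zero, Finset.sum_ite_eq', Finset.mem_univ,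
    if_true]
  exact Finset.sum_comm

theorem hamD_coord (i k : Fin n) (m : ℤ) : hamD hP i m (coord 0 k) = brA hP k i m := by
  rw [hamD, evol_coord, pow_zero, Module.End.one_apply]

theorem brG_coord (i k : Fin n) : brG hP (coord 0 i) (coord 0 k) = brA hP k i := by
  funext m
  rw [brG_coord_left, hamD_coord]

theorem brG_coord_right (F : DiffAlg U) (k : Fin n) (m : ℤ) :
    brG hP F (coord 0 k) m = ∑ e, symA hP k e (varD e (fun a => serC 1 a) F) m := by
  obtain ⟨N, hN⟩ := exists_order F
  have e0 : serC (0 : DiffAlg U) = 0 := by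
    funext a
    simp [serC]
  have e1 : ∀ b : DiffAlg U, (fun a => serC 1 a * b) = serC b := fun b => by
    funext a
    simp [serC]
  rw [brG]
  refine Finset.sum_congr rfl fun i _ => ?_
  rw [Finset.sum_eq_single k]
  · rw [varD_eq_sum i _ hN]
    simp only [e1]
    rw [symA_sum hP k i _ fun τ _ => ((bddSer_serC _).serD_pow _).smul _, Finset.sum_apply,
      finsum_eq_sum_of_support_subset (s := {0} ×ˢ Finset.range N)]
    · rw [Finset.sum_product, Finset.sum_singleton]
      refine Finset.sum_congr rfl fun τ _ => ?_
      rw [pd_coord, if_pos ⟨rfl, rfl⟩, one_mul, symA_smul, Pi.smul_apply,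
        serPow_natCast _ (bddSer_serC _), Nat.cast_zero, serPow_zero, Algebra.smul_def, map_pow,
        map_neg, map_one]
    · intro στ h
      simp only [Finset.coe_product, Finset.coe_range, Finset.coe_singleton, Set.mem_prod,
        Set.mem_Iio, Set.mem_singleton_iff]
      by_contra hn
      refine h ?_
      rw [not_and_or] at hn
      rcases hn with hn | hn
      · simp only
        rw [pd_coord, if_neg fun h' => hn h'.1, zero_mul, zero_mul]
      · simp only [hN _ (not_lt.1 hn), e0, serPow_zero_right, symA_zero, Pi.zero_apply, mul_zero]
  · intro j _ hj
    refine finsum_eq_zero_of_forall_eq_zero fun στ => ?_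
    rw [pd_coord, if_neg fun h' => hj h'.2, zero_mul, zero_mul]
  · simp

theorem bddSer_hamD (i : Fin n) (H : DiffAlg U) : BddSer fun m => hamD hP i m H := by
  obtain ⟨N, hN⟩ := exists_order H
  have e : (fun m => hamD hP i m H) = ∑ σ ∈ Finset.range N, ∑ l, fun m =>
      (serD (A := DiffAlg U) tot ^ σ) (brA hP l i) m * pd σ l H := by
    funext m
    rw [hamD, evol_eq_sum _ hN]
    simp only [Finset.sum_apply]
  rw [e]
  exact BddSer.sum fun σ _ => BddSer.sum fun l _ => ((bddSer_brA hP l i).serD_pow σ).mul_right _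

/-- The sesquilinearity `{u^i_λ ∂b} = (λ + ∂) {u^i_λ b}`. -/
theorem hamD_tot (i : Fin n) (m : ℤ) (b : DiffAlg U) :
    hamD hP i m (tot b) = serD (A := DiffAlg U) tot (fun a => hamD hP i a b) m := by
  obtain ⟨N, hN⟩ := exists_order b
  rw [hamD, evol_tot, serD_apply, add_comm]
  congr 1
  rw [hamD]
  congr 2
  funext σ l
  rw [pow_succ', Module.End.mul_apply, serD_apply, add_sub_cancel_right]

theorem hamD_iterate_tot (i : Fin n) (t : ℕ) (m : ℤ) (b : DiffAlg U) :
    hamD hP i m (tot^[t] b) = (serD (A := DiffAlg U) tot ^ t) (fun a => hamD hP i a b) m := by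
  induction t generalizing m with
  | zero => rfl
  | succ t ih =>
    rw [Function.iterate_succ_apply', hamD_tot, pow_succ', Module.End.mul_apply]
    exact congrArg (fun F => serD (A := DiffAlg U) tot F m) (funext ih)

end Generators

/-! ### Iterated brackets of generators as elements of `V_{λ,μ}` -/

section Iterated

theorem reexp_mul_left {A : Type*} [CommRing A] [Algebra ℝ A] {a : ℤ → ℤ → A} (ha : BddArr a)
    (x : A) (B : ℤ) : reexp (fun m l => x * a m l) B = fun C => x * reexp a B C := by
  simp only [mul_comm x]
  exact reexp_mul ha x B

theorem BddArr.mul_left {A : Type*} [CommRing A] {a : ℤ → ℤ → A} (ha : BddArr a) (x : A) :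
    BddArr fun m l => x * a m l := by
  simp only [mul_comm x]
  exact ha.mul_right x

theorem BddArr.sum {A : Type*} [CommRing A] {ι : Type*} {s : Finset ι} {a : ι → ℤ → ℤ → A}
    (ha : ∀ i ∈ s, BddArr (a i)) : BddArr (∑ i ∈ s, a i) :=
  Finset.sum_induction a BddArr (fun _ _ h1 h2 => h1.add h2) ⟨0, fun _ _ _ => rfl⟩ ha

theorem reexp_sum {A : Type*} [CommRing A] [Algebra ℝ A] {ι : Type*} {s : Finset ι}
    {a : ι → ℤ → ℤ → A} (ha : ∀ i ∈ s, BddArr (a i)) (B : ℤ) :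
    reexp (∑ i ∈ s, a i) B = ∑ i ∈ s, reexp (a i) B := by
  classical
  induction s using Finset.induction_on with
  | empty =>
    funext C
    simp [reexp]
  | insert t s ht ih =>
    have h := fun t ht => ha t (Finset.mem_insert_of_mem ht)
    rw [Finset.sum_insert ht, Finset.sum_insert ht, reexp_add (ha t (Finset.mem_insert_self _ _))
      (BddArr.sum h), ih h]

theorem reexp_arrLam_arrD {A : Type*} [CommRing A] [Algebra ℝ A] {d : Derivation ℝ A A}
    {α β : ℤ → A} {b : ℤ → ℤ → A} (hα : BddSer α) (hβ : BddSer β) (hb : BddArr b) (x y : A)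
    (B : ℤ) : reexp (arrLam α - arrD d (arrLam β) + arrD d (fun m l => b m l * x)
        - fun m l => b m l * y) B
      = serC (α B) - serD d (serC (β B)) + serD d (fun C => reexp b B C * x)
        - fun C => reexp b B C * y := by
  have b1 := bddArr_arrLam hα
  have b2 := bddArr_arrLam hβ
  rw [reexp_sub ((b1.sub b2.arrD).add (hb.mul_right _).arrD) (hb.mul_right _),
    reexp_add (b1.sub b2.arrD) (hb.mul_right _).arrD, reexp_sub b1 b2.arrD, reexp_arrD b2,
    reexp_arrD (hb.mul_right _), reexp_arrLam, reexp_arrLam, reexp_mul hb, reexp_mul hb]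

open TopologicalSpace (Opens)
open DiffAlg

variable {n : ℕ} {U : Opens (Fin n → ℝ)}

theorem pd_gA {P : HydroOp n} (hP : P.SmoothOn U) (i j : Fin n) {τ : ℕ} (h : 1 ≤ τ) (e : Fin n) :
    pd τ e (gA hP i j) = 0 := by
  rw [pd_ofField, if_neg (by omega)]

variable {P : HydroOp n} (hP : P.SmoothOn U)

theorem pd_ΓuA (i j : Fin n) {τ : ℕ} (h : 2 ≤ τ) (e : Fin n) : pd τ e (ΓuA hP i j) = 0 := by
  rw [ΓuA, map_sum]
  refine Finset.sum_eq_zero fun k _ => ?_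
  rw [Derivation.leibniz, pd_ofField, if_neg (by omega), pd_coord, if_neg (by omega), smul_zero,
    smul_zero, add_zero]

theorem pd_tailA (i : Fin n) {τ : ℕ} (h : 2 ≤ τ) (e : Fin n) : pd τ e (tailA hP i) = 0 := by
  rw [tailA, map_sum]
  refine Finset.sum_eq_zero fun k _ => ?_
  rw [Derivation.leibniz, pd_ofField, if_neg (by omega), pd_coord, if_neg (by omega), smul_zero,
    smul_zero, add_zero]

/-- The local part of `{u^i_λ {u^j_μ u^k}}`. -/
def outerLoc (i j k : Fin n) : ℤ → ℤ → DiffAlg U := fun m l =>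
  (if l = 1 then hamD hP i m (gA hP k j) else 0) + (if l = 0 then hamD hP i m (ΓuA hP k j) else 0)
    + hamD hP i m (tailA hP k) * tailSer (A := DiffAlg U) tot (tailA hP j) l

theorem bddArr_outerLoc (i j k : Fin n) : BddArr (outerLoc hP i j k) := by
  obtain ⟨M₁, h₁⟩ := bddSer_hamD hP i (gA hP k j)
  obtain ⟨M₂, h₂⟩ := bddSer_hamD hP i (ΓuA hP k j)
  obtain ⟨M₃, h₃⟩ := bddSer_hamD hP i (tailA hP k)
  refine ⟨max 1 (max M₁ (max M₂ M₃)), fun m l h => ?_⟩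
  rw [outerLoc]
  by_cases hl : 1 < l
  · rw [if_neg (by omega), if_neg (by omega), tailSer, if_neg (by omega), mul_zero, add_zero,
      add_zero]
  · simp only at h₁ h₂ h₃
    rw [h₁ m (by omega), h₂ m (by omega), h₃ m (by omega), zero_mul, ite_self, ite_self, add_zero,
      add_zero]

/-- The element of `V_{λ,μ}` given by `{u^i_λ {u^j_μ u^k}}`. -/
def outerArr (i j k : Fin n) : ℤ → ℤ → ℕ → DiffAlg U :=
  tailArr (A := DiffAlg U) tot (outerLoc hP i j k) (tailA hP k)
    (arrLam fun m => hamD hP i m (tailA hP j))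

theorem bddArr_outerArr (i j k : Fin n) : BddArr₃ (outerArr hP i j k) :=
  (bddArr_outerLoc hP i j k).tailArr _ (bddArr_arrLam (bddSer_hamD hP i _))

/-- The iterated bracket `{u^i_λ {u^j_μ u^k}}` is the expansion of `outerArr` for `|μ| > |λ|`: the
derivation `{u^i_λ ·}` acts on the coefficients of `P^{kj}(μ)` and commutes with `∂` up to `λ`. -/
theorem brG_outer (i j k : Fin n) (a b : ℤ) :
    brG hP (coord 0 i) (brG hP (coord 0 j) (coord 0 k) b) a = expLM (outerArr hP i j k) a b := by
  rw [outerArr, expLM_tailArr _ (bddSer_hamD hP i _), brG_coord, brG_coord_left, brA_apply,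
    map_add, map_add, Derivation.leibniz, smul_eq_mul, smul_eq_mul, outerLoc]
  have e1 : ∀ (q : Prop) [Decidable q] (x : DiffAlg U),
      hamD hP i a (if q then x else 0) = if q then hamD hP i a x else 0 := fun q _ x => by
    split_ifs
    · rfl
    · exact map_zero _
  have e2 : hamD hP i a (tailSer (A := DiffAlg U) tot (tailA hP j) b)
      = if b < 0 then (-1 : ℝ) ^ (-1 - b).toNat • (serD (A := DiffAlg U) tot ^ (-1 - b).toNat)
        (fun m => hamD hP i m (tailA hP j)) a else 0 := by
    rw [tailSer, e1, Derivation.map_smul, hamD_iterate_tot]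
  rw [e1, e1, e2]
  ring

/-- The element of `V_{λ,μ}` whose re-expansion is the variational derivative of `{u^i_λ u^j}`. -/
def varArr (i j e : Fin n) : ℤ → ℤ → DiffAlg U :=
  arrLam (fun m => (if m = 1 then pd 0 e (gA hP j i) else 0)
      + (if m = 0 then pd 0 e (ΓuA hP j i) else 0)
      + tailSer (A := DiffAlg U) tot (tailA hP i) m * pd 0 e (tailA hP j))
    - arrD (A := DiffAlg U) tot (arrLam fun m => (if m = 0 then pd 1 e (ΓuA hP j i) else 0)
      + tailSer (A := DiffAlg U) tot (tailA hP i) m * pd 1 e (tailA hP j))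
    + arrD (A := DiffAlg U) tot (fun m l =>
      arrMu (tailSer (A := DiffAlg U) tot (tailA hP j)) m l * pd 1 e (tailA hP i))
    - fun m l => arrMu (tailSer (A := DiffAlg U) tot (tailA hP j)) m l * pd 0 e (tailA hP i)

theorem bddSer_ite (c : ℤ) (x : DiffAlg U) : BddSer fun m => if m = c then x else 0 :=
  ⟨c, fun _ h => if_neg h.ne'⟩

theorem bddArr_varArr (i j e : Fin n) : BddArr (varArr hP i j e) :=
  (((bddArr_arrLam (((bddSer_ite _ _).add (bddSer_ite _ _)).add
    ((bddSer_tailSer _).mul_right _))).sub (bddArr_arrLam ((bddSer_ite _ _).add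
    ((bddSer_tailSer _).mul_right _))).arrD).add
    (((bddArr_arrMu (bddSer_tailSer _)).mul_right _).arrD)).sub
    ((bddArr_arrMu (bddSer_tailSer _)).mul_right _)

theorem serC_mul {A : Type*} [CommRing A] (x y : A) :
    (fun m => serC x m * y) = serC (x * y) := by
  funext m
  simp [serC]

theorem serC_add {A : Type*} [CommRing A] (x y : A) : serC (x + y) = serC x + serC y := by
  funext m
  rw [Pi.add_apply, serC, serC, serC]
  split_ifs <;> simp

theorem serC_zero {A : Type*} [CommRing A] : serC (0 : A) = 0 := by
  funext m
  simp [serC]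

theorem varD_zero (e : Fin n) (H : ℤ → DiffAlg U) : varD e H 0 = 0 := by
  rw [varD_eq_sum e H (N := 0) fun τ _ k => map_zero _, Finset.sum_range_zero]

/-- The variational derivative of a function of `u` and `u_x` times a derivative of another. -/
theorem varD_tail (e : Fin n) {F G : DiffAlg U} (hF : ∀ τ, 2 ≤ τ → ∀ k, pd τ k F = 0)
    (hG : ∀ τ, 2 ≤ τ → ∀ k, pd τ k G = 0) (a : ℤ) :
    varD e (serC 1) (F * tailSer (A := DiffAlg U) tot G a)
      = serC (tailSer (A := DiffAlg U) tot G a * pd 0 e F)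
        - serD (A := DiffAlg U) tot (serC (tailSer (A := DiffAlg U) tot G a * pd 1 e F))
        + serD (A := DiffAlg U) tot (fun C =>
          reexp (arrMu (tailSer (A := DiffAlg U) tot F)) a C * pd 1 e G)
        - fun C => reexp (arrMu (tailSer (A := DiffAlg U) tot F)) a C * pd 0 e G := by
  have h1 : varD e (fun m => serC 1 m * tailSer (A := DiffAlg U) tot G a) F
      = serC (tailSer (A := DiffAlg U) tot G a * pd 0 e F)
        - serD (A := DiffAlg U) tot (serC (tailSer (A := DiffAlg U) tot G a * pd 1 e F)) := by
    rw [serC_mul, one_mul, varD_of_order_le_one e _ hF, serC_mul, serC_mul]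
  rw [varD_mul, h1, serC_mul, one_mul, reexp_arrMu_tailSer, tailSer]
  by_cases ha : a < 0
  · simp only [if_pos ha]
    rw [varD_smul, varD_iterate_tot, varD_of_order_le_one e _ hG, smul_smul, ← mul_pow,
      neg_one_mul, neg_neg, one_pow]
    have e1 : ∀ (K : ℤ → DiffAlg U) (x : DiffAlg U),
        (fun C => (-K) C * x) = -fun C => K C * x := fun K x => by
      funext C
      rw [Pi.neg_apply, Pi.neg_apply]
      ring
    rw [e1, e1, map_neg]
    funext m
    simp only [Pi.add_apply, Pi.sub_apply, Pi.neg_apply, one_smul]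
    ring
  · have e1 : ∀ x : DiffAlg U, (fun C => (0 : ℤ → DiffAlg U) C * x) = 0 := fun x => by
      funext C
      rw [Pi.zero_apply, zero_mul]
    simp only [if_neg ha]
    rw [varD_zero, e1, e1, map_zero, zero_add, add_zero, sub_zero]

/-- The variational derivative of a coefficient of `{u^i_λ u^j}`. The terms in which it acts on the
argument of `(λ + ∂)⁻¹` produce, after re-expansion, a tail in `μ`. -/
theorem varD_brA (i j e : Fin n) (a : ℤ) :
    varD e (serC 1) (brA hP j i a) = reexp (varArr hP i j e) a := by
  have h1 : varD e (serC 1) (if a = 1 then gA hP j i else 0)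
      = serC (if a = 1 then pd 0 e (gA hP j i) else 0) := by
    split_ifs
    · rw [varD_of_order_le_one e _ fun τ h k => pd_gA hP j i (by omega) k, serC_mul, one_mul,
        serC_mul, pd_gA hP j i le_rfl, mul_zero, serC_zero, map_zero, sub_zero]
    · rw [varD_zero, serC_zero]
  have h2 : varD e (serC 1) (if a = 0 then ΓuA hP j i else 0)
      = serC (if a = 0 then pd 0 e (ΓuA hP j i) else 0)
        - serD (A := DiffAlg U) tot (serC (if a = 0 then pd 1 e (ΓuA hP j i) else 0)) := by
    split_ifs
    · rw [varD_of_order_le_one e _ fun τ h k => pd_ΓuA hP j i h k, serC_mul, one_mul, serC_mul,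
        one_mul]
    · rw [varD_zero, serC_zero, map_zero, sub_zero]
  rw [brA_apply, varD_add, varD_add, h1, h2, varD_tail e (fun τ h k => pd_tailA hP j h k)
    (fun τ h k => pd_tailA hP i h k), varArr]
  refine Eq.trans ?_ (reexp_arrLam_arrD (((bddSer_ite _ _).add (bddSer_ite _ _)).add
    ((bddSer_tailSer _).mul_right _)) ((bddSer_ite _ _).add ((bddSer_tailSer _).mul_right _))
    (bddArr_arrMu (bddSer_tailSer _)) _ _ a).symm
  have hs : ∀ x y : DiffAlg U, serC (x + y) = serC x + serC y := serC_add
  change _ = serC (_ + _ + _) - serD tot (serC (_ + _)) + _ - _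
  rw [hs, hs, hs, map_add]
  abel

/-- The part without `W^k (λ + μ + ∂)⁻¹` of `{{u^i_λ u^j}_{λ+μ} u^k}`. -/
def innerLoc (i j k : Fin n) : ℤ → ℤ → DiffAlg U :=
  ∑ e, ((fun m l => gA hP k e * arrD (A := DiffAlg U) tot (varArr hP i j e) m l)
    + fun m l => ΓuA hP k e * varArr hP i j e m l)

/-- The argument of `W^k (λ + μ + ∂)⁻¹` in `{{u^i_λ u^j}_{λ+μ} u^k}`. -/
def innerTail (i j : Fin n) : ℤ → ℤ → DiffAlg U :=
  ∑ e, fun m l => tailA hP e * varArr hP i j e m l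

theorem bddArr_innerLoc (i j k : Fin n) : BddArr (innerLoc hP i j k) :=
  BddArr.sum fun e _ => ((bddArr_varArr hP i j e).arrD.mul_left _).add
    ((bddArr_varArr hP i j e).mul_left _)

theorem bddArr_innerTail (i j : Fin n) : BddArr (innerTail hP i j) :=
  BddArr.sum fun e _ => (bddArr_varArr hP i j e).mul_left _

/-- The element of `V_{λ,μ}` given by `{{u^i_λ u^j}_{λ+μ} u^k}`. -/
def innerArr (i j k : Fin n) : ℤ → ℤ → ℕ → DiffAlg U :=
  tailArr (A := DiffAlg U) tot (innerLoc hP i j k) (tailA hP k) (innerTail hP i j)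

theorem bddArr_innerArr (i j k : Fin n) : BddArr₃ (innerArr hP i j k) :=
  (bddArr_innerLoc hP i j k).tailArr _ (bddArr_innerTail hP i j)

/-- The iterated bracket `{{u^i_λ u^j}_{λ+μ} u^k}` is the expansion of `innerArr` for
`|λ| > |λ+μ|`: it is `P^{k e}(λ+μ)` applied to the variational derivatives of `{u^i_λ u^j}`. -/
theorem brG_inner (i j k : Fin n) (a c : ℤ) :
    brG hP (brG hP (coord 0 i) (coord 0 j) a) (coord 0 k) c = expLS (innerArr hP i j k) a c := by
  have hb := fun e => bddArr_varArr hP i j e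
  rw [innerArr, expLS_tailArr _ (bddArr_innerLoc hP i j k) (bddArr_innerTail hP i j), brG_coord,
    brG_coord_right]
  simp only [varD_brA]
  rw [innerLoc, innerTail, reexp_sum (fun e _ => ((hb e).arrD.mul_left _).add ((hb e).mul_left _)),
    reexp_sum fun e _ => (hb e).mul_left _,
    serPow_sum _ _ fun e _ => ((hb e).mul_left _).bddSer_reexp a, Finset.sum_apply,
    Finset.sum_apply, Finset.mul_sum, ← Finset.sum_add_distrib]
  refine Finset.sum_congr rfl fun e _ => ?_
  rw [reexp_add ((hb e).arrD.mul_left _) ((hb e).mul_left _), reexp_mul_left (hb e).arrD,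
    reexp_mul_left (hb e), reexp_mul_left (hb e), reexp_arrD (hb e)]
  rfl

end Iterated

/-! ### The Jacobi identity at a jet -/

section JetPoint

open TopologicalSpace (Opens)
open DiffAlg

variable {n : ℕ} {U : Opens (Fin n → ℝ)}

/-- The coefficients of the constant series `e_i`. -/
def famE (i : Fin n) (m : ℤ) : Fin n → ℝ := if m = 0 then Pi.single i 1 else 0

theorem bilForm_famE (a : Fin n → Fin n → ℝ) (i : Fin n) (m : ℤ) (φ : Fin n → ℝ) :
    bilForm a (famE i m) φ = if m = 0 then ∑ e, a i e * φ e else 0 := by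
  rw [famE]
  split_ifs
  · simp [bilForm_apply, Pi.single_apply]
  · simp

theorem serC_apply_jet (x : DiffAlg U) (m : ℤ) (J : JetOver U) :
    serC x m J = if m = 0 then x J else 0 := by
  rw [serC]
  split_ifs <;> rfl

theorem serD_serC_apply_jet (x : DiffAlg U) (m : ℤ) (J : JetOver U) :
    serD (A := DiffAlg U) tot (serC x) m J
      = (if m - 1 = 0 then x J else 0) + if m = 0 then tot x J else 0 := by
  rw [serD_apply, DiffAlg.add_apply, serC_apply_jet, serC]
  congr 1
  split_ifs
  · rfl
  · rw [map_zero]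
    rfl

theorem arrD_mul {A : Type*} [CommRing A] [Algebra ℝ A] (d : Derivation ℝ A A) (F G : ℤ → A)
    (m l : ℤ) : arrD d (fun m l => F m * G l) m l = serD d F m * G l + F m * serD d G l := by
  rw [arrD, serD_apply, serD_apply, Derivation.leibniz, smul_eq_mul, smul_eq_mul]
  ring

variable {P : HydroOp n} (hP : P.SmoothOn U) (V : ℕ → Fin n → DiffAlg U) (J : JetOver U)

theorem evol_gA_apply (i j : Fin n) : evol V (gA hP i j) J
    = P.dgForm (J.1 0) (Pi.single i 1) (Pi.single j 1) (fun l => V 0 l J) := by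
  rw [evol_ofField]
  simp [triForm_apply, Pi.single_apply, mul_comm]

theorem evol_ΓA_apply (i j e : Fin n) : evol V (ΓA hP i j e) J
    = P.dΓForm (J.1 0) (Pi.single i 1) (Pi.single j 1) (Pi.single e 1) (fun l => V 0 l J) := by
  rw [evol_ofField]
  simp [quadForm_apply, Pi.single_apply, mul_comm]

theorem evol_wA_apply (i e : Fin n) : evol V (wA hP i e) J
    = P.dwForm (J.1 0) (Pi.single i 1) (Pi.single e 1) (fun l => V 0 l J) := by
  rw [evol_ofField]
  simp [triForm_apply, Pi.single_apply, mul_comm]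

theorem sum_dΓForm_single (v α β φ ψ : Fin n → ℝ) :
    ∑ e, φ e * P.dΓForm v α β (Pi.single e 1) ψ = P.dΓForm v α β φ ψ :=
  dotProduct_eq_of_linear ((P.dΓForm v α β).flip ψ) φ

theorem sum_dwForm_single (v α φ ψ : Fin n → ℝ) :
    ∑ e, φ e * P.dwForm v α (Pi.single e 1) ψ = P.dwForm v α φ ψ :=
  dotProduct_eq_of_linear ((P.dwForm v α).flip ψ) φ

theorem evol_ΓuA_apply (i j : Fin n) : evol V (ΓuA hP i j) J
    = P.dΓForm (J.1 0) (Pi.single i 1) (Pi.single j 1) (J.1 1) (fun l => V 0 l J)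
      + P.ΓForm (J.1 0) (Pi.single i 1) (Pi.single j 1) (fun l => V 1 l J) := by
  rw [ΓuA, map_sum, sum_apply, ← sum_dΓForm_single, triForm_apply]
  simp only [Derivation.leibniz, smul_eq_mul, DiffAlg.add_apply, DiffAlg.mul_apply, evol_ΓA_apply,
    evol_coord, Finset.sum_add_distrib, coord_apply, ofField_apply]
  simp [Pi.single_apply, add_comm]

theorem evol_tailA_apply (i : Fin n) : evol V (tailA hP i) J
    = P.linTail (J.1 0) (J.1 1) (Pi.single i 1) (fun l => V 0 l J) (fun l => V 1 l J) := by
  rw [tailA, map_sum, sum_apply, HydroOp.linTail, ← sum_dwForm_single, bilForm_apply]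
  simp only [Derivation.leibniz, smul_eq_mul, DiffAlg.add_apply, DiffAlg.mul_apply, evol_wA_apply,
    evol_coord, Finset.sum_add_distrib, coord_apply, ofField_apply]
  simp [Pi.single_apply, add_comm]

theorem tailA_eq_wVec : (fun e => tailA hP e J) = P.wVec (J.1 0) (J.1 1) := by
  funext e
  rw [bilVec_apply, tailA_apply, HydroOp.jetTail]

/-- The local part of `{u^i_λ u^l}`. -/
def locA (i : Fin n) (l : Fin n) (m : ℤ) : DiffAlg U :=
  (if m = 1 then gA hP l i else 0) + if m = 0 then ΓuA hP l i else 0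

theorem locA_apply (i : Fin n) (m : ℤ) : (fun l => locA hP i l m J)
    = P.loc (J.1 0) (J.1 1) (famE i m) (famE i (m - 1)) := by
  funext l
  rw [locA, HydroOp.loc, Pi.add_apply, bilVec_apply, triVec_apply, DiffAlg.add_apply, famE, famE]
  congr 1
  · by_cases h : m = 1
    · simp [h, Pi.single_apply]
    · simp [h, show m - 1 ≠ 0 by omega]
  · by_cases h : m = 0
    · simp [h, Pi.single_apply, ΓuA_apply]
    · simp [h]

/-- The series `(λ + ∂)⁻¹ W^i` at a jet. -/
def tailAt (i : Fin n) (m : ℤ) : ℝ := tailSer (A := DiffAlg U) tot (tailA hP i) m J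

/-- The derivative of the tail at a jet. -/
def tailDer (e : Fin n) : ℝ := tot (tailA hP e) J

/-- `(λ + ∂)` applied to the local part of `{u^i_λ u}`, at a jet. -/
def locDer (i : Fin n) (m : ℤ) (l : Fin n) : ℝ := serD (A := DiffAlg U) tot (locA hP i l) m J

theorem brA_eq (l i : Fin n) : brA hP l i
    = locA hP i l + fun m => tailSer (A := DiffAlg U) tot (tailA hP i) m * tailA hP l := by
  funext m
  rw [brA_apply, Pi.add_apply, locA, mul_comm (tailA hP l)]

theorem brA_eq_loc (i : Fin n) (m : ℤ) : (fun l => brA hP l i m J)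
    = P.loc (J.1 0) (J.1 1) (famE i m) (famE i (m - 1)) + tailAt hP J i m • P.wVec (J.1 0) (J.1 1) := by
  rw [← locA_apply hP J, ← tailA_eq_wVec hP J]
  funext l
  rw [brA_eq]
  rfl

theorem serC_tailA_apply (i : Fin n) (m : ℤ) :
    serC (tailA hP i) m J = P.wForm (J.1 0) (famE i m) (J.1 1) := by
  rw [serC_apply_jet, bilForm_famE, tailA_apply, HydroOp.jetTail]

theorem serD_brA_eq_loc (i : Fin n) (m : ℤ) :
    (fun l => serD (A := DiffAlg U) tot (brA hP l i) m J)
    = locDer hP J i m + tailAt hP J i m • tailDer hP J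
      + P.wForm (J.1 0) (famE i m) (J.1 1) • P.wVec (J.1 0) (J.1 1) := by
  rw [← tailA_eq_wVec hP J, ← serC_tailA_apply hP J]
  funext l
  rw [brA_eq, map_add, Pi.add_apply, serD_mul, serD_tailSer, DiffAlg.add_apply, DiffAlg.add_apply]
  simp only [DiffAlg.mul_apply, Pi.add_apply, Pi.smul_apply, smul_eq_mul, locDer, tailAt, tailDer]
  ring

/-- `∂W/∂u^e - (λ + ∂) ∂W/∂u^e_x` for `W = W^i`. -/
def adjA (i : Fin n) (e : Fin n) : ℤ → DiffAlg U :=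
  serC (pd 0 e (tailA hP i)) - serD (A := DiffAlg U) tot (serC (pd 1 e (tailA hP i)))

theorem pd_eq_evol (σ : ℕ) (k : Fin n) (a : DiffAlg U) :
    pd σ k a = evol (fun τ l => if τ = σ ∧ l = k then 1 else 0) a := by
  obtain ⟨N, hN⟩ := exists_order a
  have hN' : ∀ τ, max N (σ + 1) ≤ τ → ∀ k, pd τ k a = 0 := fun τ h => hN τ (by omega)
  rw [evol_eq_sum _ hN', Finset.sum_eq_single σ, Finset.sum_eq_single k]
  · simp
  · intro l _ hl
    simp [hl]
  · simp
  · intro τ _ hτ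
    simp [hτ]
  · intro h
    simp at h

theorem pd_zero_tailA_apply (i e : Fin n) : pd 0 e (tailA hP i) J
    = P.dwForm (J.1 0) (Pi.single i 1) (J.1 1) (Pi.single e 1) := by
  have e1 : (fun l => (if 0 = 0 ∧ l = e then (1 : DiffAlg U) else 0) J) = Pi.single e 1 := by
    funext l
    by_cases h : l = e <;> simp [h]
  have e2 : (fun l => (if 1 = 0 ∧ l = e then (1 : DiffAlg U) else 0) J) = 0 := by
    funext l
    simp
  rw [pd_eq_evol, evol_tailA_apply, e1, e2, HydroOp.linTail, map_zero, add_zero]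

theorem pd_one_tailA (i e : Fin n) : pd 1 e (tailA hP i) = wA hP i e := by
  rw [tailA, map_sum]
  simp [pd_ofField, pd_coord]

theorem pd_one_ΓuA (i j e : Fin n) : pd 1 e (ΓuA hP i j) = ΓA hP i j e := by
  rw [ΓuA, map_sum]
  simp [pd_ofField, pd_coord]

theorem pd_zero_ΓuA_apply (i j e : Fin n) : pd 0 e (ΓuA hP i j) J
    = P.dΓForm (J.1 0) (Pi.single i 1) (Pi.single j 1) (J.1 1) (Pi.single e 1) := by
  have e1 : (fun l => (if 0 = 0 ∧ l = e then (1 : DiffAlg U) else 0) J) = Pi.single e 1 := by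
    funext l
    by_cases h : l = e <;> simp [h]
  have e2 : (fun l => (if 1 = 0 ∧ l = e then (1 : DiffAlg U) else 0) J) = 0 := by
    funext l
    simp
  rw [pd_eq_evol, evol_ΓuA_apply, e1, e2, map_zero, add_zero]

theorem pd_zero_gA_apply (i j e : Fin n) : pd 0 e (gA hP i j) J
    = P.dgForm (J.1 0) (Pi.single i 1) (Pi.single j 1) (Pi.single e 1) := by
  have e1 : (fun l => (if 0 = 0 ∧ l = e then (1 : DiffAlg U) else 0) J) = Pi.single e 1 := by
    funext l
    by_cases h : l = e <;> simp [h]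
  rw [pd_eq_evol, evol_gA_apply, e1]

theorem adjA_apply (i : Fin n) (m : ℤ) : (fun e => adjA hP i e m J)
    = P.adjTail (J.1 0) (J.1 1) (famE i m) (famE i (m - 1)) := by
  funext e
  have e1 : tot (wA hP i e) J
      = P.dwForm (J.1 0) (Pi.single i 1) (Pi.single e 1) (J.1 1) := evol_wA_apply hP _ J i e
  rw [adjA, Pi.sub_apply, DiffAlg.sub_apply, serD_serC_apply_jet, serC_apply_jet, pd_one_tailA,
    pd_zero_tailA_apply, e1, HydroOp.adjTail, covec, LinearMap.sub_apply, LinearMap.sub_apply,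
    LinearMap.flip_apply, ofField_apply, famE, famE]
  by_cases h0 : m = 0
  · subst h0
    simp
  · by_cases h1 : m - 1 = 0
    · simp [h0, h1]
    · simp [h0, h1]

/-- `(λ + ∂)` applied to `adjA` at a jet. -/
def adjDer (i : Fin n) (m : ℤ) (e : Fin n) : ℝ := serD (A := DiffAlg U) tot (adjA hP i e) m J

/-- The local part of the variational derivative of `{u^i_λ u^j}`. -/
def varLoc (i j e : Fin n) : ℤ → ℤ → DiffAlg U :=
  arrLam (fun m => (if m = 1 then pd 0 e (gA hP j i) else 0)
      + if m = 0 then pd 0 e (ΓuA hP j i) else 0)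
    - arrD (A := DiffAlg U) tot (arrLam fun m => if m = 0 then ΓA hP j i e else 0)
    - (arrLam fun m => if m = 0 then tailA hP i * wA hP j e else 0)
    + arrLam fun m => if m = 0 then tailA hP j * wA hP i e else 0

theorem arrD_sub {A : Type*} [CommRing A] [Algebra ℝ A] (d : Derivation ℝ A A)
    (a b : ℤ → ℤ → A) : arrD d (a - b) = arrD d a - arrD d b := by
  funext m l
  simp only [arrD, Pi.sub_apply, map_sub]
  ring

theorem arrD_add {A : Type*} [CommRing A] [Algebra ℝ A] (d : Derivation ℝ A A)
    (a b : ℤ → ℤ → A) : arrD d (a + b) = arrD d a + arrD d b := by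
  funext m l
  simp only [arrD, Pi.add_apply, map_add]
  ring

theorem arrLam_sub_arrD_eq {A : Type*} [CommRing A] [Algebra ℝ A] {d : Derivation ℝ A A}
    {R Q : ℤ → A} {x y : A} (hR : serD d R = serC x) (hQ : serD d Q = serC y) (α β : ℤ → A)
    (b c b' c' : A) :
    arrLam (fun m => α m + R m * b) - arrD d (arrLam fun m => β m + R m * c)
        + arrD d (fun m l => arrMu Q m l * c') - (fun m l => arrMu Q m l * b')
      = arrLam α - arrD d (arrLam β) - (arrLam fun m => if m = 0 then x * c else 0)
        + (arrLam fun m => if m = 0 then y * c' else 0)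
        + (fun m l => R m * (serC b - serD d (serC c)) l)
        - fun m l => Q l * (serC b' - serD d (serC c')) m := by
  have e1 : ∀ (γ : ℤ → A) (z : A), arrLam (fun m => γ m + R m * z)
      = arrLam γ + fun m l => R m * serC z l := fun γ z => by
    funext m l
    rw [Pi.add_apply, Pi.add_apply, arrLam, arrLam, serC]
    split_ifs <;> simp
  have e2 : ∀ z : A, (fun m l => arrMu Q m l * z) = fun m l => serC z m * Q l := fun z => by
    funext m l
    rw [arrMu, serC]
    split_ifs <;> simp [mul_comm]
  have e3 : ∀ (z w : A) (m l : ℤ), arrLam (fun m => if m = 0 then z * w else 0) m l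
      = serC z m * serC w l := fun z w m l => by
    rw [arrLam, serC, serC]
    split_ifs <;> simp
  rw [e1, e1, e2, e2, arrD_add]
  funext m l
  have e4 : serC c' m * serC y l = serC y m * serC c' l := by
    rw [← e3, ← e3, mul_comm]
  simp only [Pi.add_apply, Pi.sub_apply, arrD_mul, hR, hQ, e3]
  linear_combination e4

/-- `varArr` sorted by the tails of `u^i` in `λ` and of `u^j` in `μ`, as `varAdj` is sorted by the
nonlocal variables. -/
theorem varArr_eq (i j e : Fin n) : varArr hP i j e = varLoc hP i j e
    + (fun m l => tailSer (A := DiffAlg U) tot (tailA hP i) m * adjA hP j e l)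
    - fun m l => tailSer (A := DiffAlg U) tot (tailA hP j) l * adjA hP i e m := by
  rw [varArr, arrLam_sub_arrD_eq (serD_tailSer _) (serD_tailSer _), varLoc, adjA, adjA,
    pd_one_tailA, pd_one_tailA, pd_one_ΓuA]

theorem varLoc_apply (hS : P.SkewAt (J.1 0)) (i j : Fin n) (m l : ℤ) :
    (fun e => varLoc hP i j e m l J) = P.adjLoc (J.1 0) (J.1 1) (famE j l) (famE j (l - 1))
      (famE i m) (famE i (m - 1)) := by
  funext e
  have e1 : tot (ΓA hP j i e) J = P.dΓForm (J.1 0) (Pi.single j 1) (Pi.single i 1)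
      (Pi.single e 1) (J.1 1) := evol_ΓA_apply hP _ J j i e
  have hW : ∀ i : Fin n, tailA hP i J = P.wForm (J.1 0) (Pi.single i 1) (J.1 1) := fun i => by
    rw [← dotProduct_bilVec, ← tailA_eq_wVec hP J, single_one_dotProduct]
  have e2 : ∀ (x : DiffAlg U) (a b : ℤ),
      arrLam (fun m => if m = 0 then x else 0) a b J = if b = 0 then if a = 0 then x J else 0 else 0 :=
    fun x a b => by
      rw [arrLam]
      split_ifs <;> rfl
  have e3 : tot (arrLam (fun m => if m = 0 then ΓA hP j i e else 0) m l) J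
      = if l = 0 then if m = 0 then tot (ΓA hP j i e) J else 0 else 0 := by
    rw [arrLam]
    split_ifs
    · rfl
    all_goals
      rw [map_zero]
      rfl
  have e4 : arrLam (fun m => (if m = 1 then pd 0 e (gA hP j i) else 0)
      + if m = 0 then pd 0 e (ΓuA hP j i) else 0) m l J
      = if l = 0 then (if m = 1 then pd 0 e (gA hP j i) J else 0)
        + (if m = 0 then pd 0 e (ΓuA hP j i) J else 0) else 0 := by
    rw [arrLam]
    split_ifs <;> simp
  rw [varLoc, Pi.add_apply, Pi.add_apply, Pi.sub_apply, Pi.sub_apply, Pi.sub_apply, Pi.sub_apply,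
    DiffAlg.add_apply, DiffAlg.sub_apply, DiffAlg.sub_apply, arrD, DiffAlg.add_apply,
    DiffAlg.add_apply, e2, e2, e2, e2, e3, e4, e1, pd_zero_gA_apply, pd_zero_ΓuA_apply,
    hS.compat, DiffAlg.mul_apply, DiffAlg.mul_apply, hW, hW, HydroOp.adjLoc, covec]
  simp only [LinearMap.sub_apply, LinearMap.add_apply, LinearMap.smul_apply, LinearMap.flip_apply,
    ofField_apply, famE, smul_eq_mul]
  by_cases h0 : m = 0
  · subst h0
    by_cases h1 : l = 0
    · subst h1
      simp
    · by_cases h2 : l - 1 = 0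
      · simp [h1, h2]
      · simp [h1, h2]
  · by_cases h1 : l = 0
    · subst h1
      by_cases h2 : m - 1 = 0
      · simp [show m = 1 by omega]
      · simp [h0, h2, show m ≠ 1 by omega]
    · simp [h0, h1]

/-- `(λ + μ + ∂)` applied to `varLoc` at a jet. -/
def varDer (i j : Fin n) (m l : ℤ) (e : Fin n) : ℝ :=
  arrD (A := DiffAlg U) tot (varLoc hP i j e) m l J

theorem varArr_apply (hS : P.SkewAt (J.1 0)) (i j : Fin n) (m l : ℤ) :
    (fun e => varArr hP i j e m l J)
      = P.adjLoc (J.1 0) (J.1 1) (famE j l) (famE j (l - 1)) (famE i m) (famE i (m - 1))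
        + tailAt hP J i m • P.adjTail (J.1 0) (J.1 1) (famE j l) (famE j (l - 1))
        - tailAt hP J j l • P.adjTail (J.1 0) (J.1 1) (famE i m) (famE i (m - 1)) := by
  rw [← varLoc_apply hP J hS, ← adjA_apply hP J, ← adjA_apply hP J]
  funext e
  rw [varArr_eq]
  rfl

theorem arrD_varArr_apply (i j : Fin n) (m l : ℤ) :
    (fun e => arrD (A := DiffAlg U) tot (varArr hP i j e) m l J)
      = varDer hP J i j m l + tailAt hP J i m • adjDer hP J j l
        + P.wForm (J.1 0) (famE i m) (J.1 1)
          • P.adjTail (J.1 0) (J.1 1) (famE j l) (famE j (l - 1))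
        - tailAt hP J j l • adjDer hP J i m
        - P.wForm (J.1 0) (famE j l) (J.1 1)
          • P.adjTail (J.1 0) (J.1 1) (famE i m) (famE i (m - 1)) := by
  rw [← adjA_apply hP J, ← adjA_apply hP J, ← serC_tailA_apply hP J, ← serC_tailA_apply hP J]
  funext e
  have e1 : (fun m l => tailSer (A := DiffAlg U) tot (tailA hP j) l * adjA hP i e m)
      = fun m l => adjA hP i e m * tailSer (A := DiffAlg U) tot (tailA hP j) l := by
    funext m l
    exact mul_comm _ _
  rw [varArr_eq, e1, arrD_sub, arrD_add, Pi.sub_apply, Pi.sub_apply, Pi.add_apply, Pi.add_apply,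
    arrD_mul, arrD_mul, serD_tailSer, serD_tailSer]
  simp only [DiffAlg.sub_apply, DiffAlg.add_apply, DiffAlg.mul_apply, Pi.add_apply, Pi.sub_apply,
    Pi.smul_apply, smul_eq_mul, varDer, adjDer, tailAt]
  ring

/-- The velocity of the field under the flow of `u^i`, coefficient of `λ^m`. -/
abbrev flow (i : Fin n) (m : ℤ) : Fin n → ℝ :=
  P.loc (J.1 0) (J.1 1) (famE i m) (famE i (m - 1)) + tailAt hP J i m • P.wVec (J.1 0) (J.1 1)

/-- The derivative of the velocity of the field under the flow of `u^i`. -/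
abbrev flowDer (i : Fin n) (m : ℤ) : Fin n → ℝ :=
  locDer hP J i m + tailAt hP J i m • tailDer hP J
    + P.wForm (J.1 0) (famE i m) (J.1 1) • P.wVec (J.1 0) (J.1 1)

theorem hamD_gA_apply (i k j : Fin n) (m : ℤ) : hamD hP i m (gA hP k j) J
    = P.dgForm (J.1 0) (Pi.single k 1) (Pi.single j 1) (flow hP J i m) := by
  rw [hamD, evol_gA_apply, flow, ← brA_eq_loc]
  rfl

theorem hamD_ΓuA_apply (i k j : Fin n) (m : ℤ) : hamD hP i m (ΓuA hP k j) J
    = P.dΓForm (J.1 0) (Pi.single k 1) (Pi.single j 1) (J.1 1) (flow hP J i m)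
      + P.ΓForm (J.1 0) (Pi.single k 1) (Pi.single j 1) (flowDer hP J i m) := by
  rw [hamD, evol_ΓuA_apply, flow, flowDer, ← brA_eq_loc, ← serD_brA_eq_loc]
  rfl

theorem hamD_tailA_apply (i k : Fin n) (m : ℤ) : hamD hP i m (tailA hP k) J
    = P.linTail (J.1 0) (J.1 1) (Pi.single k 1) (flow hP J i m) (flowDer hP J i m) := by
  rw [hamD, evol_tailA_apply, flow, flowDer, ← brA_eq_loc, ← serD_brA_eq_loc]
  rfl

theorem outerLoc_apply (i j k : Fin n) (m l : ℤ) : outerLoc hP i j k m l J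
    = P.linLoc (J.1 0) (J.1 1) (Pi.single k 1) (famE j l) (famE j (l - 1)) (flow hP J i m)
        (flowDer hP J i m)
      + tailAt hP J j l
        * P.linTail (J.1 0) (J.1 1) (Pi.single k 1) (flow hP J i m) (flowDer hP J i m) := by
  have e1 : ∀ (q : Prop) [Decidable q] (x : DiffAlg U),
      (if q then x else 0) J = if q then x J else 0 := fun q _ x => by
    split_ifs <;> rfl
  rw [outerLoc, DiffAlg.add_apply, DiffAlg.add_apply, e1, e1, DiffAlg.mul_apply, hamD_gA_apply,
    hamD_ΓuA_apply, hamD_tailA_apply, HydroOp.linLoc, famE, famE, tailAt]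
  rw [mul_comm (P.linTail _ _ _ _ _)]
  congr 1
  by_cases h0 : l = 0
  · subst h0
    simp
  · by_cases h1 : l - 1 = 0
    · simp [show l = 1 by omega]
    · simp [h0, h1, show l ≠ 1 by omega]

theorem innerLoc_apply (i j k : Fin n) (m l : ℤ) : innerLoc hP i j k m l J
    = P.gForm (J.1 0) (Pi.single k 1)
        (fun e => arrD (A := DiffAlg U) tot (varArr hP i j e) m l J)
      + P.ΓForm (J.1 0) (Pi.single k 1) (fun e => varArr hP i j e m l J) (J.1 1) := by
  rw [innerLoc, Finset.sum_apply, Finset.sum_apply, sum_apply, bilForm_apply, triForm_apply]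
  simp only [Pi.add_apply, DiffAlg.add_apply, DiffAlg.mul_apply, ΓuA_apply, ofField_apply,
    Finset.sum_add_distrib, Finset.sum_mul]
  simp [Pi.single_apply]
  refine Finset.sum_congr rfl fun e _ => Finset.sum_congr rfl fun f _ => by ring

theorem innerTail_apply (i j : Fin n) (m l : ℤ) : innerTail hP i j m l J
    = (fun e => varArr hP i j e m l J) ⬝ᵥ P.wVec (J.1 0) (J.1 1) := by
  rw [innerTail, Finset.sum_apply, Finset.sum_apply, sum_apply, ← tailA_eq_wVec hP J]
  exact Finset.sum_congr rfl fun e _ => mul_comm _ _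

theorem arrLam_hamD_apply (i j : Fin n) (m l : ℤ) :
    arrLam (fun m => hamD hP i m (tailA hP j)) m l J
    = P.linTail (J.1 0) (J.1 1) (famE j l) (flow hP J i m) (flowDer hP J i m) := by
  rw [arrLam, famE]
  split_ifs
  · exact hamD_tailA_apply hP J i j m
  · simp [HydroOp.linTail]

end JetPoint

/-! ### The Jacobi expression of the bracket as an element of `V_{λ,μ}` -/

section JacobiArray

open TopologicalSpace (Opens)
open DiffAlg

variable {n : ℕ} {U : Opens (Fin n → ℝ)} {P : HydroOp n} (hP : P.SmoothOn U) (J : JetOver U)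

/-- The vector `w^i_e W^e`. -/
def wTail (i : Fin n) : DiffAlg U := ∑ e, wA hP i e * tailA hP e

/-- The vector `Γ^{ij}_e W^e`. -/
def ΓTail (i j : Fin n) : DiffAlg U := ∑ e, ΓA hP i j e * tailA hP e

/-- The element of `V_{λ,μ}` that the argument of the outer `(λ + μ + ∂)⁻¹` is the derivative of. -/
def bdryA (i j : Fin n) : ℤ → ℤ → DiffAlg U :=
  (fun m l => serC (1 : DiffAlg U) m * serC (ΓTail hP j i) l)
    - (∑ e, fun m l => serC (wA hP i e) m * locA hP j e l)
    - (∑ e, fun m l => adjA hP i e m * serC (gA hP j e) l)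
    + (fun m l => tailSer (A := DiffAlg U) tot (tailA hP i) m * serC (wTail hP j) l)
    - fun m l => serC (wTail hP i) m * tailSer (A := DiffAlg U) tot (tailA hP j) l

theorem wTail_apply (i : Fin n) : wTail hP i J
    = P.wForm (J.1 0) (Pi.single i 1) (P.wVec (J.1 0) (J.1 1)) := by
  rw [wTail, sum_apply, ← tailA_eq_wVec hP J, bilForm_apply]
  simp [Pi.single_apply]

theorem ΓTail_apply (i j : Fin n) : ΓTail hP i j J
    = P.ΓForm (J.1 0) (Pi.single i 1) (Pi.single j 1) (P.wVec (J.1 0) (J.1 1)) := by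
  rw [ΓTail, sum_apply, ← tailA_eq_wVec hP J, triForm_apply]
  simp [Pi.single_apply]

theorem tot_wTail_apply (i : Fin n) : tot (wTail hP i) J
    = P.dwForm (J.1 0) (Pi.single i 1) (P.wVec (J.1 0) (J.1 1)) (J.1 1)
      + P.wForm (J.1 0) (Pi.single i 1) (tailDer hP J) := by
  have e1 : ∀ e, tot (wA hP i e) J
      = P.dwForm (J.1 0) (Pi.single i 1) (Pi.single e 1) (J.1 1) := evol_wA_apply hP _ J i
  rw [wTail, map_sum, sum_apply, ← sum_dwForm_single, ← tailA_eq_wVec hP J, bilForm_apply]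
  simp only [Derivation.leibniz, smul_eq_mul, DiffAlg.add_apply, DiffAlg.mul_apply, e1,
    Finset.sum_add_distrib]
  simp [Pi.single_apply, add_comm, tailDer]

theorem tot_ΓTail_apply (i j : Fin n) : tot (ΓTail hP i j) J
    = P.dΓForm (J.1 0) (Pi.single i 1) (Pi.single j 1) (P.wVec (J.1 0) (J.1 1)) (J.1 1)
      + P.ΓForm (J.1 0) (Pi.single i 1) (Pi.single j 1) (tailDer hP J) := by
  have e1 : ∀ e, tot (ΓA hP i j e) J
      = P.dΓForm (J.1 0) (Pi.single i 1) (Pi.single j 1) (Pi.single e 1) (J.1 1) :=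
    evol_ΓA_apply hP _ J i j
  rw [ΓTail, map_sum, sum_apply, ← sum_dΓForm_single, ← tailA_eq_wVec hP J, triForm_apply]
  simp only [Derivation.leibniz, smul_eq_mul, DiffAlg.add_apply, DiffAlg.mul_apply, e1,
    Finset.sum_add_distrib]
  simp [Pi.single_apply, add_comm, tailDer]

theorem serC_wTail_apply (i : Fin n) (m : ℤ) : serC (wTail hP i) m J
    = P.wForm (J.1 0) (famE i m) (P.wVec (J.1 0) (J.1 1)) := by
  rw [serC_apply_jet, wTail_apply, famE]
  split_ifs <;> simp

theorem serD_serC_wTail_apply (i : Fin n) (m : ℤ) :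
    serD (A := DiffAlg U) tot (serC (wTail hP i)) m J
    = P.dwForm (J.1 0) (famE i m) (P.wVec (J.1 0) (J.1 1)) (J.1 1)
      + P.wForm (J.1 0) (famE i (m - 1)) (P.wVec (J.1 0) (J.1 1))
      + P.wForm (J.1 0) (famE i m) (tailDer hP J) := by
  rw [serD_serC_apply_jet, wTail_apply, tot_wTail_apply, famE, famE]
  split_ifs <;> simp [add_comm, add_left_comm]

theorem serC_one_mul_ΓTail_apply (i j : Fin n) (m l : ℤ) :
    serC (1 : DiffAlg U) m J * serC (ΓTail hP j i) l J
    = P.ΓForm (J.1 0) (famE j l) (famE i m) (P.wVec (J.1 0) (J.1 1)) := by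
  rw [serC_apply_jet, serC_apply_jet, ΓTail_apply, famE, famE]
  split_ifs <;> simp

theorem arrD_one_mul_ΓTail_apply (i j : Fin n) (m l : ℤ) :
    arrD (A := DiffAlg U) tot (fun m l => serC (1 : DiffAlg U) m * serC (ΓTail hP j i) l) m l J
    = P.dΓForm (J.1 0) (famE j l) (famE i m) (P.wVec (J.1 0) (J.1 1)) (J.1 1)
      + P.ΓForm (J.1 0) (famE j (l - 1)) (famE i m) (P.wVec (J.1 0) (J.1 1))
      + P.ΓForm (J.1 0) (famE j l) (famE i (m - 1)) (P.wVec (J.1 0) (J.1 1))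
      + P.ΓForm (J.1 0) (famE j l) (famE i m) (tailDer hP J) := by
  have e1 : tot (1 : DiffAlg U) J = 0 := by
    rw [Derivation.map_one_eq_zero]
    rfl
  rw [arrD_mul, DiffAlg.add_apply, DiffAlg.mul_apply, DiffAlg.mul_apply, serD_serC_apply_jet,
    serD_serC_apply_jet, serC_apply_jet, serC_apply_jet, ΓTail_apply, tot_ΓTail_apply, e1,
    DiffAlg.one_apply, famE, famE, famE, famE]
  by_cases h1 : m = 0
  · by_cases h2 : l = 0
    · simp [h1, h2]
    · by_cases h3 : l - 1 = 0
      · simp [h1, h2, h3]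
      · simp [h1, h2, h3]
  · by_cases h2 : l = 0
    · by_cases h3 : m - 1 = 0
      · simp [h1, h2, h3]
      · simp [h1, h2, h3]
    · simp [h1, h2]

theorem sum_serC_wA_apply (i : Fin n) (m : ℤ) (φ : Fin n → ℝ) :
    ∑ e, serC (wA hP i e) m J * φ e = P.wForm (J.1 0) (famE i m) φ := by
  simp only [serC_apply_jet, bilForm_famE, ofField_apply]
  split_ifs <;> simp

theorem sum_serC_gA_apply (i : Fin n) (m : ℤ) (φ : Fin n → ℝ) :
    ∑ e, φ e * serC (gA hP i e) m J = P.gForm (J.1 0) (famE i m) φ := by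
  simp only [serC_apply_jet, bilForm_famE, ofField_apply]
  split_ifs <;> simp [mul_comm]

theorem sum_serD_serC_wA_apply (i : Fin n) (m : ℤ) (φ : Fin n → ℝ) :
    ∑ e, serD (A := DiffAlg U) tot (serC (wA hP i e)) m J * φ e
      = P.dwForm (J.1 0) (famE i m) φ (J.1 1) + P.wForm (J.1 0) (famE i (m - 1)) φ := by
  have e1 : ∀ e, tot (wA hP i e) J
      = P.dwForm (J.1 0) (Pi.single i 1) (Pi.single e 1) (J.1 1) := evol_wA_apply hP _ J i
  simp only [serD_serC_apply_jet, add_mul, Finset.sum_add_distrib, e1, ofField_apply]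
  rw [add_comm, bilForm_famE]
  congr 1
  · rw [famE]
    split_ifs
    · simp only [mul_comm _ (φ _)]
      exact sum_dwForm_single _ _ _ _
    · simp
  · split_ifs <;> simp

theorem sum_dgForm_single (v α φ ψ : Fin n → ℝ) :
    ∑ e, φ e * P.dgForm v α (Pi.single e 1) ψ = P.dgForm v α φ ψ :=
  dotProduct_eq_of_linear ((P.dgForm v α).flip ψ) φ

theorem sum_serD_serC_gA_apply (i : Fin n) (m : ℤ) (φ : Fin n → ℝ) :
    ∑ e, φ e * serD (A := DiffAlg U) tot (serC (gA hP i e)) m J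
      = P.dgForm (J.1 0) (famE i m) φ (J.1 1) + P.gForm (J.1 0) (famE i (m - 1)) φ := by
  have e1 : ∀ e, tot (gA hP i e) J
      = P.dgForm (J.1 0) (Pi.single i 1) (Pi.single e 1) (J.1 1) := evol_gA_apply hP _ J i
  simp only [serD_serC_apply_jet, mul_add, Finset.sum_add_distrib, e1, ofField_apply]
  rw [add_comm, bilForm_famE]
  congr 1
  · rw [famE]
    split_ifs
    · exact sum_dgForm_single _ _ _ _
    · simp
  · split_ifs <;> simp [mul_comm]

theorem bdryA_apply (i j : Fin n) (m l : ℤ) : bdryA hP i j m l J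
    = P.bdry (J.1 0) (J.1 1) (famE j l) (famE i m)
        (P.loc (J.1 0) (J.1 1) (famE j l) (famE j (l - 1)))
        (P.adjTail (J.1 0) (J.1 1) (famE i m) (famE i (m - 1)))
      + tailAt hP J i m * P.wForm (J.1 0) (famE j l) (P.wVec (J.1 0) (J.1 1))
      - tailAt hP J j l * P.wForm (J.1 0) (famE i m) (P.wVec (J.1 0) (J.1 1)) := by
  rw [← locA_apply hP J, ← adjA_apply hP J, HydroOp.bdry, ← sum_serC_wA_apply hP,
    ← sum_serC_gA_apply hP, ← serC_one_mul_ΓTail_apply hP, ← serC_wTail_apply hP,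
    ← serC_wTail_apply hP,
    tailAt, tailAt]
  simp only [bdryA, Pi.add_apply, Pi.sub_apply, Finset.sum_apply, DiffAlg.add_apply,
    DiffAlg.sub_apply, DiffAlg.mul_apply, sum_apply]
  ring

theorem arrD_sum {A : Type*} [CommRing A] [Algebra ℝ A] (d : Derivation ℝ A A) {ι : Type*}
    (s : Finset ι) (a : ι → ℤ → ℤ → A) : arrD d (∑ i ∈ s, a i) = ∑ i ∈ s, arrD d (a i) := by
  funext m l
  simp only [arrD, Finset.sum_apply, map_sum, Finset.sum_add_distrib]

theorem arrD_bdryA_apply (i j : Fin n) (m l : ℤ) :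
    arrD (A := DiffAlg U) tot (bdryA hP i j) m l J
    = P.bdryDeriv (J.1 0) (J.1 1) (famE j l) (famE j (l - 1)) (famE i m) (famE i (m - 1))
        (tailDer hP J) (P.loc (J.1 0) (J.1 1) (famE j l) (famE j (l - 1))) (locDer hP J j l)
        (P.adjTail (J.1 0) (J.1 1) (famE i m) (famE i (m - 1))) (adjDer hP J i m)
      + (P.wForm (J.1 0) (famE i m) (J.1 1)
          * P.wForm (J.1 0) (famE j l) (P.wVec (J.1 0) (J.1 1))
        + tailAt hP J i m * (P.dwForm (J.1 0) (famE j l) (P.wVec (J.1 0) (J.1 1)) (J.1 1)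
          + P.wForm (J.1 0) (famE j (l - 1)) (P.wVec (J.1 0) (J.1 1))
          + P.wForm (J.1 0) (famE j l) (tailDer hP J)))
      - (P.wForm (J.1 0) (famE j l) (J.1 1)
          * P.wForm (J.1 0) (famE i m) (P.wVec (J.1 0) (J.1 1))
        + tailAt hP J j l * (P.dwForm (J.1 0) (famE i m) (P.wVec (J.1 0) (J.1 1)) (J.1 1)
          + P.wForm (J.1 0) (famE i (m - 1)) (P.wVec (J.1 0) (J.1 1))
          + P.wForm (J.1 0) (famE i m) (tailDer hP J))) := by
  have h1 := arrD_one_mul_ΓTail_apply hP J i j m l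
  have h2 := sum_serD_serC_wA_apply hP J i m (fun e => locA hP j e l J)
  have h3 := sum_serC_wA_apply hP J i m (locDer hP J j l)
  have h4 := sum_serC_gA_apply hP J j l (adjDer hP J i m)
  have h5 := sum_serD_serC_gA_apply hP J j l (fun e => adjA hP i e m J)
  simp only [locDer, adjDer] at h3 h4
  rw [← locA_apply hP J, ← adjA_apply hP J, HydroOp.bdryDeriv, ← serD_serC_wTail_apply,
    ← serD_serC_wTail_apply, ← serC_wTail_apply hP, ← serC_wTail_apply hP, ← serC_tailA_apply hP,
    ← serC_tailA_apply hP, tailAt, tailAt, bdryA, arrD_sub, arrD_add, arrD_sub, arrD_sub,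
    arrD_sum, arrD_sum, Pi.sub_apply, Pi.sub_apply, Pi.add_apply, Pi.add_apply, Pi.sub_apply,
    Pi.sub_apply, Pi.sub_apply, Pi.sub_apply, DiffAlg.sub_apply, DiffAlg.add_apply,
    DiffAlg.sub_apply, DiffAlg.sub_apply, h1]
  simp only [arrD_mul, serD_tailSer, Finset.sum_apply, sum_apply, DiffAlg.add_apply,
    DiffAlg.mul_apply, Finset.sum_add_distrib]
  linear_combination -h2 - h3 - h4 - h5

/-- `locCoeff` for the generators `u^i`, `u^j`, `u^k`. -/
def locAt (i j k : Fin n) (m l : ℤ) : ℝ :=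
  P.locCoeff (J.1 0) (J.1 1) (Pi.single k 1) (famE j l) (famE j (l - 1)) (famE i m) (famE i (m - 1))
    (P.loc (J.1 0) (J.1 1) (famE j l) (famE j (l - 1))) (locDer hP J j l)
    (P.loc (J.1 0) (J.1 1) (famE i m) (famE i (m - 1))) (locDer hP J i m)
    (P.adjTail (J.1 0) (J.1 1) (famE j l) (famE j (l - 1)))
    (P.adjTail (J.1 0) (J.1 1) (famE i m) (famE i (m - 1)))
    (P.adjLoc (J.1 0) (J.1 1) (famE j l) (famE j (l - 1)) (famE i m) (famE i (m - 1)))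
    (varDer hP J i j m l)

/-- `nonlocCoeff` for the generator `u^i`. -/
def nonlocAt (p : Fin n → ℝ) (i : Fin n) (m : ℤ) : ℝ :=
  P.nonlocCoeff (J.1 0) (J.1 1) p (famE i m) (famE i (m - 1)) (tailDer hP J)
    (P.loc (J.1 0) (J.1 1) (famE i m) (famE i (m - 1))) (locDer hP J i m)
    (P.adjTail (J.1 0) (J.1 1) (famE i m) (famE i (m - 1))) (adjDer hP J i m)

theorem tailA_apply_eq_wForm (k : Fin n) :
    tailA hP k J = P.wForm (J.1 0) (Pi.single k 1) (J.1 1) := by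
  rw [← dotProduct_bilVec, ← tailA_eq_wVec hP J, single_one_dotProduct]

/-- The part of the Jacobi expression without `(λ + μ + ∂)⁻¹`. It is given by the identity
`jacobi_local_identity`, with `e_j` and `e_i` for the covectors `q` and `r`, on which the derivative
acts as multiplication by `μ` and `λ`, and the series `(μ + ∂)⁻¹ W^j` and `(λ + ∂)⁻¹ W^i` for the
nonlocal variables. -/
theorem jacobi_loc_apply (hS : P.SkewAt (J.1 0)) (i j k : Fin n) (m l : ℤ) :
    (outerLoc hP i j k m l - outerLoc hP j i k l m - innerLoc hP i j k m l) J
      = locAt hP J i j k m l + tailAt hP J j l * nonlocAt hP J (Pi.single k 1) i m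
        - tailAt hP J i m * nonlocAt hP J (Pi.single k 1) j l
        - tailA hP k J * bdryA hP i j m l J := by
  rw [DiffAlg.sub_apply, DiffAlg.sub_apply, outerLoc_apply, outerLoc_apply, innerLoc_apply,
    varArr_apply hP J hS, arrD_varArr_apply, bdryA_apply, tailA_apply_eq_wForm, ← sub_sub]
  exact P.jacobi_local_identity (J.1 0) (J.1 1) (Pi.single k 1) (famE j l) (famE j (l - 1))
    (famE i m) (famE i (m - 1)) (tailDer hP J) _ (locDer hP J j l) _ (locDer hP J i m) _
    (adjDer hP J j l) _ (adjDer hP J i m) _ (varDer hP J i j m l) _ _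

/-- The argument of `(λ + μ + ∂)⁻¹` in the Jacobi expression, given by `tail_identity`. -/
theorem jacobi_tail_apply (hS : P.SkewAt (J.1 0)) (i j : Fin n) (m l : ℤ) :
    (arrLam (fun m => hamD hP i m (tailA hP j)) m l
      - arrLam (fun m => hamD hP j m (tailA hP i)) l m - innerTail hP i j m l) J
      = arrD (A := DiffAlg U) tot (bdryA hP i j) m l J + nonlocAt hP J (famE j l) i m := by
  rw [DiffAlg.sub_apply, DiffAlg.sub_apply, arrLam_hamD_apply, arrLam_hamD_apply, innerTail_apply,
    varArr_apply hP J hS, arrD_bdryA_apply]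
  exact HydroOp.tail_identity hS (famE j l) (famE j (l - 1)) (famE i m) (famE i (m - 1))
    (tailDer hP J) _ (locDer hP J j l) _ (locDer hP J i m) (adjDer hP J i m) _ _ rfl

/-- Under the conditions the nonlocal coefficient vanishes. -/
theorem nonlocAt_eq_zero (hS : ∀ v ∈ U, P.SkewAt v) (hJ : ∀ v ∈ U, P.JacobiAt v)
    (hs : ∀ v ∈ U, Function.Surjective (P.gVec v)) (k i : Fin n) (m : ℤ) :
    nonlocAt hP J (Pi.single k 1) i m = 0 := by
  have h1 : (∑ e, fun m => adjA hP i e m * gA hP k e)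
      = serC (ΓTail hP k i) - ∑ e, fun m => locA hP i e m * wA hP k e := by
    funext m
    ext J'
    have h := HydroOp.gForm_adjTail (ξ := J'.1 1) (hS _ J'.2) (hJ _ J'.2) (Pi.single k 1)
      (famE i m) (famE i (m - 1))
    have e1 : P.ΓForm (J'.1 0) (Pi.single k 1) (famE i m) (P.wVec (J'.1 0) (J'.1 1))
        = serC (ΓTail hP k i) m J' := by
      rw [serC_apply_jet, ΓTail_apply, famE]
      split_ifs <;> simp
    rw [e1, ← locA_apply hP, ← adjA_apply hP, bilForm_apply, bilForm_apply] at h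
    simp only [Finset.sum_apply, Pi.sub_apply, DiffAlg.sub_apply, sum_apply, DiffAlg.mul_apply,
      ofField_apply]
    simp only [Pi.single_apply, mul_ite, mul_one, mul_zero, ite_mul, zero_mul, Finset.sum_ite_irrel,
      Finset.sum_const_zero, Finset.sum_ite_eq', Finset.mem_univ, if_true] at h
    simp only [mul_comm (adjA hP i _ m J'), mul_comm (locA hP i _ m J'), h]
    ring
  have h2 := congrArg (fun F => serD (A := DiffAlg U) tot F m J) h1
  simp only [map_sub, map_sum, Pi.sub_apply, Finset.sum_apply, DiffAlg.sub_apply, sum_apply,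
    serD_mul, DiffAlg.add_apply, DiffAlg.mul_apply, Finset.sum_add_distrib] at h2
  have e1 : ∀ e, tot (gA hP k e) J
      = P.dgForm (J.1 0) (Pi.single k 1) (Pi.single e 1) (J.1 1) := evol_gA_apply hP _ J k
  have e2 : ∀ e, tot (wA hP k e) J
      = P.dwForm (J.1 0) (Pi.single k 1) (Pi.single e 1) (J.1 1) := evol_wA_apply hP _ J k
  have e3 : serD (A := DiffAlg U) tot (serC (ΓTail hP k i)) m J
      = P.dΓForm (J.1 0) (Pi.single k 1) (famE i m) (P.wVec (J.1 0) (J.1 1)) (J.1 1)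
        + P.ΓForm (J.1 0) (Pi.single k 1) (famE i (m - 1)) (P.wVec (J.1 0) (J.1 1))
        + P.ΓForm (J.1 0) (Pi.single k 1) (famE i m) (tailDer hP J) := by
    rw [serD_serC_apply_jet, ΓTail_apply, tot_ΓTail_apply, famE, famE]
    split_ifs <;> simp [add_comm, add_left_comm]
  have e4 : ∀ (a : Fin n → Fin n → ℝ) (φ : Fin n → ℝ),
      bilForm a (Pi.single k 1) φ = ∑ e, φ e * a k e := fun a φ => by
    simp [bilForm_apply, Pi.single_apply, mul_comm]
  simp only [e1, e2, e3] at h2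
  rw [sum_dgForm_single (J.1 0) (Pi.single k 1) (fun e => adjA hP i e m J),
    sum_dwForm_single (J.1 0) (Pi.single k 1) (fun e => locA hP i e m J), adjA_apply,
    locA_apply] at h2
  refine HydroOp.nonlocCoeff_eq_zero (hS _ J.2) (hJ _ J.2) (hs _ J.2) _ _ _ _ _ _ ?_
  rw [e4, e4]
  simp only [adjDer, locDer]
  simp only [ofField_apply] at h2
  linear_combination h2

theorem arrD_mul_right {A : Type*} [CommRing A] [Algebra ℝ A] (d : Derivation ℝ A A)
    (a : ℤ → ℤ → A) (b : A) (m l : ℤ) :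
    arrD d (fun m l => a m l * b) m l = arrD d a m l * b + a m l * d b := by
  rw [arrD, arrD, Derivation.leibniz, smul_eq_mul, smul_eq_mul]
  ring

theorem sum_serC_ΓA_apply (k i : Fin n) (m : ℤ) (φ : Fin n → ℝ) :
    ∑ e, φ e * serC (ΓA hP k i e) m J = P.ΓForm (J.1 0) (Pi.single k 1) (famE i m) φ := by
  simp only [serC_apply_jet, famE, ofField_apply]
  split_ifs
  · simp [triForm_apply, Pi.single_apply, mul_comm]
  · simp

theorem sum_serD_serC_ΓA_apply (k i : Fin n) (m : ℤ) (φ : Fin n → ℝ) :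
    ∑ e, φ e * serD (A := DiffAlg U) tot (serC (ΓA hP k i e)) m J
      = P.dΓForm (J.1 0) (Pi.single k 1) (famE i m) φ (J.1 1)
        + P.ΓForm (J.1 0) (Pi.single k 1) (famE i (m - 1)) φ := by
  have e1 : ∀ e, tot (ΓA hP k i e) J = P.dΓForm (J.1 0) (Pi.single k 1) (Pi.single i 1)
      (Pi.single e 1) (J.1 1) := evol_ΓA_apply hP _ J k i
  simp only [serD_serC_apply_jet, mul_add, Finset.sum_add_distrib, e1]
  rw [add_comm]
  congr 1
  · rw [famE]
    split_ifs
    · exact sum_dΓForm_single _ _ _ _ _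
    · simp
  · rw [← sum_serC_ΓA_apply hP]
    simp only [serC_apply_jet]

/-- Under the conditions the local part of the Jacobi expression vanishes. -/
theorem locAt_eq_zero (hS : ∀ v ∈ U, P.SkewAt v) (hJ : ∀ v ∈ U, P.JacobiAt v)
    (hs : ∀ v ∈ U, Function.Surjective (P.gVec v)) (i j k : Fin n) (m l : ℤ) :
    locAt hP J i j k m l = 0 := by
  have e4 : ∀ (a : Fin n → Fin n → ℝ) (φ : Fin n → ℝ),
      bilForm a (Pi.single k 1) φ = ∑ e, φ e * a k e := fun a φ => by
    simp [bilForm_apply, Pi.single_apply, mul_comm]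
  have h1 : (∑ e, fun m l => varLoc hP i j e m l * gA hP k e)
      = (∑ e, fun m l => locA hP i e m * serC (ΓA hP k j e) l)
        - ∑ e, fun m l => serC (ΓA hP k i e) m * locA hP j e l := by
    funext m l
    ext J'
    have h := HydroOp.gForm_adjLoc (ξ := J'.1 1) (hS _ J'.2) (hJ _ J'.2) (Pi.single k 1)
      (famE j l) (famE j (l - 1)) (famE i m) (famE i (m - 1))
    rw [← locA_apply hP, ← locA_apply hP, ← varLoc_apply hP J' (hS _ J'.2), e4,
      ← sum_serC_ΓA_apply hP, ← sum_serC_ΓA_apply hP] at h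
    simp only [Finset.sum_apply, Pi.sub_apply, DiffAlg.sub_apply, sum_apply, DiffAlg.mul_apply,
      ofField_apply]
    simp only [mul_comm (locA hP j _ l J')] at h
    exact h
  have h2 := congrArg (fun F => arrD (A := DiffAlg U) tot F m l J) h1
  simp only [arrD_sub, arrD_sum, Pi.sub_apply, Finset.sum_apply, DiffAlg.sub_apply, sum_apply,
    arrD_mul, arrD_mul_right, DiffAlg.add_apply, DiffAlg.mul_apply, Finset.sum_add_distrib,
    mul_comm _ (locA hP j _ l J), mul_comm _ (serD (A := DiffAlg U) tot (locA hP j _) l J)] at h2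
  have e1 : ∀ e, tot (gA hP k e) J
      = P.dgForm (J.1 0) (Pi.single k 1) (Pi.single e 1) (J.1 1) := evol_gA_apply hP _ J k
  simp only [e1] at h2
  rw [sum_dgForm_single (J.1 0) (Pi.single k 1) (fun e => varLoc hP i j e m l J),
    sum_serD_serC_ΓA_apply hP J k j l (fun e => locA hP i e m J),
    sum_serD_serC_ΓA_apply hP J k i m (fun e => locA hP j e l J),
    sum_serC_ΓA_apply hP J k j l (fun e => serD (A := DiffAlg U) tot (locA hP i e) m J),
    sum_serC_ΓA_apply hP J k i m (fun e => serD (A := DiffAlg U) tot (locA hP j e) l J),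
    locA_apply, locA_apply, varLoc_apply hP J (hS _ J.2)] at h2
  refine HydroOp.locCoeff_eq_zero (hS _ J.2) (hJ _ J.2) (hs _ J.2) _ _ _ _ _ _ _ _ ?_
  rw [e4]
  simp only [varDer]
  simp only [ofField_apply] at h2
  unfold locDer
  linear_combination h2

end JacobiArray

/-! ### Injectivity of the expansions -/

section Injectivity

open PowerSeries (binomialSeries)

variable {x : ℤ → ℤ → ℕ → ℝ} {d : ℤ} {b : ℕ}

/-- The part of `∑ x_{mlp} λ^m μ^l (λ+μ)^{-p}` of degree `d`, at `λ = y`, `μ = 1`. -/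
def homPart (x : ℤ → ℤ → ℕ → ℝ) (d : ℤ) (y : ℝ) : ℝ :=
  ∑ᶠ p : ℕ, ∑ᶠ m : ℤ, x m (d + p - m) p * (y ^ m * ((1 + y) ^ p)⁻¹)

/-- Exchanging `λ` and `μ` replaces `y` by `y⁻¹`, up to a power of `y`. -/
theorem homPart_swap (x : ℤ → ℤ → ℕ → ℝ) (d : ℤ) {y : ℝ} (hy : 0 < y) :
    homPart (fun m l p => x l m p) d y = y ^ d * homPart x d y⁻¹ := by
  rw [homPart, homPart, mul_finsum]
  refine finsum_congr fun p => ?_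
  rw [mul_finsum, ← finsum_comp_equiv (Equiv.subLeft (d + p))]
  refine finsum_congr fun m => ?_
  have h1 : (1 : ℝ) + y⁻¹ = (1 + y) * y⁻¹ := by
    field_simp
    ring
  have h2 : (0 : ℝ) < 1 + y := by positivity
  simp only [Equiv.subLeft_apply, sub_sub_cancel]
  rw [h1, mul_pow, mul_inv, inv_zpow', inv_pow, inv_inv, zpow_sub₀ hy.ne', zpow_add₀ hy.ne',
    zpow_natCast, zpow_neg]
  field_simp

/-- The terms of degree `d` of the array `x` have exponents of absolute value less than `b`. -/
def DegBdd (x : ℤ → ℤ → ℕ → ℝ) (d : ℤ) (b : ℕ) : Prop :=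
  0 ≤ d + b ∧ ∀ m l (p : ℕ), m + l - p = d → x m l p ≠ 0 → -b < m ∧ m < b ∧ -b < l ∧ l < b ∧ p < b

theorem BddArr₃.exists_degBdd (hx : BddArr₃ x) (d : ℤ) : ∃ b, DegBdd x d b := by
  obtain ⟨M, hM⟩ := hx
  refine ⟨(2 * |M| + |d|).toNat + 1, ?_, fun m l p hd h => ?_⟩
  · have := neg_abs_le d
    have := abs_nonneg M
    omega
  · have h1 : m ≤ M := by
      by_contra hc
      exact h (hM m l p (Or.inl (not_le.1 hc)))
    have h2 : l ≤ M := by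
      by_contra hc
      exact h (hM m l p (Or.inr (not_le.1 hc)))
    have := le_abs_self M
    have := neg_abs_le d
    have := le_abs_self d
    have := abs_nonneg M
    have := abs_nonneg d
    omega

/-- A finitely supported sum over the integers, as a sum over a range after a shift by `K`. -/
theorem finsum_int_eq_sum_range (f : ℤ → ℝ) (K N : ℕ)
    (hf : ∀ m, f m ≠ 0 → -(K : ℤ) ≤ m ∧ m + K < N) :
    ∑ᶠ m, f m = ∑ j ∈ Finset.range N, f (j - K) := by
  rw [finsum_eq_finsum_comp f (e := fun j : ℕ => (j : ℤ) - K) fun i j h => by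
    simp only at h
    omega]
  · refine finsum_eq_sum_of_support_subset _ fun j hj => ?_
    have := hf _ hj
    simp only [Finset.coe_range, Set.mem_Iio]
    omega
  · intro m hm
    by_contra h
    have := hf m h
    exact hm (m + K).toNat (by omega)

theorem homPart_eq_sum (hb : DegBdd x d b) (y : ℝ) : homPart x d y
    = ∑ p ∈ Finset.range b, ∑ j ∈ Finset.range (3 * b),
      x (j - (2 * b : ℕ)) (d + p - (j - (2 * b : ℕ))) p
        * (y ^ ((j : ℤ) - (2 * b : ℕ)) * ((1 + y) ^ p)⁻¹) := by
  have h0 : ∀ (m : ℤ) (p : ℕ), x m (d + p - m) p * (y ^ m * ((1 + y) ^ p)⁻¹) ≠ 0 →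
      -b < m ∧ m < b ∧ p < b := fun m p h => by
    obtain ⟨h1, h2, -, -, h3⟩ := hb.2 m (d + p - m) p (by ring) (left_ne_zero_of_mul h)
    exact ⟨h1, h2, h3⟩
  rw [homPart, finsum_eq_sum_of_support_subset (s := Finset.range b)]
  · refine Finset.sum_congr rfl fun p _ => finsum_int_eq_sum_range _ _ _ fun m hm => ?_
    have := h0 m p hm
    push_cast
    omega
  · intro p hp
    by_contra h
    refine hp (finsum_eq_zero_of_forall_eq_zero fun m => ?_)
    by_contra hm
    exact h (by simpa using (h0 m p hm).2.2)

/-- The polynomial `(y (1 + y))^{2b}` times `homPart`. -/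
def homPoly (x : ℤ → ℤ → ℕ → ℝ) (d : ℤ) (b : ℕ) : Polynomial ℝ :=
  ∑ p ∈ Finset.range b, (∑ j ∈ Finset.range (3 * b),
    Polynomial.C (x (j - (2 * b : ℕ)) (d + p - (j - (2 * b : ℕ))) p) * Polynomial.X ^ j)
      * (1 + Polynomial.X) ^ (2 * b - p)

theorem eval_homPoly (hb : DegBdd x d b) {y : ℝ} (hy : 0 < y) :
    (homPoly x d b).eval y = (y * (1 + y)) ^ (2 * b) * homPart x d y := by
  have h1 : (0 : ℝ) < 1 + y := by positivity
  rw [homPart_eq_sum hb, homPoly, Polynomial.eval_finsetSum, Finset.mul_sum]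
  refine Finset.sum_congr rfl fun p hp => ?_
  rw [Polynomial.eval_mul, Polynomial.eval_finsetSum, Finset.sum_mul, Finset.mul_sum]
  refine Finset.sum_congr rfl fun j _ => ?_
  have h2 : p ≤ 2 * b := by
    have := Finset.mem_range.1 hp
    omega
  rw [zpow_sub₀ hy.ne', zpow_natCast, zpow_natCast]
  simp only [Polynomial.eval_mul, Polynomial.eval_C, Polynomial.eval_pow, Polynomial.eval_X,
    Polynomial.eval_add, Polynomial.eval_one]
  rw [pow_sub₀ _ h1.ne' h2, mul_pow]
  field_simp

theorem homPoly_eq_zero_iff (hb : DegBdd x d b) :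
    homPoly x d b = 0 ↔ ∀ y, 0 < y → homPart x d y = 0 := by
  constructor
  · intro h y hy
    have h1 := eval_homPoly hb hy
    rw [h, Polynomial.eval_zero] at h1
    have : (y * (1 + y)) ^ (2 * b) ≠ 0 := by positivity
    exact (mul_eq_zero.1 h1.symm).resolve_left this
  · intro h
    refine Polynomial.eq_zero_of_infinite_isRoot _ ((Set.Ioi_infinite (0 : ℝ)).mono fun y hy => ?_)
    change (homPoly x d b).eval y = 0
    rw [eval_homPoly hb hy, h y hy, mul_zero]

/-- The power series `∑ (expLM x a (d - a)) y^{a + 2b}`. -/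
def homSer (x : ℤ → ℤ → ℕ → ℝ) (d : ℤ) (b : ℕ) : PowerSeries ℝ :=
  ∑ p ∈ Finset.range b, binomialSeries ℝ (-p : ℤ) * ((∑ j ∈ Finset.range (3 * b),
    Polynomial.C (x (j - (2 * b : ℕ)) (d + p - (j - (2 * b : ℕ))) p) * Polynomial.X ^ j :
      Polynomial ℝ) : PowerSeries ℝ)

/-- Multiplication by `(1 + y)^{2b}` clears the denominators, all of which are powers of `1 + y`
with exponent less than `b`. -/
theorem homSer_mul (x : ℤ → ℤ → ℕ → ℝ) (d : ℤ) (b : ℕ) :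
    homSer x d b * (1 + PowerSeries.X) ^ (2 * b) = (homPoly x d b : PowerSeries ℝ) := by
  rw [homSer, homPoly, Finset.sum_mul, ← Polynomial.coeToPowerSeries.ringHom_apply, map_sum]
  refine Finset.sum_congr rfl fun p hp => ?_
  have h2 : (-p : ℤ) + (2 * b : ℕ) = (2 * b - p : ℕ) := by
    have := Finset.mem_range.1 hp
    omega
  rw [mul_right_comm, ← PowerSeries.binomialSeries_nat (R := ℤ),
    ← PowerSeries.binomialSeries_add, h2, PowerSeries.binomialSeries_nat, map_mul, mul_comm]
  congr 1
  simp

theorem coeff_homSer (hb : DegBdd x d b) (n : ℕ) :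
    PowerSeries.coeff n (homSer x d b) = expLM x (n - (2 * b : ℕ)) (d - (n - (2 * b : ℕ))) := by
  have hq : ∀ (p j : ℕ), (∑ j ∈ Finset.range (3 * b),
      Polynomial.C (x (j - (2 * b : ℕ)) (d + p - (j - (2 * b : ℕ))) p) * Polynomial.X ^ j
        : Polynomial ℝ).coeff j = x (j - (2 * b : ℕ)) (d + p - (j - (2 * b : ℕ))) p := by
    intro p j
    rw [Polynomial.finsetSum_coeff]
    simp only [Polynomial.coeff_C_mul, Polynomial.coeff_X_pow, mul_ite, mul_one, mul_zero,
      Finset.sum_ite_eq, Finset.mem_range]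
    split_ifs with h
    · rfl
    · by_contra hn
      have := hb.2 _ _ _ (by push_cast; ring) (Ne.symm hn)
      push_cast at this
      omega
  rw [homSer, map_sum, expLM, finsum_eq_sum_of_support_subset
    (s := Finset.range (n + 1) ×ˢ Finset.range b), Finset.sum_product_right]
  · refine Finset.sum_congr rfl fun p _ => ?_
    rw [PowerSeries.coeff_mul, Finset.Nat.sum_antidiagonal_eq_sum_range_succ (fun i j =>
      PowerSeries.coeff i (binomialSeries ℝ (-p : ℤ)) * PowerSeries.coeff j _)]
    refine Finset.sum_congr rfl fun k hk => ?_
    have hk' := Finset.mem_range.1 hk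
    rw [PowerSeries.binomialSeries_coeff, Polynomial.coeff_coe, hq, zsmul_one, smul_eq_mul,
      Nat.cast_sub (by omega)]
    congr 2
    · ring
    · ring
  · rintro ⟨k, p⟩ h
    have h' : ((Ring.choose (-(p : ℤ)) k : ℤ) : ℝ)
        * x (n - (2 * b : ℕ) - k) (d - (n - (2 * b : ℕ)) + p + k) p ≠ 0 := h
    have := hb.2 _ _ _ (by push_cast; ring) (right_ne_zero_of_mul h')
    simp only [Finset.coe_product, Finset.coe_range, Set.mem_prod, Set.mem_Iio]
    push_cast at this
    omega

/-- The expansion of the part of degree `d` vanishes exactly if its rational function does. -/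
theorem expLM_eq_zero_iff (hb : DegBdd x d b) :
    (∀ a, expLM x a (d - a) = 0) ↔ ∀ y, 0 < y → homPart x d y = 0 := by
  rw [← homPoly_eq_zero_iff hb]
  have h1 : homSer x d b = 0 ↔ homPoly x d b = 0 := by
    have h2 : ((1 : PowerSeries ℝ) + PowerSeries.X) ^ (2 * b) ≠ 0 := by
      refine pow_ne_zero _ fun h => ?_
      simpa using congrArg (PowerSeries.constantCoeff (R := ℝ)) h
    rw [← Polynomial.coe_eq_zero_iff, ← homSer_mul, mul_eq_zero, or_iff_left h2]
  rw [← h1]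
  constructor
  · intro h
    ext n
    rw [coeff_homSer hb, h, map_zero]
  · intro h a
    by_cases ha : 0 ≤ a + (2 * b : ℕ)
    · have h3 := coeff_homSer hb (a + (2 * b : ℕ)).toNat
      rw [h, map_zero, show ((a + (2 * b : ℕ)).toNat : ℤ) - (2 * b : ℕ) = a by omega] at h3
      exact h3.symm
    · refine finsum_eq_zero_of_forall_eq_zero fun kp => ?_
      by_contra hn
      have := hb.2 _ _ _ (by ring) (right_ne_zero_of_mul hn)
      push_cast at ha
      omega

/-- The numerator of the part of degree `d` of `∑ x_{mlp} λ^m μ^l (λ+μ)^{-p}` at `λ = 1`, in the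
variable `λ + μ`. -/
def sumPoly (x : ℤ → ℤ → ℕ → ℝ) (d : ℤ) (b : ℕ) : Polynomial ℝ :=
  ∑ p ∈ Finset.range b, ∑ j ∈ Finset.range (3 * b),
    Polynomial.C (x (j - (2 * b : ℕ)) (d + p - (j - (2 * b : ℕ))) p
        * (-1) ^ (d + p - (j - (2 * b : ℕ)))) * Polynomial.X ^ (2 * b - p)
      * (1 - Polynomial.X) ^ (d + p - (j - (2 * b : ℕ)) + (2 * b : ℕ)).toNat

/-- The power series `∑ (expLS x (d - c) c) s^{c + 2b}`. -/
def sumSer (x : ℤ → ℤ → ℕ → ℝ) (d : ℤ) (b : ℕ) : PowerSeries ℝ :=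
  ∑ p ∈ Finset.range b, ∑ j ∈ Finset.range (3 * b),
    PowerSeries.C (x (j - (2 * b : ℕ)) (d + p - (j - (2 * b : ℕ))) p
        * (-1) ^ (d + p - (j - (2 * b : ℕ)))) * PowerSeries.X ^ (2 * b - p)
      * PowerSeries.rescale (-1) (binomialSeries ℝ (d + p - (j - (2 * b : ℕ))))

theorem rescale_binomialSeries_nat (k : ℕ) :
    PowerSeries.rescale (-1 : ℝ) (binomialSeries ℝ (k : ℤ)) = (1 - PowerSeries.X) ^ k := by
  rw [PowerSeries.binomialSeries_nat, map_pow, map_add, map_one, PowerSeries.rescale_neg_one_X,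
    sub_eq_add_neg]

theorem sumSer_mul (hb : 0 ≤ d + b) :
    sumSer x d b * (1 - PowerSeries.X) ^ (2 * b) = (sumPoly x d b : PowerSeries ℝ) := by
  rw [sumSer, sumPoly, Finset.sum_mul, ← Polynomial.coeToPowerSeries.ringHom_apply, map_sum]
  refine Finset.sum_congr rfl fun p _ => ?_
  rw [Finset.sum_mul, map_sum]
  refine Finset.sum_congr rfl fun j hj => ?_
  have h2 : d + p - (j - (2 * b : ℕ)) + (2 * b : ℕ)
      = ((d + p - (j - (2 * b : ℕ)) + (2 * b : ℕ)).toNat : ℤ) := by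
    have := Finset.mem_range.1 hj
    push_cast
    omega
  generalize (d + p - (j - (2 * b : ℕ)) + (2 * b : ℕ)).toNat = k at h2 ⊢
  rw [mul_assoc, ← rescale_binomialSeries_nat, ← map_mul, ← PowerSeries.binomialSeries_add, h2,
    rescale_binomialSeries_nat]
  simp

theorem coeff_sumSer (hx : BddArr₃ x) (hb : DegBdd x d b) (n : ℕ) :
    PowerSeries.coeff n (sumSer x d b) = expLS x (d - (n - (2 * b : ℕ))) (n - (2 * b : ℕ)) := by
  have h0 : ∀ (p : ℕ) (m : ℤ), x m (d + p - m) p ≠ 0 → -b < m ∧ m < b ∧ p < b :=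
    fun p m h => by
      obtain ⟨h1, h2, -, -, h3⟩ := hb.2 m (d + p - m) p (by ring) h
      exact ⟨h1, h2, h3⟩
  have h1 : ∀ p : ℕ, reexp (fun m l => x m l p) (d - (n - (2 * b : ℕ))) (n - (2 * b : ℕ) + p)
      = if 0 ≤ (n : ℤ) - (2 * b : ℕ) + p then ∑ᶠ m : ℤ,
        ((-1 : ℝ) ^ (d + p - m - (n - (2 * b : ℕ) + p))
          * ((Ring.choose (d + p - m) (n - (2 * b : ℕ) + p : ℤ).toNat : ℤ) : ℝ))
          * x m (d + p - m) p else 0 := by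
    intro p
    rw [reexp]
    split_ifs with h
    · rw [← finsum_comp_equiv (Equiv.subLeft (d + p))]
      refine finsum_congr fun m => ?_
      rw [Equiv.subLeft_apply, smul_eq_mul]
      congr 2
      ring
    · rfl
  rw [expLS_eq_finsum_reexp hx, finsum_eq_sum_of_support_subset (s := Finset.range b)]
  · rw [sumSer, map_sum]
    refine Finset.sum_congr rfl fun p hp => ?_
    have hp' := Finset.mem_range.1 hp
    rw [h1, map_sum]
    split_ifs with h
    · rw [finsum_int_eq_sum_range _ (2 * b) (3 * b)]
      · refine Finset.sum_congr rfl fun j _ => ?_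
        have e : n = (n - (2 * b : ℕ) + p : ℤ).toNat + (2 * b - p) := by omega
        have e2 : (n - (2 * b : ℕ) + p : ℤ) = ((n - (2 * b : ℕ) + p : ℤ).toNat : ℤ) := by omega
        generalize (n - (2 * b : ℕ) + p : ℤ).toNat = k at e e2
        rw [e2, mul_right_comm]
        conv_lhs => rw [e]
        rw [PowerSeries.coeff_mul_X_pow, PowerSeries.coeff_C_mul, PowerSeries.coeff_rescale,
          PowerSeries.binomialSeries_coeff, zsmul_one,
          zpow_sub₀ (by norm_num) (d + p - (j - (2 * b : ℕ))) k, zpow_natCast]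
        have e3 : ((-1 : ℝ) ^ k)⁻¹ = (-1) ^ k := by
          rw [← inv_pow]
          norm_num
        rw [div_eq_mul_inv, e3]
        ring
      · intro m hm
        have := h0 p m (right_ne_zero_of_mul hm)
        push_cast
        omega
    · refine Finset.sum_eq_zero fun j _ => ?_
      rw [mul_right_comm, PowerSeries.coeff_mul_X_pow', if_neg (by omega)]
  · intro p hp
    by_contra h
    refine hp ?_
    simp only
    rw [h1, finsum_eq_zero_of_forall_eq_zero, ite_self]
    intro m
    by_contra hm
    exact h (by simpa using (h0 p m (right_ne_zero_of_mul hm)).2.2)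

theorem eval_sumPoly (hb : DegBdd x d b) {y : ℝ} (hy : 0 < y) :
    (sumPoly x d b).eval (1 + y⁻¹)
      = (1 + y⁻¹) ^ (2 * b) * (y ^ (d + (2 * b : ℕ)))⁻¹ * homPart x d y := by
  have h1 : (0 : ℝ) < 1 + y := by positivity
  have h3 : (0 : ℝ) < 1 + y⁻¹ := by positivity
  have h4 : (1 : ℝ) + y⁻¹ = (1 + y) * y⁻¹ := by
    field_simp
    ring
  rw [homPart_eq_sum hb, sumPoly, Polynomial.eval_finsetSum, Finset.mul_sum]
  refine Finset.sum_congr rfl fun p hp => ?_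
  rw [Polynomial.eval_finsetSum, Finset.mul_sum]
  refine Finset.sum_congr rfl fun j hj => ?_
  have h2 : p ≤ 2 * b := by
    have := Finset.mem_range.1 hp
    omega
  have h5 : d + p - (j - (2 * b : ℕ)) + (2 * b : ℕ)
      = ((d + p - (j - (2 * b : ℕ)) + (2 * b : ℕ)).toNat : ℤ) := by
    have := Finset.mem_range.1 hj
    have := hb.1
    push_cast
    omega
  simp only [Polynomial.eval_mul, Polynomial.eval_C, Polynomial.eval_pow, Polynomial.eval_X,
    Polynomial.eval_sub, Polynomial.eval_one]
  generalize x (j - (2 * b : ℕ)) (d + p - (j - (2 * b : ℕ))) p = c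
  have h6 : (1 : ℝ) - (1 + y⁻¹) = (-1) * y⁻¹ := by ring
  have h7 : ((-1 : ℝ) ^ (d + p - (j - (2 * b : ℕ)))) * (-1) ^ (d + p - (j - (2 * b : ℕ)) + (2 * b : ℕ))
      = 1 := by
    rw [← zpow_add₀ (by norm_num)]
    exact Even.neg_one_zpow ⟨d + p - (j - (2 * b : ℕ)) + b, by push_cast; ring⟩
  rw [h6, ← zpow_natCast (-1 * y⁻¹), ← h5, mul_zpow, pow_sub₀ _ h3.ne' h2]
  have h8 : (y⁻¹) ^ (d + p - (j - (2 * b : ℕ)) + (2 * b : ℕ)) * ((1 + y⁻¹) ^ p)⁻¹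
      = (y ^ (d + (2 * b : ℕ)))⁻¹ * (y ^ ((j : ℤ) - (2 * b : ℕ)) * ((1 + y) ^ p)⁻¹) := by
    rw [h4, mul_pow, mul_inv, inv_pow, inv_inv, inv_zpow', ← zpow_neg, ← zpow_natCast y p]
    have : y ^ (-(d + p - (j - (2 * b : ℕ)) + (2 * b : ℕ))) * y ^ (p : ℤ)
        = y ^ (-(d + (2 * b : ℕ))) * y ^ ((j : ℤ) - (2 * b : ℕ)) := by
      rw [← zpow_add₀ hy.ne', ← zpow_add₀ hy.ne']
      congr 1
      ring
    linear_combination ((1 + y) ^ p)⁻¹ * this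
  linear_combination c * (1 + y⁻¹) ^ (2 * b) * h8
    + c * (1 + y⁻¹) ^ (2 * b) * ((1 + y⁻¹) ^ p)⁻¹
      * (y⁻¹) ^ (d + p - (j - (2 * b : ℕ)) + (2 * b : ℕ)) * h7

/-- The rational function of an element of `V_{λ,μ}` vanishes if the expansion for `|λ| > |λ+μ|`
does. With `λ = 1` and `μ = y⁻¹`, the variable of this expansion is `1 + y⁻¹`. -/
theorem homPart_eq_zero_of_expLS (hx : BddArr₃ x) (hb : DegBdd x d b)
    (h : ∀ c, expLS x (d - c) c = 0) {y : ℝ} (hy : 0 < y) : homPart x d y = 0 := by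
  have h1 : sumSer x d b = 0 := by
    ext n
    rw [coeff_sumSer hx hb, h, map_zero]
  have h2 : sumPoly x d b = 0 := by
    rw [← Polynomial.coe_eq_zero_iff, ← sumSer_mul hb.1, h1, zero_mul]
  have h3 := eval_sumPoly hb hy
  rw [h2, Polynomial.eval_zero] at h3
  have h4 : (1 + y⁻¹) ^ (2 * b) * (y ^ (d + (2 * b : ℕ)))⁻¹ ≠ 0 := by positivity
  exact (mul_eq_zero.1 h3.symm).resolve_left h4

/-- An element of `V_{λ,μ}` whose expansion for `|λ| > |λ+μ|` vanishes has vanishing expansion for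
`|μ| > |λ|`. -/
theorem expLM_eq_zero_of_expLS (hx : BddArr₃ x) (h : ∀ a c, expLS x a c = 0) (a b : ℤ) :
    expLM x a b = 0 := by
  obtain ⟨N, hN⟩ := hx.exists_degBdd (a + b)
  have h1 := (expLM_eq_zero_iff hN).2 (fun y hy =>
    homPart_eq_zero_of_expLS hx hN (fun c => h _ c) hy) a
  rwa [add_sub_cancel_left] at h1

theorem BddArr₃.swap {A : Type*} [CommRing A] {x : ℤ → ℤ → ℕ → A} (hx : BddArr₃ x) :
    BddArr₃ fun m l p => x l m p := by
  obtain ⟨M, hM⟩ := hx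
  exact ⟨M, fun m l p h => hM l m p h.symm⟩

/-- An element of `V_{λ,μ}` whose expansion for `|λ| > |μ|` vanishes has vanishing expansion for
`|μ| > |λ|`. -/
theorem expLM_eq_zero_of_swap (hx : BddArr₃ x) (h : ∀ a b, expLM (fun m l p => x l m p) a b = 0)
    (a b : ℤ) : expLM x a b = 0 := by
  obtain ⟨N, hN⟩ := hx.exists_degBdd (a + b)
  obtain ⟨K, hK⟩ := hx.swap.exists_degBdd (a + b)
  have h1 := (expLM_eq_zero_iff hK).1 fun c => h _ _
  have h2 := (expLM_eq_zero_iff hN).2 (fun y hy => by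
    have h3 := homPart_swap x (a + b) (inv_pos.2 hy)
    rw [h1 _ (inv_pos.2 hy), inv_inv] at h3
    exact (mul_eq_zero.1 h3.symm).resolve_left (zpow_ne_zero _ (inv_pos.2 hy).ne')) a
  rwa [add_sub_cancel_left] at h2

end Injectivity

/-! ### The Jacobi identity of Poisson vertex algebras -/

section PVAJacobi

open TopologicalSpace (Opens)
open DiffAlg

variable {n : ℕ} {U : Opens (Fin n → ℝ)}

theorem expLM_apply {T : ℤ → ℤ → ℕ → DiffAlg U} (hT : BddArr₃ T) (J : JetOver U) (a b : ℤ) :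
    expLM T a b J = expLM (fun m l p => T m l p J) a b := by
  rw [expLM, expLM, finsum_apply (expLM_support_finite hT a b)]
  rfl

theorem expLS_apply {T : ℤ → ℤ → ℕ → DiffAlg U} (hT : BddArr₃ T) (J : JetOver U) (a c : ℤ) :
    expLS T a c J = expLS (fun m l p => T m l p J) a c := by
  rw [expLS, expLS, finsum_apply (expLS_support_finite hT a c)]
  refine finsum_congr fun kpm => ?_
  split_ifs <;> rfl

variable {P : HydroOp n} (hP : P.SmoothOn U)

theorem lamBracket_outer (i j k : Fin n) (a b : ℤ) (J : JetOver U) :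
    P.lamBracket (jetGen i) (P.lamBracket (jetGen j) (jetGen k) b) a J.1
      = expLM (fun m l p => outerArr hP i j k m l p J) a b := by
  rw [← expLM_apply (bddArr_outerArr hP i j k), ← brG_outer]
  exact (restr_jetGen i).lamBracket hP ((restr_jetGen j).lamBracket hP (restr_jetGen k) b) a J

theorem lamBracket_inner (i j k : Fin n) (a c : ℤ) (J : JetOver U) :
    P.lamBracket (P.lamBracket (jetGen i) (jetGen j) a) (jetGen k) c J.1
      = expLS (fun m l p => innerArr hP i j k m l p J) a c := by
  rw [← expLS_apply (bddArr_innerArr hP i j k), ← brG_inner]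
  exact ((restr_jetGen i).lamBracket hP (restr_jetGen j) a).lamBracket hP (restr_jetGen k) c J

/-- The Jacobi expression of three generators, as an element of `V_{λ,μ}`. -/
def jacobiArr (i j k : Fin n) : ℤ → ℤ → ℕ → DiffAlg U :=
  outerArr hP i j k - (fun m l p => outerArr hP j i k l m p) - innerArr hP i j k

/-- Under the conditions the Jacobi expression of three generators lies in the kernel of the
expansion in powers of `λ` and `λ + μ`. -/
theorem jacobiArr_eq_tailArr (hS : ∀ v ∈ U, P.SkewAt v) (hJ : ∀ v ∈ U, P.JacobiAt v)
    (hs : ∀ v ∈ U, Function.Surjective (P.gVec v)) (i j k : Fin n) :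
    jacobiArr hP i j k = tailArr (A := DiffAlg U) tot (fun m l => -(bdryA hP i j m l * tailA hP k))
      (tailA hP k) (arrD (A := DiffAlg U) tot (bdryA hP i j)) := by
  have h1 : ∀ m l, arrLam (fun m => hamD hP i m (tailA hP j)) m l
      - arrLam (fun m => hamD hP j m (tailA hP i)) l m - innerTail hP i j m l
      = arrD (A := DiffAlg U) tot (bdryA hP i j) m l := by
    intro m l
    ext J
    rw [jacobi_tail_apply hP J (hS _ J.2)]
    rw [famE]
    split_ifs
    · rw [nonlocAt_eq_zero hP J hS hJ hs, add_zero]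
    · simp [nonlocAt, HydroOp.nonlocCoeff, HydroOp.linTail, HydroOp.linLoc]
  funext m l p
  rcases p with _ | s
  · ext J
    change (outerLoc hP i j k m l - outerLoc hP j i k l m - innerLoc hP i j k m l) J = _
    rw [jacobi_loc_apply hP J (hS _ J.2), locAt_eq_zero hP J hS hJ hs,
      nonlocAt_eq_zero hP J hS hJ hs, nonlocAt_eq_zero hP J hS hJ hs, tailArr, neg_apply,
      DiffAlg.mul_apply]
    ring
  · change (-1 : ℝ) ^ s • (tailA hP k * tot^[s] _) - (-1 : ℝ) ^ s • (tailA hP k * tot^[s] _)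
      - (-1 : ℝ) ^ s • (tailA hP k * tot^[s] _) = (-1 : ℝ) ^ s • (tailA hP k * tot^[s] _)
    rw [← h1, iterate_map_sub, iterate_map_sub, mul_sub, mul_sub, smul_sub, smul_sub]

theorem expandLamMu_eq (t : ℤ → ℤ → ℕ → Jet n → ℝ) (a b : ℤ) (J : Jet n) :
    expandLamMu t a b J = expLM (fun m l p => t m l p J) a b := rfl

theorem expandMuLam_eq (t : ℤ → ℤ → ℕ → Jet n → ℝ) (a b : ℤ) (J : Jet n) :
    expandMuLam t a b J = expLM (fun m l p => t l m p J) b a := rfl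

theorem expandLamSum_eq (t : ℤ → ℤ → ℕ → Jet n → ℝ) (a c : ℤ) (J : Jet n) :
    expandLamSum t a c J = expLS (fun m l p => t m l p J) a c := rfl

theorem BddArr₃.isAdmissibleArray {T : ℤ → ℤ → ℕ → DiffAlg U} (hT : BddArr₃ T) :
    IsAdmissibleArray U fun m l p => extend (T m l p) := by
  obtain ⟨M, hM⟩ := hT
  refine ⟨fun m l p => isDiffFun_iff.2 ⟨_, restr_extend _⟩, M, fun m l p h => ?_⟩
  funext J
  simp only [hM m l p h, extend]
  split_ifs <;> rfl

theorem BddSer.mul_mul {A : Type*} [CommRing A] {F G : ℤ → A} (hF : BddSer F) (hG : BddSer G) :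
    BddArr fun m l => F m * G l := by
  obtain ⟨M, hM⟩ := hF
  obtain ⟨N, hN⟩ := hG
  refine ⟨max M N, fun m l h => ?_⟩
  rcases h with h | h
  · simp [hM m (by omega)]
  · simp [hN l (by omega)]

theorem bddSer_locA (i l : Fin n) : BddSer (locA hP i l) :=
  ⟨1, fun m h => by rw [locA, if_neg (by omega), if_neg (by omega), add_zero]⟩

theorem bddSer_adjA (i e : Fin n) : BddSer (adjA hP i e) := by
  obtain ⟨M, hM⟩ := (bddSer_serC (pd 1 e (tailA hP i))).serD (d := (tot : Derivation ℝ _ _))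
  refine ⟨max M 0, fun m h => ?_⟩
  rw [adjA, Pi.sub_apply, hM m (by omega), serC, if_neg (by omega), sub_zero]

theorem bddArr_bdryA (i j : Fin n) : BddArr (bdryA hP i j) := by
  refine ((((((bddSer_serC _).mul_mul (bddSer_serC _)).sub ?_).sub ?_).add
    ((bddSer_tailSer _).mul_mul (bddSer_serC _))).sub
    ((bddSer_serC _).mul_mul (bddSer_tailSer _)))
  · exact BddArr.sum fun e _ => (bddSer_serC _).mul_mul (bddSer_locA hP j e)
  · exact BddArr.sum fun e _ => (bddSer_adjA hP i e).mul_mul (bddSer_serC _)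

/-- The conditions imply the Jacobi identity. -/
theorem pvaJacobi_of_conditions (hP : P.SmoothOn U) (hS : ∀ v ∈ U, P.SkewAt v)
    (hJ : ∀ v ∈ U, P.JacobiAt v)
    (hs : ∀ v ∈ U, Function.Surjective (P.gVec v)) (i j k : Fin n) :
    P.PVAJacobi U (jetGen i) (jetGen j) (jetGen k) := by
  have hb1 := bddArr_outerArr hP i j k
  have hb2 := (bddArr_outerArr hP j i k).swap
  have hb3 := bddArr_innerArr hP i j k
  have hext : ∀ (f g : DiffAlg U), extend (f - g) = extend f - extend g := fun f g => by
    funext J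
    rw [Pi.sub_apply, extend, extend, extend]
    split_ifs
    · rfl
    · rw [sub_zero]
  refine ⟨fun m l p => extend (outerArr hP i j k m l p),
    fun m l p => extend (outerArr hP j i k l m p),
    fun m l p => extend ((outerArr hP i j k - fun m l p => outerArr hP j i k l m p) m l p),
    hb1.isAdmissibleArray, hb2.isAdmissibleArray, (hb1.sub hb2).isAdmissibleArray,
    fun A B J hJU => ?_, fun A B J hJU => ?_, fun A C J hJU => ?_, ?_⟩
  · have h := lamBracket_outer hP i j k A B ⟨J, hJU⟩
    rw [expandLamMu_eq]
    simp only [extend_of_mem _ hJU]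
    exact h
  · have h := lamBracket_outer hP j i k B A ⟨J, hJU⟩
    rw [expandMuLam_eq]
    simp only [extend_of_mem _ hJU]
    exact h
  · have h := lamBracket_inner hP i j k A C ⟨J, hJU⟩
    rw [expandLamSum_eq]
    simp only [extend_of_mem _ hJU]
    refine h.trans ?_
    rw [← expLS_apply hb3, ← expLS_apply (hb1.sub hb2)]
    have h0 : expLS (jacobiArr hP i j k) A C = 0 := by
      rw [jacobiArr_eq_tailArr hP hS hJ hs]
      exact expLS_tailArr_arrD _ (bddArr_bdryA hP i j) A C
    rw [jacobiArr, expLS_sub (hb1.sub hb2) hb3, sub_eq_zero] at h0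
    rw [h0]
  · funext m l p
    exact (hext _ _).symm

end PVAJacobi

/-! ### The conditions from the Jacobi identity of Poisson vertex algebras -/

section PVANecessity

open TopologicalSpace (Opens)
open DiffAlg

variable {n : ℕ} {U : Opens (Fin n → ℝ)} {P : HydroOp n} (hP : P.SmoothOn U)

/-- If the Jacobi identity holds, then the Jacobi expression has zero expansion: each of the three
terms of `t₁ - t₂ - t₃ = 0` differs from the corresponding term of the Jacobi expression by an array
one of whose expansions is zero, and then so are the others. -/
theorem expLM_jacobiArr_eq_zero {i j k : Fin n}
    (h : P.PVAJacobi U (jetGen i) (jetGen j) (jetGen k)) (J : JetOver U) (a b : ℤ) :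
    expLM (fun m l p => jacobiArr hP i j k m l p J) a b = 0 := by
  obtain ⟨t₁, t₂, t₃, ⟨-, M₁, hM₁⟩, ⟨-, M₂, hM₂⟩, ⟨-, M₃, hM₃⟩, h₁, h₂, h₃, ht⟩ := h
  have hev : ∀ {T : ℤ → ℤ → ℕ → DiffAlg U}, BddArr₃ T → BddArr₃ fun m l p => T m l p J := by
    rintro T ⟨M, hM⟩
    exact ⟨M, fun m l p h => by simp only [hM m l p h]; rfl⟩
  have hj : ∀ {t : ℤ → ℤ → ℕ → Jet n → ℝ} {M : ℤ}, (∀ m l p, M < m ∨ M < l → t m l p = 0) →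
      BddArr₃ fun m l p => t m l p J.1 := fun {t M} hM =>
    ⟨M, fun m l p h => by simp only [hM m l p h]; rfl⟩
  have b₁ := (hj hM₁).sub (hev (bddArr_outerArr hP i j k))
  have b₂ := (hj hM₂).sub (hev (bddArr_outerArr hP j i k).swap)
  have b₃ := (hj hM₃).sub (hev (bddArr_innerArr hP i j k))
  have e₁ := fun a b => expLM_sub (hj hM₁) (hev (bddArr_outerArr hP i j k)) a b
  have e₂ := fun a b => expLM_sub (hj hM₂).swap (hev (bddArr_outerArr hP j i k)) a b
  have e₃ := fun a c => expLS_sub (hj hM₃) (hev (bddArr_innerArr hP i j k)) a c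
  have z₁ : ∀ a b, expLM ((fun m l p => t₁ m l p J.1) - fun m l p => outerArr hP i j k m l p J) a b
      = 0 := fun a b => by
    rw [e₁, ← expandLamMu_eq, ← h₁ a b J.1 J.2, lamBracket_outer hP i j k a b J, sub_self]
  have z₂ := expLM_eq_zero_of_swap b₂ (fun a b => by
    refine (e₂ a b).trans ?_
    rw [← expandMuLam_eq, ← h₂ b a J.1 J.2, lamBracket_outer hP j i k a b J, sub_self])
  have z₃ := expLM_eq_zero_of_expLS b₃ (fun a c => by
    rw [e₃, ← expandLamSum_eq, ← h₃ a c J.1 J.2, lamBracket_inner hP i j k a c J, sub_self])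
  have e : (fun m l p => jacobiArr hP i j k m l p J)
      = (((fun m l p => t₂ m l p J.1) - fun m l p => outerArr hP j i k l m p J)
        + ((fun m l p => t₃ m l p J.1) - fun m l p => innerArr hP i j k m l p J))
        - ((fun m l p => t₁ m l p J.1) - fun m l p => outerArr hP i j k m l p J) := by
    funext m l p
    have h4 := congrFun (congrFun (congrFun (congrFun ht m) l) p) J.1
    simp only [jacobiArr, Pi.sub_apply, Pi.add_apply, DiffAlg.sub_apply] at h4 ⊢
    linear_combination h4
  rw [e, expLM_sub (b₂.add b₃) b₁, expLM_add b₂ b₃, z₁, z₂, z₃]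
  simp

theorem expLM_eq_of_local {x : ℤ → ℤ → ℕ → ℝ} (h : ∀ m l p, x m l (p + 1) = 0) (a b : ℤ) :
    expLM x a b = x a b 0 := by
  rw [expLM, finsum_eq_single _ (0, 0)]
  · simp
  · rintro ⟨k, p⟩ hkp
    rcases p with _ | p
    · have hk : k ≠ 0 := fun h => hkp (by rw [h])
      simp [Ring.choose_zero_pos ℤ (Nat.pos_of_ne_zero hk)]
    · simp only
      rw [h, smul_zero]

variable {J : JetOver U}

/-- Where `u_x` vanishes, only the coefficient of `u_xx` contributes to the total derivative of a
function linear in `u_x`. -/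
theorem tot_sum_mul_coord (h1 : J.1 1 = 0) (A : Fin n → DiffAlg U) :
    tot (∑ f, A f * coord 1 f) J = ∑ f, A f J * J.1 2 f := by
  rw [map_sum, sum_apply]
  refine Finset.sum_congr rfl fun f _ => ?_
  rw [Derivation.leibniz, tot, evol_coord]
  simp [h1]

theorem tot_mul_of_eq_zero {a b : DiffAlg U} (h : a J = 0) : tot (a * b) J = tot a J * b J := by
  rw [Derivation.leibniz]
  simp [h, mul_comm]

theorem tailA_of_vel_zero (h1 : J.1 1 = 0) (i : Fin n) : tailA hP i J = 0 := by
  rw [tailA_apply, HydroOp.jetTail]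
  simp [h1]

theorem tailDer_of_vel_zero (h1 : J.1 1 = 0) : tailDer hP J = P.wVec (J.1 0) (J.1 2) := by
  funext e
  rw [tailDer, tailA, tot_sum_mul_coord h1, bilVec_apply]
  rfl

theorem tot_tot_ofField (h1 : J.1 1 = 0) (f : (Fin n → ℝ) → ℝ) (hf : ContDiffOn ℝ ∞ f U) :
    tot (tot (ofField f hf)) J = ∑ l, fieldDeriv l f (J.1 0) * J.1 2 l := by
  have e : tot (ofField f hf)
      = ∑ l, ofField (fieldDeriv l f) (hf.fieldDeriv U.isOpen l) * coord 1 l := by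
    rw [tot, evol_ofField]
    exact Finset.sum_congr rfl fun l _ => mul_comm _ _
  rw [e, tot_sum_mul_coord h1]
  rfl

theorem tot_ofField_of_vel_zero (h1 : J.1 1 = 0) (f : (Fin n → ℝ) → ℝ)
    (hf : ContDiffOn ℝ ∞ f U) : tot (ofField f hf) J = 0 := by
  rw [tot, evol_ofField, sum_apply]
  simp [h1]

theorem locDer_of_vel_zero (h1 : J.1 1 = 0) (i : Fin n) (m : ℤ) :
    locDer hP J i m
      = P.gVec (J.1 0) (famE i (m - 2)) + P.ΓVec (J.1 0) (famE i m) (J.1 2) := by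
  have e1 := locA_apply hP J i (m - 1)
  have e2 : ∀ l, tot (locA hP i l m) J = P.ΓVec (J.1 0) (famE i m) (J.1 2) l := fun l => by
    have e3 : tot (if m = 1 then gA hP l i else 0) J = 0 := by
      split_ifs
      · exact tot_ofField_of_vel_zero h1 _ _
      · rw [map_zero]
        rfl
    rw [locA, map_add, DiffAlg.add_apply, e3, zero_add, famE, triVec_apply]
    split_ifs
    · rw [ΓuA, tot_sum_mul_coord h1]
      simp [Pi.single_apply]
    · rw [map_zero]
      simp
  funext l
  rw [locDer, serD_apply, DiffAlg.add_apply, congrFun e1 l, e2, HydroOp.loc, h1]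
  simp [sub_sub]

theorem adjDer_of_vel_zero (h1 : J.1 1 = 0) (i : Fin n) {m : ℤ} (hm : m ≠ 1) :
    adjDer hP J i m = covec (P.dwForm (J.1 0) (famE i m) (J.1 2)
      - (P.dwForm (J.1 0) (famE i m)).flip (J.1 2) - P.wForm (J.1 0) (famE i (m - 2))) := by
  have e1 := adjA_apply hP J i (m - 1)
  funext e
  have e2 : tot (adjA hP i e m) J = P.dwForm (J.1 0) (famE i m) (J.1 2) (Pi.single e 1)
      - P.dwForm (J.1 0) (famE i m) (Pi.single e 1) (J.1 2) := by
    have e3 : pd 0 e (tailA hP i)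
        = ∑ f, ofField (fieldDeriv e fun v => P.w v i f)
          ((hP.2.2 i f).fieldDeriv U.isOpen e) * coord 1 f := by
      rw [tailA, map_sum]
      refine Finset.sum_congr rfl fun f _ => ?_
      rw [Derivation.leibniz, pd_coord, pd_ofField]
      simp [mul_comm]
    have hm1 : m - 1 ≠ 0 := by omega
    rw [adjA, Pi.sub_apply, serD_apply, pd_one_tailA, serC, serC, serC, if_neg hm1, zero_add, famE]
    split_ifs
    · rw [map_sub, DiffAlg.sub_apply, e3, tot_sum_mul_coord h1, tot_tot_ofField h1]
      simp [triForm_apply, Pi.single_apply]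
    · simp
  rw [adjDer, serD_apply, DiffAlg.add_apply, congrFun e1 e, e2, HydroOp.adjTail, h1,
    show m - 1 - 1 = m - 2 by ring]
  simp [covec]
  ring

theorem varDer_of_vel_zero (hS : P.SkewAt (J.1 0)) (h1 : J.1 1 = 0) (i j : Fin n) {m l : ℤ}
    (hm : m ≠ 1) (hl : l ≠ 1) : varDer hP J i j m l = covec (
      P.ΓForm (J.1 0) (famE i (m - 2)) (famE j l) - P.ΓForm (J.1 0) (famE j (l - 2)) (famE i m)
      + P.dΓForm (J.1 0) (famE j l) (famE i m) (J.1 2)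
      - (P.dΓForm (J.1 0) (famE j l) (famE i m)).flip (J.1 2)
      - P.wForm (J.1 0) (famE i m) (J.1 2) • P.wForm (J.1 0) (famE j l)
      + P.wForm (J.1 0) (famE j l) (J.1 2) • P.wForm (J.1 0) (famE i m)) := by
  have e1 := varLoc_apply hP J hS i j (m - 1) l
  have e2 := varLoc_apply hP J hS i j m (l - 1)
  funext e
  have hm' : famE i (m - 1) = 0 := if_neg (by omega)
  have hl' : famE j (l - 1) = 0 := if_neg (by omega)
  have e3 : tot (varLoc hP i j e m l) J
      = P.dΓForm (J.1 0) (famE j l) (famE i m) (J.1 2) (Pi.single e 1)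
      - P.dΓForm (J.1 0) (famE j l) (famE i m) (Pi.single e 1) (J.1 2)
      - P.wForm (J.1 0) (famE i m) (J.1 2) * P.wForm (J.1 0) (famE j l) (Pi.single e 1)
      + P.wForm (J.1 0) (famE j l) (J.1 2) * P.wForm (J.1 0) (famE i m) (Pi.single e 1) := by
    have e4 : pd 0 e (ΓuA hP j i)
        = ∑ f, ofField (fieldDeriv e fun v => P.Γ v j i f)
          ((hP.2.1 j i f).fieldDeriv U.isOpen e) * coord 1 f := by
      rw [ΓuA, map_sum]
      refine Finset.sum_congr rfl fun f _ => ?_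
      rw [Derivation.leibniz, pd_coord, pd_ofField]
      simp [mul_comm]
    have e5 : ∀ i j : Fin n, tot (tailA hP i * wA hP j e) J
        = P.wForm (J.1 0) (Pi.single i 1) (J.1 2)
          * P.wForm (J.1 0) (Pi.single j 1) (Pi.single e 1) := fun i j => by
      rw [tot_mul_of_eq_zero (tailA_of_vel_zero hP h1 i)]
      change tailDer hP J i * _ = _
      rw [tailDer_of_vel_zero hP h1]
      simp [bilVec_apply, bilForm_apply, Pi.single_apply]
    have e6 : varLoc hP i j e m l = if m = 0 then if l = 0 then
        pd 0 e (ΓuA hP j i) - tot (ΓA hP j i e) - tailA hP i * wA hP j e + tailA hP j * wA hP i e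
        else 0 else 0 := by
      have hm1 : m - 1 ≠ 0 := by omega
      have hl1 : l - 1 ≠ 0 := by omega
      simp only [varLoc, arrD, arrLam, Pi.add_apply, Pi.sub_apply, if_neg hm, if_neg hm1, if_neg hl1,
        ite_self, zero_add]
      split_ifs <;> simp
    rw [e6, famE, famE]
    split_ifs
    · rw [map_add, map_sub, map_sub, DiffAlg.add_apply, DiffAlg.sub_apply, DiffAlg.sub_apply, e4,
        tot_sum_mul_coord h1, tot_tot_ofField h1, e5, e5]
      simp [quadForm_apply, Pi.single_apply]
    all_goals simp
  rw [varDer, arrD, DiffAlg.add_apply, DiffAlg.add_apply, congrFun e1 e, congrFun e2 e, e3,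
    HydroOp.adjLoc, HydroOp.adjLoc, h1, show m - 1 - 1 = m - 2 by ring,
    show l - 1 - 1 = l - 2 by ring, hm', hl']
  simp [covec]
  ring

theorem nonlocAt_of_vel_zero (hS : P.SkewAt (J.1 0)) (h1 : J.1 1 = 0) (p : Fin n → ℝ) (i : Fin n)
    {m : ℤ} (hm : m ≠ 1) : nonlocAt hP J p i m
      = P.wForm (J.1 0) p (P.gVec (J.1 0) (famE i (m - 2)))
        - P.wForm (J.1 0) (famE i (m - 2)) (P.gVec (J.1 0) p)
        + P.codazzi (J.1 0) p (famE i m) (J.1 2) := by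
  have hm' : famE i (m - 1) = 0 := if_neg (by omega)
  have e1 : P.loc (J.1 0) 0 (famE i m) 0 = 0 := by simp [HydroOp.loc]
  have e2 : P.adjTail (J.1 0) 0 (famE i m) 0 = 0 := by
    funext e
    simp [HydroOp.adjTail, covec]
  rw [nonlocAt, h1, hm', e1, e2, tailDer_of_vel_zero hP h1, locDer_of_vel_zero hP h1]
  exact HydroOp.nonlocCoeff_of_vel_zero hS _ _ _ _ _ (adjDer_of_vel_zero hP h1 i hm)

theorem locAt_of_vel_zero (hS : P.SkewAt (J.1 0)) (h1 : J.1 1 = 0) (i j k : Fin n)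
    {m l : ℤ} (hm : m ≠ 1) (hl : l ≠ 1) : locAt hP J i j k m l
      = P.ΓForm (J.1 0) (Pi.single k 1) (famE j l) (P.gVec (J.1 0) (famE i (m - 2)))
        - P.ΓForm (J.1 0) (famE i (m - 2)) (famE j l) (P.gVec (J.1 0) (Pi.single k 1))
        - (P.ΓForm (J.1 0) (Pi.single k 1) (famE i m) (P.gVec (J.1 0) (famE j (l - 2)))
          - P.ΓForm (J.1 0) (famE j (l - 2)) (famE i m) (P.gVec (J.1 0) (Pi.single k 1)))
        + P.gauss (J.1 0) (Pi.single k 1) (famE j l) (famE i m) (J.1 2) := by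
  have hm' : famE i (m - 1) = 0 := if_neg (by omega)
  have hl' : famE j (l - 1) = 0 := if_neg (by omega)
  have e1 : ∀ q, P.loc (J.1 0) 0 q 0 = 0 := fun q => by simp [HydroOp.loc]
  have e2 : ∀ q, P.adjTail (J.1 0) 0 q 0 = 0 := fun q => by
    funext e
    simp [HydroOp.adjTail, covec]
  have e3 : ∀ q r, P.adjLoc (J.1 0) 0 q 0 r 0 = 0 := fun q r => by
    funext e
    simp [HydroOp.adjLoc, covec]
  rw [locAt, h1, hm', hl', e1, e1, e2, e2, e3, locDer_of_vel_zero hP h1, locDer_of_vel_zero hP h1]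
  exact HydroOp.locCoeff_of_vel_zero hS _ _ _ _ _ _ _ (varDer_of_vel_zero hP hS h1 i j hm hl)

theorem tailAt_of_nonneg (i : Fin n) {m : ℤ} (hm : 0 ≤ m) : tailAt hP J i m = 0 := by
  rw [tailAt, tailSer, if_neg (by omega)]
  rfl

theorem tailAt_neg_two (h1 : J.1 1 = 0) (i : Fin n) :
    tailAt hP J i (-2) = -P.wVec (J.1 0) (J.1 2) i := by
  rw [← tailDer_of_vel_zero hP h1, tailDer, tailAt, tailSer, if_pos (by omega)]
  simp

/-- The Jacobi identity at jets with `u_x = 0`. -/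
theorem locAt_add_nonlocAt_eq_zero {i j k : Fin n} (hS : P.SkewAt (J.1 0)) (h1 : J.1 1 = 0)
    (h : P.PVAJacobi U (jetGen i) (jetGen j) (jetGen k)) (m l : ℤ) :
    locAt hP J i j k m l + tailAt hP J j l * nonlocAt hP J (Pi.single k 1) i m
      - tailAt hP J i m * nonlocAt hP J (Pi.single k 1) j l = 0 := by
  have h2 := expLM_jacobiArr_eq_zero hP h J m l
  have hW := tailA_of_vel_zero hP h1 k
  have hz : ∀ (s : ℕ) (y : DiffAlg U), ((-1 : ℝ) ^ s • (tailA hP k * y)) J = 0 := fun s y => by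
    rw [DiffAlg.smul_apply, DiffAlg.mul_apply, hW, zero_mul, mul_zero]
  have h3 : ∀ m l s, jacobiArr hP i j k m l (s + 1) J = 0 := by
    intro m l s
    have o1 : ∀ i j m l, outerArr hP i j k m l (s + 1) J = 0 := fun i j m l => hz _ _
    have o2 : innerArr hP i j k m l (s + 1) J = 0 := hz _ _
    simp [jacobiArr, o1, o2]
  rw [expLM_eq_of_local h3] at h2
  have h4 := jacobi_loc_apply hP J hS i j k m l
  rw [hW, zero_mul, sub_zero] at h4
  exact h4.symm.trans h2

theorem exists_jet {v : Fin n → ℝ} (hv : v ∈ U) (η : Fin n → ℝ) :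
    ∃ J : JetOver U, J.1 0 = v ∧ J.1 1 = 0 ∧ J.1 2 = η :=
  ⟨⟨fun σ => if σ = 0 then v else if σ = 2 then η else 0, by simpa using hv⟩, by simp⟩

/-- The Jacobi identity implies the conditions. -/
theorem jacobiAt_of_pvaJacobi (hP : P.SmoothOn U) (hS : ∀ v ∈ U, P.SkewAt v)
    (h : ∀ i j k, P.PVAJacobi U (jetGen i) (jetGen j) (jetGen k)) : ∀ v ∈ U, P.JacobiAt v := by
  have hnl : ∀ v ∈ U, ∀ η, P.wVec v η ≠ 0 → ∀ i k,
      P.codazzi v (Pi.single k 1) (Pi.single i 1) η = 0 ∧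
      P.wForm v (Pi.single k 1) (P.gVec v (Pi.single i 1))
        = P.wForm v (Pi.single i 1) (P.gVec v (Pi.single k 1)) := by
    intro v hv η hη i k
    obtain ⟨J, rfl, h1, rfl⟩ := exists_jet hv η
    have hSJ := hS _ hv
    obtain ⟨j, hj⟩ : ∃ j, P.wVec (J.1 0) (J.1 2) j ≠ 0 := by
      by_contra hn
      push Not at hn
      exact hη (funext hn)
    -- The coefficient of `μ^{-2}` isolates the nonlocal coefficient, because that of the series
    -- `(μ + ∂)⁻¹ W^j` is `-(w η)_j` while all local terms are polynomial in `μ`. Of the nonlocal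
    -- coefficient, `λ^0` gives the Codazzi expression and `λ^2` the symmetry of `w g`.
    have hf : famE j (-2) = 0 := if_neg (by omega)
    have hf' : famE j (-2 - 2) = 0 := if_neg (by omega)
    have key : ∀ m : ℤ, 0 ≤ m → m ≠ 1 → nonlocAt hP J (Pi.single k 1) i m = 0 := by
      intro m hm hm1
      have h2 := locAt_add_nonlocAt_eq_zero hP hSJ h1 (h i j k) m (-2)
      rw [locAt_of_vel_zero hP hSJ h1 i j k hm1 (by omega), tailAt_of_nonneg hP i hm,
        tailAt_neg_two hP h1, hf, hf'] at h2
      have hg : P.gauss (J.1 0) (Pi.single k 1) 0 (famE i m) (J.1 2) = 0 := by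
        simp [HydroOp.gauss]
      rw [hg] at h2
      simpa [hj] using h2
    have k0 := key 0 le_rfl (by omega)
    have k2 := key 2 (by omega) (by omega)
    rw [nonlocAt_of_vel_zero hP hSJ h1 _ _ (by omega)] at k0 k2
    have f0 : famE i 0 = Pi.single i 1 := if_pos rfl
    have f1 : famE i (0 - 2) = 0 := if_neg (by omega)
    have f2 : famE i 2 = 0 := if_neg (by omega)
    have f3 : famE i (2 - 2) = Pi.single i 1 := if_pos (by omega)
    have hc : P.codazzi (J.1 0) (Pi.single k 1) 0 (J.1 2) = 0 := by simp [HydroOp.codazzi]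
    rw [f0, f1] at k0
    rw [f2, f3, hc] at k2
    refine ⟨by simpa using k0, by linarith⟩
  have hwc := HydroOp.wSymm_codazzi_of_nonloc U.isOpen hP (fun v hv p r0 r2 η hη => by
    have e1 : P.codazzi v p r0 η = 0 := by
      refine IsLinearMap.eq_of_single (F := fun p => P.codazzi v p r0 η) (G := fun _ => 0)
        ⟨by intros; simp [HydroOp.codazzi]; ring, by intros; simp [HydroOp.codazzi]; ring⟩
        ⟨by simp, by simp⟩ (fun k => ?_) p
      exact IsLinearMap.eq_of_single (F := fun r0 => P.codazzi v _ r0 η) (G := fun _ => 0)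
        ⟨by intros; simp [HydroOp.codazzi]; ring, by intros; simp [HydroOp.codazzi]; ring⟩
        ⟨by simp, by simp⟩ (fun i => (hnl v hv η hη i k).1) r0
    have e2 : P.wForm v p (P.gVec v r2) = P.wForm v r2 (P.gVec v p) := by
      refine IsLinearMap.eq_of_single (F := fun p => P.wForm v p (P.gVec v r2))
        (G := fun p => P.wForm v r2 (P.gVec v p)) ⟨by intros; simp, by intros; simp⟩
        ⟨by intros; simp, by intros; simp⟩ (fun k => ?_) p
      exact IsLinearMap.eq_of_single (F := fun r2 => P.wForm v _ (P.gVec v r2))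
        (G := fun r2 => P.wForm v r2 (P.gVec v _)) ⟨by intros; simp, by intros; simp⟩
        ⟨by intros; simp, by intros; simp⟩ (fun i => (hnl v hv η hη i k).2) r2
    rw [e1, e2]
    ring)
  have f0 : ∀ i : Fin n, famE i 0 = Pi.single i 1 := fun i => if_pos rfl
  have f1 : ∀ i : Fin n, famE i (0 - 2) = 0 := fun i => if_neg (by omega)
  have f2 : ∀ i : Fin n, famE i 2 = 0 := fun i => if_neg (by omega)
  have f3 : ∀ i : Fin n, famE i (2 - 2) = Pi.single i 1 := fun i => if_pos (by omega)
  -- In non-negative powers of `λ` and `μ` only the local part is left: its coefficient of `λ^2` is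
  -- the torsion, and that of `λ^0` the Gauss expression.
  have hloc : ∀ J : JetOver U, J.1 1 = 0 → ∀ i j k, ∀ m : ℤ, 0 ≤ m → m ≠ 1 →
      locAt hP J i j k m 0 = 0 := by
    intro J h1 i j k m hm hm1
    have h2 := locAt_add_nonlocAt_eq_zero hP (hS _ J.2) h1 (h i j k) m 0
    rwa [tailAt_of_nonneg hP _ hm, tailAt_of_nonneg hP _ le_rfl, zero_mul, zero_mul, sub_zero,
      add_zero] at h2
  intro v hv
  refine ⟨fun a b c => ?_, (hwc v hv).1, (hwc v hv).2, fun p b c ξ => ?_⟩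
  · obtain ⟨J, rfl, h1, -⟩ := exists_jet hv 0
    have key : ∀ i j k, P.ΓForm (J.1 0) (Pi.single k 1) (Pi.single j 1)
        (P.gVec (J.1 0) (Pi.single i 1))
        = P.ΓForm (J.1 0) (Pi.single i 1) (Pi.single j 1) (P.gVec (J.1 0) (Pi.single k 1)) := by
      intro i j k
      have h2 := hloc J h1 i j k 2 (by omega) (by omega)
      rw [locAt_of_vel_zero hP (hS _ hv) h1 i j k (by omega) (by omega), f0, f1, f2, f3] at h2
      have hg : P.gauss (J.1 0) (Pi.single k 1) (Pi.single j 1) 0 (J.1 2) = 0 := by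
        simp [HydroOp.gauss]
      rw [hg] at h2
      simp only [map_zero, LinearMap.zero_apply] at h2
      linarith
    refine IsLinearMap.eq_of_single (F := fun a => P.ΓForm (J.1 0) b c (P.gVec (J.1 0) a))
      (G := fun a => P.ΓForm (J.1 0) a c (P.gVec (J.1 0) b)) ⟨by intros; simp, by intros; simp⟩
      ⟨by intros; simp, by intros; simp⟩ (fun i => ?_) a
    refine IsLinearMap.eq_of_single (F := fun b => P.ΓForm (J.1 0) b c (P.gVec (J.1 0) _))
      (G := fun b => P.ΓForm (J.1 0) _ c (P.gVec (J.1 0) b)) ⟨by intros; simp, by intros; simp⟩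
      ⟨by intros; simp, by intros; simp⟩ (fun k => ?_) b
    exact IsLinearMap.eq_of_single (F := fun c => P.ΓForm (J.1 0) _ c (P.gVec (J.1 0) _))
      (G := fun c => P.ΓForm (J.1 0) _ c (P.gVec (J.1 0) _)) ⟨by intros; simp, by intros; simp⟩
      ⟨by intros; simp, by intros; simp⟩ (fun j => key i j k) c
  · obtain ⟨J, rfl, h1, rfl⟩ := exists_jet hv ξ
    have key : ∀ i j k, P.gauss (J.1 0) (Pi.single k 1) (Pi.single j 1) (Pi.single i 1) (J.1 2)
        = 0 := by
      intro i j k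
      have h2 := hloc J h1 i j k 0 le_rfl (by omega)
      rw [locAt_of_vel_zero hP (hS _ hv) h1 i j k (by omega) (by omega), f0, f0, f1, f1] at h2
      simpa using h2
    refine IsLinearMap.eq_of_single (F := fun p => P.gauss (J.1 0) p b c (J.1 2))
      (G := fun _ => 0) ⟨by intros; simp [HydroOp.gauss]; ring,
        by intros; simp [HydroOp.gauss]; ring⟩ ⟨by simp, by simp⟩ (fun k => ?_) p
    refine IsLinearMap.eq_of_single (F := fun b => P.gauss (J.1 0) _ b c (J.1 2))
      (G := fun _ => 0) ⟨by intros; simp [HydroOp.gauss]; ring,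
        by intros; simp [HydroOp.gauss]; ring⟩ ⟨by simp, by simp⟩ (fun j => ?_) b
    exact IsLinearMap.eq_of_single (F := fun c => P.gauss (J.1 0) _ _ c (J.1 2))
      (G := fun _ => 0) ⟨by intros; simp [HydroOp.gauss]; ring,
        by intros; simp [HydroOp.gauss]; ring⟩ ⟨by simp, by simp⟩ (fun i => key i j k) c

end PVANecessity

/-! ### The skew-symmetry of Poisson vertex algebras -/

section SeriesAdjoint

variable {A : Type*} [CommRing A] [Algebra ℝ A] {d : Derivation ℝ A A}

theorem serPow_serC_apply (k : ℤ) (x : A) (a : ℤ) : serPow d k (serC x) a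
    = if a ≤ k then ((Ring.choose k (k - a).toNat : ℤ) : ℝ) • d^[(k - a).toNat] x else 0 := by
  rw [serPow]
  split_ifs with h
  · rw [finsum_eq_single _ (k - a).toNat fun t ht => by
      rw [serC, if_neg (by omega), iterate_map_zero, smul_zero], serC, if_pos (by omega)]
  · refine finsum_eq_zero_of_forall_eq_zero fun t => ?_
    rw [serC, if_neg (by omega), iterate_map_zero, smul_zero]

variable (d) in
/-- The series `∑_s (-λ-∂)^s F_s`, the adjoint of `∑_s F_s λ^s`. -/
def serAdj (F : ℤ → A) : ℤ → A := fun a => ∑ᶠ s : ℤ, (-1 : ℝ) ^ s • serPow d s (serC (F s)) a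

theorem serAdj_support_finite {F : ℤ → A} (hF : BddSer F) (a : ℤ) :
    (Function.support fun s : ℤ => (-1 : ℝ) ^ s • serPow d s (serC (F s)) a).Finite := by
  obtain ⟨M, hM⟩ := hF
  refine (Set.finite_Icc a M).subset fun s h => ?_
  by_contra hn
  refine h ?_
  simp only [serPow_serC_apply]
  rw [Set.mem_Icc, not_and_or, not_le, not_le] at hn
  rcases hn with hn | hn
  · rw [if_neg (by omega), smul_zero]
  · rw [hM s hn, iterate_map_zero, smul_zero, ite_self, smul_zero]

theorem serAdj_add {F G : ℤ → A} (hF : BddSer F) (hG : BddSer G) :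
    serAdj d (F + G) = serAdj d F + serAdj d G := by
  funext a
  rw [Pi.add_apply, serAdj, serAdj, serAdj, ← finsum_add_distrib (serAdj_support_finite hF a)
    (serAdj_support_finite hG a)]
  refine finsum_congr fun s => ?_
  rw [← smul_add, Pi.add_apply, serPow_serC_apply, serPow_serC_apply, serPow_serC_apply]
  split_ifs
  · rw [iterate_map_add, smul_add]
  · rw [add_zero]

theorem serAdj_single (k : ℤ) (x : A) :
    serAdj d (fun s => if s = k then x else 0) = (-1 : ℝ) ^ k • serPow d k (serC x) := by
  funext a
  rw [serAdj, finsum_eq_single _ k fun s hs => by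
    rw [serPow_serC_apply, if_neg hs, iterate_map_zero, smul_zero, ite_self, smul_zero], if_pos rfl]
  rfl

/-- The binomial formula for `(∂ - ∂₂)^b = ∂₁^b`, where `∂ = ∂₁ + ∂₂` is the derivation of a
product. -/
theorem sum_choose_iterate_mul (x y : A) (b : ℕ) :
    ∑ p ∈ Finset.HasAntidiagonal.antidiagonal b, b.choose p.1 • ((-1 : ℝ) ^ p.1 • d^[p.2] (x * d^[p.1] y))
      = y * d^[b] x := by
  induction b generalizing y with
  | zero => simp [mul_comm]
  | succ b ih =>
    have h := Finset.sum_antidiagonal_choose_succ_nsmul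
      (fun t s => (-1 : ℝ) ^ t • d^[s] (x * d^[t] y)) b
    have h1 : ∑ p ∈ Finset.HasAntidiagonal.antidiagonal b,
        b.choose p.1 • ((-1 : ℝ) ^ p.1 • d^[p.2 + 1] (x * d^[p.1] y)) = d (y * d^[b] x) := by
      rw [← ih, map_sum]
      refine Finset.sum_congr rfl fun p _ => ?_
      rw [map_nsmul, Derivation.map_smul, Function.iterate_succ_apply']
    have h2 : ∑ p ∈ Finset.HasAntidiagonal.antidiagonal b,
        b.choose p.2 • ((-1 : ℝ) ^ (p.1 + 1) • d^[p.2] (x * d^[p.1 + 1] y))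
        = -(d y * d^[b] x) := by
      rw [← ih, ← Finset.sum_neg_distrib]
      refine Finset.sum_congr rfl fun p hp => ?_
      rw [Nat.choose_symm_of_eq_add (Finset.HasAntidiagonal.mem_antidiagonal.1 hp).symm, pow_succ, mul_neg_one,
        neg_smul, smul_neg, Function.iterate_succ_apply]
    rw [h, h1, h2, Function.iterate_succ_apply', Derivation.leibniz, smul_eq_mul, smul_eq_mul]
    ring

/-- The adjoint of `x (λ+∂)⁻¹ y` is `-y (λ+∂)⁻¹ x`. -/
theorem serAdj_tailSer (x y : A) :
    serAdj d (fun s => x * tailSer d y s) = -fun s => y * tailSer d x s := by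
  funext a
  rw [Pi.neg_apply, serAdj]
  by_cases ha : a < 0
  swap
  · rw [tailSer, if_neg ha, mul_zero, neg_zero]
    refine finsum_eq_zero_of_forall_eq_zero fun s => ?_
    rw [serPow_serC_apply]
    split_ifs
    · rw [tailSer, if_neg (by omega), mul_zero, iterate_map_zero, smul_zero, smul_zero]
    · rw [smul_zero]
  obtain ⟨b, rfl⟩ : ∃ b : ℕ, a = -1 - b := ⟨(-1 - a).toNat, by omega⟩
  rw [tailSer, if_pos ha, show (-1 - (-1 - (b : ℤ))).toNat = b by omega, mul_smul_comm,
    ← sum_choose_iterate_mul x y b,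
    finsum_eq_sum_of_support_subset
      (s := (Finset.HasAntidiagonal.antidiagonal b).image fun p => -1 - (p.1 : ℤ))]
  · rw [Finset.sum_image, Finset.smul_sum, ← Finset.sum_neg_distrib]
    · refine Finset.sum_congr rfl fun p hp => ?_
      obtain ⟨t, k⟩ := p
      rw [Finset.HasAntidiagonal.mem_antidiagonal] at hp
      simp only at hp ⊢
      subst hp
      rw [serPow_serC_apply, if_pos (by push_cast; omega), tailSer, if_pos (by omega),
        show (-1 - (t : ℤ) - (-1 - ((t + k : ℕ) : ℤ))).toNat = k by omega,
        show (-1 - (-1 - (t : ℤ))).toNat = t by omega]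
      have e1 : (-1 : ℝ) ^ (-1 - (t : ℤ)) = -(-1) ^ t := by
        rw [show -1 - (t : ℤ) = -((t + 1 : ℕ) : ℤ) by push_cast; ring, zpow_neg, zpow_natCast,
          ← inv_pow, inv_neg_one, pow_succ, mul_neg_one]
      rw [choose_neg_succ, Nat.choose_symm_add, e1, mul_smul_comm, iterate_map_smul,
        ← Nat.cast_smul_eq_nsmul ℝ, smul_smul, smul_smul, smul_smul, smul_smul, ← neg_smul]
      congr 1
      rw [pow_add]
      ring
    · intro p hp q hq h
      simp only [Finset.mem_coe, Finset.HasAntidiagonal.mem_antidiagonal] at hp hq h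
      ext <;> omega
  · intro s hs
    by_contra hn
    refine hs ?_
    simp only
    rw [serPow_serC_apply]
    split_ifs with h
    · rw [tailSer, if_neg, mul_zero, iterate_map_zero, smul_zero, smul_zero]
      intro h3
      refine hn ?_
      rw [Finset.coe_image]
      exact ⟨((-1 - s).toNat, b - (-1 - s).toNat), by
        rw [Finset.mem_coe, Finset.HasAntidiagonal.mem_antidiagonal]; omega, by simp only; omega⟩
    · rw [smul_zero]

end SeriesAdjoint
section PVASkew

open TopologicalSpace (Opens)
open DiffAlg

variable {n : ℕ} {U : Opens (Fin n → ℝ)} {P : HydroOp n} (hP : P.SmoothOn U)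

theorem pvaSkew_iff (i j : Fin n) : P.PVASkew U (jetGen i) (jetGen j)
    ↔ brA hP i j = -serAdj (A := DiffAlg U) tot (brA hP j i) := by
  have e1 : ∀ i j a, Restr (P.lamBracket (jetGen i) (jetGen j) a) (brA hP j i a) := by
    intro i j a J
    rw [← brG_coord]
    exact (restr_jetGen i).lamBracket hP (restr_jetGen j) a J
  have e2 : ∀ a (J : JetOver U), ∑ᶠ s : ℤ, (-1 : ℝ) ^ s
      * lamPow s (lamConst (P.lamBracket (jetGen i) (jetGen j) s)) a J.1
      = serAdj (A := DiffAlg U) tot (brA hP j i) a J := by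
    intro a J
    rw [serAdj, finsum_apply (serAdj_support_finite (bddSer_brA hP j i) a)]
    refine finsum_congr fun s => ?_
    rw [DiffAlg.smul_apply, (e1 i j s).lamConst.lamPow (bddSer_serC _) s a J]
  constructor
  · intro h
    funext a
    ext J
    rw [Pi.neg_apply, DiffAlg.neg_apply, ← e2, ← h a J.1 J.2, e1 j i a J]
  · intro h a J hJ
    have h2 := e1 j i a ⟨J, hJ⟩
    have h3 := e2 a ⟨J, hJ⟩
    simp only at h2 h3
    rw [h2, h3, h]
    rfl

theorem serAdj_brA (i j : Fin n) (a : ℤ) (J : JetOver U) :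
    serAdj (A := DiffAlg U) tot (brA hP j i) a J
      = -((if a - 1 = 0 then gA hP j i J else 0) + if a = 0 then tot (gA hP j i) J else 0)
        + (if a = 0 then ΓuA hP j i J else 0)
        - tailA hP i J * tailSer (A := DiffAlg U) tot (tailA hP j) a J := by
  have e : brA hP j i = (fun s => if s = 1 then gA hP j i else 0)
      + (fun s => if s = 0 then ΓuA hP j i else 0)
      + fun s => tailA hP j * tailSer (A := DiffAlg U) tot (tailA hP i) s := by
    funext s
    exact brA_apply hP j i s
  have b1 : ∀ (k : ℤ) (x : DiffAlg U), BddSer fun s => if s = k then x else 0 := fun k x =>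
    ⟨k, fun s hs => if_neg (by omega)⟩
  have h1 := serPow_natCast (d := (tot : Derivation ℝ (DiffAlg U) (DiffAlg U))) 1
    (bddSer_serC (gA hP j i))
  rw [Nat.cast_one, pow_one] at h1
  rw [e, serAdj_add ((b1 _ _).add (b1 _ _)) ((bddSer_tailSer _).mul_left _),
    serAdj_add (b1 _ _) (b1 _ _), serAdj_single, serAdj_single, serAdj_tailSer, h1, serPow_zero,
    ← serD_serC_apply_jet, ← serC_apply_jet]
  simp only [Pi.add_apply, Pi.neg_apply, Pi.smul_apply, DiffAlg.add_apply, DiffAlg.neg_apply,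
    DiffAlg.smul_apply, DiffAlg.mul_apply]
  norm_num
  ring

/-- The skew-symmetry on the generators is the symmetry of `g` and its compatibility with `Γ`. -/
theorem pvaSkew_iff_skewAt (hP : P.SmoothOn U) :
    (∀ i j, P.PVASkew U (jetGen i) (jetGen j)) ↔ ∀ v ∈ U, P.SkewAt v := by
  have e1 : ∀ (i j : Fin n) (J : JetOver U), tot (gA hP i j) J
      = P.dgForm (J.1 0) (Pi.single i 1) (Pi.single j 1) (J.1 1) :=
    fun i j J => evol_gA_apply hP _ J i j
  have e2 : ∀ (i j : Fin n) (J : JetOver U), ΓuA hP i j J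
      = P.ΓForm (J.1 0) (Pi.single i 1) (Pi.single j 1) (J.1 1) := fun i j J => by
    rw [ΓuA_apply]
    simp [triForm_apply, Pi.single_apply]
  constructor
  · intro h v hv
    rw [HydroOp.SkewAt_iff]
    refine ⟨fun i j => ?_, fun i j k => ?_⟩
    · have h1 := congrArg (fun x : DiffAlg U => x ⟨fun _ => v, hv⟩)
        (congrFun ((pvaSkew_iff hP i j).1 (h i j)) 1)
      rw [Pi.neg_apply, DiffAlg.neg_apply, serAdj_brA, brA_apply] at h1
      simp only [if_pos, sub_self, one_ne_zero, if_false, DiffAlg.add_apply, DiffAlg.mul_apply,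
        DiffAlg.zero_apply, ofField_apply] at h1
      linear_combination h1
    · have h1 := congrArg (fun x : DiffAlg U =>
          x ⟨fun σ => if σ = 0 then v else Pi.single k 1, by simpa using hv⟩)
        (congrFun ((pvaSkew_iff hP j i).1 (h j i)) 0)
      rw [Pi.neg_apply, DiffAlg.neg_apply, serAdj_brA, brA_apply] at h1
      simp [e1, e2] at h1
      linarith
  · intro hS i j
    rw [pvaSkew_iff hP]
    funext a
    ext J
    have h1 := (hS _ J.2).compat (Pi.single j 1) (Pi.single i 1) (J.1 1)
    have h2 := (HydroOp.SkewAt_iff.1 (hS _ J.2)).1 i j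
    rw [Pi.neg_apply, DiffAlg.neg_apply, serAdj_brA, brA_apply, e1, e2, h1, DiffAlg.add_apply,
      DiffAlg.add_apply, DiffAlg.mul_apply]
    have e3 : (if a = 1 then gA hP i j else 0) J = if a - 1 = 0 then gA hP j i J else 0 := by
      by_cases ha : a = 1
      · simp [ha, h2]
      · rw [if_neg ha, if_neg (by omega)]
        rfl
    rw [e3]
    by_cases ha : a = 0
    · rw [if_pos ha, if_pos ha, if_pos ha, e2]
      ring
    · rw [if_neg ha, if_neg ha, if_neg ha, DiffAlg.zero_apply]
      ring

/-- The Hamiltonian property in the formalism of Poisson vertex algebras. -/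
theorem isHamiltonianPVA_iff (hP : P.SmoothOn U) (hg : P.NondegenerateOn U) :
    P.IsHamiltonianPVA U ↔ P.Conditions U := by
  rw [HydroOp.conditions_iff U.isOpen hP hg, HydroOp.IsHamiltonianPVA, pvaSkew_iff_skewAt hP]
  refine and_congr_right fun hS => ⟨fun h => jacobiAt_of_pvaJacobi hP hS h, fun hJ =>
    pvaJacobi_of_conditions hP hS hJ fun v hv => HydroOp.gVec_surjective ?_⟩
  exact hg v hv

end PVASkew

theorem mainTheorem4 {n : ℕ} (U : Set (Fin n → ℝ)) (hU : IsOpen U) (P : HydroOp n)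
    (hP : P.SmoothOn U) (hg : P.NondegenerateOn U) :
    (P.IsHamiltonianDist U ↔ P.Conditions U) ∧
    (P.IsHamiltonianOp U ↔ P.Conditions U) ∧
    (P.IsHamiltonianPVA U ↔ P.Conditions U) := by
  refine ⟨?_, HydroOp.isHamiltonianOp_iff hU hP hg, ?_⟩
  · rw [HydroOp.isHamiltonianDist_iff_op hU hP, HydroOp.isHamiltonianOp_iff hU hP hg]
  · exact isHamiltonianPVA_iff (U := ⟨U, hU⟩) hP hg

end
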